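/- **Setting.** Let $\sigma\in\mathbb R$ and let $\nu$ be a Lévy measure on $\mathbb R$ with $\int_{|x|>1}e^x\,\nu(dx)<\infty$. Let $X$ be a Lévy process with $X(0)=0$ and $\mathrm E\,e^{iuX(t)}=e^{t\psi(u)}$, where $$\psi(u)=-\tfrac12\sigma^2u(u+i)+\psi_0(u),\qquad \psi_0(u)=\int_{\mathbb R}\bigl(e^{iux}-1-iu(e^x-1)\bigr)\nu(dx)$$ (so that $e^{X}$ is a martingale). Let $\mathsf C(\tau,k)=\mathrm E(e^{X(\tau)}-e^k)^+$ be the normalized call price and $$\mathsf C^{BS}(v,k)=\Phi\Bigl(\frac{-k+v/2}{\sqrt v}\Bigr)-e^k\,\Phi\Bigl(\frac{-k-v/2}{\sqrt v}\Bigr).$$ The implied volatility $\sigma_{imp}(\tau,k)$ is the number $s>0$ with $\mathsf C^{BS}(s^2\tau,k)=\mathsf C(\tau,k)$. Put $R(y)=y^2-\frac14$, $\upsilon_0(u)=\psi_0(u-\frac i2)$, $\Xi_0(y)=\upsilon_0(iy)+\frac12\sigma^2R(y)$, $\Xi_n=\Xi_0^{(n)}$ and $\Xi_{01,\pm}(y)=\Xi_0(y)-\Xi_1(y)(y\pm\frac12)$.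 Let $(-\mathsf Y_+,\mathsf Y_-)$ be the interior of the set of $y$ with $\int_{|x|>1}e^{(1/2-y)x}\nu(dx)<\infty$. For a function $\Xi_0$ and a point $y$ define $$a_0=\Bigl(\mathrm{sign}(y+\tfrac12)\sqrt{-2\Xi_{01,+}(y)}-\mathrm{sign}(y-\tfrac12)\sqrt{-2\Xi_{01,-}(y)}\Bigr)^2,\quad r=R\Bigl(\frac{\Xi_1(y)}{a_0}\Bigr),\quad c_0=\frac1{\sqrt{\Xi_2(y)}\,R(y)},$$ $$c_1=-\frac1{2\Xi_2}\Bigl(\frac{6y^2+\frac12}{R^2}+\frac{2y\,\Xi_3}{R\,\Xi_2}+\frac{5\Xi_3^2}{12\Xi_2^2}-\frac{\Xi_4}{4\Xi_2}\Bigr)\quad\text{(all functions at }y),$$ $$a_1=\frac{2\ln(\sqrt{a_0}\,r\,c_0)}{r},\qquad a_2=\frac{2c_1}r+\frac{ra_1\bigl((ra_1-3)(r+\frac14)-\frac14\bigr)+6r+2}{r^3a_0},$$ $$b_0=\sqrt{a_0},\qquad b_1=\frac{a_1}{2\sqrt{a_0}},\qquad b_2=\frac{4a_0a_2-a_1^2}{8a_0^{3/2}}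 .$$ **Statement.** Assume Cramér's condition $\limsup_{|u|\to\infty}|\mathrm E\,e^{iuX(1)}|<1$. Let $y\in(-\mathsf Y_+,\mathsf Y_-)$ and $\bar k=-\Xi_1(y)$. Then for every $\tau>0$ the implied volatility $\sigma_{imp}(\tau,\tau\bar k)$ exists and is unique. If $y\ne\pm\frac12$, there are real sequences $(a_n)$, $(b_n)$, whose terms with $n\le2$ are given by the formulas above, such that, as asymptotic series for $\tau\to\infty$, $$\sigma_{imp}(\tau,\tau\bar k)^2\sim a_0+\frac{a_1}\tau+\frac{a_2}{\tau^2}+\dots,\qquad \sigma_{imp}(\tau,\tau\bar k)\sim b_0+\frac{b_1}\tau+\frac{b_2}{\tau^2}+\dots$$ (that is, for every $N$ the error of the sum of the terms with $n<N$ is $O(\tau^{-N})$). If $y=\pm\frac12$, then $\sigma_{imp}(\tau,\tau\bar k)\to b_0$ (with $\mathrm{sign}\,0=0$). **Specializations.** The same conclusions hold in the following cases, without assuming Cramér's condition, with the stated $\Xi_0$ in place of the one above. 1. *Tempered stable processes* with diffusion coefficient $\sigma$ and $\nu(dx)=\bigl(c_+x^{-1-\alpha}e^{-\kappa_+x}1_{x>0}+c_-|x|^{-1-\alpha}e^{-\kappa_-|x|}1_{x<0}\bigr)dx$,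 where $\alpha<2$, $\alpha\ne0,1$, $c_\pm\ge0$, $\kappa_+\ge1$, $\kappa_-\ge0$, $(\sigma,c_+,c_-)\ne(0,0,0)$ (and $\nu$ is a Lévy measure with $\int_{|x|>1}e^x\,\nu(dx)<\infty$): for $y\in(-\kappa_++\frac12,\kappa_-+\frac12)$ and $$\Xi_0(y)=\tfrac12\sigma^2R(y)+\sum_{s=\pm}a_s\bigl(\kappa_s+s(y-\tfrac12)\bigr)^\alpha-\gamma(y-\tfrac12)+\delta,$$ where, in this formula only, $a_\pm=\Gamma(-\alpha)c_\pm$, $\gamma=\sum_{s=\pm}a_s(\kappa_s^\alpha-(\kappa_s-s)^\alpha)$ and $\delta=-\sum_{s=\pm}a_s\kappa_s^\alpha$. 2. *Normal inverse Gaussian processes* with parameters $\sigma,\varkappa>0$ (no diffusion component) and $\nu(dx)=\frac{\sigma^2\omega\varkappa e^{-x/2}}{\pi|x|}K_1(\omega|x|)\,dx$, where $\omega=\sqrt{\varkappa^2+1/4}$ and $K_1$ is the modified Bessel function: for $y\in(-\omega,\omega)$ and $\Xi_0(y)=\sigma^2\varkappa\bigl(\varkappa-\sqrt{\omega^2-y^2}\bigr)$.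 3. *Merton processes* with diffusion coefficient $\sigma$ and $\nu(dx)=\frac{\lambda}{\sqrt{2\pi}\,\eta}e^{-(x-\mu)^2/(2\eta^2)}dx$, where $\lambda,\eta>0$: for all $y\in\mathbb R$ and $\Xi_0(y)=\frac12\sigma^2R(y)+\lambda\bigl(e^{-q(y-1/2)+\eta^2R(y)/2}-1-(1-e^q)(y-\frac12)\bigr)$, where $q=\mu+\frac12\eta^2$. -/

import Mathlib

open MeasureTheory ProbabilityTheory Filter Topology Set
open scoped NNReal

noncomputable section

/-! ### Exponential Lévy processes -/

/-- `X` is a (real-valued) Lévy process: a càdlàg process started at `0` with independent and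
stationary increments. -/
structure IsLevyProcess {Ω : Type*} [MeasurableSpace Ω] (P : Measure Ω) (X : ℝ≥0 → Ω → ℝ) :
    Prop where
  measurable : ∀ t, Measurable (X t)
  start : ∀ᵐ ω ∂P, X 0 ω = 0
  indep : HasIndepIncrements X P
  stationary : ∀ s t : ℝ≥0, IdentDistrib (fun ω => X (s + t) ω - X s ω) (X t) P P
  cadlag : ∀ᵐ ω ∂P, ∀ t : ℝ≥0, ContinuousWithinAt (fun s => X s ω) (Ici t) t ∧
    ∃ l : ℝ, Tendsto (fun s => X s ω) (𝓝[<] t) (𝓝 l)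

/-- `ν` is a Lévy measure whose large positive jumps have a finite exponential moment. -/
structure IsExpLevyMeasure (ν : Measure ℝ) : Prop where
  zero : ν {0} = 0
  small : ∫⁻ x, ENNReal.ofReal (min (x ^ 2) 1) ∂ν < ⊤
  large : ∫⁻ x in {x : ℝ | 1 < |x|}, ENNReal.ofReal (Real.exp x) ∂ν < ⊤

/-- The pure-jump and drift part `ψ₀` of the Lévy exponent, the drift being the one that makes
`exp X` a martingale. -/
def jumpExponent (ν : Measure ℝ) (u : ℂ) : ℂ :=
  ∫ x : ℝ, (Complex.exp (Complex.I * u * x) - 1 - Complex.I * u * (Complex.exp x - 1)) ∂ν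

/-- The Lévy exponent `ψ(u) = -σ²u(u+i)/2 + ψ₀(u)` of an exponential Lévy process with diffusion
coefficient `σ` and Lévy measure `ν`. -/
def levyExponent (σ : ℝ) (ν : Measure ℝ) (u : ℂ) : ℂ :=
  -(1 / 2) * (σ : ℂ) ^ 2 * u * (u + Complex.I) + jumpExponent ν u

/-- `F₀ exp X` is an exponential Lévy (martingale) process: `X` is a Lévy process with diffusion
coefficient `σ`, Lévy measure `ν` and the martingale drift, as expressed by the Lévy-Khinchine
formula. -/
structure IsExpLevyProcess {Ω : Type*} [MeasurableSpace Ω] (P : Measure Ω) (X : ℝ≥0 → Ω → ℝ)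
    (σ : ℝ) (ν : Measure ℝ) : Prop where
  levy : IsLevyProcess P X
  measure : IsExpLevyMeasure ν
  khinchine : ∀ (t : ℝ≥0) (u : ℝ),
    charFun (P.map (X t)) u = Complex.exp ((t : ℂ) * levyExponent σ ν u)

/-- Cramér's condition `limsup_{|u| → ∞} |E exp(i u X₁)| < 1`. -/
def CramerCondition {Ω : Type*} [MeasurableSpace Ω] (P : Measure Ω) (X : ℝ≥0 → Ω → ℝ) : Prop :=
  ∃ c : ℝ, c < 1 ∧ ∀ᶠ u : ℝ in cocompact ℝ, ‖charFun (P.map (X 1)) u‖ ≤ c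

/-! ### Option prices and implied volatility -/

/-- Normalised price `E (e^{X_τ} - e^k)⁺` of the call with maturity `τ` and log-strike `k`. -/
def callPrice {Ω : Type*} [MeasurableSpace Ω] (P : Measure Ω) (X : ℝ≥0 → Ω → ℝ)
    (τ : ℝ≥0) (k : ℝ) : ℝ :=
  ∫ ω, max (Real.exp (X τ ω) - Real.exp k) 0 ∂P

/-- The standard normal distribution function. -/
def stdNormalCDF (x : ℝ) : ℝ := cdf (gaussianReal 0 1) x

/-- The normalised Black-Scholes call price with total variance `v` and log-strike `k`. -/
def bsCall (v k : ℝ) : ℝ :=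
  stdNormalCDF ((-k + v / 2) / √v) - Real.exp k * stdNormalCDF ((-k - v / 2) / √v)

open Classical in
/-- The volatility implied by a normalised price surface `C` at maturity `τ` and log-strike `k`
(with the value `0` if there is none). -/
def impliedVol (C : ℝ≥0 → ℝ → ℝ) (τ : ℝ≥0) (k : ℝ) : ℝ :=
  if h : ∃ s : ℝ, 0 < s ∧ bsCall (s ^ 2 * τ) k = C τ k then h.choose else 0

/-! ### The functions `Ξ` and the coefficients of the expansion -/

/-- `R(y) = y² - 1/4`. -/
def quadR (y : ℝ) : ℝ := y ^ 2 - 1 / 4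

/-- `Ξ₀(y) = υ₀(iy) + σ²R(y)/2`, where `υ₀(u) = ψ₀(u - i/2)` (which is real at `u = iy`). -/
def levyXi (σ : ℝ) (ν : Measure ℝ) (y : ℝ) : ℝ :=
  (jumpExponent ν (Complex.I * y - Complex.I / 2)).re + 1 / 2 * σ ^ 2 * quadR y

/-- The open interval `(-Y₊, Y₋)` of those `y` for which the exponent `ψ(u - i/2)` converges
(equivalently, is analytic) near the line `Im u = y`. -/
def analyticityInterval (ν : Measure ℝ) : Set ℝ :=
  interior {y : ℝ | IntegrableOn (fun x : ℝ => Real.exp ((1 / 2 - y) * x)) {x : ℝ | 1 < |x|} ν}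

/-- `Ξ_{01,±}(y) = Ξ₀(y) - Ξ₀'(y) (y ± 1/2)`, with `ε = ±1`. -/
def xi01 (Ξ : ℝ → ℝ) (ε y : ℝ) : ℝ := Ξ y - deriv Ξ y * (y + ε / 2)

def coeffA0 (Ξ : ℝ → ℝ) (y : ℝ) : ℝ :=
  (Real.sign (y + 1 / 2) * √(-2 * xi01 Ξ 1 y) - Real.sign (y - 1 / 2) * √(-2 * xi01 Ξ (-1) y)) ^ 2

/-- `r(y) = R(Ξ₁(y) / a₀(y))`. -/
def coeffr (Ξ : ℝ → ℝ) (y : ℝ) : ℝ := quadR (deriv Ξ y / coeffA0 Ξ y)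

def coeffc0 (Ξ : ℝ → ℝ) (y : ℝ) : ℝ := 1 / (√(iteratedDeriv 2 Ξ y) * quadR y)

def coeffc1 (Ξ : ℝ → ℝ) (y : ℝ) : ℝ :=
  -(1 / (2 * iteratedDeriv 2 Ξ y)) *
    ((6 * y ^ 2 + 1 / 2) / quadR y ^ 2
      + 2 * y * iteratedDeriv 3 Ξ y / (quadR y * iteratedDeriv 2 Ξ y)
      + 5 * iteratedDeriv 3 Ξ y ^ 2 / (12 * iteratedDeriv 2 Ξ y ^ 2)
      - iteratedDeriv 4 Ξ y / (4 * iteratedDeriv 2 Ξ y))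

def coeffA1 (Ξ : ℝ → ℝ) (y : ℝ) : ℝ :=
  2 * Real.log (√(coeffA0 Ξ y) * coeffr Ξ y * coeffc0 Ξ y) / coeffr Ξ y

def coeffA2 (Ξ : ℝ → ℝ) (y : ℝ) : ℝ :=
  2 * coeffc1 Ξ y / coeffr Ξ y
    + (coeffr Ξ y * coeffA1 Ξ y *
          ((coeffr Ξ y * coeffA1 Ξ y - 3) * (coeffr Ξ y + 1 / 4) - 1 / 4)
        + 6 * coeffr Ξ y + 2) / (coeffr Ξ y ^ 3 * coeffA0 Ξ y)

def coeffB0 (Ξ : ℝ → ℝ) (y : ℝ) : ℝ := √(coeffA0 Ξ y)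

def coeffB1 (Ξ : ℝ → ℝ) (y : ℝ) : ℝ := coeffA1 Ξ y / (2 * √(coeffA0 Ξ y))

def coeffB2 (Ξ : ℝ → ℝ) (y : ℝ) : ℝ :=
  (4 * coeffA0 Ξ y * coeffA2 Ξ y - coeffA1 Ξ y ^ 2) / (8 * √(coeffA0 Ξ y) ^ 3)

/-- `f(τ) ~ a₀ + a₁/τ + a₂/τ² + …` as `τ → ∞`, in the sense of asymptotic series. -/
def HasLargeTimeSeries (f : ℝ≥0 → ℝ) (a : ℕ → ℝ) : Prop :=
  ∀ N : ℕ, (fun τ : ℝ≥0 => f τ - ∑ j ∈ Finset.range N, a j / (τ : ℝ) ^ j)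
    =O[atTop] (fun τ : ℝ≥0 => 1 / (τ : ℝ) ^ N)

/-- The long-time expansion, at the saddlepoint parameter `y`, of the volatility implied by the
price surface `C`. With `k̄ = -Ξ₁(y)`: the implied volatility at log-strike `τ k̄` is well defined
for all `τ > 0`; if `y ≠ ±1/2`, its square and itself have full asymptotic series in `1/τ` with the
explicit coefficients above; for `y = ±1/2`, where the formulas for `a₁`, `a₂` are `0/0`,
its limit is still `b₀(y)`. -/
def HasLongTimeExpansion (C : ℝ≥0 → ℝ → ℝ) (Ξ : ℝ → ℝ) (y : ℝ) : Prop :=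
  (∀ τ : ℝ≥0, 0 < τ →
    ∃! s : ℝ, 0 < s ∧ bsCall (s ^ 2 * τ) (τ * -deriv Ξ y) = C τ (τ * -deriv Ξ y)) ∧
  (y ≠ 1 / 2 → y ≠ -(1 / 2) → ∃ a b : ℕ → ℝ,
    HasLargeTimeSeries (fun τ => impliedVol C τ (τ * -deriv Ξ y) ^ 2) a ∧
    HasLargeTimeSeries (fun τ => impliedVol C τ (τ * -deriv Ξ y)) b ∧
    a 0 = coeffA0 Ξ y ∧ a 1 = coeffA1 Ξ y ∧ a 2 = coeffA2 Ξ y ∧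
    b 0 = coeffB0 Ξ y ∧ b 1 = coeffB1 Ξ y ∧ b 2 = coeffB2 Ξ y) ∧
  (y = 1 / 2 ∨ y = -(1 / 2) →
    Tendsto (fun τ : ℝ≥0 => impliedVol C τ (τ * -deriv Ξ y)) atTop (𝓝 (coeffB0 Ξ y)))

/-! ### Tempered stable, normal inverse Gaussian and Merton processes -/

/-- The tempered stable Lévy measure. -/
def temperedStableMeasure (α cp cm κp κm : ℝ) : Measure ℝ :=
  volume.withDensity fun x : ℝ => ENNReal.ofReal
    (if 0 < x then cp / x ^ (α + 1) * Real.exp (-κp * x)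
      else if x < 0 then cm / |x| ^ (α + 1) * Real.exp (-κm * |x|) else 0)

/-- `Ξ₀` for tempered stable processes (`α ≠ 0, 1`) with diffusion coefficient `σ`, where
`a_± = Γ(-α) c_±`, `γ = Σ a_± (κ_±^α - (κ_± ∓ 1)^α)`, `δ = -Σ a_± κ_±^α`. -/
def temperedStableXi (σ α cp cm κp κm y : ℝ) : ℝ :=
  let ap := Real.Gamma (-α) * cp
  let am := Real.Gamma (-α) * cm
  let γ := ap * (κp ^ α - (κp - 1) ^ α) + am * (κm ^ α - (κm + 1) ^ α)
  let δ := -(ap * κp ^ α) - am * κm ^ α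
  1 / 2 * σ ^ 2 * quadR y + ap * (κp + (y - 1 / 2)) ^ α + am * (κm - (y - 1 / 2)) ^ α
    - γ * (y - 1 / 2) + δ

/-- The modified Bessel function `K₁(z) = ∫₀^∞ e^{-z cosh t} cosh t dt`, `z > 0`. -/
def besselK1 (z : ℝ) : ℝ := ∫ t in Ioi (0 : ℝ), Real.exp (-z * Real.cosh t) * Real.cosh t

/-- The normal inverse Gaussian Lévy measure, `ω = √(ϰ² + 1/4)`. -/
def nigMeasure (σ ϰ : ℝ) : Measure ℝ :=
  volume.withDensity fun x : ℝ => ENNReal.ofReal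
    (σ ^ 2 * √(ϰ ^ 2 + 1 / 4) * ϰ * Real.exp (-x / 2) / (Real.pi * |x|)
      * besselK1 (√(ϰ ^ 2 + 1 / 4) * |x|))

def nigXi (σ ϰ y : ℝ) : ℝ := σ ^ 2 * ϰ * (ϰ - √((ϰ ^ 2 + 1 / 4) - y ^ 2))

/-- The Merton Lévy measure: `l` times the normal law with mean `μ` and variance `η²`. -/
def mertonMeasure (l μ η : ℝ) : Measure ℝ :=
  volume.withDensity fun x : ℝ => ENNReal.ofReal
    (l / (√(2 * Real.pi) * η) * Real.exp (-(x - μ) ^ 2 / (2 * η ^ 2)))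

/-- `Ξ₀` for Merton processes with diffusion coefficient `σ`, where `q = μ + η²/2`. -/
def mertonXi (σ l μ η y : ℝ) : ℝ :=
  let q := μ + η ^ 2 / 2
  1 / 2 * σ ^ 2 * quadR y
    + l * (Real.exp (-q * (y - 1 / 2) + η ^ 2 / 2 * quadR y) - 1
      - (1 - Real.exp q) * (y - 1 / 2))

end

/-! Put `ε = 1/τ` and `p = 1/2 - y`, and let `K` be the cumulant function, so that `K 0 = K 1 = 0`
and `Ξ₀ y = K (1/2 - y)`. Fourier inversion on the line `Re z = p` writes the call price as an
intrinsic part, given by the position of `p` relative to `0` and `1`, plus an integral of `exp (τ (K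
z - k̄ z))` against `1 / (z (z - 1))`. The strike `k̄ = K' p` makes `p` the saddle point, so the
price is intrinsic part plus `√ε · exp (Ξ₀₁₊ / ε) · S ε` up to a constant, and Laplace's method
expands the amplitude `S` in powers of `ε` (`laplace_isBigO`, `callPrice_saddle`). Its first two
coefficients give `c₀` and `c₀ c₁`.

The Black-Scholes price with total variance `w / ε` has the same shape: exponent `-d₁² / 2` and an
amplitude made of two Mills ratios (`bsCall_div`). Matching exponents and intrinsic parts forces
`d₁² = -2 Ξ₀₁₊` and `d₂² = -2 Ξ₀₁₋` with the signs of `y ± 1/2`; since `d₁ - d₂ = √w`, the limit is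
`a₀`. Monotonicity of the Black-Scholes price in the variance makes this matching a proof of
convergence (`tendsto_impliedVariance`). Taking logarithms then gives an equation `w = a₀ + ε H (w,
ε)` with `H` analytic in its ingredients. Each substitution of an expansion of `w` into the right
side gains one order, so a full series exists, and `a₁ = H`, `a₂ = H'` at `ε = 0`.

At `y = ±1/2` the line passes through a pole of the kernel. There only the limit is claimed: prices
at nearby strikes, where the saddlepoint form is available, bound the price from both sides closely
enough on the exponential scale.

Laplace's method needs `|E exp ((p + iu) X)|` to stay away from its value at `u = 0`. This is
`StronglyNonlattice`, which survives exponential tilting (`tiltedDecay_bounded_below`) and yields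
`K'' > 0`. It follows from Cramér's condition, from a diffusion part, or by Riemann-Lebesgue from a
Lévy density positive on an interval; the last two serve the special families. For these it remains
to evaluate `Ξ₀` as an explicit integral.

Implied volatilities exist because prices lie strictly between the arbitrage bounds: otherwise `X τ`
would lie on one side of `τ K' p`, against strict convexity of `K`. -/

/-! ### Asymptotic expansions as `ε → 0+` -/

/-- `f` agrees with the polynomial `q` up to `O(ε ^ N)` as `ε → 0+`. -/
def ApproxPoly (N : ℕ) (f : ℝ → ℝ) (q : Polynomial ℝ) : Prop :=
  (fun ε => f ε - q.eval ε) =O[𝓝[>] (0 : ℝ)] fun ε => ε ^ N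

/-- `f` has an asymptotic expansion in powers of `ε` up to order `N` as `ε → 0+`. -/
def HasExpansion (N : ℕ) (f : ℝ → ℝ) : Prop := ∃ q, ApproxPoly N f q

theorem pow_isBigO_pow_zero_right {M N : ℕ} (h : M ≤ N) :
    (fun ε : ℝ => ε ^ N) =O[𝓝[>] (0 : ℝ)] fun ε => ε ^ M :=
  Asymptotics.IsBigO.of_bound 1 (by
    have : ∀ᶠ ε : ℝ in 𝓝[>] 0, ε ∈ Ioo (0 : ℝ) 1 := Ioo_mem_nhdsGT one_pos
    filter_upwards [this] with ε hε
    rw [Real.norm_of_nonneg (pow_nonneg hε.1.le _), Real.norm_of_nonneg (pow_nonneg hε.1.le _),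
      one_mul]
    exact pow_le_pow_of_le_one hε.1.le hε.2.le h)

theorem polynomial_eval_isBigO_one (q : Polynomial ℝ) :
    (fun ε => q.eval ε) =O[𝓝[>] (0 : ℝ)] fun _ => (1 : ℝ) :=
  ((q.continuous.tendsto 0).mono_left nhdsWithin_le_nhds).isBigO_one ℝ

namespace ApproxPoly

variable {N : ℕ} {f g : ℝ → ℝ} {p q : Polynomial ℝ}

theorem mono {M : ℕ} (h : ApproxPoly N f q) (hM : M ≤ N) : ApproxPoly M f q :=
  Asymptotics.IsBigO.trans h (pow_isBigO_pow_zero_right hM)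

theorem congr (h : ApproxPoly N f q) (hfg : f =ᶠ[𝓝[>] 0] g) : ApproxPoly N g q :=
  Asymptotics.IsBigO.congr' h (hfg.mono fun ε hε => by simp only [hε]) EventuallyEq.rfl

theorem isBigO_one (h : ApproxPoly N f q) : f =O[𝓝[>] (0 : ℝ)] fun _ => (1 : ℝ) := by
  have h0 := (h.mono (Nat.zero_le N))
  have := Asymptotics.IsBigO.add h0 (by simpa using polynomial_eval_isBigO_one q)
  simpa using this

theorem add (hf : ApproxPoly N f p) (hg : ApproxPoly N g q) :
    ApproxPoly N (fun ε => f ε + g ε) (p + q) := by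
  refine (Asymptotics.IsBigO.add hf hg).congr_left fun ε => ?_
  rw [Polynomial.eval_add]; ring

theorem mul (hf : ApproxPoly N f p) (hg : ApproxPoly N g q) :
    ApproxPoly N (fun ε => f ε * g ε) (p * q) := by
  -- `f g - p q = (f - p) g + p (g - q)`, and both `g` and `p` are bounded near `0`.
  have h1 := Asymptotics.IsBigO.mul hf hg.isBigO_one
  have h2 := Asymptotics.IsBigO.mul (polynomial_eval_isBigO_one p) hg
  simp only [mul_one, one_mul] at h1 h2
  refine (h1.add h2).congr_left fun ε => ?_
  rw [Polynomial.eval_mul]; ring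

theorem const (c : ℝ) : ApproxPoly N (fun _ => c) (Polynomial.C c) := by
  simp [ApproxPoly, Asymptotics.isBigO_zero]

theorem id_mul (hf : ApproxPoly N f q) :
    ApproxPoly (N + 1) (fun ε => ε * f ε) (Polynomial.X * q) := by
  have := Asymptotics.IsBigO.mul (Asymptotics.isBigO_refl (fun ε : ℝ => ε) (𝓝[>] 0)) hf
  refine this.congr (fun ε => ?_) (fun ε => ?_)
  · simp; ring
  · ring

theorem tendsto (hf : ApproxPoly (N + 1) f q) : Tendsto f (𝓝[>] 0) (𝓝 (q.eval 0)) := by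
  have h1 : Tendsto (fun ε : ℝ => ε ^ (N + 1)) (𝓝[>] 0) (𝓝 0) := by
    have : Tendsto (fun ε : ℝ => ε ^ (N + 1)) (𝓝 0) (𝓝 (0 ^ (N + 1))) :=
      (continuous_pow _).tendsto 0
    simpa using this.mono_left nhdsWithin_le_nhds
  have h2 := Asymptotics.IsBigO.trans_tendsto hf h1
  have h3 := h2.add ((q.continuous.tendsto 0).mono_left nhdsWithin_le_nhds)
  simpa using h3

end ApproxPoly

namespace HasExpansion

variable {N : ℕ} {f g : ℝ → ℝ}

theorem congr (h : HasExpansion N f) (hfg : f =ᶠ[𝓝[>] 0] g) : HasExpansion N g :=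
  h.imp fun _ hq => hq.congr hfg

theorem add (hf : HasExpansion N f) (hg : HasExpansion N g) :
    HasExpansion N fun ε => f ε + g ε :=
  let ⟨_, hp⟩ := hf; let ⟨_, hq⟩ := hg; ⟨_, hp.add hq⟩

theorem mul (hf : HasExpansion N f) (hg : HasExpansion N g) :
    HasExpansion N fun ε => f ε * g ε :=
  let ⟨_, hp⟩ := hf; let ⟨_, hq⟩ := hg; ⟨_, hp.mul hq⟩

theorem const (c : ℝ) : HasExpansion N fun _ => c := ⟨_, ApproxPoly.const c⟩

theorem const_mul (c : ℝ) (hf : HasExpansion N f) : HasExpansion N fun ε => c * f ε :=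
  (const c).mul hf

theorem neg (hf : HasExpansion N f) : HasExpansion N fun ε => -f ε :=
  ((const (-1)).mul hf).congr (Eventually.of_forall fun ε => by simp)

theorem sub (hf : HasExpansion N f) (hg : HasExpansion N g) :
    HasExpansion N fun ε => f ε - g ε :=
  (hf.add hg.neg).congr (Eventually.of_forall fun ε => by ring)

/-- The gain of one order drives the bootstrap in `hasExpansion_impliedVariance`. -/
theorem id_mul (hf : HasExpansion N f) : HasExpansion (N + 1) fun ε => ε * f ε :=
  let ⟨_, hq⟩ := hf; ⟨_, hq.id_mul⟩

theorem id : HasExpansion N fun ε => ε :=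
  ⟨Polynomial.X, by simp [ApproxPoly, Asymptotics.isBigO_zero]⟩

theorem pow (hf : HasExpansion N f) (n : ℕ) : HasExpansion N fun ε => f ε ^ n := by
  induction n with
  | zero => simpa using const 1
  | succ n ih => exact (ih.mul hf).congr (Eventually.of_forall fun ε => (pow_succ _ _).symm)

theorem sum {ι : Type*} (s : Finset ι) {F : ι → ℝ → ℝ} (h : ∀ i ∈ s, HasExpansion N (F i)) :
    HasExpansion N fun ε => ∑ i ∈ s, F i ε := by
  classical
  induction s using Finset.induction_on with
  | empty => simpa using const 0
  | insert a s ha ih =>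
    have := (h a (Finset.mem_insert_self a s)).add
      (ih fun i hi => h i (Finset.mem_insert_of_mem hi))
    exact this.congr (Eventually.of_forall fun ε => by simp only [Finset.sum_insert ha])

theorem of_isBigO (hf : HasExpansion N f)
    (h : (fun ε => g ε - f ε) =O[𝓝[>] (0 : ℝ)] fun ε => ε ^ N) : HasExpansion N g := by
  obtain ⟨q, hq⟩ := hf
  refine ⟨q, (Asymptotics.IsBigO.add h hq).congr_left fun ε => ?_⟩
  ring

/-- Since `f - c = O(ε)`, the Taylor remainder of `φ` at `c` of a given order is of the same order
in `ε`, and the Taylor polynomial is a polynomial in `f`. -/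
theorem comp_analyticAt {φ : ℝ → ℝ} {c : ℝ} (hφ : AnalyticAt ℝ φ c) (hf : HasExpansion N f)
    (hlim : Tendsto f (𝓝[>] 0) (𝓝 c)) : HasExpansion N fun ε => φ (f ε) := by
  -- At order `0` the approximating polynomial says nothing about the limit `c`, and only
  -- boundedness is claimed.
  rcases N with _ | N
  · refine ⟨0, ?_⟩
    simpa [ApproxPoly] using (hφ.continuousAt.tendsto.comp hlim).isBigO_one ℝ
  obtain ⟨p, hp⟩ := hφ
  obtain ⟨q, hq⟩ := hf
  have hc : q.eval 0 = c := tendsto_nhds_unique hq.tendsto hlim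
  have hlim0 : Tendsto (fun ε => f ε - c) (𝓝[>] 0) (𝓝 0) := by
    simpa using hlim.sub_const c
  have h1 := (hp.isBigO_sub_partialSum_pow (N + 1)).comp_tendsto hlim0
  have hO : (fun ε => f ε - c) =O[𝓝[>] (0 : ℝ)] fun ε => ε := by
    have h2 := (hq.mono (M := 1) (by lia))
    have h3 : (fun ε => q.eval ε - c) =O[𝓝[>] (0 : ℝ)] fun ε => ε ^ 1 := by
      have := (q.hasDerivAt 0).isBigO_sub
      simp only [hc, sub_zero] at this
      simpa using this.mono nhdsWithin_le_nhds
    refine (Asymptotics.IsBigO.add h2 h3).congr (fun ε => by ring) (fun ε => by simp)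
  have h4 : (fun ε => φ (f ε) - p.partialSum (N + 1) (f ε - c)) =O[𝓝[>] (0 : ℝ)]
      fun ε => ε ^ (N + 1) := by
    refine Asymptotics.IsBigO.trans (h1.congr_left fun ε => ?_) (hO.norm_left.pow (N + 1))
    simp
  refine of_isBigO (f := fun ε => p.partialSum (N + 1) (f ε - c)) ?_ h4
  have h5 : HasExpansion (N + 1) fun ε => f ε - c := HasExpansion.sub ⟨q, hq⟩ (const c)
  refine (sum (Finset.range (N + 1)) (F := fun k ε => p.coeff k * (f ε - c) ^ k)
    fun k _ => (h5.pow k).const_mul _).congr (Eventually.of_forall fun ε => ?_)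
  simp only [FormalMultilinearSeries.partialSum]
  refine Finset.sum_congr rfl fun k _ => ?_
  rw [FormalMultilinearSeries.apply_eq_pow_smul_coeff, smul_eq_mul, mul_comm]

end HasExpansion

/-- Uniqueness of expansions: it is applied to the difference of two polynomials that approximate
the same function. -/
theorem Polynomial.X_pow_dvd_of_isBigO {N : ℕ} {q : Polynomial ℝ}
    (h : (fun ε => q.eval ε) =O[𝓝[>] (0 : ℝ)] fun ε => ε ^ N) : Polynomial.X ^ N ∣ q := by
  induction N with
  | zero => simp
  | succ N ih =>
    obtain ⟨r, rfl⟩ := ih (h.trans (pow_isBigO_pow_zero_right (Nat.le_succ N)))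
    rw [pow_succ]
    refine mul_dvd_mul_left _ (Polynomial.X_dvd_iff.2 ?_)
    have h2 : (fun ε => r.eval ε) =O[𝓝[>] (0 : ℝ)] fun ε => ε := by
      rw [Asymptotics.isBigO_iff] at h ⊢
      obtain ⟨C, hC⟩ := h
      refine ⟨C, ?_⟩
      filter_upwards [hC, self_mem_nhdsWithin] with ε hε (hpos : 0 < ε)
      simp only [Polynomial.eval_mul, Polynomial.eval_pow, Polynomial.eval_X, norm_mul, pow_succ,
        norm_pow] at hε
      have : 0 < ‖ε‖ ^ N := pow_pos (norm_pos_iff.2 hpos.ne') _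
      nlinarith
    have h3 : Tendsto (fun ε : ℝ => ε) (𝓝[>] 0) (𝓝 0) := nhdsWithin_le_nhds
    have h4 := h2.trans_tendsto h3
    have h5 : Tendsto (fun ε => r.eval ε) (𝓝[>] 0) (𝓝 (r.eval 0)) :=
      (r.continuous.tendsto 0).mono_left nhdsWithin_le_nhds
    rw [Polynomial.coeff_zero_eq_eval_zero]
    exact tendsto_nhds_unique h5 h4

theorem exists_series_of_hasExpansion {f : ℝ → ℝ} (h : ∀ N, HasExpansion N f) :
    ∃ a : ℕ → ℝ, ∀ N, (fun ε => f ε - ∑ j ∈ Finset.range N, a j * ε ^ j)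
      =O[𝓝[>] (0 : ℝ)] fun ε => ε ^ N := by
  choose q hq using h
  -- Order `j + 1` is the first one that determines coefficient `j`; by uniqueness all higher orders
  -- agree with it.
  refine ⟨fun j => (q (j + 1)).coeff j, fun N => ?_⟩
  set s : Polynomial ℝ :=
    ∑ j ∈ Finset.range N, Polynomial.C ((q (j + 1)).coeff j) * Polynomial.X ^ j with hs
  have hcoeff : ∀ j < N, (q N - s).coeff j = 0 := by
    intro j hj
    have h1 : (fun ε => (q N - q (j + 1)).eval ε) =O[𝓝[>] (0 : ℝ)] fun ε => ε ^ (j + 1) := by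
      refine (Asymptotics.IsBigO.sub (hq (j + 1)) ((hq N).mono hj)).congr_left fun ε => ?_
      rw [Polynomial.eval_sub]; ring
    have h2 := Polynomial.X_pow_dvd_iff.1 (Polynomial.X_pow_dvd_of_isBigO h1) j (Nat.lt_succ_self j)
    rw [Polynomial.coeff_sub] at h2 ⊢
    rw [hs, Polynomial.finsetSum_coeff]
    simp only [Polynomial.coeff_C_mul_X_pow]
    rw [Finset.sum_ite_eq, if_pos (Finset.mem_range.2 hj)]
    exact h2
  obtain ⟨r, hr⟩ := Polynomial.X_pow_dvd_iff.2 hcoeff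
  have h3 : (fun ε => (q N - s).eval ε) =O[𝓝[>] (0 : ℝ)] fun ε => ε ^ N := by
    rw [hr]
    have := Asymptotics.IsBigO.mul
      (Asymptotics.isBigO_refl (fun ε : ℝ => ε ^ N) (𝓝[>] 0)) (polynomial_eval_isBigO_one r)
    simpa using this
  refine (Asymptotics.IsBigO.add (hq N) h3).congr_left fun ε => ?_
  rw [Polynomial.eval_sub, hs, Polynomial.eval_finsetSum]
  simp

/-- The first coefficients of an asymptotic series are the successive limits. -/
theorem tendsto_of_series {f : ℝ → ℝ} {a : ℕ → ℝ}
    (h : ∀ N, (fun ε => f ε - ∑ j ∈ Finset.range N, a j * ε ^ j)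
      =O[𝓝[>] (0 : ℝ)] fun ε => ε ^ N) (n : ℕ) :
    Tendsto (fun ε => (f ε - ∑ j ∈ Finset.range n, a j * ε ^ j) / ε ^ n) (𝓝[>] 0) (𝓝 (a n)) := by
  have h1 : (fun ε => (f ε - ∑ j ∈ Finset.range n, a j * ε ^ j) / ε ^ n - a n)
      =O[𝓝[>] (0 : ℝ)] fun ε => ε := by
    have h2 := h (n + 1)
    rw [Asymptotics.isBigO_iff] at h2 ⊢
    obtain ⟨C, hC⟩ := h2
    refine ⟨C, ?_⟩
    filter_upwards [hC, self_mem_nhdsWithin] with ε hε (hpos : 0 < ε)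
    have hp : 0 < ε ^ n := pow_pos hpos n
    rw [Finset.sum_range_succ] at hε
    have e1 : (f ε - ∑ j ∈ Finset.range n, a j * ε ^ j) / ε ^ n - a n
        = (f ε - (∑ j ∈ Finset.range n, a j * ε ^ j + a n * ε ^ n)) / ε ^ n := by
      field_simp; ring
    rw [e1, norm_div, div_le_iff₀ (norm_pos_iff.2 hp.ne')]
    refine hε.trans_eq ?_
    rw [pow_succ, norm_mul]; ring
  have h3 : Tendsto (fun ε : ℝ => ε) (𝓝[>] 0) (𝓝 0) := nhdsWithin_le_nhds
  simpa using (h1.trans_tendsto h3).add_const (a n)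

/-! ### Laplace's method along a vertical line -/

/-- Taylor coefficient of order `j` at `0`. -/
noncomputable def taylorCoeff (f : ℂ → ℂ) (j : ℕ) : ℂ := iteratedDeriv j f 0 / (j.factorial : ℂ)

theorem AnalyticAt.isBigO_sub_taylorCoeff {f : ℂ → ℂ} (hf : AnalyticAt ℂ f 0) (n : ℕ) :
    (fun w => f w - ∑ j ∈ Finset.range n, taylorCoeff f j * w ^ j) =O[𝓝 0] fun w => ‖w‖ ^ n := by
  have := hf.hasFPowerSeriesAt.isBigO_sub_partialSum_pow n
  simp only [zero_add] at this
  refine this.congr_left fun w => ?_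
  congr 1
  simp only [FormalMultilinearSeries.partialSum, FormalMultilinearSeries.apply_eq_pow_smul_coeff,
    smul_eq_mul, FormalMultilinearSeries.coeff_ofScalars, taylorCoeff]
  exact Finset.sum_congr rfl fun j _ => by ring

/-- The moments of the unnormalised Gaussian weight. -/
noncomputable def gaussMoment (A : ℝ) (n : ℕ) : ℝ := ∫ x : ℝ, x ^ n * Real.exp (-A * x ^ 2 / 2)

theorem integrable_pow_mul_gauss {A : ℝ} (hA : 0 < A) (n : ℕ) :
    Integrable fun x : ℝ => x ^ n * Real.exp (-A * x ^ 2) := by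
  have := integrable_rpow_mul_exp_neg_mul_sq hA (s := n) (by
    have : (0 : ℝ) ≤ n := Nat.cast_nonneg n
    linarith)
  simpa using this

/-- This is why the Laplace expansion in `√ε` contains only integer powers of `ε`. -/
theorem gaussMoment_odd (A : ℝ) {n : ℕ} (hn : Odd n) : gaussMoment A n = 0 := by
  have h := integral_neg_eq_self (fun x : ℝ => x ^ n * Real.exp (-A * x ^ 2 / 2)) volume
  simp only [neg_sq, hn.neg_pow, neg_mul, integral_neg] at h
  simp only [gaussMoment, neg_mul]
  linarith

theorem gaussMoment_zero {A : ℝ} (hA : 0 < A) : gaussMoment A 0 = √(2 * Real.pi / A) := by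
  have h := integral_gaussian (A / 2)
  simp only [gaussMoment, pow_zero, one_mul]
  rw [show 2 * Real.pi / A = Real.pi / (A / 2) by field_simp, ← h]
  congr 1; ext x; congr 1; ring

/-- Integration by parts against `-A x exp (-A x² / 2)`, the derivative of the weight. -/
theorem gaussMoment_add_two {A : ℝ} (hA : 0 < A) (n : ℕ) :
    gaussMoment A (n + 2) = (n + 1) / A * gaussMoment A n := by
  have hA2 : 0 < A / 2 := by positivity
  have hi : ∀ n : ℕ, Integrable fun x : ℝ => x ^ n * Real.exp (-A * x ^ 2 / 2) := fun n =>
    (integrable_pow_mul_gauss hA2 n).congr (Eventually.of_forall fun x => by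
      simp only; congr 2; ring)
  have h := integral_mul_deriv_eq_deriv_mul_of_integrable
    (u := fun x : ℝ => x ^ (n + 1)) (v := fun x : ℝ => Real.exp (-A * x ^ 2 / 2))
    (u' := fun x => ((n + 1 : ℕ) : ℝ) * x ^ n)
    (v' := fun x => Real.exp (-A * x ^ 2 / 2) * (-A * x))
    (fun x _ => by simpa using hasDerivAt_pow (n + 1) x)
    (fun x _ => by
      have h0 : HasDerivAt (fun x : ℝ => -A * x ^ 2 / 2) (-A * x) x := by
        have := ((hasDerivAt_pow 2 x).const_mul (-A)).div_const 2
        refine this.congr_deriv ?_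
        simp only [Nat.cast_ofNat, Nat.add_one_sub_one, pow_one]; ring
      exact h0.exp)
    (((hi (n + 2)).const_mul (-A)).congr (Eventually.of_forall fun x => by
      simp only [Pi.mul_apply]; ring))
    (((hi n).const_mul (n + 1)).congr (Eventually.of_forall fun x => by
      simp only [Pi.mul_apply]; push_cast; ring))
    ((hi (n + 1)).congr (Eventually.of_forall fun x => by simp only [Pi.mul_apply]))
  have e1 : ∀ x : ℝ, x ^ (n + 1) * (Real.exp (-A * x ^ 2 / 2) * (-A * x))
      = -A * (x ^ (n + 2) * Real.exp (-A * x ^ 2 / 2)) := fun x => by ring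
  have e2 : ∀ x : ℝ, ((n + 1 : ℕ) : ℝ) * x ^ n * Real.exp (-A * x ^ 2 / 2)
      = (n + 1) * (x ^ n * Real.exp (-A * x ^ 2 / 2)) := fun x => by push_cast; ring
  simp only [e1, e2, integral_const_mul] at h
  simp only [gaussMoment]
  rw [div_mul_eq_mul_div, eq_div_iff hA.ne']
  linarith

section Laplace

variable {F g κ : ℂ → ℂ} {A : ℝ}

/-- The Taylor coefficients entering the Laplace expansion. -/
noncomputable def laplaceCoeff (κ g : ℂ → ℂ) (m j : ℕ) : ℂ :=
  taylorCoeff (fun w => κ w ^ m * g w) j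

/-- The Laplace expansion, as a polynomial in the square root of the small parameter. -/
noncomputable def laplaceSum (κ g : ℂ → ℂ) (M : ℕ) (s x : ℝ) : ℂ :=
  ∑ m ∈ Finset.range M, ∑ j ∈ Finset.range (M - m),
    (s : ℂ) ^ (m + j) * laplaceCoeff κ g m j * (Complex.I * x) ^ (3 * m + j) / (m.factorial : ℂ)

/-- One disc must serve for the local form of `F` and for all Taylor remainders. The bound by `A /
4` keeps the cubic term below half of the quadratic one, so half of the Gaussian decay survives. -/
theorem laplace_local (hA : 0 < A) (hκ : AnalyticAt ℂ κ 0) (hg : AnalyticAt ℂ g 0)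
    (hF : ∀ᶠ w in 𝓝 (0 : ℂ), F w = A * w ^ 2 / 2 + w ^ 3 * κ w) (M : ℕ) :
    ∃ δ > 0, ∃ C > 0, ∀ w : ℂ, ‖w‖ ≤ δ →
      F w = A * w ^ 2 / 2 + w ^ 3 * κ w ∧ ‖w‖ * ‖κ w‖ ≤ A / 4 ∧ ‖κ w‖ ≤ C ∧ ‖g w‖ ≤ C ∧
      ∀ m ∈ Finset.range M,
        ‖κ w ^ m * g w - ∑ j ∈ Finset.range (M - m), laplaceCoeff κ g m j * w ^ j‖
          ≤ C * ‖w‖ ^ (M - m) := by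
  have h1 : ∀ m ∈ Finset.range M, ∃ C, ∀ᶠ w in 𝓝 (0 : ℂ),
      ‖κ w ^ m * g w - ∑ j ∈ Finset.range (M - m), laplaceCoeff κ g m j * w ^ j‖
          ≤ C * ‖w‖ ^ (M - m) := by
    intro m _
    have := (show AnalyticAt ℂ (fun w => κ w ^ m * g w) 0 from (hκ.pow m).mul hg).isBigO_sub_taylorCoeff (M - m)
    obtain ⟨C, hC⟩ := this.bound
    exact ⟨C, by simpa [laplaceCoeff] using hC⟩
  choose! C hC using h1
  have h2 : ∀ᶠ w in 𝓝 (0 : ℂ), ‖w‖ * ‖κ w‖ ≤ A / 4 := by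
    have : Tendsto (fun w : ℂ => ‖w‖ * ‖κ w‖) (𝓝 0) (𝓝 (‖(0 : ℂ)‖ * ‖κ 0‖)) :=
      (continuous_norm.tendsto _).mul hκ.continuousAt.norm
    rw [norm_zero, zero_mul] at this
    exact (this.eventually_lt_const (by positivity : (0 : ℝ) < A / 4)).mono fun _ h => h.le
  have h3 : ∀ᶠ w in 𝓝 (0 : ℂ), ‖κ w‖ ≤ ‖κ 0‖ + 1 :=
    (hκ.continuousAt.norm.eventually_lt_const (lt_add_one ‖κ 0‖)).mono fun _ h => h.le
  have h4 : ∀ᶠ w in 𝓝 (0 : ℂ), ‖g w‖ ≤ ‖g 0‖ + 1 :=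
    (hg.continuousAt.norm.eventually_lt_const (lt_add_one ‖g 0‖)).mono fun _ h => h.le
  have h5 := (Filter.eventually_all_finset (Finset.range M)).2 hC
  obtain ⟨δ, hδ, hall⟩ := Metric.eventually_nhds_iff_ball.1
    (hF.and (h2.and (h3.and (h4.and h5))))
  -- The sum of all individual constants, with absolute values, is positive and dominates each of
  -- them.
  refine ⟨δ / 2, by positivity, (‖κ 0‖ + 1) + (‖g 0‖ + 1) + ∑ m ∈ Finset.range M, |C m|,
    by positivity, fun w hw => ?_⟩
  obtain ⟨a1, a2, a3, a4, a5⟩ := hall w (by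
    rw [mem_ball_zero_iff]; linarith)
  have hs : 0 ≤ ∑ m ∈ Finset.range M, |C m| := Finset.sum_nonneg fun _ _ => abs_nonneg _
  refine ⟨a1, a2, ?_, ?_, fun m hm => (a5 m hm).trans ?_⟩
  · linarith [norm_nonneg (g 0)]
  · linarith [norm_nonneg (κ 0)]
  · gcongr
    have := Finset.single_le_sum (f := fun m => |C m|) (fun _ _ => abs_nonneg _) hm
    linarith [norm_nonneg (g 0), norm_nonneg (κ 0), le_abs_self (C m)]

theorem norm_I_mul_ofReal (x : ℝ) : ‖Complex.I * (x : ℂ)‖ = |x| := by simp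

theorem pow_le_one_add_pow {x : ℝ} {a b : ℕ} (hab : a ≤ b) : |x| ^ a ≤ (1 + |x|) ^ b := by
  have h0 := abs_nonneg x
  calc |x| ^ a ≤ (1 + |x|) ^ a := by gcongr; linarith
    _ ≤ (1 + |x|) ^ b := pow_le_pow_right₀ (by linarith) hab

/-- On the scale `u = s x` the exponent is `-A x² / 2 + w` with `|w|` at most both `A x² / 4` and `C
s |x|³`. Truncating `exp w` at order `M` and each `κ ^ m g` at order `M - m` leaves errors that all
carry the factor `s ^ M`. -/
theorem laplace_pointwise_near {M : ℕ} {C s x : ℝ} (hA : 0 < A) (hC : 0 < C) (hs : 0 < s)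
    (h1 : F (Complex.I * (s * x : ℝ)) = A * (Complex.I * (s * x : ℝ)) ^ 2 / 2
      + (Complex.I * (s * x : ℝ)) ^ 3 * κ (Complex.I * (s * x : ℝ)))
    (h2 : ‖Complex.I * ((s * x : ℝ) : ℂ)‖ * ‖κ (Complex.I * (s * x : ℝ))‖ ≤ A / 4)
    (h3 : ‖κ (Complex.I * (s * x : ℝ))‖ ≤ C) (h4 : ‖g (Complex.I * (s * x : ℝ))‖ ≤ C)
    (h5 : ∀ m ∈ Finset.range M,
      ‖κ (Complex.I * (s * x : ℝ)) ^ m * g (Complex.I * (s * x : ℝ))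
        - ∑ j ∈ Finset.range (M - m), laplaceCoeff κ g m j * (Complex.I * (s * x : ℝ)) ^ j‖
          ≤ C * ‖Complex.I * ((s * x : ℝ) : ℂ)‖ ^ (M - m)) :
    ‖Complex.exp (F (Complex.I * (s * x : ℝ)) / (s : ℂ) ^ 2) * g (Complex.I * (s * x : ℝ))
      - Complex.exp (-A * (x : ℂ) ^ 2 / 2) * laplaceSum κ g M s x‖
      ≤ (C ^ M * C + M * C) * s ^ M * ((1 + |x|) ^ (3 * M) * Real.exp (-A * x ^ 2 / 4)) := by
  set u : ℂ := Complex.I * ((s * x : ℝ) : ℂ) with hu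
  have hun : ‖u‖ = s * |x| := by rw [hu, norm_I_mul_ofReal, abs_mul, abs_of_pos hs]
  have hue : u = s * (Complex.I * x) := by rw [hu]; push_cast; ring
  have hsc : (s : ℂ) ≠ 0 := by exact_mod_cast hs.ne'
  set w : ℂ := u ^ 3 * κ u / (s : ℂ) ^ 2 with hw
  have hwb : ‖w‖ ≤ A * x ^ 2 / 4 := by
    rw [hw, norm_div, norm_mul, norm_pow, norm_pow, Complex.norm_of_nonneg hs.le,
      div_le_iff₀ (by positivity)]
    have : ‖u‖ ^ 3 * ‖κ u‖ = ‖u‖ ^ 2 * (‖u‖ * ‖κ u‖) := by ring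
    rw [this]
    calc ‖u‖ ^ 2 * (‖u‖ * ‖κ u‖) ≤ ‖u‖ ^ 2 * (A / 4) := by gcongr
      _ = A * x ^ 2 / 4 * s ^ 2 := by rw [hun, mul_pow, sq_abs]; ring
  have hwb2 : ‖w‖ ≤ C * s * |x| ^ 3 := by
    rw [hw, norm_div, norm_mul, norm_pow, norm_pow, Complex.norm_of_nonneg hs.le,
      div_le_iff₀ (by positivity), hun]
    calc (s * |x|) ^ 3 * ‖κ u‖ ≤ (s * |x|) ^ 3 * C := by gcongr
      _ = _ := by ring
  have hF : F u / (s : ℂ) ^ 2 = -A * (x : ℂ) ^ 2 / 2 + w := by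
    rw [h1, hw, add_div]
    congr 1
    rw [hue]
    field_simp
    rw [Complex.I_sq]
    ring
  -- The error splits into the remainder of the exponential series times `g` and the Taylor
  -- remainders of the terms `κ ^ m g`.
  have hT : Complex.exp (F u / (s : ℂ) ^ 2) * g u
      - Complex.exp (-A * (x : ℂ) ^ 2 / 2) * laplaceSum κ g M s x
      = Complex.exp (-A * (x : ℂ) ^ 2 / 2) *
        ((Complex.exp w - ∑ m ∈ Finset.range M, w ^ m / (m.factorial : ℂ)) * g u
        + ∑ m ∈ Finset.range M, (s : ℂ) ^ m * (Complex.I * x) ^ (3 * m) / (m.factorial : ℂ) *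
          (κ u ^ m * g u - ∑ j ∈ Finset.range (M - m), laplaceCoeff κ g m j * u ^ j)) := by
    rw [hF, Complex.exp_add]
    have e1 : laplaceSum κ g M s x = ∑ m ∈ Finset.range M,
        (s : ℂ) ^ m * (Complex.I * x) ^ (3 * m) / (m.factorial : ℂ) *
          ∑ j ∈ Finset.range (M - m), laplaceCoeff κ g m j * u ^ j := by
      unfold laplaceSum
      refine Finset.sum_congr rfl fun m _ => ?_
      rw [Finset.mul_sum]
      refine Finset.sum_congr rfl fun j _ => ?_
      rw [hue, mul_pow (s : ℂ)]; ring
    have e2 : (∑ m ∈ Finset.range M, w ^ m / (m.factorial : ℂ)) * g u = ∑ m ∈ Finset.range M,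
        (s : ℂ) ^ m * (Complex.I * x) ^ (3 * m) / (m.factorial : ℂ) * (κ u ^ m * g u) := by
      rw [Finset.sum_mul]
      refine Finset.sum_congr rfl fun m _ => ?_
      have : w = s * (Complex.I * x) ^ 3 * κ u := by
        rw [hw, hue]; field_simp
      rw [this, mul_pow, mul_pow, ← pow_mul]; ring
    simp only [mul_sub, Finset.sum_sub_distrib, sub_mul, e2, e1, mul_add]
    ring
  rw [hT, norm_mul]
  have hexp : ‖Complex.exp (-A * (x : ℂ) ^ 2 / 2)‖ = Real.exp (-A * x ^ 2 / 2) := by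
    rw [Complex.norm_exp]; congr 1
    have : (-A * (x : ℂ) ^ 2 / 2) = ((-A * x ^ 2 / 2 : ℝ) : ℂ) := by push_cast; ring
    rw [this, Complex.ofReal_re]
  have hb1 : ‖(Complex.exp w - ∑ m ∈ Finset.range M, w ^ m / (m.factorial : ℂ)) * g u‖
      ≤ C ^ M * C * s ^ M * (1 + |x|) ^ (3 * M) * Real.exp (A * x ^ 2 / 4) := by
    rw [norm_mul]
    calc _ ≤ (‖w‖ ^ M * Real.exp ‖w‖) * C := by
          gcongr
          exact Complex.norm_exp_sub_sum_le_norm_mul_exp w M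
      _ ≤ ((C * s * |x| ^ 3) ^ M * Real.exp (A * x ^ 2 / 4)) * C := by gcongr
      _ = C ^ M * C * s ^ M * |x| ^ (3 * M) * Real.exp (A * x ^ 2 / 4) := by
          rw [mul_pow, mul_pow, ← pow_mul]; ring
      _ ≤ _ := by
          gcongr
          linarith
  have hb2 : ‖∑ m ∈ Finset.range M, (s : ℂ) ^ m * (Complex.I * x) ^ (3 * m) / (m.factorial : ℂ) *
          (κ u ^ m * g u - ∑ j ∈ Finset.range (M - m), laplaceCoeff κ g m j * u ^ j)‖
      ≤ M * C * s ^ M * (1 + |x|) ^ (3 * M) := by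
    have : ∀ m ∈ Finset.range M, ‖(s : ℂ) ^ m * (Complex.I * x) ^ (3 * m) / (m.factorial : ℂ) *
          (κ u ^ m * g u - ∑ j ∈ Finset.range (M - m), laplaceCoeff κ g m j * u ^ j)‖
        ≤ C * s ^ M * (1 + |x|) ^ (3 * M) := by
      intro m hm
      have hmM : m < M := Finset.mem_range.1 hm
      rw [norm_mul, norm_div, norm_mul, norm_pow, norm_pow, norm_I_mul_ofReal,
        Complex.norm_of_nonneg hs.le, Complex.norm_natCast]
      have hf : (1 : ℝ) ≤ m.factorial := by exact_mod_cast Nat.one_le_iff_ne_zero.2 m.factorial_ne_zero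
      calc _ ≤ s ^ m * |x| ^ (3 * m) * (C * (s * |x|) ^ (M - m)) := by
            rw [← hun]
            gcongr
            · exact div_le_self (by positivity) hf
            · exact h5 m hm
        _ = C * s ^ M * |x| ^ (3 * m + (M - m)) := by
            rw [mul_pow, pow_add]
            have : s ^ M = s ^ m * s ^ (M - m) := by rw [← pow_add]; congr 1; lia
            rw [this]; ring
        _ ≤ _ := by
            gcongr
            exact pow_le_one_add_pow (by lia)
    refine (norm_sum_le_of_le _ this).trans_eq ?_
    rw [Finset.sum_const, Finset.card_range, nsmul_eq_mul]; ring
  have hexp1 : (1 : ℝ) ≤ Real.exp (A * x ^ 2 / 4) := Real.one_le_exp (by positivity)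
  rw [hexp]
  calc _ ≤ Real.exp (-A * x ^ 2 / 2) * (C ^ M * C * s ^ M * (1 + |x|) ^ (3 * M)
          * Real.exp (A * x ^ 2 / 4) + M * C * s ^ M * (1 + |x|) ^ (3 * M)
          * Real.exp (A * x ^ 2 / 4)) := by
        gcongr
        refine (norm_add_le _ _).trans (add_le_add hb1 (hb2.trans ?_))
        have h0 : 0 ≤ M * C * s ^ M * (1 + |x|) ^ (3 * M) := by positivity
        nlinarith
    _ = (C ^ M * C + M * C) * s ^ M * ((1 + |x|) ^ (3 * M) *
          (Real.exp (-A * x ^ 2 / 2) * Real.exp (A * x ^ 2 / 4))) := by ring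
    _ = _ := by
        rw [← Real.exp_add]; congr 4; ring

/-- Far out, `(s |x| / δ) ^ (M - m - j) ≥ 1` may be inserted into each term. This raises its power
of `s` to `M` at the price of a polynomial in `|x|`, which the Gaussian absorbs. -/
theorem laplaceSum_far {M : ℕ} {δ : ℝ} (hδ : 0 < δ) (hA : 0 < A) :
    ∃ C > 0, ∀ s x : ℝ, 0 < s → δ < s * |x| →
    ‖Complex.exp (-A * (x : ℂ) ^ 2 / 2) * laplaceSum κ g M s x‖
      ≤ C * s ^ M * ((1 + |x|) ^ (3 * M) * Real.exp (-A * x ^ 2 / 4)) := by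
  refine ⟨(∑ m ∈ Finset.range M, ∑ j ∈ Finset.range (M - m),
    ‖laplaceCoeff κ g m j‖ * δ⁻¹ ^ (M - m - j)) + 1, ?_, fun s x hs hx => ?_⟩
  · have : 0 ≤ ∑ m ∈ Finset.range M, ∑ j ∈ Finset.range (M - m),
      ‖laplaceCoeff κ g m j‖ * δ⁻¹ ^ (M - m - j) := by positivity
    linarith
  have hexp : ‖Complex.exp (-A * (x : ℂ) ^ 2 / 2)‖ ≤ Real.exp (-A * x ^ 2 / 4) := by
    rw [Complex.norm_exp]
    have : (-A * (x : ℂ) ^ 2 / 2) = ((-A * x ^ 2 / 2 : ℝ) : ℂ) := by push_cast; ring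
    rw [this, Complex.ofReal_re]
    refine Real.exp_le_exp.2 ?_
    have : 0 ≤ A * x ^ 2 := by positivity
    linarith
  have hb : ‖laplaceSum κ g M s x‖ ≤ (∑ m ∈ Finset.range M, ∑ j ∈ Finset.range (M - m),
      ‖laplaceCoeff κ g m j‖ * δ⁻¹ ^ (M - m - j)) * (s ^ M * (1 + |x|) ^ (3 * M)) := by
    rw [Finset.sum_mul]
    refine norm_sum_le_of_le _ fun m hm => ?_
    rw [Finset.sum_mul]
    refine norm_sum_le_of_le _ fun j hj => ?_
    have hm' := Finset.mem_range.1 hm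
    have hj' := Finset.mem_range.1 hj
    rw [norm_div, norm_mul, norm_mul, norm_pow, norm_pow, norm_I_mul_ofReal,
      Complex.norm_of_nonneg hs.le, Complex.norm_natCast]
    have hf : (1 : ℝ) ≤ m.factorial := by exact_mod_cast Nat.one_le_iff_ne_zero.2 m.factorial_ne_zero
    have h1 : (1 : ℝ) ≤ (δ⁻¹ * (s * |x|)) ^ (M - m - j) := by
      refine one_le_pow₀ ?_
      rw [inv_mul_eq_div, le_div_iff₀ hδ]; linarith
    calc _ ≤ s ^ (m + j) * ‖laplaceCoeff κ g m j‖ * |x| ^ (3 * m + j) :=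
          div_le_self (by positivity) hf
      _ ≤ s ^ (m + j) * ‖laplaceCoeff κ g m j‖ * |x| ^ (3 * m + j) *
          (δ⁻¹ * (s * |x|)) ^ (M - m - j) := le_mul_of_one_le_right (by positivity) h1
      _ = ‖laplaceCoeff κ g m j‖ * δ⁻¹ ^ (M - m - j) *
          (s ^ M * |x| ^ (3 * m + j + (M - m - j))) := by
          have : s ^ M = s ^ (m + j) * s ^ (M - m - j) := by rw [← pow_add]; congr 1; lia
          rw [this, mul_pow, mul_pow, pow_add (|x|)]; ring
      _ ≤ _ := by
          gcongr
          exact pow_le_one_add_pow (by lia)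
  rw [norm_mul]
  have hp : 0 ≤ s ^ M * (1 + |x|) ^ (3 * M) := by positivity
  calc _ ≤ Real.exp (-A * x ^ 2 / 4) * ((∑ m ∈ Finset.range M, ∑ j ∈ Finset.range (M - m),
      ‖laplaceCoeff κ g m j‖ * δ⁻¹ ^ (M - m - j) + 1) * (s ^ M * (1 + |x|) ^ (3 * M))) := by
        gcongr
        refine hb.trans ?_
        rw [add_mul]; linarith
    _ = _ := by ring

/-- The part of the integral away from the saddle is exponentially small; this makes it smaller than
any power of `s`. -/
theorem exp_neg_div_sq_le {η s : ℝ} (hη : 0 < η) (hs : 0 < s) (n : ℕ) :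
    Real.exp (-η / s ^ 2) ≤ n.factorial / η ^ n * s ^ (2 * n) := by
  have h := Real.pow_div_factorial_le_exp (x := η / s ^ 2) (by positivity) n
  rw [neg_div, Real.exp_neg, inv_le_comm₀ (Real.exp_pos _) (by positivity)]
  refine le_trans (le_of_eq ?_) h
  rw [div_pow, ← pow_mul]; field_simp

theorem laplaceSum_integral (hA : 0 < A) (M : ℕ) (s : ℝ) :
    Integrable (fun x : ℝ => Complex.exp (-A * (x : ℂ) ^ 2 / 2) * laplaceSum κ g M s x) ∧
    ∫ x : ℝ, Complex.exp (-A * (x : ℂ) ^ 2 / 2) * laplaceSum κ g M s x =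
      ∑ m ∈ Finset.range M, ∑ j ∈ Finset.range (M - m),
        (s : ℂ) ^ (m + j) * (laplaceCoeff κ g m j * Complex.I ^ (3 * m + j)
          * gaussMoment A (3 * m + j) / (m.factorial : ℂ)) := by
  have hA2 : 0 < A / 2 := by positivity
  have hi : ∀ n : ℕ, Integrable fun x : ℝ => x ^ n * Real.exp (-A * x ^ 2 / 2) := fun n =>
    (integrable_pow_mul_gauss hA2 n).congr (Eventually.of_forall fun x => by
      simp only; congr 2; ring)
  have e : ∀ x : ℝ, Complex.exp (-A * (x : ℂ) ^ 2 / 2) * laplaceSum κ g M s x =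
      ∑ m ∈ Finset.range M, ∑ j ∈ Finset.range (M - m),
        ((s : ℂ) ^ (m + j) * laplaceCoeff κ g m j * Complex.I ^ (3 * m + j) / (m.factorial : ℂ)) *
          ((x ^ (3 * m + j) * Real.exp (-A * x ^ 2 / 2) : ℝ) : ℂ) := by
    intro x
    unfold laplaceSum
    rw [Finset.mul_sum]
    refine Finset.sum_congr rfl fun m _ => ?_
    rw [Finset.mul_sum]
    refine Finset.sum_congr rfl fun j _ => ?_
    push_cast
    rw [mul_pow]; ring
  simp only [e]
  have hij : ∀ m j : ℕ, Integrable fun x : ℝ =>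
      ((s : ℂ) ^ (m + j) * laplaceCoeff κ g m j * Complex.I ^ (3 * m + j) / (m.factorial : ℂ)) *
          ((x ^ (3 * m + j) * Real.exp (-A * x ^ 2 / 2) : ℝ) : ℂ) :=
    fun m j => (hi (3 * m + j)).ofReal.const_mul _
  refine ⟨integrable_finsetSum _ fun m _ => integrable_finsetSum _ fun j _ => hij m j, ?_⟩
  rw [integral_finsetSum _ fun m _ => integrable_finsetSum _ fun j _ => hij m j]
  refine Finset.sum_congr rfl fun m _ => ?_
  rw [integral_finsetSum _ fun j _ => hij m j]
  refine Finset.sum_congr rfl fun j _ => ?_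
  rw [integral_const_mul, integral_complex_ofReal]
  simp only [gaussMoment]
  ring

/-- Laplace's method: the rescaled integral has an asymptotic expansion to every order. -/
theorem laplace_isBigO (hA : 0 < A) (hκ : AnalyticAt ℂ κ 0) (hg : AnalyticAt ℂ g 0)
    (hF : ∀ᶠ w in 𝓝 (0 : ℂ), F w = A * w ^ 2 / 2 + w ^ 3 * κ w)
    (hFm : Measurable fun u : ℝ => F (Complex.I * u))
    (hgi : Integrable fun u : ℝ => g (Complex.I * u))
    (hneg : ∀ δ > 0, ∃ η > 0, ∀ u : ℝ, δ ≤ |u| → (F (Complex.I * u)).re ≤ -η) (M : ℕ) :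
    (fun s : ℝ => (∫ x : ℝ, Complex.exp (F (Complex.I * (s * x : ℝ)) / (s : ℂ) ^ 2)
        * g (Complex.I * (s * x : ℝ)))
      - ∑ m ∈ Finset.range M, ∑ j ∈ Finset.range (M - m),
        (s : ℂ) ^ (m + j) * (laplaceCoeff κ g m j * Complex.I ^ (3 * m + j)
          * gaussMoment A (3 * m + j) / (m.factorial : ℂ))) =O[𝓝[>] (0 : ℝ)] fun s => s ^ M := by
  obtain ⟨δ, hδ, C, hC, hloc⟩ := laplace_local hA hκ hg hF M
  obtain ⟨C', hC', hfar⟩ := laplaceSum_far (κ := κ) (g := g) (M := M) hδ hA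
  obtain ⟨η, hη, htail⟩ := hneg δ hδ
  set B : ℝ → ℝ := fun x => (1 + |x|) ^ (3 * M) * Real.exp (-A * x ^ 2 / 4) with hB
  have hBi : Integrable B := by
    have hA4 : 0 < A / 4 := by positivity
    have h0 : Integrable fun x : ℝ => (2 : ℝ) ^ (3 * M) * Real.exp (-(A / 4) * x ^ 2)
        + 2 ^ (3 * M) * |x ^ (3 * M) * Real.exp (-(A / 4) * x ^ 2)| := by
      refine Integrable.add ?_ ((integrable_pow_mul_gauss hA4 _).abs.const_mul _)
      simpa using (integrable_pow_mul_gauss hA4 0).const_mul ((2 : ℝ) ^ (3 * M))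
    refine h0.mono' (by fun_prop) (Eventually.of_forall fun x => ?_)
    have hBx : B x = (1 + |x|) ^ (3 * M) * Real.exp (-(A / 4) * x ^ 2) := by
      simp only [hB]; congr 2; ring
    rw [hBx, Real.norm_of_nonneg (by positivity), abs_mul, abs_of_pos (Real.exp_pos _), ← mul_assoc,
      ← add_mul]
    refine mul_le_mul_of_nonneg_right ?_ (Real.exp_pos _).le
    rw [abs_pow]
    have hx := abs_nonneg x
    rcases le_total |x| 1 with h1 | h1
    · calc (1 + |x|) ^ (3 * M) ≤ 2 ^ (3 * M) := by gcongr; linarith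
        _ ≤ _ := by linarith [show (0 : ℝ) ≤ 2 ^ (3 * M) * |x| ^ (3 * M) by positivity]
    · calc (1 + |x|) ^ (3 * M) ≤ (2 * |x|) ^ (3 * M) := by gcongr; linarith
        _ = 2 ^ (3 * M) * |x| ^ (3 * M) := mul_pow _ _ _
        _ ≤ _ := by linarith [show (0 : ℝ) ≤ 2 ^ (3 * M) by positivity]
  set G : ℝ := ∫ u : ℝ, ‖g (Complex.I * u)‖ with hG
  have hG0 : 0 ≤ G := integral_nonneg fun _ => norm_nonneg _
  set C₁ : ℝ := (C ^ M * C + M * C) + C' with hC₁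
  have hC₁0 : 0 ≤ C₁ := by positivity
  -- The range is split at `s |x| = δ`: inside, the local expansion applies; outside, the integrand
  -- and the model sum are estimated separately.
  have hpt : ∀ s : ℝ, 0 < s → ∀ x : ℝ,
      ‖Complex.exp (F (Complex.I * (s * x : ℝ)) / (s : ℂ) ^ 2) * g (Complex.I * (s * x : ℝ))
        - Complex.exp (-A * (x : ℂ) ^ 2 / 2) * laplaceSum κ g M s x‖
      ≤ C₁ * s ^ M * B x + Real.exp (-η / s ^ 2) * ‖g (Complex.I * (s * x : ℝ))‖ := by
    intro s hs x
    have hBx : 0 ≤ s ^ M * B x := by simp only [hB]; positivity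
    rcases le_or_gt (s * |x|) δ with hle | hgt
    · have hn : ‖Complex.I * ((s * x : ℝ) : ℂ)‖ ≤ δ := by
        rw [norm_I_mul_ofReal, abs_mul, abs_of_pos hs]; exact hle
      obtain ⟨h1, h2, h3, h4, h5⟩ := hloc _ hn
      refine (laplace_pointwise_near hA hC hs h1 h2 h3 h4 h5).trans ?_
      have : 0 ≤ Real.exp (-η / s ^ 2) * ‖g (Complex.I * (s * x : ℝ))‖ := by positivity
      have h6 : (C ^ M * C + M * C) * (s ^ M * B x) ≤ C₁ * (s ^ M * B x) :=
        mul_le_mul_of_nonneg_right (by rw [hC₁]; linarith) hBx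
      simp only [hB] at h6 ⊢
      linarith
    · refine (norm_sub_le _ _).trans ?_
      rw [add_comm]
      refine add_le_add ((hfar s x hs hgt).trans ?_) ?_
      · have h6 : C' * (s ^ M * B x) ≤ C₁ * (s ^ M * B x) :=
          mul_le_mul_of_nonneg_right (by rw [hC₁]; linarith [show 0 ≤ C ^ M * C + M * C by positivity]) hBx
        simp only [hB] at h6 ⊢
        linarith
      · rw [norm_mul, Complex.norm_exp]
        gcongr
        have : ((F (Complex.I * (s * x : ℝ)) / (s : ℂ) ^ 2)).re
            = (F (Complex.I * (s * x : ℝ))).re / s ^ 2 := by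
          rw [show (s : ℂ) ^ 2 = ((s ^ 2 : ℝ) : ℂ) by push_cast; ring, Complex.div_ofReal_re]
        rw [this]
        gcongr
        exact htail _ (by rw [abs_mul, abs_of_pos hs]; exact hgt.le)
  have hre : ∀ u : ℝ, u ≠ 0 → (F (Complex.I * u)).re ≤ 0 := by
    intro u hu
    obtain ⟨η', hη', h⟩ := hneg |u| (abs_pos.2 hu)
    linarith [h u le_rfl]
  have hEi : ∀ s : ℝ, 0 < s → Integrable fun x : ℝ =>
      Complex.exp (F (Complex.I * (s * x : ℝ)) / (s : ℂ) ^ 2) * g (Complex.I * (s * x : ℝ)) := by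
    intro s hs
    have h1 : Integrable fun u : ℝ => Complex.exp (F (Complex.I * u) / (s : ℂ) ^ 2)
        * g (Complex.I * u) := by
      refine hgi.mono ((Complex.measurable_exp.comp (hFm.div_const _)).aestronglyMeasurable.mul
        hgi.aestronglyMeasurable) ?_
      have : ∀ᵐ u : ℝ, u ≠ 0 := by simp [ae_iff, measure_singleton]
      filter_upwards [this] with u hu
      rw [norm_mul, Complex.norm_exp]
      refine mul_le_of_le_one_left (norm_nonneg _) (Real.exp_le_one_iff.2 ?_)
      rw [show (s : ℂ) ^ 2 = ((s ^ 2 : ℝ) : ℂ) by push_cast; ring, Complex.div_ofReal_re]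
      exact div_nonpos_of_nonpos_of_nonneg (hre u hu) (by positivity)
    exact h1.comp_mul_left' hs.ne'
  rw [Asymptotics.isBigO_iff]
  refine ⟨C₁ * (∫ x, B x) + (M + 1).factorial / η ^ (M + 1) * G, ?_⟩
  have hev : ∀ᶠ s : ℝ in 𝓝[>] 0, s ∈ Ioo (0 : ℝ) 1 := Ioo_mem_nhdsGT one_pos
  filter_upwards [hev] with s hs
  have hs0 := hs.1
  obtain ⟨hTi, hT⟩ := laplaceSum_integral (κ := κ) (g := g) hA M s
  rw [← hT, ← integral_sub (hEi s hs0) hTi]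
  have hgs : Integrable fun x : ℝ => ‖g (Complex.I * (s * x : ℝ))‖ :=
    (hgi.norm).comp_mul_left' hs0.ne'
  have hgint : ∫ x : ℝ, ‖g (Complex.I * (s * x : ℝ))‖ = s⁻¹ * G := by
    have := Measure.integral_comp_mul_left (fun u : ℝ => ‖g (Complex.I * u)‖) s
    rw [this, abs_of_pos (inv_pos.2 hs0), smul_eq_mul]
  have hb := norm_integral_le_of_norm_le
    ((hBi.const_mul (C₁ * s ^ M)).add (hgs.const_mul (Real.exp (-η / s ^ 2))))
    (Eventually.of_forall (hpt s hs0))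
  refine hb.trans ?_
  simp only [Pi.add_apply]
  rw [integral_add (hBi.const_mul _) (hgs.const_mul _), integral_const_mul, integral_const_mul,
    hgint, Real.norm_of_nonneg (by positivity : 0 ≤ s ^ M), add_mul]
  -- The order `M + 1` pays for the Jacobian `s⁻¹`: `s ^ (2 (M + 1) - 1) ≤ s ^ M`.
  have h7 : Real.exp (-η / s ^ 2) * (s⁻¹ * G) ≤ (M + 1).factorial / η ^ (M + 1) * G * s ^ M := by
    calc _ ≤ ((M + 1).factorial / η ^ (M + 1) * s ^ (2 * (M + 1))) * (s⁻¹ * G) := by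
          gcongr
          exact exp_neg_div_sq_le hη hs0 _
      _ = (M + 1).factorial / η ^ (M + 1) * G * (s ^ M * s ^ (M + 1)) := by
          have : s ^ (2 * (M + 1)) = s ^ M * s ^ (M + 1) * s := by
            rw [← pow_add, ← pow_succ]; congr 1; lia
          rw [this]; field_simp
      _ ≤ (M + 1).factorial / η ^ (M + 1) * G * (s ^ M * 1) := by
          gcongr
          exact pow_le_one₀ hs0.le hs.2.le
      _ = _ := by ring
  linarith

/-- The expansion polynomial of Laplace's method. -/
noncomputable def laplacePoly (κ g : ℂ → ℂ) (A : ℝ) (N : ℕ) : Polynomial ℝ :=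
  ∑ m ∈ Finset.range (2 * N), ∑ j ∈ Finset.range (2 * N - m),
    if Even (m + j) then Polynomial.C ((laplaceCoeff κ g m j * Complex.I ^ (3 * m + j)).re
      * gaussMoment A (3 * m + j) / m.factorial) * Polynomial.X ^ ((m + j) / 2) else 0

/-- With `s = √ε`, order `2 N` in `s` is order `N` in `ε`. As `3 m + j` and `m + j` have equal
parity, every odd power of `s` comes with an odd Gaussian moment and drops out. -/
theorem laplace_approxPoly (hA : 0 < A) (hκ : AnalyticAt ℂ κ 0) (hg : AnalyticAt ℂ g 0)
    (hF : ∀ᶠ w in 𝓝 (0 : ℂ), F w = A * w ^ 2 / 2 + w ^ 3 * κ w)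
    (hFm : Measurable fun u : ℝ => F (Complex.I * u))
    (hgi : Integrable fun u : ℝ => g (Complex.I * u))
    (hneg : ∀ δ > 0, ∃ η > 0, ∀ u : ℝ, δ ≤ |u| → (F (Complex.I * u)).re ≤ -η) (N : ℕ) :
    ApproxPoly N (fun ε : ℝ => (√ε)⁻¹ *
      (∫ u : ℝ, Complex.exp (F (Complex.I * u) / (ε : ℂ)) * g (Complex.I * u)).re)
      (laplacePoly κ g A N) := by
  have hs : Tendsto (fun ε : ℝ => √ε) (𝓝[>] 0) (𝓝[>] 0) := by
    refine tendsto_nhdsWithin_iff.2 ⟨?_, ?_⟩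
    · have := (Real.continuous_sqrt.tendsto 0)
      rw [Real.sqrt_zero] at this
      exact this.mono_left nhdsWithin_le_nhds
    · filter_upwards [self_mem_nhdsWithin] with ε hε
      exact Real.sqrt_pos.2 hε
  have h := (laplace_isBigO hA hκ hg hF hFm hgi hneg (2 * N)).comp_tendsto hs
  unfold ApproxPoly
  rw [Asymptotics.isBigO_iff] at h ⊢
  obtain ⟨C, hC⟩ := h
  refine ⟨C, ?_⟩
  filter_upwards [hC, self_mem_nhdsWithin] with ε hε (hpos : 0 < ε)
  have hsp : 0 < √ε := Real.sqrt_pos.2 hpos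
  have hsq : √ε ^ 2 = ε := Real.sq_sqrt hpos.le
  simp only [Function.comp_apply] at hε
  have e1 : ∫ x : ℝ, Complex.exp (F (Complex.I * (√ε * x : ℝ)) / ((√ε : ℝ) : ℂ) ^ 2)
      * g (Complex.I * (√ε * x : ℝ)) = (((√ε)⁻¹ : ℝ) : ℂ) *
        ∫ u : ℝ, Complex.exp (F (Complex.I * u) / (ε : ℂ)) * g (Complex.I * u) := by
    have hc : ((√ε : ℝ) : ℂ) ^ 2 = (ε : ℂ) := by exact_mod_cast hsq
    have := Measure.integral_comp_mul_left (fun u : ℝ =>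
      Complex.exp (F (Complex.I * u) / (ε : ℂ)) * g (Complex.I * u)) (√ε)
    rw [hc, this, abs_of_pos (inv_pos.2 hsp), Complex.real_smul]
  have e2 : (∑ m ∈ Finset.range (2 * N), ∑ j ∈ Finset.range (2 * N - m),
        ((√ε : ℝ) : ℂ) ^ (m + j) * (laplaceCoeff κ g m j * Complex.I ^ (3 * m + j)
          * gaussMoment A (3 * m + j) / (m.factorial : ℂ))).re
      = (laplacePoly κ g A N).eval ε := by
    rw [laplacePoly, Polynomial.eval_finsetSum, Complex.re_sum]
    refine Finset.sum_congr rfl fun m _ => ?_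
    rw [Polynomial.eval_finsetSum, Complex.re_sum]
    refine Finset.sum_congr rfl fun j _ => ?_
    have : ((√ε : ℝ) : ℂ) ^ (m + j) * (laplaceCoeff κ g m j * Complex.I ^ (3 * m + j)
          * gaussMoment A (3 * m + j) / (m.factorial : ℂ))
        = ((√ε ^ (m + j) * (gaussMoment A (3 * m + j) / m.factorial) : ℝ) : ℂ)
          * (laplaceCoeff κ g m j * Complex.I ^ (3 * m + j)) := by
      push_cast; ring
    rw [this, Complex.re_ofReal_mul]
    split_ifs with hev
    · obtain ⟨n, hn⟩ := hev
      have h2 : (m + j) / 2 = n := by lia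
      rw [Polynomial.eval_mul, Polynomial.eval_C, Polynomial.eval_pow, Polynomial.eval_X, h2,
        hn, ← two_mul, pow_mul, hsq]
      ring
    · have : Odd (3 * m + j) := by
        rw [Nat.not_even_iff_odd] at hev
        have h3 : 3 * m + j = 2 * m + (m + j) := by ring
        rw [h3]
        exact (even_two_mul m).add_odd hev
      rw [gaussMoment_odd A this]
      simp
  rw [e1] at hε
  have h3 := (Complex.abs_re_le_norm _).trans hε
  rw [Complex.sub_re, e2, Complex.re_ofReal_mul, pow_mul, hsq] at h3
  simpa using h3

end Laplace

/-- Only the pairs `(m, j) = (0,0), (0,2), (1,1), (2,0)` contribute; relative to the total mass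
their Gaussian moments are `1`, `1/A`, `3/A²` and `15/A³`. -/
theorem laplacePoly_two {κ g : ℂ → ℂ} {A k₀ k₁ g₀ g₁ g₂ : ℝ} (hA : 0 < A)
    (hκ : AnalyticAt ℂ κ 0) (hg : AnalyticAt ℂ g 0) (hk0 : κ 0 = k₀) (hk1 : deriv κ 0 = k₁)
    (hg0 : g 0 = g₀) (hg1 : deriv g 0 = g₁) (hg2 : iteratedDeriv 2 g 0 = g₂) :
    laplacePoly κ g A 2 = Polynomial.C (√(2 * Real.pi / A) * g₀) + Polynomial.C
      (√(2 * Real.pi / A) * (-(g₂ / 2) / A + 3 * (k₁ * g₀ + k₀ * g₁) / A ^ 2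
        - 15 / 2 * k₀ ^ 2 * g₀ / A ^ 3)) * Polynomial.X := by
  have c00 : laplaceCoeff κ g 0 0 = g₀ := by simp [laplaceCoeff, taylorCoeff, hg0]
  have c02 : laplaceCoeff κ g 0 2 = ((g₂ / 2 : ℝ) : ℂ) := by
    simp [laplaceCoeff, taylorCoeff, hg2]
  have c11 : laplaceCoeff κ g 1 1 = ((k₁ * g₀ + k₀ * g₁ : ℝ) : ℂ) := by
    simp only [laplaceCoeff, taylorCoeff, iteratedDeriv_one, pow_one, Nat.factorial_one,
      Nat.cast_one, div_one]
    have := hκ.differentiableAt.hasDerivAt.mul hg.differentiableAt.hasDerivAt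
    rw [show (fun w => κ w * g w) = κ * g from rfl, this.deriv, hk0, hk1, hg0, hg1]
    push_cast; ring
  have c20 : laplaceCoeff κ g 2 0 = ((k₀ ^ 2 * g₀ : ℝ) : ℂ) := by
    simp [laplaceCoeff, taylorCoeff, hk0, hg0]
  have m2 : gaussMoment A 2 = 1 / A * √(2 * Real.pi / A) := by
    rw [gaussMoment_add_two hA 0, gaussMoment_zero hA]; norm_num
  have m4 : gaussMoment A 4 = 3 / A ^ 2 * √(2 * Real.pi / A) := by
    rw [gaussMoment_add_two hA 2, m2]; push_cast; field_simp; norm_num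
  have m6 : gaussMoment A 6 = 15 / A ^ 3 * √(2 * Real.pi / A) := by
    rw [gaussMoment_add_two hA 4, m4]; push_cast; field_simp; norm_num
  have i4 : Complex.I ^ 4 = 1 := Complex.I_pow_four
  have i6 : Complex.I ^ 6 = -1 := by
    rw [show 6 = 4 + 2 from rfl, pow_add, i4, Complex.I_sq, one_mul]
  simp only [laplacePoly, Finset.sum_range_succ, Finset.sum_range_zero, Nat.reduceMul,
    Nat.reduceSub, Nat.reduceAdd]
  norm_num [Nat.even_iff, c00, c02, c11, c20, i4, i6, m2, m4, m6, gaussMoment_zero hA,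
    ← Complex.ofReal_pow, ← Complex.ofReal_mul, ← Complex.ofReal_add, ← Complex.ofReal_div,
    Nat.factorial, -Complex.ofReal_pow, -Complex.ofReal_mul, -Complex.ofReal_add,
    -Complex.ofReal_div, -map_mul, -map_add, -map_neg, -map_sub]
  rw [mul_comm g₀, add_assoc, add_assoc, ← add_mul, ← add_mul, ← map_add, ← map_add]
  congr 3
  ring

/-- `κ` is the third iterate of the divided difference at `0`; its power series is that of `f`
shifted by three places, which gives analyticity and its first coefficients at once. -/
theorem AnalyticAt.exists_cubic_remainder {f : ℂ → ℂ} (hf : AnalyticAt ℂ f 0) :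
    ∃ κ : ℂ → ℂ, AnalyticAt ℂ κ 0 ∧
      (∀ w, f w = f 0 + deriv f 0 * w + iteratedDeriv 2 f 0 / 2 * w ^ 2 + w ^ 3 * κ w) ∧
      κ 0 = iteratedDeriv 3 f 0 / 6 ∧ deriv κ 0 = iteratedDeriv 4 f 0 / 24 := by
  set D : (ℂ → ℂ) → ℂ → ℂ := Function.swap dslope 0 with hD
  have hp := hf.hasFPowerSeriesAt
  have hit := fun k => hp.has_fpower_series_iterate_dslope_fslope k
  have hcoeff : ∀ k, (D^[k] f) 0 = iteratedDeriv k f 0 / k.factorial := by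
    intro k
    have := (hit k).coeff_zero 1
    rw [← this, ← FormalMultilinearSeries.coeff, FormalMultilinearSeries.coeff_iterate_fslope,
      zero_add, FormalMultilinearSeries.coeff_ofScalars]
  have hstep : ∀ k w, (D^[k] f) w = (D^[k] f) 0 + w * (D^[k + 1] f) w := by
    intro k w
    have := sub_smul_dslope (D^[k] f) 0 w
    rw [Function.iterate_succ', Function.comp_apply]
    simp only [hD, Function.swap] at this ⊢
    rw [sub_zero, smul_eq_mul] at this
    rw [this]; ring
  refine ⟨D^[3] f, ⟨_, hit 3⟩, fun w => ?_, ?_, ?_⟩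
  · have h0 := hstep 0 w
    have h1 := hstep 1 w
    have h2 := hstep 2 w
    rw [hcoeff] at h1 h2
    simp only [Function.iterate_zero, id_eq] at h0
    rw [h0, h1, h2]
    simp [iteratedDeriv_one, Nat.factorial]
    ring
  · rw [hcoeff]; simp [Nat.factorial]
  · have h := (hit 3).hasDerivAt.deriv
    refine h.trans ?_
    change FormalMultilinearSeries.coeff _ 1 = _
    rw [FormalMultilinearSeries.coeff_iterate_fslope, FormalMultilinearSeries.coeff_ofScalars]
    simp [Nat.factorial]

/-! ### Exponential moments from the analytic continuation of the characteristic function -/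

theorem integrable_gauss_bound {f : ℝ → ℂ} {C c : ℝ} (hc : 0 < c) (hf : Continuous f)
    (hb : ∀ y, ‖f y‖ ≤ C * Real.exp (-c * y ^ 2)) : Integrable f :=
  ((integrable_exp_neg_mul_sq hc).const_mul C).mono' hf.aestronglyMeasurable
    (Eventually.of_forall hb)

/-- Shifting a vertical line of integration. -/
theorem integral_vertical_line_eq {f : ℂ → ℂ} {p C c : ℝ} (hc : 0 < c)
    (hcont : ContinuousOn f {z | z.re ∈ uIcc 0 p})
    (hd : DifferentiableOn ℂ f {z | z.re ∈ Ioo (min 0 p) (max 0 p)})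
    (hb : ∀ z, z.re ∈ uIcc 0 p → ‖f z‖ ≤ C * Real.exp (-c * z.im ^ 2)) :
    ∫ y : ℝ, f (y * Complex.I) = ∫ y : ℝ, f (p + y * Complex.I) := by
  have hline : ∀ a ∈ uIcc 0 p, Integrable fun y : ℝ => f ((a : ℂ) + y * Complex.I) := by
    intro a ha
    refine integrable_gauss_bound (C := C) hc ?_ fun y => ?_
    · refine hcont.comp_continuous (by fun_prop) fun y => ?_
      simpa using ha
    · simpa using hb (a + y * Complex.I) (by simpa using ha)
  have h0 := hline 0 left_mem_uIcc
  have hp := hline p right_mem_uIcc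
  have hrect : ∀ T : ℝ, 0 < T →
      Complex.I • (∫ y : ℝ in -T..T, f ((p : ℂ) + y * Complex.I))
        - Complex.I • (∫ y : ℝ in -T..T, f (((0 : ℝ) : ℂ) + y * Complex.I))
      = (∫ x : ℝ in (0 : ℝ)..p, f (x + T * Complex.I))
        - ∫ x : ℝ in (0 : ℝ)..p, f (x + ((-T : ℝ) : ℂ) * Complex.I) := by
    intro T hT
    have h := Complex.integral_boundary_rect_eq_zero_of_continuousOn_of_differentiableOn f
      (⟨0, -T⟩ : ℂ) (⟨p, T⟩ : ℂ) (hcont.mono fun z hz => hz.1) (hd.mono fun z hz => hz.1)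
    simp only at h
    linear_combination h
  -- The two horizontal sides of the rectangle are the cases `σ = ±1`; the Gaussian bound in `Im z`
  -- makes both vanish.
  have hhor : ∀ σ : ℝ, σ ^ 2 = 1 →
      Tendsto (fun T : ℝ => ∫ x : ℝ in (0 : ℝ)..p, f (x + ((σ * T : ℝ) : ℂ) * Complex.I))
        atTop (𝓝 0) := by
    intro σ hσ
    have hb2 : ∀ T : ℝ, ‖∫ x : ℝ in (0 : ℝ)..p, f (x + ((σ * T : ℝ) : ℂ) * Complex.I)‖
        ≤ C * Real.exp (-c * T ^ 2) * |p - 0| := by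
      intro T
      refine intervalIntegral.norm_integral_le_of_norm_le_const fun x hx => ?_
      have := hb (x + ((σ * T : ℝ) : ℂ) * Complex.I) (by
        simpa using uIoc_subset_uIcc hx)
      refine this.trans_eq ?_
      simp [mul_pow, hσ]
    refine squeeze_zero_norm hb2 ?_
    have h1 : Tendsto (fun T : ℝ => Real.exp (-c * T ^ 2)) atTop (𝓝 0) := by
      refine Real.tendsto_exp_atBot.comp ?_
      have : Tendsto (fun T : ℝ => T ^ 2) atTop atTop := tendsto_pow_atTop two_ne_zero
      exact this.const_mul_atTop_of_neg (by linarith)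
    simpa using (h1.const_mul C).mul_const |p - 0|
  have hL : Tendsto (fun T : ℝ => Complex.I • (∫ y : ℝ in -T..T, f ((p : ℂ) + y * Complex.I))
        - Complex.I • (∫ y : ℝ in -T..T, f (((0 : ℝ) : ℂ) + y * Complex.I))) atTop
      (𝓝 (Complex.I • (∫ y : ℝ, f ((p : ℂ) + y * Complex.I))
        - Complex.I • (∫ y : ℝ, f (((0 : ℝ) : ℂ) + y * Complex.I)))) :=
    ((intervalIntegral_tendsto_integral hp tendsto_neg_atTop_atBot tendsto_id).const_smul _).sub
      ((intervalIntegral_tendsto_integral h0 tendsto_neg_atTop_atBot tendsto_id).const_smul _)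
  have hR := (hhor 1 (by norm_num)).sub (hhor (-1) (by norm_num))
  have hLR := tendsto_nhds_unique (hL.congr' ?_) hR
  · rw [sub_zero, sub_eq_zero] at hLR
    have := smul_right_injective ℂ Complex.I_ne_zero hLR
    simp only [Complex.ofReal_zero, zero_add] at this
    exact this.symm
  · filter_upwards [eventually_gt_atTop 0] with T hT
    rw [hrect T hT]
    simp

section ExpMoment

variable {μ : Measure ℝ} [IsProbabilityMeasure μ] {Φ : ℂ → ℂ} {p B : ℝ}

/-- The Fourier transform of a Gaussian with complex centre `q`: the regularised exponential `exp (q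
x - ε x² / 2)` becomes a superposition of characters, to which the characteristic function applies.
-/
theorem gauss_kernel_integral {ε : ℝ} (hε : 0 < ε) (q : ℂ) (x : ℝ) :
    ∫ y : ℝ, Complex.exp ((y * Complex.I - q) ^ 2 / (2 * ε)) * Complex.exp (y * x * Complex.I)
      = √(2 * Real.pi * ε) * Complex.exp (q * x - ε * x ^ 2 / 2) := by
  have hε' : (ε : ℂ) ≠ 0 := by exact_mod_cast hε.ne'
  have h := fourierIntegral_gaussian (b := ((1 / (2 * ε) : ℝ) : ℂ))
    (by rw [Complex.ofReal_re]; positivity) (x - q / ε)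
  have e1 : ∀ y : ℝ, Complex.exp ((y * Complex.I - q) ^ 2 / (2 * ε))
      * Complex.exp (y * x * Complex.I) = Complex.exp (q ^ 2 / (2 * ε)) *
      (Complex.exp (Complex.I * (x - q / ε) * y)
        * Complex.exp (-((1 / (2 * ε) : ℝ) : ℂ) * y ^ 2)) := by
    intro y
    rw [← Complex.exp_add, ← Complex.exp_add, ← Complex.exp_add]
    congr 1
    push_cast
    field_simp
    ring_nf
    rw [Complex.I_sq]; ring
  simp only [e1]
  rw [integral_const_mul, h]
  have e2 : ((Real.pi : ℂ) / ((1 / (2 * ε) : ℝ) : ℂ)) ^ (1 / 2 : ℂ) = √(2 * Real.pi * ε) := by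
    rw [Real.sqrt_eq_rpow, Complex.ofReal_cpow (by positivity)]
    push_cast
    congr 1
    field_simp
  rw [e2, mul_left_comm, ← Complex.exp_add]
  congr 2
  push_cast
  field_simp
  ring

/-- With the damping `exp (-ε x² / 2)` every exponential moment exists. It is an integral of `Φ`
over the imaginary axis against a Gaussian centred at `q`; moving the line to real part `p`, through
the centre, turns it into a genuine Gaussian average of `Φ`. -/
theorem gauss_smoothed_moment {ε : ℝ} (hε : 0 < ε) (u₀ : ℝ)
    (hΦ : ∀ u : ℝ, charFun μ u = Φ (u * Complex.I))
    (hcont : ContinuousOn Φ {z | z.re ∈ uIcc 0 p})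
    (hd : DifferentiableOn ℂ Φ {z | z.re ∈ Ioo (min 0 p) (max 0 p)})
    (hb : ∀ z : ℂ, z.re ∈ uIcc 0 p → ‖Φ z‖ ≤ B) :
    √(2 * Real.pi) * ∫ x : ℝ, Complex.exp ((p + u₀ * Complex.I) * x - ε * x ^ 2 / 2) ∂μ
      = ∫ v : ℝ, Real.exp (-v ^ 2 / 2) * Φ (p + (u₀ + √ε * v : ℝ) * Complex.I) := by
  set q : ℂ := p + u₀ * Complex.I with hq
  have hε' : (ε : ℂ) ≠ 0 := by exact_mod_cast hε.ne'
  have hB : 0 ≤ B := (norm_nonneg _).trans (hb 0 (by simp))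
  have hknorm : ∀ z : ℂ, z.re ∈ uIcc 0 p → ‖Complex.exp ((z - q) ^ 2 / (2 * ε))‖
      ≤ Real.exp ((p ^ 2 + u₀ ^ 2) / (2 * ε)) * Real.exp (-(1 / (4 * ε)) * z.im ^ 2) := by
    intro z hz
    rw [Complex.norm_exp, ← Real.exp_add, Real.exp_le_exp]
    have e : ((z - q) ^ 2 / (2 * ε)).re = ((z.re - p) ^ 2 - (z.im - u₀) ^ 2) / (2 * ε) := by
      rw [show (2 * (ε : ℂ)) = ((2 * ε : ℝ) : ℂ) by push_cast; ring, Complex.div_ofReal_re]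
      congr 1
      simp [hq, pow_two]
    rw [e]
    have h1 : (z.re - p) ^ 2 ≤ p ^ 2 := by
      rw [sq_le_sq]
      have := abs_sub_right_of_mem_uIcc hz
      rw [sub_zero] at this
      rwa [abs_sub_comm]
    have h2 : z.im ^ 2 / 2 - u₀ ^ 2 ≤ (z.im - u₀) ^ 2 := by nlinarith [sq_nonneg (z.im - 2 * u₀)]
    have e2 : (p ^ 2 + u₀ ^ 2) / (2 * ε) + -(1 / (4 * ε)) * z.im ^ 2
        = (p ^ 2 + u₀ ^ 2 - z.im ^ 2 / 2) / (2 * ε) := by field_simp; ring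
    rw [e2]
    refine div_le_div_of_nonneg_right ?_ (by positivity)
    linarith
  have hc : 0 < 1 / (4 * ε) := by positivity
  have hker : Continuous fun y : ℝ => Complex.exp ((y * Complex.I - q) ^ 2 / (2 * ε)) := by
    fun_prop
  have hkeri : Integrable fun y : ℝ => Complex.exp ((y * Complex.I - q) ^ 2 / (2 * ε)) :=
    integrable_gauss_bound hc hker fun y => by
      simpa using hknorm (y * Complex.I) (by simp)
  have hF : ∫ x : ℝ, (√(2 * Real.pi * ε) : ℂ) * Complex.exp (q * x - ε * x ^ 2 / 2) ∂μ
      = ∫ y : ℝ, Complex.exp ((y * Complex.I - q) ^ 2 / (2 * ε)) * Φ (y * Complex.I) := by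
    simp_rw [← gauss_kernel_integral hε q]
    rw [integral_integral_swap]
    · refine integral_congr_ae (Eventually.of_forall fun y => ?_)
      simp only
      rw [integral_const_mul, ← hΦ, charFun_apply_real]
    · have h1 : Integrable (fun z : ℝ × ℝ => (1 : ℂ) *
          Complex.exp ((z.2 * Complex.I - q) ^ 2 / (2 * ε))) (μ.prod volume) :=
        Integrable.mul_prod (integrable_const _) hkeri
      refine h1.mono (by fun_prop) (Eventually.of_forall fun z => ?_)
      simp only [one_mul]
      rw [Function.uncurry_def]
      simp only
      rw [norm_mul, show ((z.2 : ℂ) * z.1 * Complex.I) = ((z.2 * z.1 : ℝ) : ℂ) * Complex.I by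
        push_cast; ring, Complex.norm_exp_ofReal_mul_I, mul_one]
  have hshift := integral_vertical_line_eq
    (f := fun z => Complex.exp ((z - q) ^ 2 / (2 * ε)) * Φ z) (p := p)
    (C := Real.exp ((p ^ 2 + u₀ ^ 2) / (2 * ε)) * B) hc
    (ContinuousOn.mul (by fun_prop) hcont) (DifferentiableOn.mul (by fun_prop) hd) (fun z hz => by
      rw [norm_mul]
      calc _ ≤ (Real.exp ((p ^ 2 + u₀ ^ 2) / (2 * ε)) * Real.exp (-(1 / (4 * ε)) * z.im ^ 2)) * B :=
            mul_le_mul (hknorm z hz) (hb z hz) (norm_nonneg _) (by positivity)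
        _ = _ := by ring)
  rw [hshift, integral_const_mul] at hF
  have hsε : 0 < √ε := Real.sqrt_pos.2 hε
  have hsq : √ε ^ 2 = ε := Real.sq_sqrt hε.le
  -- The substitution `y = u₀ + √ε v` normalises the Gaussian.
  have hsub : ∫ y : ℝ, Complex.exp ((p + y * Complex.I - q) ^ 2 / (2 * ε))
      * Φ (p + y * Complex.I)
      = √ε * ∫ v : ℝ, Real.exp (-v ^ 2 / 2) * Φ (p + (u₀ + √ε * v : ℝ) * Complex.I) := by
    set G : ℝ → ℂ := fun y => Complex.exp ((p + y * Complex.I - q) ^ 2 / (2 * ε))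
      * Φ (p + y * Complex.I) with hG
    have h1 := integral_add_left_eq_self (μ := volume) G u₀
    have h2 := Measure.integral_comp_mul_left (fun w => G (u₀ + w)) (√ε)
    rw [abs_of_pos (inv_pos.2 hsε), h1, Complex.real_smul] at h2
    have h3 : ∀ v : ℝ, G (u₀ + √ε * v)
        = Real.exp (-v ^ 2 / 2) * Φ (p + (u₀ + √ε * v : ℝ) * Complex.I) := by
      intro v
      simp only [hG, hq]
      congr 1
      rw [Complex.ofReal_exp]
      congr 1
      have hc : ((√ε : ℝ) : ℂ) ^ 2 = (ε : ℂ) := by exact_mod_cast hsq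
      push_cast
      rw [show ((p : ℂ) + (u₀ + √ε * v) * Complex.I - (p + u₀ * Complex.I))
        = √ε * v * Complex.I by ring, mul_pow, mul_pow, hc, Complex.I_sq]
      field_simp
    simp only [h3] at h2
    rw [h2]
    have : (√ε : ℂ) ≠ 0 := by exact_mod_cast hsε.ne'
    push_cast
    field_simp
  rw [hsub, Real.sqrt_mul (by positivity)] at hF
  have hne : (√ε : ℂ) ≠ 0 := by exact_mod_cast hsε.ne'
  apply mul_left_cancel₀ hne
  rw [← hF]
  push_cast
  ring

/-- Gaussian averages are an approximate identity; the bound `B` dominates. -/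
theorem tendsto_gauss_average
    (hcont : ContinuousOn Φ {z | z.re ∈ uIcc 0 p}) (u₀ : ℝ)
    (hb : ∀ z : ℂ, z.re ∈ uIcc 0 p → ‖Φ z‖ ≤ B) {ε : ℕ → ℝ} (hε : Tendsto ε atTop (𝓝 0)) :
    Tendsto (fun n => ∫ v : ℝ, Real.exp (-v ^ 2 / 2) * Φ (p + (u₀ + √(ε n) * v : ℝ) * Complex.I))
      atTop (𝓝 (√(2 * Real.pi) * Φ (p + u₀ * Complex.I))) := by
  have hline : Continuous fun y : ℝ => Φ (p + y * Complex.I) :=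
    hcont.comp_continuous (by fun_prop) fun y => by simp
  have hg : Integrable fun v : ℝ => Real.exp (-v ^ 2 / 2) :=
    (integrable_exp_neg_mul_sq (by norm_num : (0 : ℝ) < 1 / 2)).congr
      (Eventually.of_forall fun v => by simp only; congr 1; ring)
  have hgi : ∫ v : ℝ, Real.exp (-v ^ 2 / 2) = √(2 * Real.pi) := by
    have := integral_gaussian (1 / 2)
    rw [show Real.pi / (1 / 2) = 2 * Real.pi by ring] at this
    rw [← this]
    congr 1; ext v; congr 1; ring
  have e : (√(2 * Real.pi) : ℂ) * Φ (p + u₀ * Complex.I)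
      = ∫ v : ℝ, (Real.exp (-v ^ 2 / 2) : ℂ) * Φ (p + u₀ * Complex.I) := by
    rw [integral_mul_const, integral_complex_ofReal, hgi]
  rw [e]
  refine tendsto_integral_of_dominated_convergence (fun v => Real.exp (-v ^ 2 / 2) * B)
    (fun n => ?_) (hg.mul_const B) (fun n => Eventually.of_forall fun v => ?_)
    (Eventually.of_forall fun v => ?_)
  · have : Continuous fun v : ℝ => Φ (p + (u₀ + √(ε n) * v : ℝ) * Complex.I) :=
      hline.comp (by fun_prop)
    exact (Continuous.mul (by fun_prop) this).aestronglyMeasurable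
  · rw [norm_mul, Complex.norm_of_nonneg (Real.exp_pos _).le]
    gcongr
    exact hb _ (by simp)
  · refine Tendsto.const_mul _ ?_
    have h1 : Tendsto (fun n => u₀ + √(ε n) * v) atTop (𝓝 (u₀ + √0 * v)) :=
      ((hε.sqrt).mul_const v).const_add u₀
    rw [Real.sqrt_zero, zero_mul, add_zero] at h1
    exact (hline.tendsto u₀).comp h1

/-- If the characteristic function of `μ` continues analytically and boundedly to the strip between
`0` and `p`, then `μ` has an exponential moment of order `p`, given by the continuation. -/
theorem exp_moment_of_continuation
    (hΦ : ∀ u : ℝ, charFun μ u = Φ (u * Complex.I))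
    (hcont : ContinuousOn Φ {z | z.re ∈ uIcc 0 p})
    (hd : DifferentiableOn ℂ Φ {z | z.re ∈ Ioo (min 0 p) (max 0 p)})
    (hb : ∀ z : ℂ, z.re ∈ uIcc 0 p → ‖Φ z‖ ≤ B) :
    Integrable (fun x : ℝ => Real.exp (p * x)) μ ∧
    ∀ u : ℝ, ∫ x : ℝ, Complex.exp ((p + u * Complex.I) * x) ∂μ = Φ (p + u * Complex.I) := by
  set ε : ℕ → ℝ := fun n => 1 / ((n : ℝ) + 1) with hε
  have hε0 : ∀ n, 0 < ε n := fun n => by simp only [hε]; positivity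
  have hεlim : Tendsto ε atTop (𝓝 0) := tendsto_one_div_add_atTop_nhds_zero_nat
  have hs : (0 : ℝ) < √(2 * Real.pi) := Real.sqrt_pos.2 (by positivity)
  have hsC : ((√(2 * Real.pi) : ℝ) : ℂ) ≠ 0 := by exact_mod_cast hs.ne'
  have hlim : ∀ u : ℝ, Tendsto (fun n => ∫ x : ℝ,
      Complex.exp ((p + u * Complex.I) * x - ε n * x ^ 2 / 2) ∂μ) atTop
      (𝓝 (Φ (p + u * Complex.I))) := by
    intro u
    have h1 := tendsto_gauss_average hcont u hb hεlim
    have h2 := h1.const_mul ((√(2 * Real.pi) : ℂ)⁻¹)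
    rw [inv_mul_cancel_left₀ hsC] at h2
    refine h2.congr fun n => ?_
    rw [← gauss_smoothed_moment (hε0 n) u hΦ hcont hd hb, inv_mul_cancel_left₀ hsC]
  -- At `u = 0` the damped integrands are positive and their integrals converge, so Fatou's lemma
  -- bounds the undamped moment. Once it is finite, `exp (p x)` dominates and identifies the moments
  -- for every `u`.
  have hi : Integrable (fun x : ℝ => Real.exp (p * x)) μ := by
    refine ⟨by fun_prop, ?_⟩
    have hfatou := lintegral_liminf_le (μ := μ) (u := (atTop : Filter ℕ))
      (f := fun n x => ENNReal.ofReal (Real.exp (p * x - ε n * x ^ 2 / 2))) (fun n => by fun_prop)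
    have hpt : ∀ x : ℝ, liminf (fun n => ENNReal.ofReal (Real.exp (p * x - ε n * x ^ 2 / 2))) atTop
        = ENNReal.ofReal (Real.exp (p * x)) := by
      intro x
      refine Tendsto.liminf_eq (ENNReal.tendsto_ofReal ((Real.continuous_exp.tendsto _).comp ?_))
      have : Tendsto (fun n => p * x - ε n * x ^ 2 / 2) atTop (𝓝 (p * x - 0 * x ^ 2 / 2)) :=
        tendsto_const_nhds.sub ((hεlim.mul_const _).div_const _)
      simpa using this
    simp only [hpt] at hfatou
    have hval : ∀ n, ∫⁻ x, ENNReal.ofReal (Real.exp (p * x - ε n * x ^ 2 / 2)) ∂μ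
        = ENNReal.ofReal ‖∫ x : ℝ,
          Complex.exp ((p + (0 : ℝ) * Complex.I) * x - ε n * x ^ 2 / 2) ∂μ‖ := by
      intro n
      have hbd : ∀ x : ℝ, p * x - ε n * x ^ 2 / 2 ≤ p ^ 2 / (2 * ε n) := by
        intro x
        rw [le_div_iff₀ (by have := hε0 n; positivity)]
        nlinarith [sq_nonneg (p - ε n * x)]
      have hint : Integrable (fun x : ℝ => Real.exp (p * x - ε n * x ^ 2 / 2)) μ :=
        (integrable_const (Real.exp (p ^ 2 / (2 * ε n)))).mono' (by fun_prop)
          (Eventually.of_forall fun x => by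
            rw [Real.norm_of_nonneg (Real.exp_pos _).le]
            exact Real.exp_le_exp.2 (hbd x))
      have e : ∀ x : ℝ, Complex.exp ((p + (0 : ℝ) * Complex.I) * x - ε n * x ^ 2 / 2)
          = ((Real.exp (p * x - ε n * x ^ 2 / 2) : ℝ) : ℂ) := by
        intro x; push_cast; congr 1; ring
      simp only [e]
      rw [integral_complex_ofReal, Complex.norm_of_nonneg
        (integral_nonneg fun x => (Real.exp_pos _).le),
        ofReal_integral_eq_lintegral_ofReal hint (Eventually.of_forall fun x => (Real.exp_pos _).le)]
    have hl : Tendsto (fun n => ∫⁻ x, ENNReal.ofReal (Real.exp (p * x - ε n * x ^ 2 / 2)) ∂μ) atTop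
        (𝓝 (ENNReal.ofReal ‖Φ (p + (0 : ℝ) * Complex.I)‖)) := by
      simp only [hval]
      exact ENNReal.tendsto_ofReal (hlim 0).norm
    rw [hl.liminf_eq] at hfatou
    rw [hasFiniteIntegral_iff_ofReal (Eventually.of_forall fun x => (Real.exp_pos _).le)]
    exact hfatou.trans_lt ENNReal.ofReal_lt_top
  refine ⟨hi, fun u => ?_⟩
  refine tendsto_nhds_unique ?_ (hlim u)
  refine tendsto_integral_of_dominated_convergence (fun x => Real.exp (p * x))
    (fun n => by fun_prop) hi (fun n => Eventually.of_forall fun x => ?_)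
    (Eventually.of_forall fun x => ?_)
  · rw [Complex.norm_exp, Real.exp_le_exp]
    have e : ((p + u * Complex.I) * x - ε n * x ^ 2 / 2 : ℂ)
        = ((p * x - ε n * x ^ 2 / 2 : ℝ) : ℂ) + ((u * x : ℝ) : ℂ) * Complex.I := by
      push_cast; ring
    rw [e]
    simp only [Complex.add_re, Complex.ofReal_re, Complex.re_ofReal_mul, Complex.I_re, mul_zero,
      add_zero]
    have : 0 ≤ ε n * x ^ 2 := mul_nonneg (hε0 n).le (sq_nonneg x)
    linarith
  · refine (Complex.continuous_exp.tendsto _).comp ?_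
    have h0 : Tendsto (fun n => ((ε n : ℝ) : ℂ)) atTop (𝓝 ((0 : ℝ) : ℂ)) :=
      (Complex.continuous_ofReal.tendsto 0).comp hεlim
    have : Tendsto (fun n => ((p + u * Complex.I) * x - ε n * x ^ 2 / 2 : ℂ)) atTop
        (𝓝 ((p + u * Complex.I) * x - ((0 : ℝ) : ℂ) * x ^ 2 / 2)) :=
      tendsto_const_nhds.sub ((h0.mul_const _).div_const _)
    simpa using this

end ExpMoment

/-! ### The cumulant function -/

/-- The integrand of the jump part of the cumulant function. -/
noncomputable def jumpKernel (z : ℂ) (x : ℝ) : ℂ :=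
  Complex.exp (z * x) - 1 - z * (Complex.exp x - 1)

/-- The cumulant function `log E exp (z X₁)` of an exponential Lévy process. -/
noncomputable def cumulant (σ : ℝ) (ν : Measure ℝ) (z : ℂ) : ℂ :=
  (σ : ℂ) ^ 2 / 2 * (z * (z - 1)) + ∫ x : ℝ, jumpKernel z x ∂ν

/-- The orders of the exponential moments of the large jumps. -/
def momentSet (ν : Measure ℝ) : Set ℝ :=
  {p : ℝ | IntegrableOn (fun x : ℝ => Real.exp (p * x)) {x : ℝ | 1 < |x|} ν}

theorem jumpExponent_eq (ν : Measure ℝ) (u : ℂ) :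
    jumpExponent ν u = ∫ x : ℝ, jumpKernel (Complex.I * u) x ∂ν := rfl

theorem levyExponent_eq_cumulant (σ : ℝ) (ν : Measure ℝ) (u : ℂ) :
    levyExponent σ ν u = cumulant σ ν (u * Complex.I) := by
  rw [levyExponent, cumulant, jumpExponent_eq, mul_comm u]
  congr 1
  ring_nf
  rw [Complex.I_sq]; ring

theorem measurableSet_large : MeasurableSet {x : ℝ | 1 < |x|} :=
  measurableSet_lt measurable_const (by fun_prop)

theorem compl_large : {x : ℝ | 1 < |x|}ᶜ = {x : ℝ | |x| ≤ 1} := by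
  ext x; simp

theorem measurableSet_small : MeasurableSet {x : ℝ | |x| ≤ 1} :=
  compl_large ▸ measurableSet_large.compl

theorem momentSet_eq (ν : Measure ℝ) :
    momentSet ν = integrableExpSet id (ν.restrict {x : ℝ | 1 < |x|}) := rfl

theorem convex_momentSet (ν : Measure ℝ) : Convex ℝ (momentSet ν) := by
  rw [momentSet_eq]; exact convex_integrableExpSet

theorem norm_cexp_sub_one_sub_le (w : ℂ) : ‖Complex.exp w - 1 - w‖ ≤ ‖w‖ ^ 2 * Real.exp ‖w‖ := by
  have := Complex.norm_exp_sub_sum_le_norm_mul_exp w 2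
  simpa [Finset.sum_range_succ, sub_sub] using this

theorem norm_cexp_sub_one_le (w : ℂ) : ‖Complex.exp w - 1‖ ≤ ‖w‖ * Real.exp ‖w‖ := by
  have := Complex.norm_exp_sub_sum_le_norm_mul_exp w 1
  simpa using this

theorem norm_mul_ofReal_le {z : ℂ} {x R : ℝ} (hz : ‖z‖ ≤ R) (hx : |x| ≤ 1) :
    ‖z * x‖ ≤ R * |x| ∧ ‖z * x‖ ≤ R := by
  have h0 : ‖z * x‖ = ‖z‖ * |x| := by simp
  have hR : 0 ≤ R := (norm_nonneg z).trans hz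
  rw [h0]
  exact ⟨by gcongr, (mul_le_mul hz hx (abs_nonneg x) hR).trans_eq (mul_one R)⟩

/-- The kernel is regrouped into two differences, each of second order at `x = 0`, because near `0`
only `x²` is integrable against a Lévy measure. -/
theorem norm_jumpKernel_small {z : ℂ} {x R : ℝ} (hz : ‖z‖ ≤ R) (hx : |x| ≤ 1) :
    ‖jumpKernel z x‖ ≤ (R ^ 2 * Real.exp R + R * Real.exp 1) * x ^ 2 := by
  have hR : 0 ≤ R := (norm_nonneg z).trans hz
  obtain ⟨h1, h2⟩ := norm_mul_ofReal_le hz hx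
  have h3 : ‖((x : ℝ) : ℂ)‖ = |x| := by simp
  have e : jumpKernel z x = (Complex.exp (z * x) - 1 - z * x)
      - z * (Complex.exp x - 1 - x) := by rw [jumpKernel]; ring
  rw [e]
  refine (norm_sub_le _ _).trans ?_
  rw [norm_mul]
  have a1 : ‖Complex.exp (z * x) - 1 - z * x‖ ≤ (R * |x|) ^ 2 * Real.exp R :=
    (norm_cexp_sub_one_sub_le _).trans (by gcongr)
  have a2 : ‖Complex.exp x - 1 - x‖ ≤ |x| ^ 2 * Real.exp 1 := by
    refine (norm_cexp_sub_one_sub_le _).trans ?_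
    rw [h3]; gcongr
  calc _ ≤ (R * |x|) ^ 2 * Real.exp R + R * (|x| ^ 2 * Real.exp 1) := by gcongr
    _ = _ := by rw [mul_pow, sq_abs]; ring

theorem hasDerivAt_jumpKernel (z : ℂ) (x : ℝ) :
    HasDerivAt (fun z => jumpKernel z x) (x * Complex.exp (z * x) - (Complex.exp x - 1)) z := by
  have h1 : HasDerivAt (fun z : ℂ => z * x) (x : ℂ) z := by
    simpa using (hasDerivAt_id z).mul_const (x : ℂ)
  have h2 := (h1.cexp.sub_const 1).sub ((hasDerivAt_id z).mul_const (Complex.exp x - 1))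
  refine h2.congr_deriv ?_
  simp; ring

theorem continuous_jumpKernel (z : ℂ) : Continuous (jumpKernel z) := by
  unfold jumpKernel; fun_prop

/-! ### Integrability of the jump kernel, regularity of the cumulant function, exponential moments
-/

namespace IsExpLevyMeasure

variable {ν : Measure ℝ}

theorem integrableOn_sq (hν : IsExpLevyMeasure ν) : IntegrableOn (fun x : ℝ => x ^ 2) {x : ℝ | |x| ≤ 1} ν := by
  refine ⟨by fun_prop, ?_⟩
  rw [hasFiniteIntegral_iff_ofReal (Eventually.of_forall fun x => sq_nonneg x)]
  refine lt_of_le_of_lt ?_ hν.small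
  refine (setLIntegral_mono_ae' measurableSet_small (Eventually.of_forall fun x hx => ?_)).trans
    (setLIntegral_le_lintegral _ _)
  refine ENNReal.ofReal_le_ofReal (le_min le_rfl ?_)
  have hx' : |x| ≤ 1 := hx
  rw [← sq_abs]
  exact pow_le_one₀ (abs_nonneg x) hx'

theorem measure_large_lt_top (hν : IsExpLevyMeasure ν) : ν {x : ℝ | 1 < |x|} < ⊤ := by
  refine lt_of_le_of_lt ?_ hν.small
  rw [← setLIntegral_one]
  refine (setLIntegral_mono_ae' measurableSet_large (Eventually.of_forall fun x hx => ?_)).trans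
    (setLIntegral_le_lintegral _ _)
  have hx' : 1 < |x| := hx
  rw [min_eq_right, ENNReal.ofReal_one]
  rw [← sq_abs]
  exact one_le_pow₀ hx'.le

theorem isFiniteMeasure_large (hν : IsExpLevyMeasure ν) : IsFiniteMeasure (ν.restrict {x : ℝ | 1 < |x|}) :=
  ⟨by rw [Measure.restrict_apply_univ]; exact hν.measure_large_lt_top⟩

theorem zero_mem (hν : IsExpLevyMeasure ν) : (0 : ℝ) ∈ momentSet ν := by
  have := hν.isFiniteMeasure_large
  simp [momentSet, IntegrableOn]

theorem one_mem (hν : IsExpLevyMeasure ν) : (1 : ℝ) ∈ momentSet ν := by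
  refine ⟨by fun_prop, ?_⟩
  rw [hasFiniteIntegral_iff_ofReal (Eventually.of_forall fun x => (Real.exp_pos _).le)]
  simpa using hν.large

theorem uIcc_subset (hν : IsExpLevyMeasure ν) {p : ℝ} (hp : p ∈ momentSet ν) : uIcc 0 p ⊆ momentSet ν :=
  (convex_momentSet ν).ordConnected.uIcc_subset hν.zero_mem hp

theorem integrableOn_large (hν : IsExpLevyMeasure ν) {z : ℂ} (hz : z.re ∈ momentSet ν) :
    IntegrableOn (jumpKernel z) {x : ℝ | 1 < |x|} ν := by
  have := hν.isFiniteMeasure_large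
  have h1 : IntegrableOn (fun x : ℝ => Complex.exp (z * x)) {x : ℝ | 1 < |x|} ν := by
    refine Integrable.mono' hz (by fun_prop) (Eventually.of_forall fun x => ?_)
    rw [Complex.norm_exp]; simp
  have h2 : IntegrableOn (fun x : ℝ => Complex.exp x) {x : ℝ | 1 < |x|} ν := by
    refine Integrable.mono' hν.one_mem (by fun_prop) (Eventually.of_forall fun x => ?_)
    rw [Complex.norm_exp]; simp
  exact (h1.sub (integrable_const 1)).sub ((h2.sub (integrable_const 1)).const_mul z)

theorem integrableOn_small (hν : IsExpLevyMeasure ν) (z : ℂ) : IntegrableOn (jumpKernel z) {x : ℝ | |x| ≤ 1} ν := by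
  refine Integrable.mono' (hν.integrableOn_sq.const_mul
    (‖z‖ ^ 2 * Real.exp ‖z‖ + ‖z‖ * Real.exp 1))
    (continuous_jumpKernel z).aestronglyMeasurable ?_
  exact (ae_restrict_mem measurableSet_small).mono fun x hx => norm_jumpKernel_small le_rfl hx

theorem integrable_jumpKernel (hν : IsExpLevyMeasure ν) {z : ℂ} (hz : z.re ∈ momentSet ν) : Integrable (jumpKernel z) ν := by
  rw [← integrableOn_univ, ← union_compl_self {x : ℝ | 1 < |x|}, compl_large]
  exact (hν.integrableOn_large hz).union (hν.integrableOn_small z)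

/-- Small jumps contribute an entire function of `z`. Large jumps form a finite measure, and their
contribution is its moment generating function up to an affine term. -/
theorem integral_jumpKernel (hν : IsExpLevyMeasure ν) {z : ℂ} (hz : z.re ∈ momentSet ν) :
    ∫ x, jumpKernel z x ∂ν = (∫ x in {x : ℝ | |x| ≤ 1}, jumpKernel z x ∂ν)
      + (complexMGF id (ν.restrict {x : ℝ | 1 < |x|}) z - ν.real {x : ℝ | 1 < |x|}
        - z * ∫ x in {x : ℝ | 1 < |x|}, (Complex.exp x - 1) ∂ν) := by
  have := hν.isFiniteMeasure_large
  rw [← integral_add_compl measurableSet_large (hν.integrable_jumpKernel hz), compl_large, add_comm]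
  congr 1
  have h1 : IntegrableOn (fun x : ℝ => Complex.exp (z * x)) {x : ℝ | 1 < |x|} ν := by
    refine Integrable.mono' hz (by fun_prop) (Eventually.of_forall fun x => ?_)
    rw [Complex.norm_exp]; simp
  have h2 : IntegrableOn (fun x : ℝ => Complex.exp x) {x : ℝ | 1 < |x|} ν := by
    refine Integrable.mono' hν.one_mem (by fun_prop) (Eventually.of_forall fun x => ?_)
    rw [Complex.norm_exp]; simp
  have h3 : IntegrableOn (fun x : ℝ => Complex.exp (z * x) - 1) {x : ℝ | 1 < |x|} ν :=
    h1.sub (integrable_const 1)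
  have h4 : IntegrableOn (fun x : ℝ => z * (Complex.exp x - 1)) {x : ℝ | 1 < |x|} ν :=
    (h2.sub (integrable_const 1)).const_mul z
  unfold jumpKernel
  rw [integral_sub h3 h4, integral_sub h1 (integrable_const 1), integral_const_mul, integral_const]
  simp [complexMGF, Measure.real]

theorem differentiable_small (hν : IsExpLevyMeasure ν) :
    Differentiable ℂ fun z => ∫ x in {x : ℝ | |x| ≤ 1}, jumpKernel z x ∂ν := by
  intro z₀
  set R : ℝ := ‖z₀‖ + 1 with hR
  have hR0 : 0 ≤ R := by positivity
  have := hasDerivAt_integral_of_dominated_loc_of_deriv_le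
    (μ := ν.restrict {x : ℝ | |x| ≤ 1}) (F := fun z x => jumpKernel z x)
    (F' := fun z x => x * Complex.exp (z * x) - (Complex.exp x - 1))
    (x₀ := z₀) (s := Metric.ball z₀ 1) (bound := fun x => (R * Real.exp R + Real.exp 1) * x ^ 2)
    (Metric.ball_mem_nhds z₀ one_pos)
    (Eventually.of_forall fun z => (continuous_jumpKernel z).aestronglyMeasurable)
    (hν.integrableOn_small z₀) (by fun_prop) ?_ (hν.integrableOn_sq.const_mul _)
    (Eventually.of_forall fun x z _ => hasDerivAt_jumpKernel z x)
  · exact this.2.differentiableAt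
  · refine (ae_restrict_mem measurableSet_small).mono fun x hx z hz => ?_
    have hx' : |x| ≤ 1 := hx
    have hz' : ‖z‖ ≤ R := by
      have := norm_sub_norm_le z z₀
      rw [Metric.mem_ball, dist_eq_norm] at hz
      linarith
    obtain ⟨h1, h2⟩ := norm_mul_ofReal_le hz' hx'
    have h3 : ‖((x : ℝ) : ℂ)‖ = |x| := by simp
    -- Again each difference is quadratic in `x`, uniformly for `z` in the unit ball around `z₀`.
    have e : (x : ℂ) * Complex.exp (z * x) - (Complex.exp x - 1)
        = x * (Complex.exp (z * x) - 1) - (Complex.exp x - 1 - x) := by ring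
    rw [e]
    refine (norm_sub_le _ _).trans ?_
    rw [norm_mul, h3]
    have a1 : ‖Complex.exp (z * x) - 1‖ ≤ (R * |x|) * Real.exp R :=
      (norm_cexp_sub_one_le _).trans (by gcongr)
    have a2 : ‖Complex.exp x - 1 - x‖ ≤ |x| ^ 2 * Real.exp 1 := by
      refine (norm_cexp_sub_one_sub_le _).trans ?_
      rw [h3]; gcongr
    calc _ ≤ |x| * ((R * |x|) * Real.exp R) + |x| ^ 2 * Real.exp 1 := by gcongr
      _ = _ := by rw [← sq_abs x]; ring

/-- Continuity on the closed strip is needed because `0` or `1` may be an endpoint of the moment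
set. For `Re z` between `a` and `b`, `exp (a x) + exp (b x)` dominates. -/
theorem continuousOn_large {a b : ℝ} (ha : a ∈ momentSet ν) (hb : b ∈ momentSet ν) :
    ContinuousOn (complexMGF id (ν.restrict {x : ℝ | 1 < |x|})) {z | z.re ∈ uIcc a b} := by
  unfold complexMGF
  refine continuousOn_of_dominated (bound := fun x => Real.exp (a * x) + Real.exp (b * x))
    (fun z _ => by fun_prop) (fun z hz => Eventually.of_forall fun x => ?_) (ha.add hb)
    (Eventually.of_forall fun x => by fun_prop)
  rw [Complex.norm_exp]
  simp only [id_eq, Complex.mul_re, Complex.ofReal_re, Complex.ofReal_im, mul_zero, sub_zero]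
  have hz' : z.re ∈ uIcc a b := hz
  have : z.re * x ≤ max (a * x) (b * x) := by
    rcases mem_uIcc.1 hz' with ⟨h1, h2⟩ | ⟨h1, h2⟩ <;> rcases le_total 0 x with h | h
    · exact le_max_of_le_right (by gcongr)
    · exact le_max_of_le_left (mul_le_mul_of_nonpos_right h1 h)
    · exact le_max_of_le_left (by gcongr)
    · exact le_max_of_le_right (mul_le_mul_of_nonpos_right h1 h)
  refine (Real.exp_le_exp.2 this).trans ?_
  rcases max_choice (a * x) (b * x) with h | h <;> rw [h] <;>
    linarith [Real.exp_pos (a * x), Real.exp_pos (b * x)]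

theorem continuousOn_cumulant (hν : IsExpLevyMeasure ν) (σ : ℝ) {a b : ℝ} (ha : a ∈ momentSet ν) (hb : b ∈ momentSet ν) :
    ContinuousOn (cumulant σ ν) {z | z.re ∈ uIcc a b} := by
  have hsub : ∀ z : ℂ, z.re ∈ uIcc a b → z.re ∈ momentSet ν := fun z hz =>
    (convex_momentSet ν).ordConnected.uIcc_subset ha hb hz
  unfold cumulant
  refine ContinuousOn.add (by fun_prop) ?_
  refine ContinuousOn.congr ?_ fun z hz => hν.integral_jumpKernel (hsub z hz)
  refine hν.differentiable_small.continuous.continuousOn.add ?_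
  exact ((continuousOn_large ha hb).sub continuousOn_const).sub (by fun_prop)

theorem differentiableOn_cumulant (hν : IsExpLevyMeasure ν) (σ : ℝ) :
    DifferentiableOn ℂ (cumulant σ ν) {z | z.re ∈ interior (momentSet ν)} := by
  unfold cumulant
  refine DifferentiableOn.add (by fun_prop) ?_
  refine DifferentiableOn.congr ?_ fun z hz => hν.integral_jumpKernel (interior_subset hz)
  refine hν.differentiable_small.differentiableOn.add ?_
  exact ((differentiableOn_complexMGF (X := id) (μ := ν.restrict {x : ℝ | 1 < |x|})).sub_const _).sub
    (by fun_prop)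

theorem analyticAt_cumulant (hν : IsExpLevyMeasure ν) (σ : ℝ) {z : ℂ} (hz : z.re ∈ interior (momentSet ν)) :
    AnalyticAt ℂ (cumulant σ ν) z :=
  (hν.differentiableOn_cumulant σ).analyticAt
    ((isOpen_interior.preimage Complex.continuous_re).mem_nhds hz)

theorem re_jumpKernel (p u x : ℝ) : (jumpKernel (p + u * Complex.I) x).re
    = Real.exp (p * x) * Real.cos (u * x) - 1 - p * (Real.exp x - 1) := by
  have e1 : ((p : ℂ) + u * Complex.I) * x = ((p * x : ℝ) : ℂ) + ((u * x : ℝ) : ℂ) * Complex.I := by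
    push_cast; ring
  have e2 : jumpKernel (p + u * Complex.I) x = ((Real.exp (p * x) : ℝ) : ℂ)
      * Complex.exp (((u * x : ℝ) : ℂ) * Complex.I) - 1 - ((p + u * Complex.I)
        * ((Real.exp x - 1 : ℝ) : ℂ)) := by
    rw [jumpKernel, e1, Complex.exp_add]; push_cast; ring
  rw [e2, Complex.sub_re, Complex.sub_re, Complex.re_ofReal_mul, Complex.exp_ofReal_mul_I_re,
    Complex.re_mul_ofReal]
  simp

theorem integrable_tilt_cos (hν : IsExpLevyMeasure ν) {p : ℝ} (hp : p ∈ momentSet ν) (u : ℝ) :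
    Integrable (fun x : ℝ => Real.exp (p * x) * (1 - Real.cos (u * x))) ν := by
  have h1 := (hν.integrable_jumpKernel (z := p + (0 : ℝ) * Complex.I) (by simpa using hp)).re
  have h2 := (hν.integrable_jumpKernel (z := p + u * Complex.I) (by simpa using hp)).re
  refine (h1.sub h2).congr (Eventually.of_forall fun x => ?_)
  simp only [Pi.sub_apply, RCLike.re_to_complex, re_jumpKernel]
  simp; ring

/-- The subtracted terms are nonnegative, so on each vertical line the modulus of `exp (t K)` is
largest at the real point, and its decay is an explicit integral against `ν`. -/
theorem re_cumulant_sub (hν : IsExpLevyMeasure ν) (σ : ℝ) {p : ℝ} (hp : p ∈ momentSet ν) (u : ℝ) :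
    (cumulant σ ν (p + u * Complex.I)).re = (cumulant σ ν p).re - σ ^ 2 * u ^ 2 / 2
      - ∫ x : ℝ, Real.exp (p * x) * (1 - Real.cos (u * x)) ∂ν := by
  have hi1 := hν.integrable_jumpKernel (z := p + (0 : ℝ) * Complex.I) (by simpa using hp)
  have hi2 := hν.integrable_jumpKernel (z := p + u * Complex.I) (by simpa using hp)
  have h : ∫ x : ℝ, Real.exp (p * x) * (1 - Real.cos (u * x)) ∂ν
      = (∫ x, jumpKernel (p + (0 : ℝ) * Complex.I) x ∂ν).re
        - (∫ x, jumpKernel (p + u * Complex.I) x ∂ν).re := by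
    have r1 := integral_re hi1
    have r2 := integral_re hi2
    simp only [RCLike.re_to_complex] at r1 r2
    have hr1 : Integrable (fun x => (jumpKernel (p + (0 : ℝ) * Complex.I) x).re) ν := hi1.re
    have hr2 : Integrable (fun x => (jumpKernel (p + u * Complex.I) x).re) ν := hi2.re
    rw [← r1, ← r2, ← integral_sub hr1 hr2]
    refine integral_congr_ae (Eventually.of_forall fun x => ?_)
    simp only [re_jumpKernel]
    simp; ring
  rw [h]
  simp only [Complex.ofReal_zero, zero_mul, add_zero]
  simp only [cumulant, Complex.add_re]
  have e : (σ : ℂ) ^ 2 / 2 = ((σ ^ 2 / 2 : ℝ) : ℂ) := by push_cast; ring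
  rw [e]
  simp only [Complex.re_ofReal_mul]
  simp
  ring

theorem cumulant_ofReal (σ : ℝ) (ν : Measure ℝ) (p : ℝ) :
    cumulant σ ν p = (((cumulant σ ν p).re : ℝ) : ℂ) := by
  have : ∀ x : ℝ, jumpKernel p x
      = ((Real.exp (p * x) - 1 - p * (Real.exp x - 1) : ℝ) : ℂ) := by
    intro x; simp [jumpKernel]
  have e : cumulant σ ν p = ((σ ^ 2 / 2 * (p * (p - 1))
      + ∫ x : ℝ, (Real.exp (p * x) - 1 - p * (Real.exp x - 1)) ∂ν : ℝ) : ℂ) := by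
    simp only [cumulant, this]
    rw [integral_complex_ofReal]
    push_cast; ring
  rw [e, Complex.ofReal_re]

theorem cumulant_zero (σ : ℝ) (ν : Measure ℝ) : cumulant σ ν 0 = 0 := by
  simp [cumulant, jumpKernel]

theorem cumulant_one (σ : ℝ) (ν : Measure ℝ) : cumulant σ ν 1 = 0 := by
  simp [cumulant, jumpKernel]

theorem Ioo_subset_interior (hν : IsExpLevyMeasure ν) {p : ℝ} (hp : p ∈ momentSet ν) :
    Ioo (min 0 p) (max 0 p) ⊆ interior (momentSet ν) :=
  interior_maximal (Ioo_subset_Icc_self.trans (hν.uIcc_subset hp)) isOpen_Ioo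

/-- The exponential moments of an exponential Lévy process. -/
theorem exp_moment (hν : IsExpLevyMeasure ν) {σ t : ℝ} (ht : 0 ≤ t) {μ : Measure ℝ} [IsProbabilityMeasure μ]
    (hμ : ∀ u : ℝ, charFun μ u = Complex.exp (t * cumulant σ ν (u * Complex.I)))
    {p : ℝ} (hp : p ∈ momentSet ν) :
    Integrable (fun x : ℝ => Real.exp (p * x)) μ ∧
    ∀ u : ℝ, ∫ x : ℝ, Complex.exp ((p + u * Complex.I) * x) ∂μ
      = Complex.exp (t * cumulant σ ν (p + u * Complex.I)) := by
  have hcont := hν.continuousOn_cumulant σ hν.zero_mem hp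
  have hreal : ContinuousOn (fun q : ℝ => (cumulant σ ν q).re) (uIcc 0 p) :=
    Complex.continuous_re.comp_continuousOn
      (hcont.comp Complex.continuous_ofReal.continuousOn fun q hq => by simpa using hq)
  obtain ⟨B, hB⟩ := (isCompact_uIcc.image_of_continuousOn hreal).bddAbove
  refine exp_moment_of_continuation (Φ := fun z => Complex.exp (t * cumulant σ ν z))
    (B := Real.exp (t * B)) hμ (by fun_prop)
    (((hν.differentiableOn_cumulant σ).mono fun z hz => hν.Ioo_subset_interior hp hz).const_mul _).cexp
    fun z hz => ?_
  -- On every vertical line the modulus is largest at the real point, so it suffices that `B` bounds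
  -- the cumulant on a compact real segment.
  rw [Complex.norm_exp, Complex.re_ofReal_mul, Real.exp_le_exp]
  refine mul_le_mul_of_nonneg_left ?_ ht
  have h1 := hν.re_cumulant_sub σ (hν.uIcc_subset hp hz) z.im
  rw [Complex.re_add_im] at h1
  have h2 : 0 ≤ ∫ x : ℝ, Real.exp (z.re * x) * (1 - Real.cos (z.im * x)) ∂ν :=
    integral_nonneg fun x => mul_nonneg (Real.exp_pos _).le (by linarith [Real.cos_le_one (z.im * x)])
  have h3 : (cumulant σ ν z.re).re ≤ B := hB (mem_image_of_mem _ hz)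
  have : 0 ≤ σ ^ 2 * z.im ^ 2 := by positivity
  linarith

end IsExpLevyMeasure

/-! ### Decay of the tilted characteristic function -/

/-- `Re (K p - K (p + i u))` for the cumulant function `K`. -/
noncomputable def tiltedDecay (σ : ℝ) (ν : Measure ℝ) (p u : ℝ) : ℝ :=
  σ ^ 2 * u ^ 2 / 2 + ∫ x : ℝ, Real.exp (p * x) * (1 - Real.cos (u * x)) ∂ν

/-- The modulus of the characteristic function is bounded away from `1` outside every
neighbourhood of the origin. -/
def StronglyNonlattice (σ : ℝ) (ν : Measure ℝ) : Prop :=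
  ∀ δ > 0, ∃ η > 0, ∀ u : ℝ, δ ≤ |u| → η ≤ tiltedDecay σ ν 0 u

theorem abs_sin_nat_mul_le (n : ℕ) (x : ℝ) : |Real.sin (n * x)| ≤ n * |Real.sin x| := by
  induction n with
  | zero => simp
  | succ n ih =>
    push_cast
    rw [add_mul, one_mul, Real.sin_add]
    refine (abs_add_le _ _).trans ?_
    rw [abs_mul, abs_mul, add_mul, one_mul]
    refine add_le_add ((mul_le_of_le_one_right (abs_nonneg _) (Real.abs_cos_le_one x)).trans ih)
      (mul_le_of_le_one_left (abs_nonneg _) (Real.abs_cos_le_one _))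

/-- Since `1 - cos x = 2 sin² (x/2)`, this is the square of `|sin (n x)| ≤ n |sin x|`. It carries
lower bounds for the decay at frequency `n u` back to frequency `u`. -/
theorem one_sub_cos_nat_mul_le (n : ℕ) (x : ℝ) :
    1 - Real.cos (n * x) ≤ n ^ 2 * (1 - Real.cos x) := by
  have h : ∀ y : ℝ, 1 - Real.cos y = 2 * |Real.sin (y / 2)| ^ 2 := fun y => by
    rw [sq_abs]
    have h2 := Real.cos_two_mul (y / 2)
    rw [mul_div_cancel₀ y two_ne_zero] at h2
    have := Real.sin_sq_add_cos_sq (y / 2)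
    linarith
  rw [h, h, mul_div_assoc]
  have h2 := abs_sin_nat_mul_le n (x / 2)
  have h3 := abs_nonneg (Real.sin (n * (x / 2)))
  nlinarith

namespace IsExpLevyMeasure

variable {ν : Measure ℝ} {σ : ℝ}

theorem one_sub_cos_nonneg (x : ℝ) : 0 ≤ 1 - Real.cos x := by linarith [Real.cos_le_one x]

theorem tiltedDecay_eq (hν : IsExpLevyMeasure ν) {p : ℝ} (hp : p ∈ momentSet ν) (u : ℝ) :
    tiltedDecay σ ν p u
      = (cumulant σ ν p).re - (cumulant σ ν (p + u * Complex.I)).re := by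
  rw [hν.re_cumulant_sub σ hp u, tiltedDecay]; ring

theorem tiltedDecay_nonneg (p u : ℝ) : 0 ≤ tiltedDecay σ ν p u :=
  add_nonneg (by positivity) (integral_nonneg fun _ =>
    mul_nonneg (Real.exp_pos _).le (one_sub_cos_nonneg _))

theorem tiltedDecay_nat_mul_le (hν : IsExpLevyMeasure ν) {p : ℝ} (hp : p ∈ momentSet ν) (n : ℕ)
    (u : ℝ) : tiltedDecay σ ν p (n * u) ≤ n ^ 2 * tiltedDecay σ ν p u := by
  rw [tiltedDecay, tiltedDecay, mul_add, ← integral_const_mul]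
  refine add_le_add (le_of_eq (by ring)) ?_
  refine integral_mono (hν.integrable_tilt_cos hp _) ((hν.integrable_tilt_cos hp _).const_mul _)
    fun x => ?_
  simp only
  rw [mul_left_comm, mul_assoc (n : ℝ)]
  exact mul_le_mul_of_nonneg_left (one_sub_cos_nat_mul_le n _) (Real.exp_pos _).le

theorem continuous_tiltedDecay (hν : IsExpLevyMeasure ν) {p : ℝ} (hp : p ∈ momentSet ν) :
    Continuous (tiltedDecay σ ν p) := by
  have h1 : Continuous fun u : ℝ => cumulant σ ν (p + u * Complex.I) :=
    (hν.continuousOn_cumulant σ hp hp).comp_continuous (by fun_prop) fun u => by simp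
  have : tiltedDecay σ ν p = fun u : ℝ =>
      (cumulant σ ν p).re - (cumulant σ ν (p + u * Complex.I)).re :=
    funext fun u => hν.tiltedDecay_eq hp u
  rw [this]
  exact continuous_const.sub (Complex.continuous_re.comp h1)

/-- Control near infinity suffices: a zero of the decay at some `u ≠ 0` would give zeros at all
multiples `n u`, which are eventually large. On the compact remainder the positive continuous decay
attains its minimum. -/
theorem stronglyNonlattice_of_eventually (hν : IsExpLevyMeasure ν) {η₀ : ℝ} (hη₀ : 0 < η₀)
    (h : ∀ᶠ u : ℝ in cocompact ℝ, η₀ ≤ tiltedDecay σ ν 0 u) : StronglyNonlattice σ ν := by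
  obtain ⟨t, ht, hsub⟩ := mem_cocompact.1 h
  have hpos : ∀ u : ℝ, u ≠ 0 → 0 < tiltedDecay σ ν 0 u := by
    intro u hu
    refine lt_of_le_of_ne (tiltedDecay_nonneg 0 u) fun h0 => ?_
    obtain ⟨B, hB⟩ := ht.isBounded.exists_norm_le
    obtain ⟨n, hn⟩ := exists_nat_gt (B / |u|)
    have hn' : (n : ℝ) * u ∉ t := by
      intro hmem
      have h1 := hB _ hmem
      rw [div_lt_iff₀ (abs_pos.2 hu)] at hn
      rw [norm_mul, Real.norm_natCast, Real.norm_eq_abs] at h1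
      linarith
    have h2 : η₀ ≤ tiltedDecay σ ν 0 (n * u) := hsub hn'
    have h3 := hν.tiltedDecay_nat_mul_le (σ := σ) hν.zero_mem n u
    rw [← h0, mul_zero] at h3
    linarith
  intro δ hδ
  have hcl : IsClosed {u : ℝ | δ ≤ |u|} := isClosed_le continuous_const continuous_abs
  have hc := ht.inter_right hcl
  rcases (t ∩ {u : ℝ | δ ≤ |u|}).eq_empty_or_nonempty with he | hne
  · refine ⟨η₀, hη₀, fun u hu => hsub fun hut => ?_⟩
    have : u ∈ t ∩ {u : ℝ | δ ≤ |u|} := ⟨hut, hu⟩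
    rw [he] at this
    exact this
  · obtain ⟨u₀, hu₀, hmin⟩ := hc.exists_isMinOn hne
      (hν.continuous_tiltedDecay (σ := σ) hν.zero_mem).continuousOn
    have hu₀' : u₀ ≠ 0 := by
      rintro rfl
      have : δ ≤ |(0 : ℝ)| := hu₀.2
      rw [abs_zero] at this
      linarith
    refine ⟨min η₀ (tiltedDecay σ ν 0 u₀), lt_min hη₀ (hpos u₀ hu₀'), fun u hu => ?_⟩
    by_cases hut : u ∈ t
    · exact (min_le_right _ _).trans (hmin ⟨hut, hu⟩)
    · exact (min_le_left _ _).trans (hsub hut)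

/-- Continuity from above of the finite measure of large jumps. -/
theorem exists_measure_tail_lt (hν : IsExpLevyMeasure ν) {η : ℝ} (hη : 0 < η) :
    ∃ M : ℝ, 1 ≤ M ∧ ν.real {x : ℝ | M < |x|} < η := by
  have hanti : Antitone fun n : ℕ => {x : ℝ | (n : ℝ) + 1 < |x|} := by
    intro m n hmn x hx
    have hx' : (n : ℝ) + 1 < |x| := hx
    have : (m : ℝ) ≤ n := by exact_mod_cast hmn
    change (m : ℝ) + 1 < |x|
    linarith
  have hlim := tendsto_measure_iInter_atTop (μ := ν)
    (s := fun n : ℕ => {x : ℝ | (n : ℝ) + 1 < |x|})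
    (fun n => (measurableSet_lt measurable_const (by fun_prop)).nullMeasurableSet) hanti
    ⟨0, by simpa using hν.measure_large_lt_top.ne⟩
  have hempty : ⋂ n : ℕ, {x : ℝ | (n : ℝ) + 1 < |x|} = ∅ := by
    refine eq_empty_of_forall_notMem fun x hx => ?_
    obtain ⟨n, hn⟩ := exists_nat_gt |x|
    have : (n : ℝ) + 1 < |x| := mem_iInter.1 hx n
    linarith
  rw [hempty, measure_empty] at hlim
  have hlim2 := (ENNReal.tendsto_toReal ENNReal.zero_ne_top).comp hlim
  obtain ⟨n, hn⟩ := (hlim2.eventually (gt_mem_nhds (by simpa using hη))).exists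
  exact ⟨n + 1, by linarith [(Nat.cast_nonneg n : (0 : ℝ) ≤ n)], hn⟩

/-- Tilting preserves the condition. Jumps beyond `M` have mass below `η / 4`, hence contribute at
most `η / 2` to the untilted decay; for the others the tilt factor is at least `exp (-|p| M)`. -/
theorem tiltedDecay_bounded_below (hν : IsExpLevyMeasure ν) (hnl : StronglyNonlattice σ ν)
    {p : ℝ} (hp : p ∈ momentSet ν) {δ : ℝ} (hδ : 0 < δ) :
    ∃ η > 0, ∀ u : ℝ, δ ≤ |u| → η ≤ tiltedDecay σ ν p u := by
  obtain ⟨η, hη, h⟩ := hnl δ hδ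
  obtain ⟨M, hM, hMη⟩ := hν.exists_measure_tail_lt (by positivity : 0 < η / 4)
  refine ⟨Real.exp (-(|p| * M)) * (η / 2), by positivity, fun u hu => ?_⟩
  have hS : MeasurableSet {x : ℝ | M < |x|} := measurableSet_lt measurable_const (by fun_prop)
  have hfin : ν {x : ℝ | M < |x|} ≠ ⊤ :=
    ((measure_mono fun x (hx : M < |x|) => hM.trans_lt hx).trans_lt hν.measure_large_lt_top).ne
  have hi0 := hν.integrable_tilt_cos hν.zero_mem u
  have hip := hν.integrable_tilt_cos hp u
  have h1 := h u hu
  rw [tiltedDecay, ← integral_add_compl hS hi0] at h1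
  rw [tiltedDecay, ← integral_add_compl hS hip]
  have h2 : ∫ x in {x : ℝ | M < |x|}, Real.exp (0 * x) * (1 - Real.cos (u * x)) ∂ν ≤ η / 2 := by
    have : IsFiniteMeasure (ν.restrict {x : ℝ | M < |x|}) :=
      ⟨by rw [Measure.restrict_apply_univ]; exact hfin.lt_top⟩
    calc _ ≤ ∫ x in {x : ℝ | M < |x|}, (2 : ℝ) ∂ν := by
          refine integral_mono hi0.integrableOn (integrable_const _) fun x => ?_
          simp only [zero_mul, Real.exp_zero, one_mul]
          linarith [Real.neg_one_le_cos (u * x)]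
      _ = ν.real {x : ℝ | M < |x|} * 2 := by simp [Measure.real]
      _ ≤ _ := by linarith
  have h3 : 0 ≤ ∫ x in {x : ℝ | M < |x|}, Real.exp (p * x) * (1 - Real.cos (u * x)) ∂ν :=
    integral_nonneg fun x => mul_nonneg (Real.exp_pos _).le (one_sub_cos_nonneg _)
  have h4 : Real.exp (-(|p| * M)) * ∫ x in {x : ℝ | M < |x|}ᶜ,
        Real.exp (0 * x) * (1 - Real.cos (u * x)) ∂ν
      ≤ ∫ x in {x : ℝ | M < |x|}ᶜ, Real.exp (p * x) * (1 - Real.cos (u * x)) ∂ν := by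
    rw [← integral_const_mul]
    refine setIntegral_mono_on (hi0.integrableOn.const_mul _) hip.integrableOn hS.compl
      fun x hx => ?_
    rw [zero_mul, Real.exp_zero, one_mul]
    refine mul_le_mul_of_nonneg_right (Real.exp_le_exp.2 ?_) (one_sub_cos_nonneg _)
    have hx' : |x| ≤ M := not_lt.1 hx
    have : |p * x| ≤ |p| * M := by rw [abs_mul]; gcongr
    linarith [neg_abs_le (p * x)]
  have h5 : Real.exp (-(|p| * M)) ≤ 1 := Real.exp_le_one_iff.2 (by
    have := mul_nonneg (abs_nonneg p) (zero_le_one.trans hM); linarith)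
  have h6 : Real.exp (-(|p| * M)) * (σ ^ 2 * u ^ 2 / 2) ≤ σ ^ 2 * u ^ 2 / 2 :=
    mul_le_of_le_one_left (by positivity) h5
  have h7 : Real.exp (-(|p| * M)) * (η / 2) ≤ Real.exp (-(|p| * M)) * (σ ^ 2 * u ^ 2 / 2
      + ∫ x in {x : ℝ | M < |x|}ᶜ, Real.exp (0 * x) * (1 - Real.cos (u * x)) ∂ν) := by
    refine mul_le_mul_of_nonneg_left ?_ (Real.exp_pos _).le
    linarith
  rw [mul_add] at h7
  linarith

/-- For small `u` a multiple `n u` with `1 ≤ |n u| ≤ 2` falls in the range of the uniform bound, and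
passing back to `u` costs `n² ≤ 4 / u²`. -/
theorem tiltedDecay_quadratic (hν : IsExpLevyMeasure ν) (hnl : StronglyNonlattice σ ν)
    {p : ℝ} (hp : p ∈ momentSet ν) :
    ∃ c > 0, ∀ u : ℝ, |u| ≤ 1 → c * u ^ 2 ≤ tiltedDecay σ ν p u := by
  obtain ⟨η, hη, h⟩ := hν.tiltedDecay_bounded_below hnl hp one_pos
  refine ⟨η / 4, by positivity, fun u hu => ?_⟩
  rcases eq_or_ne u 0 with rfl | hu0
  · simpa using tiltedDecay_nonneg p 0
  have hup : 0 < |u| := abs_pos.2 hu0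
  set n := ⌈1 / |u|⌉₊ with hn
  have h1 : 1 / |u| ≤ n := Nat.le_ceil _
  have h2 : (n : ℝ) < 1 / |u| + 1 := Nat.ceil_lt_add_one (by positivity)
  have h3 : (n : ℝ) * |u| ≤ 2 := by
    have : (n : ℝ) * |u| ≤ (1 / |u| + 1) * |u| := by gcongr
    have e : (1 / |u| + 1) * |u| = 1 + |u| := by field_simp
    linarith
  have h4 := h (n * u) (by
    rw [abs_mul, Nat.abs_cast]
    rwa [div_le_iff₀ hup] at h1)
  have h5 := h4.trans (hν.tiltedDecay_nat_mul_le hp n u)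
  have h6 : (n : ℝ) ^ 2 * u ^ 2 ≤ 4 := by
    rw [← sq_abs u, ← mul_pow]
    have : 0 ≤ (n : ℝ) * |u| := by positivity
    nlinarith
  have h7 := tiltedDecay_nonneg (σ := σ) (ν := ν) p u
  have h8 : 0 ≤ u ^ 2 := sq_nonneg u
  calc η / 4 * u ^ 2 ≤ ((n : ℝ) ^ 2 * tiltedDecay σ ν p u) / 4 * u ^ 2 := by gcongr
    _ = ((n : ℝ) ^ 2 * u ^ 2) * tiltedDecay σ ν p u / 4 := by ring
    _ ≤ 4 * tiltedDecay σ ν p u / 4 := by gcongr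
    _ = _ := by ring

end IsExpLevyMeasure

/-! ### The real cumulant function -/

/-- Laplace's method uses complex derivatives of the cumulant function, the coefficients of the
theorem use real ones of `Ξ`; this identifies them. -/
theorem iteratedDeriv_ofReal_eq {f : ℂ → ℂ} {g : ℝ → ℝ} {U : Set ℝ} (hU : IsOpen U)
    (hf : ∀ x ∈ U, AnalyticAt ℂ f x) (hfg : ∀ x ∈ U, f x = g x) (n : ℕ) :
    ∀ x ∈ U, iteratedDeriv n f x = ((iteratedDeriv n g x : ℝ) : ℂ) := by
  induction n with
  | zero => simpa using hfg
  | succ n ih =>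
    intro x hx
    have h1 : HasDerivAt (iteratedDeriv n f) (iteratedDeriv (n + 1) f x) (x : ℂ) := by
      rw [iteratedDeriv_succ]
      refine DifferentiableAt.hasDerivAt ?_
      rw [iteratedDeriv_eq_iterate]
      exact ((hf x hx).iterated_deriv n).differentiableAt
    have hev : (fun t : ℝ => iteratedDeriv n f t) =ᶠ[𝓝 x]
        fun t : ℝ => ((iteratedDeriv n g t : ℝ) : ℂ) := by
      filter_upwards [hU.mem_nhds hx] with t ht using ih t ht
    have h2 : HasDerivAt (iteratedDeriv n g) (iteratedDeriv (n + 1) f x).re x := by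
      refine h1.real_of_complex.congr_of_eventuallyEq ?_
      filter_upwards [hev] with t ht
      rw [ht, Complex.ofReal_re]
    have h3 := (h1.comp_ofReal.congr_of_eventuallyEq hev.symm).unique h2.ofReal_comp
    rw [h3, iteratedDeriv_succ (f := g), h2.deriv]

/-- The real cumulant function. -/
noncomputable def realCumulant (σ : ℝ) (ν : Measure ℝ) (p : ℝ) : ℝ := (cumulant σ ν p).re

/-- The change of variable `p = 1/2 - y` links the notation of the theorem with the cumulant
function; derivatives of odd order change sign. -/
theorem levyXi_eq (σ : ℝ) (ν : Measure ℝ) : levyXi σ ν = fun y => realCumulant σ ν (1 / 2 - y) := by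
  ext y
  have e1 : Complex.I * (Complex.I * (y : ℂ) - Complex.I / 2) = ((1 / 2 - y : ℝ) : ℂ) := by
    push_cast
    ring_nf
    rw [Complex.I_sq]; ring
  rw [levyXi, jumpExponent_eq, e1, realCumulant, cumulant, Complex.add_re, add_comm]
  congr 1
  have e2 : (σ : ℂ) ^ 2 / 2 * (((1 / 2 - y : ℝ) : ℂ) * (((1 / 2 - y : ℝ) : ℂ) - 1))
      = ((σ ^ 2 / 2 * ((1 / 2 - y) * ((1 / 2 - y) - 1)) : ℝ) : ℂ) := by push_cast; ring
  rw [e2, Complex.ofReal_re, quadR]; ring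

theorem iteratedDeriv_levyXi (σ : ℝ) (ν : Measure ℝ) (n : ℕ) (y : ℝ) :
    iteratedDeriv n (levyXi σ ν) y
      = (-1) ^ n * iteratedDeriv n (realCumulant σ ν) (1 / 2 - y) := by
  rw [levyXi_eq, iteratedDeriv_comp_const_sub]
  simp

theorem deriv_levyXi (σ : ℝ) (ν : Measure ℝ) (y : ℝ) :
    deriv (levyXi σ ν) y = -deriv (realCumulant σ ν) (1 / 2 - y) := by
  rw [← iteratedDeriv_one, iteratedDeriv_levyXi, iteratedDeriv_one]; ring

theorem analyticityInterval_iff {ν : Measure ℝ} {y : ℝ} :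
    y ∈ analyticityInterval ν ↔ 1 / 2 - y ∈ interior (momentSet ν) := by
  have h := (Homeomorph.subLeft (1 / 2 : ℝ)).preimage_interior (momentSet ν)
  change y ∈ interior ((Homeomorph.subLeft (1 / 2 : ℝ)) ⁻¹' (momentSet ν)) ↔ _
  rw [← h]; rfl

namespace IsExpLevyMeasure

variable {ν : Measure ℝ} {σ : ℝ}

theorem iteratedDeriv_cumulant (hν : IsExpLevyMeasure ν) {p : ℝ}
    (hp : p ∈ interior (momentSet ν)) (n : ℕ) :
    iteratedDeriv n (cumulant σ ν) p = ((iteratedDeriv n (realCumulant σ ν) p : ℝ) : ℂ) :=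
  iteratedDeriv_ofReal_eq isOpen_interior
    (fun _ hx => hν.analyticAt_cumulant σ (by simpa using hx))
    (fun x _ => cumulant_ofReal σ ν x) n p hp

theorem differentiableAt_realCumulant (hν : IsExpLevyMeasure ν) {p : ℝ}
    (hp : p ∈ interior (momentSet ν)) : DifferentiableAt ℝ (realCumulant σ ν) p :=
  (hν.analyticAt_cumulant σ (z := (p : ℂ))
    (by simpa using hp)).differentiableAt.hasDerivAt.real_of_complex.differentiableAt

theorem continuousOn_realCumulant (hν : IsExpLevyMeasure ν) :
    ∀ p ∈ momentSet ν, ∀ q ∈ momentSet ν, ContinuousOn (realCumulant σ ν) (uIcc p q) :=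
  fun _ hp _ hq => Complex.continuous_re.comp_continuousOn
    ((hν.continuousOn_cumulant σ hp hq).comp Complex.continuous_ofReal.continuousOn
      fun r hr => by simpa using hr)

/-- The second order expansion of the cumulant function, with an analytic remainder. -/
theorem exists_remainder (hν : IsExpLevyMeasure ν) {p : ℝ} (hp : p ∈ interior (momentSet ν)) :
    ∃ κ : ℂ → ℂ, AnalyticAt ℂ κ 0 ∧
      (∀ w, cumulant σ ν (p + w) = realCumulant σ ν p + deriv (realCumulant σ ν) p * w
        + (iteratedDeriv 2 (realCumulant σ ν) p : ℝ) * w ^ 2 / 2 + w ^ 3 * κ w) ∧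
      κ 0 = ((iteratedDeriv 3 (realCumulant σ ν) p / 6 : ℝ) : ℂ) ∧
      deriv κ 0 = ((iteratedDeriv 4 (realCumulant σ ν) p / 24 : ℝ) : ℂ) := by
  have han := hν.analyticAt_cumulant σ (z := (p : ℂ)) (by simpa using hp)
  have hf : AnalyticAt ℂ (fun w => cumulant σ ν (p + w)) 0 := by
    refine AnalyticAt.fun_comp ?_ (by fun_prop)
    simpa using han
  obtain ⟨κ, hκ, h1, h2, h3⟩ := hf.exists_cubic_remainder
  have hit : ∀ n, iteratedDeriv n (fun w => cumulant σ ν (p + w)) 0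
      = ((iteratedDeriv n (realCumulant σ ν) p : ℝ) : ℂ) := by
    intro n
    rw [iteratedDeriv_comp_const_add]
    simp only [add_zero]
    exact hν.iteratedDeriv_cumulant hp n
  refine ⟨κ, hκ, fun w => ?_, ?_, ?_⟩
  · rw [h1 w, hit, ← iteratedDeriv_one, hit, iteratedDeriv_one, add_zero, cumulant_ofReal]
    rw [realCumulant]; ring
  · rw [h2, hit]; push_cast; ring
  · rw [h3, hit]; push_cast; ring

/-- In the expansion at `p` the decay is `u² (K''(p) / 2 + o(1))`, and it is at least `c u²`; hence
`K''(p) ≥ 2 c`. -/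
theorem iteratedDeriv_two_pos (hν : IsExpLevyMeasure ν) (hnl : StronglyNonlattice σ ν) {p : ℝ}
    (hp : p ∈ interior (momentSet ν)) : 0 < iteratedDeriv 2 (realCumulant σ ν) p := by
  obtain ⟨κ, hκ, h1, -, -⟩ := hν.exists_remainder (σ := σ) hp
  obtain ⟨c, hc, hq⟩ := hν.tiltedDecay_quadratic hnl (interior_subset hp)
  set A := iteratedDeriv 2 (realCumulant σ ν) p with hA
  have hre : ∀ u : ℝ, tiltedDecay σ ν p u
      = u ^ 2 * (A / 2 - u * (κ (u * Complex.I)).im) := by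
    intro u
    have hI3 : Complex.I ^ 3 = -Complex.I := by rw [pow_succ, Complex.I_sq]; ring
    rw [hν.tiltedDecay_eq (interior_subset hp), h1 (u * Complex.I), mul_pow, mul_pow,
      Complex.I_sq, hI3]
    have e : (realCumulant σ ν p : ℂ) + deriv (realCumulant σ ν) p * (u * Complex.I)
        + (A : ℂ) * ((u : ℂ) ^ 2 * -1) / 2 + (u : ℂ) ^ 3 * -Complex.I * κ (u * Complex.I)
        = ((realCumulant σ ν p - A * u ^ 2 / 2 : ℝ) : ℂ)
          + ((deriv (realCumulant σ ν) p * u : ℝ) : ℂ) * Complex.I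
          + ((u ^ 3 : ℝ) : ℂ) * (-Complex.I * κ (u * Complex.I)) := by push_cast; ring
    rw [e]
    simp only [Complex.add_re, Complex.ofReal_re, Complex.re_ofReal_mul, Complex.I_re, mul_zero,
      add_zero]
    simp only [Complex.mul_re, Complex.neg_re, Complex.neg_im, Complex.I_im, Complex.I_re,
      realCumulant]
    ring
  have hlim : Tendsto (fun u : ℝ => A / 2 - u * (κ (u * Complex.I)).im) (𝓝[>] 0)
      (𝓝 (A / 2 - 0 * (κ ((0 : ℝ) * Complex.I)).im)) := by
    have h2 : ContinuousAt (fun u : ℝ => A / 2 - u * (κ (u * Complex.I)).im) 0 := by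
      have h3 : ContinuousAt (fun u : ℝ => κ (u * Complex.I)) 0 := by
        refine ContinuousAt.comp (f := fun u : ℝ => (u : ℂ) * Complex.I) (g := κ) ?_ (by fun_prop)
        simpa using hκ.continuousAt
      exact continuousAt_const.sub (continuousAt_id.mul (Complex.continuous_im.continuousAt.comp h3))
    exact h2.tendsto.mono_left nhdsWithin_le_nhds
  have hge : c ≤ A / 2 - 0 * (κ ((0 : ℝ) * Complex.I)).im := by
    refine ge_of_tendsto hlim ?_
    filter_upwards [Ioo_mem_nhdsGT one_pos] with u hu
    have h4 := hq u (by rw [abs_of_pos hu.1]; exact hu.2.le)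
    rw [hre u, mul_comm] at h4
    exact le_of_mul_le_mul_left h4 (pow_pos hu.1 2)
  linarith

/-- Positivity of `K''` holds in the interior only. Continuity on closed subintervals extends strict
convexity to the endpoints of the moment set, where `0` or `1` may lie. -/
theorem strictConvexOn_realCumulant (hν : IsExpLevyMeasure ν) (hnl : StronglyNonlattice σ ν) :
    StrictConvexOn ℝ (momentSet ν) (realCumulant σ ν) := by
  have key : ∀ p ∈ momentSet ν, ∀ q ∈ momentSet ν, p < q →
      StrictConvexOn ℝ (Icc p q) (realCumulant σ ν) := by
    intro p hp q hq hpq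
    refine strictConvexOn_of_deriv2_pos (convex_Icc p q) ?_ fun x hx => ?_
    · rw [← uIcc_of_le hpq.le]
      exact hν.continuousOn_realCumulant p hp q hq
    · rw [← iteratedDeriv_eq_iterate]
      exact hν.iteratedDeriv_two_pos hnl
        (interior_mono ((convex_momentSet ν).ordConnected.out hp hq) hx)
  refine ⟨convex_momentSet ν, fun p hp q hq hpq a b ha hb hab => ?_⟩
  rcases lt_or_gt_of_ne hpq with h | h
  · exact (key p hp q hq h).2 (left_mem_Icc.2 h.le) (right_mem_Icc.2 h.le) hpq ha hb hab
  · exact (key q hq p hp h).2 (right_mem_Icc.2 h.le) (left_mem_Icc.2 h.le) hpq ha hb hab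

/-- A strictly convex function lies above its tangents. -/
theorem realCumulant_tangent_lt (hν : IsExpLevyMeasure ν) (hnl : StronglyNonlattice σ ν) {p q : ℝ}
    (hp : p ∈ interior (momentSet ν)) (hq : q ∈ momentSet ν) (hpq : p ≠ q) :
    realCumulant σ ν p + deriv (realCumulant σ ν) p * (q - p) < realCumulant σ ν q := by
  have hc := hν.strictConvexOn_realCumulant hnl
  have hd := hν.differentiableAt_realCumulant (σ := σ) hp
  rcases lt_or_gt_of_ne hpq with h | h
  · have := hc.deriv_lt_slope (interior_subset hp) hq h hd
    rw [slope_def_field, lt_div_iff₀ (by linarith)] at this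
    linarith
  · have := hc.slope_lt_deriv hq (interior_subset hp) h hd
    rw [slope_def_field, div_lt_iff₀ (by linarith)] at this
    linarith

theorem realCumulant_zero : realCumulant σ ν 0 = 0 := by
  rw [realCumulant, Complex.ofReal_zero, cumulant_zero, Complex.zero_re]

theorem realCumulant_one : realCumulant σ ν 1 = 0 := by
  rw [realCumulant, Complex.ofReal_one, cumulant_one, Complex.zero_re]

end IsExpLevyMeasure

open scoped NNReal FourierTransform

/-! ### The Fourier representation of call prices -/

/-- The one-sided exponential with Fourier transform `1 / (q + i u)`. -/
noncomputable def oneSidedExp (q x : ℝ) : ℂ :=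
  if 0 < q then (Ioi (0 : ℝ)).indicator (fun x : ℝ => Complex.exp (-q * x)) x
    else -(Iic (0 : ℝ)).indicator (fun x : ℝ => Complex.exp (-q * x)) x

/-- The Fourier transform of the damped payoff. -/
noncomputable def priceKernel (p : ℝ) (w : ℂ) : ℂ := 1 / ((p + w) * (p - 1 + w))

/-- The call payoff, normalised by subtracting its exponential asymptotes and damped. -/
noncomputable def dampedPayoff (p x : ℝ) : ℝ :=
  Real.exp (-p * x) * (max (Real.exp x - 1) 0 - (if p < 1 then Real.exp x else 0)
    + (if p < 0 then 1 else 0))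

theorem integrable_oneSidedExp {q : ℝ} (hq : q ≠ 0) : Integrable (oneSidedExp q) := by
  unfold oneSidedExp
  rcases lt_or_gt_of_ne hq with h | h
  · simp only [not_lt.2 h.le, if_false]
    refine Integrable.neg ((integrable_indicator_iff measurableSet_Iic).2 ?_)
    simpa using integrableOn_exp_mul_complex_Iic (a := -q) (by simpa using h) 0
  · simp only [h, if_true]
    refine (integrable_indicator_iff measurableSet_Ioi).2 ?_
    simpa using integrableOn_exp_mul_complex_Ioi (a := -q) (by simpa using h) 0

theorem integral_oneSidedExp {q : ℝ} (hq : q ≠ 0) (u : ℝ) :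
    ∫ x : ℝ, Complex.exp (-(u * x) * Complex.I) * oneSidedExp q x = 1 / (q + u * Complex.I) := by
  have e : ∀ x : ℝ, Complex.exp (-(u * x) * Complex.I) * Complex.exp (-q * x)
      = Complex.exp (-(q + u * Complex.I) * x) := fun x => by
    rw [← Complex.exp_add]; congr 1; ring
  unfold oneSidedExp
  rcases lt_or_gt_of_ne hq with h | h
  · simp only [not_lt.2 h.le, if_false, mul_neg]
    have e2 : ∀ x : ℝ, Complex.exp (-(u * x) * Complex.I)
        * (Iic (0 : ℝ)).indicator (fun x : ℝ => Complex.exp (-q * x)) x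
        = (Iic (0 : ℝ)).indicator (fun x : ℝ => Complex.exp (-(q + u * Complex.I) * x)) x := by
      intro x
      by_cases hx : x ∈ Iic (0 : ℝ)
      · rw [indicator_of_mem hx, indicator_of_mem hx, e]
      · rw [indicator_of_notMem hx, indicator_of_notMem hx, mul_zero]
    simp only [e2]
    rw [integral_neg, integral_indicator measurableSet_Iic,
      integral_exp_mul_complex_Iic (by simpa using h)]
    simp only [Complex.ofReal_zero, mul_zero, Complex.exp_zero]
    rw [div_neg, neg_neg]
  · simp only [h, if_true]
    have e2 : ∀ x : ℝ, Complex.exp (-(u * x) * Complex.I)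
        * (Ioi (0 : ℝ)).indicator (fun x : ℝ => Complex.exp (-q * x)) x
        = (Ioi (0 : ℝ)).indicator (fun x : ℝ => Complex.exp (-(q + u * Complex.I) * x)) x := by
      intro x
      by_cases hx : x ∈ Ioi (0 : ℝ)
      · rw [indicator_of_mem hx, indicator_of_mem hx, e]
      · rw [indicator_of_notMem hx, indicator_of_notMem hx, mul_zero]
    simp only [e2]
    rw [integral_indicator measurableSet_Ioi, integral_exp_mul_complex_Ioi (by simpa using h)]
    simp only [Complex.ofReal_zero, mul_zero, Complex.exp_zero]
    rw [neg_div_neg_eq]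

/-- The partial fraction decomposition of the kernel, seen on the payoff side. The subtracted
asymptotes give a call for `p > 1`, a call minus the asset for `0 < p < 1` and a put for `p < 0`. -/
theorem dampedPayoff_eq {p : ℝ} (h0 : p ≠ 0) (h1 : p ≠ 1) (x : ℝ) :
    (dampedPayoff p x : ℂ) = oneSidedExp (p - 1) x - oneSidedExp p x := by
  have hexp : Real.exp (-p * x) * Real.exp x = Real.exp (-(p - 1) * x) := by
    rw [← Real.exp_add]; congr 1; ring
  have c0 : ∀ q : ℝ, Complex.exp (-q * x) = ((Real.exp (-q * x) : ℝ) : ℂ) := fun q => by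
    push_cast; rfl
  have c1 : (0 < p - 1) ↔ ¬ p < 1 := by
    rw [sub_pos, not_lt]; exact ⟨le_of_lt, fun h => lt_of_le_of_ne h (Ne.symm h1)⟩
  have c2 : (0 < p) ↔ ¬ p < 0 := by
    rw [not_lt]; exact ⟨le_of_lt, fun h => lt_of_le_of_ne h (Ne.symm h0)⟩
  unfold dampedPayoff oneSidedExp
  by_cases hx : 0 < x
  · have hm : max (Real.exp x - 1) 0 = Real.exp x - 1 :=
      max_eq_left (by linarith [Real.one_le_exp hx.le])
    simp only [indicator_of_mem (show x ∈ Ioi (0 : ℝ) from hx),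
      indicator_of_notMem (show x ∉ Iic (0 : ℝ) from not_le.2 hx), c0, c1, c2, hm, ← hexp]
    by_cases g1 : p < 1 <;> by_cases g2 : p < 0 <;> (simp [g1, g2]; try ring)
  · have hx' := not_lt.1 hx
    have hm : max (Real.exp x - 1) 0 = 0 :=
      max_eq_right (by linarith [Real.exp_le_one_iff.2 hx'])
    simp only [indicator_of_notMem (show x ∉ Ioi (0 : ℝ) from hx),
      indicator_of_mem (show x ∈ Iic (0 : ℝ) from hx'), c0, c1, c2, hm, ← hexp]
    by_cases g1 : p < 1 <;> by_cases g2 : p < 0 <;> (simp [g1, g2]; try ring)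

theorem ofReal_add_mul_I_ne_zero {q : ℝ} (hq : q ≠ 0) (u : ℝ) : (q : ℂ) + u * Complex.I ≠ 0 := by
  intro h
  have := congrArg Complex.re h
  simp at this
  exact hq this

theorem priceKernel_eq_sub {p : ℝ} (h0 : p ≠ 0) (h1 : p ≠ 1) (u : ℝ) :
    priceKernel p (u * Complex.I) = 1 / (((p - 1 : ℝ) : ℂ) + u * Complex.I)
      - 1 / (p + u * Complex.I) := by
  have a := ofReal_add_mul_I_ne_zero h0 u
  have b := ofReal_add_mul_I_ne_zero (sub_ne_zero.2 h1) u
  rw [priceKernel, div_sub_div _ _ b a]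
  congr 1
  · push_cast; ring
  · push_cast; ring

theorem norm_ofReal_add_mul_I_sq (q u : ℝ) : ‖(q : ℂ) + u * Complex.I‖ ^ 2 = q ^ 2 + u ^ 2 := by
  rw [← Complex.normSq_eq_norm_sq, Complex.normSq_add_mul_I]

theorem continuous_priceKernel {p : ℝ} (h0 : p ≠ 0) (h1 : p ≠ 1) :
    Continuous fun u : ℝ => priceKernel p (u * Complex.I) := by
  simp only [priceKernel_eq_sub h0 h1]
  exact (continuous_const.div (by fun_prop) (ofReal_add_mul_I_ne_zero (sub_ne_zero.2 h1))).sub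
    (continuous_const.div (by fun_prop) (ofReal_add_mul_I_ne_zero h0))

/-- Each factor decays like `1 / |u|`, and a product is at most the sum of the squares of its
factors. -/
theorem integrable_priceKernel {p : ℝ} (h0 : p ≠ 0) (h1 : p ≠ 1) :
    Integrable fun u : ℝ => priceKernel p (u * Complex.I) := by
  have key : ∀ q : ℝ, q ≠ 0 → ∃ c > 0, ∀ u : ℝ, c * (1 + u ^ 2) ≤ q ^ 2 + u ^ 2 := by
    intro q hq
    have hq2 : 0 < q ^ 2 := by positivity
    refine ⟨min (q ^ 2) 1, lt_min hq2 one_pos, fun u => ?_⟩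
    have a := min_le_left (q ^ 2) 1
    have b := min_le_right (q ^ 2) 1
    nlinarith [sq_nonneg u]
  obtain ⟨c, hc, hcb⟩ := key p h0
  obtain ⟨d, hd, hdb⟩ := key (p - 1) (sub_ne_zero.2 h1)
  refine (integrable_inv_one_add_sq.const_mul (c⁻¹ + d⁻¹)).mono'
    (continuous_priceKernel h0 h1).aestronglyMeasurable (Eventually.of_forall fun u => ?_)
  set a := ‖(p : ℂ) + u * Complex.I‖ with ha
  set b := ‖((p - 1 : ℝ) : ℂ) + u * Complex.I‖ with hb
  have ha0 : 0 < a := norm_pos_iff.2 (ofReal_add_mul_I_ne_zero h0 u)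
  have hb0 : 0 < b := norm_pos_iff.2 (ofReal_add_mul_I_ne_zero (sub_ne_zero.2 h1) u)
  have e : ‖priceKernel p (u * Complex.I)‖ = a⁻¹ * b⁻¹ := by
    rw [priceKernel, norm_div, norm_mul, norm_one, one_div, mul_inv, ha, hb]
    push_cast; rfl
  have a2 : a⁻¹ ^ 2 ≤ c⁻¹ * (1 + u ^ 2)⁻¹ := by
    rw [inv_pow, ← mul_inv]
    refine inv_anti₀ (by positivity) ?_
    rw [ha, norm_ofReal_add_mul_I_sq]
    exact hcb u
  have b2 : b⁻¹ ^ 2 ≤ d⁻¹ * (1 + u ^ 2)⁻¹ := by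
    rw [inv_pow, ← mul_inv]
    refine inv_anti₀ (by positivity) ?_
    rw [hb, norm_ofReal_add_mul_I_sq]
    exact hdb u
  rw [e, add_mul]
  have a3 : 0 < a⁻¹ := inv_pos.2 ha0
  have b3 : 0 < b⁻¹ := inv_pos.2 hb0
  nlinarith [sq_nonneg (a⁻¹ - b⁻¹)]

theorem integral_dampedPayoff {p : ℝ} (h0 : p ≠ 0) (h1 : p ≠ 1) (u : ℝ) :
    ∫ x : ℝ, Complex.exp (-(u * x) * Complex.I) * (dampedPayoff p x : ℂ)
      = priceKernel p (u * Complex.I) := by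
  simp only [dampedPayoff_eq h0 h1, mul_sub]
  have hi : ∀ q : ℝ, q ≠ 0 → Integrable fun x : ℝ =>
      Complex.exp (-(u * x) * Complex.I) * oneSidedExp q x := by
    intro q hq
    refine (integrable_oneSidedExp hq).bdd_mul (c := 1) (by fun_prop)
      (Eventually.of_forall fun x => ?_)
    rw [show -((u : ℂ) * x) * Complex.I = ((-(u * x) : ℝ) : ℂ) * Complex.I by push_cast; ring,
      Complex.norm_exp_ofReal_mul_I]
  rw [integral_sub (hi _ (sub_ne_zero.2 h1)) (hi _ h0), integral_oneSidedExp (sub_ne_zero.2 h1),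
    integral_oneSidedExp h0, priceKernel_eq_sub h0 h1]

/-- The two one-sided exponentials jump at `0`, but their difference is continuous, so the inversion
theorem holds at every point. -/
theorem dampedPayoff_inversion {p : ℝ} (h0 : p ≠ 0) (h1 : p ≠ 1) (x : ℝ) :
    ∫ u : ℝ, Complex.exp (u * x * Complex.I) * priceKernel p (u * Complex.I)
      = 2 * Real.pi * (dampedPayoff p x : ℂ) := by
  set f : ℝ → ℂ := fun x => (dampedPayoff p x : ℂ) with hf
  have hcont : Continuous f := by
    simp only [hf, dampedPayoff]
    refine Complex.continuous_ofReal.comp (Continuous.mul (by fun_prop) ?_)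
    refine Continuous.add (Continuous.sub (by fun_prop) ?_) continuous_const
    split_ifs <;> fun_prop
  have hint : Integrable f := by
    simp only [hf, dampedPayoff_eq h0 h1]
    exact (integrable_oneSidedExp (sub_ne_zero.2 h1)).sub (integrable_oneSidedExp h0)
  have hF : 𝓕 f = fun v : ℝ => priceKernel p ((2 * Real.pi * v : ℝ) * Complex.I) := by
    ext v
    rw [Real.fourier_real_eq_integral_exp_smul, ← integral_dampedPayoff h0 h1]
    refine integral_congr_ae (Eventually.of_forall fun y => ?_)
    simp only [smul_eq_mul, hf]
    congr 2
    push_cast; ring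
  have hFi : Integrable (𝓕 f) := by
    rw [hF]
    exact (integrable_priceKernel h0 h1).comp_mul_left' (by positivity)
  have hinv := congrFun (hcont.fourierInv_fourier_eq hint hFi) x
  rw [Real.fourierInv_eq', hF] at hinv
  have hsub := Measure.integral_comp_mul_left
    (fun u : ℝ => Complex.exp (u * x * Complex.I) * priceKernel p (u * Complex.I)) (2 * Real.pi)
  rw [abs_of_pos (by positivity), Complex.real_smul] at hsub
  have e : ∫ v : ℝ, Complex.exp (((2 * Real.pi * v : ℝ) : ℂ) * x * Complex.I)
        * priceKernel p (((2 * Real.pi * v : ℝ) : ℂ) * Complex.I) = f x := by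
    rw [← hinv]
    refine integral_congr_ae (Eventually.of_forall fun v => ?_)
    simp only [smul_eq_mul]
    congr 2
    simp; ring
  rw [e] at hsub
  have hpi : (Real.pi : ℂ) ≠ 0 := by exact_mod_cast Real.pi_ne_zero
  change _ = 2 * (Real.pi : ℂ) * f x
  rw [hsub]
  generalize (∫ u : ℝ, Complex.exp (u * x * Complex.I) * priceKernel p (u * Complex.I)) = c
  push_cast
  field_simp

/-- The strike scales out by translation of `x`; the powers of `exp k` collect to `exp (k (1 - p))`.
-/
theorem payoff_eq_dampedPayoff (p k x : ℝ) :
    max (Real.exp x - Real.exp k) 0 - (if p < 1 then Real.exp x else 0)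
      + (if p < 0 then Real.exp k else 0)
      = Real.exp (k * (1 - p)) * (Real.exp (p * x) * dampedPayoff p (x - k)) := by
  have e1 : Real.exp x - Real.exp k = Real.exp k * (Real.exp (x - k) - 1) := by
    rw [mul_sub, ← Real.exp_add]; simp
  have e2 : Real.exp (k * (1 - p)) * (Real.exp (p * x) * Real.exp (-p * (x - k))) = Real.exp k := by
    rw [← Real.exp_add, ← Real.exp_add]; congr 1; ring
  have e3 : Real.exp k * Real.exp (x - k) = Real.exp x := by rw [← Real.exp_add]; simp
  rw [dampedPayoff]
  rw [show Real.exp (k * (1 - p)) * (Real.exp (p * x) * (Real.exp (-p * (x - k))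
      * (max (Real.exp (x - k) - 1) 0 - (if p < 1 then Real.exp (x - k) else 0)
        + (if p < 0 then 1 else 0))))
      = (Real.exp (k * (1 - p)) * (Real.exp (p * x) * Real.exp (-p * (x - k))))
      * (max (Real.exp (x - k) - 1) 0 - (if p < 1 then Real.exp (x - k) else 0)
        + (if p < 0 then 1 else 0)) by ring, e2, mul_add, mul_sub,
    mul_max_of_nonneg _ _ (Real.exp_pos k).le, mul_zero, ← e1]
  split_ifs <;> simp [e3]

namespace IsExpLevyMeasure

variable {ν : Measure ℝ} {σ t : ℝ} {μ : Measure ℝ} [IsProbabilityMeasure μ]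

theorem integrable_exp_law (hν : IsExpLevyMeasure ν) (ht : 0 ≤ t)
    (hμ : ∀ u : ℝ, charFun μ u = Complex.exp (t * cumulant σ ν (u * Complex.I))) :
    Integrable (fun x : ℝ => Real.exp x) μ := by
  simpa using (hν.exp_moment ht hμ hν.one_mem).1

theorem integral_exp_mul_law (hν : IsExpLevyMeasure ν) (ht : 0 ≤ t)
    (hμ : ∀ u : ℝ, charFun μ u = Complex.exp (t * cumulant σ ν (u * Complex.I))) {p : ℝ}
    (hp : p ∈ momentSet ν) :
    ∫ x : ℝ, Real.exp (p * x) ∂μ = Real.exp (t * realCumulant σ ν p) := by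
  have h := (hν.exp_moment ht hμ hp).2 0
  simp only [Complex.ofReal_zero, zero_mul, add_zero] at h
  rw [cumulant_ofReal] at h
  have e : ∀ x : ℝ, Complex.exp ((p : ℂ) * x) = ((Real.exp (p * x) : ℝ) : ℂ) := fun x => by
    push_cast; rfl
  simp only [e] at h
  rw [integral_complex_ofReal] at h
  rw [realCumulant]
  exact_mod_cast h

theorem integral_exp_law (hν : IsExpLevyMeasure ν) (ht : 0 ≤ t)
    (hμ : ∀ u : ℝ, charFun μ u = Complex.exp (t * cumulant σ ν (u * Complex.I))) :
    ∫ x : ℝ, Real.exp x ∂μ = 1 := by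
  simpa [realCumulant_one] using hν.integral_exp_mul_law ht hμ hν.one_mem

theorem integrable_payoff (hν : IsExpLevyMeasure ν) (ht : 0 ≤ t)
    (hμ : ∀ u : ℝ, charFun μ u = Complex.exp (t * cumulant σ ν (u * Complex.I))) (k : ℝ) :
    Integrable (fun x : ℝ => max (Real.exp x - Real.exp k) 0) μ :=
  ((hν.integrable_exp_law ht hμ).sub (integrable_const _)).pos_part

/-- The Fourier representation of call prices. -/
theorem price_eq (hν : IsExpLevyMeasure ν) (ht : 0 ≤ t)
    (hμ : ∀ u : ℝ, charFun μ u = Complex.exp (t * cumulant σ ν (u * Complex.I))) {p : ℝ}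
    (hp : p ∈ momentSet ν) (h0 : p ≠ 0) (h1 : p ≠ 1) (k : ℝ) :
    ((∫ x, max (Real.exp x - Real.exp k) 0 ∂μ) - (if p < 1 then 1 else 0)
      + (if p < 0 then Real.exp k else 0) : ℝ)
      = Real.exp (k * (1 - p)) / (2 * Real.pi) * (∫ u : ℝ, Complex.exp
        (t * cumulant σ ν (p + u * Complex.I) - k * (u * Complex.I))
          * priceKernel p (u * Complex.I)).re := by
  obtain ⟨hpi, hpc⟩ := hν.exp_moment ht hμ hp
  have hL : (∫ x, max (Real.exp x - Real.exp k) 0 ∂μ) - (if p < 1 then 1 else 0)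
      + (if p < 0 then Real.exp k else 0)
      = Real.exp (k * (1 - p)) * ∫ x, Real.exp (p * x) * dampedPayoff p (x - k) ∂μ := by
    have hi1 : Integrable (fun x : ℝ => if p < 1 then Real.exp x else 0) μ := by
      split_ifs
      · exact hν.integrable_exp_law ht hμ
      · exact integrable_const 0
    have hi2 : Integrable (fun x : ℝ => max (Real.exp x - Real.exp k) 0
      - (if p < 1 then Real.exp x else 0)) μ := (hν.integrable_payoff ht hμ k).sub hi1
    rw [← integral_const_mul]
    simp only [← payoff_eq_dampedPayoff]
    rw [integral_add hi2 (integrable_const _), integral_sub (hν.integrable_payoff ht hμ k) hi1]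
    congr 1
    · congr 1
      split_ifs
      · exact (hν.integral_exp_law ht hμ).symm
      · simp
    · simp
  -- Fubini: the inversion formula for the payoff is averaged over the law, and the inner integral
  -- becomes the exponential moment of order `p + i u`.
  have hC : ((∫ x, Real.exp (p * x) * dampedPayoff p (x - k) ∂μ : ℝ) : ℂ) * (2 * Real.pi)
      = ∫ u : ℝ, Complex.exp (t * cumulant σ ν (p + u * Complex.I) - k * (u * Complex.I))
          * priceKernel p (u * Complex.I) := by
    have e1 : ∀ x : ℝ, ((Real.exp (p * x) * dampedPayoff p (x - k) : ℝ) : ℂ) * (2 * Real.pi)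
        = ∫ u : ℝ, (Real.exp (p * x) : ℂ) * (Complex.exp (u * ((x - k : ℝ) : ℂ) * Complex.I)
          * priceKernel p (u * Complex.I)) := by
      intro x
      rw [integral_const_mul, dampedPayoff_inversion h0 h1]
      push_cast; ring
    rw [← integral_complex_ofReal, ← integral_mul_const]
    simp only [e1]
    rw [integral_integral_swap]
    · refine integral_congr_ae (Eventually.of_forall fun u => ?_)
      simp only
      have e2 : ∀ x : ℝ, (Real.exp (p * x) : ℂ) * (Complex.exp (u * ((x - k : ℝ) : ℂ) * Complex.I)
          * priceKernel p (u * Complex.I)) = Complex.exp ((p + u * Complex.I) * x)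
            * (Complex.exp (-(k * (u * Complex.I))) * priceKernel p (u * Complex.I)) := by
        intro x
        rw [Complex.ofReal_exp, ← mul_assoc, ← mul_assoc, ← Complex.exp_add, ← Complex.exp_add]
        congr 2
        push_cast; ring
      simp only [e2]
      rw [integral_mul_const, hpc u, ← mul_assoc, ← Complex.exp_add, ← sub_eq_add_neg]
    · have hm : Integrable (fun z : ℝ × ℝ => (Real.exp (p * z.1) : ℂ)
          * priceKernel p (z.2 * Complex.I)) (μ.prod volume) :=
        Integrable.mul_prod hpi.ofReal (integrable_priceKernel h0 h1)
      have hpk : AEStronglyMeasurable (fun z : ℝ × ℝ => priceKernel p (z.2 * Complex.I))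
          (μ.prod volume) :=
        ((continuous_priceKernel h0 h1).comp continuous_snd).aestronglyMeasurable
      refine hm.mono ?_ (Eventually.of_forall fun z => ?_)
      · exact AEStronglyMeasurable.mul (by fun_prop) (AEStronglyMeasurable.mul (by fun_prop) hpk)
      · simp only [Function.uncurry_def, norm_mul]
        rw [show (z.2 : ℂ) * ((z.1 - k : ℝ) : ℂ) * Complex.I
          = ((z.2 * (z.1 - k) : ℝ) : ℂ) * Complex.I by push_cast; ring,
          Complex.norm_exp_ofReal_mul_I, one_mul]
  rw [hL, ← hC]
  have e3 : ((∫ x, Real.exp (p * x) * dampedPayoff p (x - k) ∂μ : ℝ) : ℂ) * (2 * Real.pi)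
      = (((∫ x, Real.exp (p * x) * dampedPayoff p (x - k) ∂μ) * (2 * Real.pi) : ℝ) : ℂ) := by
    push_cast; ring
  rw [e3, Complex.ofReal_re]
  have := Real.pi_pos
  field_simp

end IsExpLevyMeasure

/-! ### The saddlepoint expansion of call prices -/

theorem priceKernel_derivs {p : ℝ} (h0 : p ≠ 0) (h1 : p ≠ 1) :
    AnalyticAt ℂ (priceKernel p) 0 ∧
    priceKernel p 0 = ((1 / (p * (p - 1)) : ℝ) : ℂ) ∧
    deriv (priceKernel p) 0 = ((-(2 * p - 1) / (p * (p - 1)) ^ 2 : ℝ) : ℂ) ∧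
    iteratedDeriv 2 (priceKernel p) 0 = (((6 * p ^ 2 - 6 * p + 2) / (p * (p - 1)) ^ 3 : ℝ) : ℂ) := by
  set D : ℂ → ℂ := fun w => (p + w) * (p - 1 + w) with hD
  have h0c : (p : ℂ) ≠ 0 := by exact_mod_cast h0
  have h1c : (p : ℂ) - 1 ≠ 0 := by
    have : p - 1 ≠ 0 := sub_ne_zero.2 h1
    exact_mod_cast this
  have hD0 : D 0 = p * (p - 1) := by simp [hD]
  have hD0ne : D 0 ≠ 0 := by rw [hD0]; exact mul_ne_zero h0c h1c
  have hDd : ∀ w, HasDerivAt D (2 * p - 1 + 2 * w) w := by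
    intro w
    have := ((hasDerivAt_id w).const_add (p : ℂ)).mul ((hasDerivAt_id w).const_add ((p : ℂ) - 1))
    refine this.congr_deriv ?_
    simp only [id_eq]; ring
  have hDc : Continuous D := by fun_prop
  have hev : ∀ᶠ w in 𝓝 (0 : ℂ), D w ≠ 0 := hDc.continuousAt.eventually_ne hD0ne
  have hg : priceKernel p = fun w => (D w)⁻¹ := by
    ext w; simp [priceKernel, hD]
  have hg1 : ∀ w, D w ≠ 0 → HasDerivAt (priceKernel p) (-(2 * p - 1 + 2 * w) / D w ^ 2) w := by
    intro w hw
    rw [hg]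
    exact (hDd w).inv hw
  have hg2 : HasDerivAt (fun w => -(2 * p - 1 + 2 * w) / D w ^ 2)
      ((-2 * D 0 ^ 2 - (-(2 * p - 1 + 2 * 0)) * (2 * D 0 * (2 * p - 1 + 2 * 0))) / (D 0 ^ 2) ^ 2)
      0 := by
    have hn : HasDerivAt (fun w : ℂ => -(2 * (p : ℂ) - 1 + 2 * w)) (-2) 0 := by
      exact (((hasDerivAt_id (0 : ℂ)).const_mul 2).const_add (2 * (p : ℂ) - 1)).neg.congr_deriv
        (by simp)
    have hd : HasDerivAt (fun w => D w ^ 2) (2 * D 0 * (2 * p - 1 + 2 * 0)) 0 := by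
      exact ((hDd 0).pow 2).congr_deriv (by simp)
    exact hn.div hd (pow_ne_zero 2 hD0ne)
  refine ⟨?_, ?_, ?_, ?_⟩
  · rw [hg]
    exact AnalyticAt.inv (by simp only [hD]; fun_prop) hD0ne
  · simp only [hg, hD0]; push_cast; rw [one_div]
  · rw [(hg1 0 hD0ne).deriv, hD0]; push_cast; ring
  · rw [iteratedDeriv_succ, iteratedDeriv_one]
    have : deriv (priceKernel p) =ᶠ[𝓝 0] fun w => -(2 * p - 1 + 2 * w) / D w ^ 2 := by
      filter_upwards [hev] with w hw using (hg1 w hw).deriv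
    rw [this.deriv_eq, hg2.deriv, hD0]
    push_cast
    field_simp
    ring

namespace IsExpLevyMeasure

variable {ν : Measure ℝ} {σ : ℝ}

/-- The rescaled saddlepoint integral of the price representation. -/
noncomputable def saddleIntegral (σ : ℝ) (ν : Measure ℝ) (p ε : ℝ) : ℝ :=
  (√ε)⁻¹ * (∫ u : ℝ, Complex.exp ((cumulant σ ν (p + Complex.I * u) - realCumulant σ ν p
    - deriv (realCumulant σ ν) p * (Complex.I * u)) / (ε : ℂ)) * priceKernel p (Complex.I * u)).re

/-- Subtracting `K p + K' p · w` leaves a phase with vanishing value and derivative at `w = 0`,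
quadratic coefficient `K'' p > 0`, and real part bounded away from `0` off the saddle. -/
theorem saddleIntegral_approxPoly (hν : IsExpLevyMeasure ν) (hnl : StronglyNonlattice σ ν) {p : ℝ}
    (hp : p ∈ interior (momentSet ν)) (h0 : p ≠ 0) (h1 : p ≠ 1) :
    ∃ κ : ℂ → ℂ, AnalyticAt ℂ κ 0 ∧
      κ 0 = ((iteratedDeriv 3 (realCumulant σ ν) p / 6 : ℝ) : ℂ) ∧
      deriv κ 0 = ((iteratedDeriv 4 (realCumulant σ ν) p / 24 : ℝ) : ℂ) ∧
      ∀ N, ApproxPoly N (saddleIntegral σ ν p)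
        (laplacePoly κ (priceKernel p) (iteratedDeriv 2 (realCumulant σ ν) p) N) := by
  obtain ⟨κ, hκ, hexp, hk0, hk1⟩ := hν.exists_remainder (σ := σ) hp
  have hpm := interior_subset hp
  refine ⟨κ, hκ, hk0, hk1, fun N => ?_⟩
  have hline : Continuous fun u : ℝ => cumulant σ ν (p + Complex.I * u) :=
    (hν.continuousOn_cumulant σ hpm hpm).comp_continuous (by fun_prop) fun u => by simp
  refine laplace_approxPoly (F := fun w => cumulant σ ν (p + w) - realCumulant σ ν p
    - deriv (realCumulant σ ν) p * w) (hν.iteratedDeriv_two_pos hnl hp) hκ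
    (priceKernel_derivs h0 h1).1 (Eventually.of_forall fun w => ?_) ?_ ?_ (fun δ hδ => ?_) N
  · simp only [hexp w]; ring
  · exact (Continuous.measurable (by fun_prop))
  · simpa only [mul_comm] using integrable_priceKernel h0 h1
  · obtain ⟨η, hη, h⟩ := hν.tiltedDecay_bounded_below hnl hpm hδ
    refine ⟨η, hη, fun u hu => ?_⟩
    have h2 := h u hu
    rw [hν.tiltedDecay_eq hpm, mul_comm (u : ℂ)] at h2
    simp only [Complex.sub_re, Complex.ofReal_re, Complex.re_ofReal_mul]
    simp only [Complex.mul_re, Complex.I_re, Complex.I_im, Complex.ofReal_re, Complex.ofReal_im,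
      realCumulant]
    linarith

/-- `c₀` and `c₁` are the two Laplace coefficients rewritten in `y`: `p (p - 1) = R(y)`, and only
the third derivative changes sign. -/
theorem saddleIntegral_approxPoly_two (hν : IsExpLevyMeasure ν) (hnl : StronglyNonlattice σ ν)
    {y : ℝ} (hy : y ∈ analyticityInterval ν) (h0 : y ≠ 1 / 2) (h1 : y ≠ -(1 / 2)) :
    ApproxPoly 2 (saddleIntegral σ ν (1 / 2 - y))
      (Polynomial.C (√(2 * Real.pi) * coeffc0 (levyXi σ ν) y)
        + Polynomial.C (√(2 * Real.pi) * (coeffc0 (levyXi σ ν) y * coeffc1 (levyXi σ ν) y))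
          * Polynomial.X) := by
  have hp := analyticityInterval_iff.1 hy
  have hp0 : (1 / 2 - y) ≠ 0 := fun h => h0 (by linarith)
  have hp1 : (1 / 2 - y) ≠ 1 := fun h => h1 (by linarith)
  obtain ⟨κ, hκ, hk0, hk1, h⟩ := hν.saddleIntegral_approxPoly hnl hp hp0 hp1
  obtain ⟨ga, g0, g1, g2⟩ := priceKernel_derivs hp0 hp1
  have hA := hν.iteratedDeriv_two_pos hnl hp
  have h2 := h 2
  rw [laplacePoly_two hA hκ ga hk0 hk1 g0 g1 g2] at h2
  have i2 := iteratedDeriv_levyXi σ ν 2 y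
  have i3 := iteratedDeriv_levyXi σ ν 3 y
  have i4 := iteratedDeriv_levyXi σ ν 4 y
  have hR : (1 / 2 - y) * (1 / 2 - y - 1) = quadR y := by rw [quadR]; ring
  have hRne : quadR y ≠ 0 := by
    rw [← hR]; exact mul_ne_zero hp0 (sub_ne_zero.2 hp1)
  set A := iteratedDeriv 2 (realCumulant σ ν) (1 / 2 - y) with hAdef
  set B := iteratedDeriv 3 (realCumulant σ ν) (1 / 2 - y) with hB
  set E := iteratedDeriv 4 (realCumulant σ ν) (1 / 2 - y) with hE
  have i2' : iteratedDeriv 2 (levyXi σ ν) y = A := by rw [i2]; ring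
  have i3' : iteratedDeriv 3 (levyXi σ ν) y = -B := by rw [i3]; ring
  have i4' : iteratedDeriv 4 (levyXi σ ν) y = E := by rw [i4]; ring
  have hsA : 0 < √A := Real.sqrt_pos.2 hA
  have hs : √(2 * Real.pi / A) = √(2 * Real.pi) / √A := Real.sqrt_div (by positivity) _
  have e0 : √(2 * Real.pi) * coeffc0 (levyXi σ ν) y
      = √(2 * Real.pi / A) * (1 / ((1 / 2 - y) * (1 / 2 - y - 1))) := by
    rw [coeffc0, i2', hR, hs]; ring
  have e1 : √(2 * Real.pi) * (coeffc0 (levyXi σ ν) y * coeffc1 (levyXi σ ν) y)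
      = √(2 * Real.pi / A) * (-((6 * (1 / 2 - y) ^ 2 - 6 * (1 / 2 - y) + 2)
          / ((1 / 2 - y) * (1 / 2 - y - 1)) ^ 3 / 2) / A
        + 3 * (E / 24 * (1 / ((1 / 2 - y) * (1 / 2 - y - 1)))
          + B / 6 * (-(2 * (1 / 2 - y) - 1) / ((1 / 2 - y) * (1 / 2 - y - 1)) ^ 2)) / A ^ 2
        - 15 / 2 * (B / 6) ^ 2 * (1 / ((1 / 2 - y) * (1 / 2 - y - 1))) / A ^ 3) := by
    rw [← mul_assoc, e0, coeffc1, i2', i3', i4', hR]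
    rw [mul_assoc]
    congr 1
    field_simp
    ring
  rw [e0, e1]
  exact h2

end IsExpLevyMeasure

/-! ### Call prices in saddlepoint form -/

section LevyProcess

variable {Ω : Type*} [MeasurableSpace Ω] {P : Measure Ω} {X : ℝ≥0 → Ω → ℝ} {σ : ℝ} {ν : Measure ℝ}

theorem IsExpLevyProcess.charFun_eq (hX : IsExpLevyProcess P X σ ν) (t : ℝ≥0) (u : ℝ) :
    charFun (P.map (X t)) u = Complex.exp ((t : ℝ) * cumulant σ ν (u * Complex.I)) := by
  rw [hX.khinchine, levyExponent_eq_cumulant]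

theorem callPrice_eq_integral_map (hX : IsExpLevyProcess P X σ ν) (t : ℝ≥0) (k : ℝ) :
    callPrice P X t k = ∫ x, max (Real.exp x - Real.exp k) 0 ∂(P.map (X t)) := by
  rw [integral_map (hX.levy.measurable t).aemeasurable (by fun_prop)]; rfl

/-- The intrinsic part of the call price in the saddlepoint regime of `y`. -/
noncomputable def intrinsicPart (y k : ℝ) : ℝ :=
  (if -(1 / 2) < y then 1 else 0) - (if 1 / 2 < y then Real.exp k else 0)

/-- The prefactor `exp (k (1 - p))` with `k = τ K' p` and the saddle value `exp (τ K p)` combine to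
`exp (τ Ξ₀₁₊)`. -/
theorem callPrice_saddle [IsProbabilityMeasure P] (hX : IsExpLevyProcess P X σ ν) {y : ℝ}
    (hy : y ∈ analyticityInterval ν) (h0 : y ≠ 1 / 2) (h1 : y ≠ -(1 / 2)) {τ : ℝ≥0} (hτ : 0 < τ) :
    callPrice P X τ (τ * -deriv (levyXi σ ν) y)
      = intrinsicPart y (τ * -deriv (levyXi σ ν) y)
        + Real.exp (τ * xi01 (levyXi σ ν) 1 y) * √(1 / (τ : ℝ)) / (2 * Real.pi)
          * IsExpLevyMeasure.saddleIntegral σ ν (1 / 2 - y) (1 / (τ : ℝ)) := by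
  have hν := hX.measure
  have hp := analyticityInterval_iff.1 hy
  have hp0 : (1 / 2 - y) ≠ 0 := fun h => h0 (by linarith)
  have hp1 : (1 / 2 - y) ≠ 1 := fun h => h1 (by linarith)
  have hτr : (0 : ℝ) < τ := hτ
  have : IsProbabilityMeasure (P.map (X τ)) :=
    Measure.isProbabilityMeasure_map (hX.levy.measurable τ).aemeasurable
  set p := 1 / 2 - y with hpdef
  set m := deriv (realCumulant σ ν) p with hm
  have hk : -deriv (levyXi σ ν) y = m := by rw [deriv_levyXi]; ring
  have h := hν.price_eq τ.coe_nonneg (hX.charFun_eq τ) (interior_subset hp) hp0 hp1 (τ * m)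
  rw [← callPrice_eq_integral_map hX] at h
  have c1 : (p < 1) ↔ (-(1 / 2) < y) := by
    rw [hpdef]; constructor <;> intro h <;> linarith
  have c2 : (p < 0) ↔ (1 / 2 < y) := by
    rw [hpdef]; constructor <;> intro h <;> linarith
  simp only [c1, c2] at h
  rw [hk, intrinsicPart]
  have e1 : ∀ u : ℝ, Complex.exp (((τ : ℝ) : ℂ) * cumulant σ ν (p + u * Complex.I)
        - ((τ * m : ℝ) : ℂ) * (u * Complex.I))
      = ((Real.exp (τ * realCumulant σ ν p) : ℝ) : ℂ)
        * Complex.exp ((cumulant σ ν (p + Complex.I * u) - realCumulant σ ν p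
          - m * (Complex.I * u)) / ((1 / (τ : ℝ) : ℝ) : ℂ)) := by
    intro u
    rw [Complex.ofReal_exp, ← Complex.exp_add]
    congr 1
    have : ((τ : ℝ) : ℂ) ≠ 0 := by exact_mod_cast hτr.ne'
    push_cast
    field_simp
    ring
  simp only [e1, mul_assoc] at h
  rw [integral_const_mul, Complex.re_ofReal_mul] at h
  have hs : √(1 / (τ : ℝ)) ≠ 0 := (Real.sqrt_pos.2 (by positivity)).ne'
  have e2 : Real.exp (τ * xi01 (levyXi σ ν) 1 y)
      = Real.exp (τ * (m * (1 - p))) * Real.exp (τ * realCumulant σ ν p) := by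
    rw [← Real.exp_add, xi01]
    congr 1
    have : deriv (levyXi σ ν) y = -m := by rw [← hk]; ring
    rw [this, levyXi_eq, hpdef]; ring
  rw [IsExpLevyMeasure.saddleIntegral, e2]
  have e3 : ∀ J : ℝ, Real.exp (τ * (m * (1 - p))) * Real.exp (τ * realCumulant σ ν p)
      * √(1 / (τ : ℝ)) / (2 * Real.pi) * ((√(1 / (τ : ℝ)))⁻¹ * J)
      = Real.exp (τ * (m * (1 - p))) / (2 * Real.pi) * (Real.exp (τ * realCumulant σ ν p) * J) := by
    intro J; field_simp
  rw [e3]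
  have hcomm : ∀ u : ℝ, (u : ℂ) * Complex.I = Complex.I * u := fun u => mul_comm _ _
  simp only [hcomm] at h
  linarith

end LevyProcess

/-! ### The Black-Scholes price as a function of the total variance -/

theorem gaussianPDFReal_std (x : ℝ) :
    gaussianPDFReal 0 1 x = (√(2 * Real.pi))⁻¹ * Real.exp (-x ^ 2 / 2) := by
  simp [gaussianPDFReal_def]

theorem continuous_gaussianPDFReal_std : Continuous (gaussianPDFReal 0 1) := by
  have : gaussianPDFReal 0 1 = fun x => (√(2 * Real.pi))⁻¹ * Real.exp (-x ^ 2 / 2) :=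
    funext gaussianPDFReal_std
  rw [this]; fun_prop

theorem stdNormalCDF_eq_integral (x : ℝ) :
    stdNormalCDF x = ∫ t in Iic x, gaussianPDFReal 0 1 t := by
  rw [stdNormalCDF, cdf_eq_real, measureReal_def,
    gaussianReal_apply_eq_integral _ one_ne_zero, ENNReal.toReal_ofReal]
  exact setIntegral_nonneg measurableSet_Iic fun t _ => gaussianPDFReal_nonneg _ _ _

theorem one_sub_stdNormalCDF_eq_integral (x : ℝ) :
    1 - stdNormalCDF x = ∫ t in Ioi x, gaussianPDFReal 0 1 t := by
  rw [stdNormalCDF_eq_integral, ← integral_gaussianPDFReal_eq_one 0 one_ne_zero,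
    ← integral_add_compl (measurableSet_Iic (a := x)) (integrable_gaussianPDFReal 0 1), compl_Iic]
  ring

theorem stdNormalCDF_neg (x : ℝ) : stdNormalCDF (-x) = 1 - stdNormalCDF x := by
  rw [one_sub_stdNormalCDF_eq_integral, stdNormalCDF_eq_integral, ← integral_comp_neg_Ioi]
  simp [gaussianPDFReal_std]

theorem hasDerivAt_stdNormalCDF (x : ℝ) :
    HasDerivAt stdNormalCDF (gaussianPDFReal 0 1 x) x := by
  have h : stdNormalCDF = fun x => (∫ t in Iic (0 : ℝ), gaussianPDFReal 0 1 t)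
      + ∫ t in (0 : ℝ)..x, gaussianPDFReal 0 1 t := by
    funext z
    rw [stdNormalCDF_eq_integral, ← intervalIntegral.integral_Iic_sub_Iic
      (integrable_gaussianPDFReal 0 1).integrableOn (integrable_gaussianPDFReal 0 1).integrableOn]
    ring
  rw [h]
  exact (intervalIntegral.integral_hasDerivAt_right
    (integrable_gaussianPDFReal 0 1).intervalIntegrable
    (stronglyMeasurable_gaussianPDFReal 0 1).stronglyMeasurableAtFilter
    continuous_gaussianPDFReal_std.continuousAt).const_add _

theorem continuous_stdNormalCDF : Continuous stdNormalCDF :=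
  continuous_iff_continuousAt.2 fun x => (hasDerivAt_stdNormalCDF x).continuousAt

theorem tendsto_stdNormalCDF_atTop : Tendsto stdNormalCDF atTop (𝓝 1) := tendsto_cdf_atTop _

theorem tendsto_stdNormalCDF_atBot : Tendsto stdNormalCDF atBot (𝓝 0) := tendsto_cdf_atBot _

/-- From `d₁² - d₂² = -2 k`. It reduces the variance derivative to one positive term and later
merges the two Gaussian tails. -/
theorem gaussianPDFReal_bs {v : ℝ} (hv : 0 < v) (k : ℝ) :
    Real.exp k * gaussianPDFReal 0 1 ((-k - v / 2) / √v)
      = gaussianPDFReal 0 1 ((-k + v / 2) / √v) := by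
  rw [gaussianPDFReal_std, gaussianPDFReal_std, mul_left_comm, ← Real.exp_add]
  congr 2
  rw [div_pow, div_pow, Real.sq_sqrt hv.le]
  field_simp
  ring

theorem hasDerivAt_bsCall {v : ℝ} (hv : 0 < v) (k : ℝ) :
    HasDerivAt (fun v => bsCall v k) (gaussianPDFReal 0 1 ((-k + v / 2) / √v) / (2 * √v)) v := by
  have hs : 0 < √v := Real.sqrt_pos.2 hv
  have h1 : HasDerivAt (fun v => (-k + v / 2) / √v) _ v :=
    (((hasDerivAt_id v).div_const 2).const_add (-k)).div (Real.hasDerivAt_sqrt hv.ne') hs.ne'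
  have h2 : HasDerivAt (fun v => (-k - v / 2) / √v) _ v :=
    (((hasDerivAt_id v).div_const 2).const_sub (-k)).div (Real.hasDerivAt_sqrt hv.ne') hs.ne'
  have h := ((hasDerivAt_stdNormalCDF _).comp v h1).sub
    (((hasDerivAt_stdNormalCDF _).comp v h2).const_mul (Real.exp k))
  refine h.congr_deriv ?_
  rw [← mul_assoc, gaussianPDFReal_bs hv, ← mul_sub, div_eq_mul_inv (gaussianPDFReal 0 1 _)]
  congr 1
  have : √v ^ 2 = v := Real.sq_sqrt hv.le
  simp only [id]
  field_simp
  rw [this]; ring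

theorem strictMonoOn_bsCall (k : ℝ) : StrictMonoOn (fun v => bsCall v k) (Ioi 0) := by
  refine strictMonoOn_of_deriv_pos (convex_Ioi 0)
    (fun v hv => (hasDerivAt_bsCall hv k).continuousAt.continuousWithinAt) fun v hv => ?_
  rw [interior_Ioi] at hv
  rw [(hasDerivAt_bsCall hv k).deriv]
  exact div_pos (gaussianPDFReal_pos _ _ _ one_ne_zero)
    (mul_pos two_pos (Real.sqrt_pos.2 hv))

theorem tendsto_bsCall_atTop (k : ℝ) : Tendsto (fun v => bsCall v k) atTop (𝓝 1) := by
  have hs : Tendsto (fun v : ℝ => √v) atTop atTop := Real.tendsto_sqrt_atTop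
  have h0 : Tendsto (fun v : ℝ => -k / √v) atTop (𝓝 0) := hs.const_div_atTop _
  have e : ∀ᶠ v : ℝ in atTop, 0 < v := eventually_gt_atTop 0
  have h1 : Tendsto (fun v => (-k + v / 2) / √v) atTop atTop := by
    refine (h0.add_atTop (hs.atTop_div_const two_pos)).congr' (e.mono fun v hv => ?_)
    have : √v ^ 2 = v := Real.sq_sqrt hv.le
    have hs : 0 < √v := Real.sqrt_pos.2 hv
    field_simp
    rw [this]
  have h2 : Tendsto (fun v => (-k - v / 2) / √v) atTop atBot := by
    refine (h0.add_atBot (tendsto_neg_atTop_atBot.comp (hs.atTop_div_const two_pos))).congr'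
      (e.mono fun v hv => ?_)
    have : √v ^ 2 = v := Real.sq_sqrt hv.le
    have hs : 0 < √v := Real.sqrt_pos.2 hv
    simp only [Function.comp]
    field_simp
    rw [this]; ring
  simpa [bsCall] using (tendsto_stdNormalCDF_atTop.comp h1).sub
    ((tendsto_stdNormalCDF_atBot.comp h2).const_mul (Real.exp k))

theorem tendsto_bsCall_zero (k : ℝ) :
    Tendsto (fun v => bsCall v k) (𝓝[>] 0) (𝓝 (max (1 - Real.exp k) 0)) := by
  have hs : Tendsto (fun v : ℝ => √v) (𝓝[>] 0) (𝓝 0) := by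
    simpa using (Real.continuous_sqrt.tendsto 0).mono_left nhdsWithin_le_nhds
  have hs' : Tendsto (fun v : ℝ => √v) (𝓝[>] 0) (𝓝[>] 0) :=
    tendsto_nhdsWithin_iff.2 ⟨hs, eventually_mem_nhdsWithin.mono fun v hv => Real.sqrt_pos.2 hv⟩
  have hi : Tendsto (fun v : ℝ => (√v)⁻¹) (𝓝[>] 0) atTop := tendsto_inv_nhdsGT_zero.comp hs'
  have e1 : ∀ᶠ v : ℝ in 𝓝[>] 0, -k * (√v)⁻¹ + √v / 2 = (-k + v / 2) / √v :=
    eventually_mem_nhdsWithin.mono fun v (hv : 0 < v) => by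
      have : √v ^ 2 = v := Real.sq_sqrt hv.le
      have hs : 0 < √v := Real.sqrt_pos.2 hv
      field_simp
      rw [this]
  have e2 : ∀ᶠ v : ℝ in 𝓝[>] 0, -k * (√v)⁻¹ + -(√v / 2) = (-k - v / 2) / √v :=
    eventually_mem_nhdsWithin.mono fun v (hv : 0 < v) => by
      have : √v ^ 2 = v := Real.sq_sqrt hv.le
      have hs : 0 < √v := Real.sqrt_pos.2 hv
      field_simp
      rw [this]; ring
  have hs2 : Tendsto (fun v : ℝ => √v / 2) (𝓝[>] 0) (𝓝 0) := by simpa using hs.div_const 2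
  have hs3 : Tendsto (fun v : ℝ => -(√v / 2)) (𝓝[>] 0) (𝓝 0) := by simpa using hs2.neg
  rcases lt_trichotomy k 0 with hk | hk | hk
  · rw [max_eq_left (by linarith [Real.exp_lt_one_iff.2 hk])]
    have h := hi.const_mul_atTop (neg_pos.2 hk)
    simpa [bsCall] using (tendsto_stdNormalCDF_atTop.comp ((h.atTop_add hs2).congr' e1)).sub
      ((tendsto_stdNormalCDF_atTop.comp ((h.atTop_add hs3).congr' e2)).const_mul (Real.exp k))
  · subst hk
    have h1 : Tendsto (fun v : ℝ => (-0 + v / 2) / √v) (𝓝[>] 0) (𝓝 0) :=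
      hs2.congr' (e1.mono fun v hv => by beta_reduce; rw [← hv]; simp)
    have h2 : Tendsto (fun v : ℝ => (-0 - v / 2) / √v) (𝓝[>] 0) (𝓝 0) :=
      hs3.congr' (e2.mono fun v hv => by beta_reduce; rw [← hv]; simp)
    simpa [bsCall] using ((continuous_stdNormalCDF.tendsto 0).comp h1).sub
      (((continuous_stdNormalCDF.tendsto 0).comp h2).const_mul (Real.exp 0))
  · rw [max_eq_right (by linarith [Real.one_lt_exp_iff.2 hk])]
    have h := hi.const_mul_atTop_of_neg (neg_neg_of_pos hk)
    simpa [bsCall] using (tendsto_stdNormalCDF_atBot.comp ((h.atBot_add hs2).congr' e1)).sub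
      ((tendsto_stdNormalCDF_atBot.comp ((h.atBot_add hs3).congr' e2)).const_mul (Real.exp k))

/-- Every arbitrage-free price is attained at exactly one volatility. -/
theorem existsUnique_bsCall {c k τ : ℝ} (hτ : 0 < τ) (h0 : 1 - Real.exp k < c) (h0' : 0 < c)
    (h1 : c < 1) : ∃! s : ℝ, 0 < s ∧ bsCall (s ^ 2 * τ) k = c := by
  obtain ⟨v₂, h2, hv₂⟩ := (((tendsto_bsCall_atTop k).eventually_const_lt h1).and
    (eventually_gt_atTop 0)).exists
  obtain ⟨v₁, ⟨h3, hv₁⟩, h4⟩ := ((((tendsto_bsCall_zero k).eventually_lt_const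
    (max_lt h0 h0')).and eventually_mem_nhdsWithin).and
      (mem_nhdsWithin_of_mem_nhds (Iio_mem_nhds hv₂))).exists
  obtain ⟨v, hv, hvc⟩ := intermediate_value_Icc (f := fun v => bsCall v k) (le_of_lt h4)
    (fun v hv => (hasDerivAt_bsCall (lt_of_lt_of_le hv₁ hv.1) k).continuousAt.continuousWithinAt)
    ⟨h3.le, h2.le⟩
  have hv0 : 0 < v := lt_of_lt_of_le hv₁ hv.1
  refine ⟨√(v / τ), ⟨Real.sqrt_pos.2 (by positivity), ?_⟩, fun s hs => ?_⟩
  · rw [Real.sq_sqrt (by positivity), div_mul_cancel₀ _ hτ.ne']; exact hvc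
  · have : s ^ 2 * τ = v := (strictMonoOn_bsCall k).injOn (mem_Ioi.2 (by have := hs.1; positivity))
      (mem_Ioi.2 hv0) (hs.2.trans hvc.symm)
    rw [← this, mul_div_cancel_right₀ _ hτ.ne', Real.sqrt_sq hs.1.le]

/-! ### Mills' ratio and its asymptotic expansion -/

/-- A scaled Mills ratio. -/
noncomputable def millsIntegral (m ε : ℝ) : ℝ :=
  ∫ t in Ioi (0 : ℝ), Real.exp (-(m * t) - ε * t ^ 2 / 2)

/-- In the variable `m / √ε + √ε t` the exponent is `m² / (2ε) + m t + ε t² / 2`; its first term is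
the density that is pulled out. -/
theorem one_sub_stdNormalCDF_div {ε : ℝ} (hε : 0 < ε) (m : ℝ) :
    1 - stdNormalCDF (m / √ε) = √ε * gaussianPDFReal 0 1 (m / √ε) * millsIntegral m ε := by
  have hs : 0 < √ε := Real.sqrt_pos.2 hε
  have h1 : ∫ t in Ioi (m / √ε), gaussianPDFReal 0 1 t
      = ∫ t in Ioi (0 : ℝ), gaussianPDFReal 0 1 (t + m / √ε) := by
    rw [← (measurePreserving_add_right volume (m / √ε)).setIntegral_preimage_emb
      (measurableEmbedding_addRight _) (gaussianPDFReal 0 1)]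
    simp
  have h2 := integral_comp_mul_left_Ioi (fun t => gaussianPDFReal 0 1 (t + m / √ε)) 0 hs
  rw [mul_zero, smul_eq_mul, eq_inv_mul_iff_mul_eq₀ hs.ne'] at h2
  rw [one_sub_stdNormalCDF_eq_integral, h1, ← h2, mul_assoc]
  congr 1
  rw [millsIntegral, ← integral_const_mul]
  refine integral_congr_ae (Eventually.of_forall fun t => ?_)
  simp only [gaussianPDFReal_std]
  rw [mul_assoc, ← Real.exp_add]
  congr 2
  have : √ε ^ 2 = ε := Real.sq_sqrt hε.le
  field_simp
  rw [this]
  ring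

/-- The signed remainder `(-1) ^ N R_N` has derivative `(-1) ^ (N - 1) R_{N-1}` and vanishes at `0`
for `N ≥ 1`. By induction it lies between `0` and the first omitted term. -/
theorem exp_neg_remainder_bound (N : ℕ) {x : ℝ} (hx : 0 ≤ x) :
    |Real.exp (-x) - ∑ n ∈ Finset.range N, (-x) ^ n / n.factorial| ≤ x ^ N / N.factorial := by
  have key : ∀ N : ℕ, ∀ x : ℝ, 0 ≤ x →
      0 ≤ (-1) ^ N * (Real.exp (-x) - ∑ n ∈ Finset.range N, (-x) ^ n / n.factorial) ∧
      (-1) ^ N * (Real.exp (-x) - ∑ n ∈ Finset.range N, (-x) ^ n / n.factorial)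
        ≤ x ^ N / N.factorial := by
    intro N
    induction N with
    | zero => intro x hx; simp [Real.exp_nonneg, hx]
    | succ N ih =>
      intro x hx
      have hd : ∀ t : ℝ, HasDerivAt (fun t : ℝ => (-1) ^ (N + 1) * (Real.exp (-t)
          - ∑ n ∈ Finset.range (N + 1), (-t) ^ n / n.factorial))
          ((-1) ^ N * (Real.exp (-t) - ∑ n ∈ Finset.range N, (-t) ^ n / n.factorial)) t := by
        intro t
        have hs : HasDerivAt (fun t : ℝ => ∑ n ∈ Finset.range (N + 1), (-t) ^ n / n.factorial)
            (-∑ n ∈ Finset.range N, (-t) ^ n / n.factorial) t := by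
          have : (fun t : ℝ => ∑ n ∈ Finset.range (N + 1), (-t) ^ n / (n.factorial : ℝ))
              = fun t => ∑ n ∈ Finset.range N, (-t) ^ (n + 1) / ((n + 1).factorial : ℝ) + 1 := by
            funext t; rw [Finset.sum_range_succ']; simp
          rw [this, ← Finset.sum_neg_distrib]
          refine (HasDerivAt.fun_sum fun n _ => ?_).add_const 1
          refine (((hasDerivAt_id t).neg.pow (n + 1)).div_const _).congr_deriv ?_
          have : ((n + 1).factorial : ℝ) = (n + 1) * n.factorial := by
            rw [Nat.factorial_succ]; push_cast; ring
          rw [this]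
          have h3 : (n.factorial : ℝ) ≠ 0 := by positivity
          have h4 : (n + 1 : ℝ) ≠ 0 := by positivity
          simp
          field_simp
        refine ((((hasDerivAt_id t).neg.exp).sub hs).const_mul _).congr_deriv ?_
        simp only [pow_succ, Pi.neg_apply, id]
        ring
      have hp : ∀ t : ℝ, HasDerivAt (fun t : ℝ => t ^ (N + 1) / ((N + 1).factorial : ℝ))
          (t ^ N / N.factorial) t := by
        intro t
        refine ((hasDerivAt_pow (N + 1) t).div_const _).congr_deriv ?_
        have : ((N + 1).factorial : ℝ) = (N + 1) * N.factorial := by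
          rw [Nat.factorial_succ]; push_cast; ring
        rw [this]
        have h3 : (N.factorial : ℝ) ≠ 0 := by positivity
        have h4 : (N + 1 : ℝ) ≠ 0 := by positivity
        push_cast
        field_simp
      have z0 : (-1 : ℝ) ^ (N + 1) * (Real.exp (-0)
          - ∑ n ∈ Finset.range (N + 1), (-0 : ℝ) ^ n / n.factorial) = 0 := by
        rw [Finset.sum_range_succ']; simp
      constructor
      · have hm := monotoneOn_of_deriv_nonneg (convex_Ici (0 : ℝ))
          (fun t _ => (hd t).continuousAt.continuousWithinAt)
          (fun t _ => (hd t).differentiableAt.differentiableWithinAt)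
          (fun t ht => by
            rw [interior_Ici] at ht
            rw [(hd t).deriv]; exact (ih t (le_of_lt ht)).1)
        have := hm (mem_Ici.2 le_rfl) (mem_Ici.2 hx) hx
        beta_reduce at this
        rwa [z0] at this
      · have hm := monotoneOn_of_deriv_nonneg (convex_Ici (0 : ℝ))
          (fun t _ => ((hp t).sub (hd t)).continuousAt.continuousWithinAt)
          (fun t _ => ((hp t).sub (hd t)).differentiableAt.differentiableWithinAt)
          (fun t ht => by
            rw [interior_Ici] at ht
            rw [((hp t).sub (hd t)).deriv]; exact sub_nonneg.2 (ih t (le_of_lt ht)).2)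
        have := hm (mem_Ici.2 le_rfl) (mem_Ici.2 hx) hx
        simp only [Pi.sub_apply] at this
        rw [z0] at this
        simp at this
        simpa using this
  obtain ⟨h1, h2⟩ := key N x hx
  rwa [← abs_of_nonneg h1, abs_mul, abs_pow, abs_neg, abs_one, one_pow, one_mul] at h2

theorem integral_pow_mul_exp_neg_mul {m : ℝ} (hm : 0 < m) (n : ℕ) :
    ∫ t in Ioi (0 : ℝ), t ^ n * Real.exp (-(m * t)) = n.factorial / m ^ (n + 1) := by
  have h := Real.integral_rpow_mul_exp_neg_mul_Ioi (a := n + 1) (by positivity) hm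
  rw [Real.Gamma_nat_eq_factorial] at h
  rw [div_eq_inv_mul, ← one_div, ← one_div_pow, ← Real.rpow_natCast]
  push_cast
  rw [← h]
  refine setIntegral_congr_fun measurableSet_Ioi fun t _ => ?_
  simp

theorem integrableOn_pow_mul_exp_neg_mul {m : ℝ} (hm : 0 < m) (n : ℕ) :
    IntegrableOn (fun t : ℝ => t ^ n * Real.exp (-(m * t))) (Ioi 0) :=
  Integrable.of_integral_ne_zero (by rw [integral_pow_mul_exp_neg_mul hm]; positivity)

/-- The coefficients of the asymptotic series of `millsIntegral`. -/
noncomputable def millsCoeff (n : ℕ) : ℝ := (2 * n).factorial / (n.factorial * 2 ^ n)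

/-- Expanding `exp (-ε t² / 2)` under the integral; the error bound is explicit in `m`, so `m` may
later depend on `ε`. -/
theorem millsIntegral_bound {m ε : ℝ} (hm : 0 < m) (hε : 0 ≤ ε) (N : ℕ) :
    |millsIntegral m ε - ∑ n ∈ Finset.range N, (-ε) ^ n * millsCoeff n / m ^ (2 * n + 1)|
      ≤ ε ^ N * millsCoeff N / m ^ (2 * N + 1) := by
  have hi := fun n => integrableOn_pow_mul_exp_neg_mul hm (2 * n)
  have hI := fun n => integral_pow_mul_exp_neg_mul hm (2 * n)
  have hint : IntegrableOn (fun t : ℝ => Real.exp (-(m * t) - ε * t ^ 2 / 2)) (Ioi 0) := by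
    refine Integrable.mono' (hi 0) (by fun_prop) (Eventually.of_forall fun t => ?_)
    rw [Real.norm_of_nonneg (Real.exp_nonneg _)]
    simp only [mul_zero, pow_zero, one_mul]
    exact Real.exp_le_exp.2 (by have : 0 ≤ ε * t ^ 2 / 2 := by positivity
                                linarith)
  have hsum : ∀ t : ℝ, (∑ n ∈ Finset.range N, (-(ε * t ^ 2 / 2)) ^ n / n.factorial)
      * Real.exp (-(m * t)) = ∑ n ∈ Finset.range N,
        ((-ε) ^ n / (n.factorial * 2 ^ n)) * (t ^ (2 * n) * Real.exp (-(m * t))) := by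
    intro t
    rw [Finset.sum_mul]
    refine Finset.sum_congr rfl fun n _ => ?_
    rw [show -(ε * t ^ 2 / 2) = (-ε) * t ^ 2 / 2 by ring, div_pow, mul_pow, ← pow_mul]
    field_simp
  have hsi : ∑ n ∈ Finset.range N, (-ε) ^ n * millsCoeff n / m ^ (2 * n + 1)
      = ∫ t in Ioi (0 : ℝ), (∑ n ∈ Finset.range N, (-(ε * t ^ 2 / 2)) ^ n / n.factorial)
        * Real.exp (-(m * t)) := by
    simp only [hsum]
    rw [integral_finsetSum _ fun n _ => (hi n).const_mul _]
    refine Finset.sum_congr rfl fun n _ => ?_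
    rw [integral_const_mul, hI, millsCoeff]
    ring
  have hsint : IntegrableOn (fun t : ℝ => (∑ n ∈ Finset.range N,
      (-(ε * t ^ 2 / 2)) ^ n / n.factorial) * Real.exp (-(m * t))) (Ioi 0) := by
    simp only [hsum]
    exact integrable_finsetSum _ fun n _ => (hi n).const_mul _
  rw [hsi, millsIntegral, ← integral_sub hint hsint]
  have hR : ε ^ N * millsCoeff N / m ^ (2 * N + 1) = ∫ t in Ioi (0 : ℝ),
      (ε ^ N / (N.factorial * 2 ^ N)) * (t ^ (2 * N) * Real.exp (-(m * t))) := by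
    rw [integral_const_mul, hI, millsCoeff]; ring
  rw [hR, ← Real.norm_eq_abs]
  refine norm_integral_le_of_norm_le (μ := volume.restrict (Ioi 0)) ((hi N).const_mul _)
    (Eventually.of_forall fun t => ?_)
  rw [sub_eq_add_neg (-(m * t)), Real.exp_add, mul_comm, ← sub_mul, norm_mul,
    Real.norm_of_nonneg (Real.exp_nonneg _), ← mul_assoc]
  refine mul_le_mul_of_nonneg_right ((exp_neg_remainder_bound N
    (x := ε * t ^ 2 / 2) (by positivity)).trans_eq ?_) (Real.exp_nonneg _)
  rw [div_pow, mul_pow, ← pow_mul]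
  field_simp

/-- The odd extension of `millsIntegral` in the first variable. -/
noncomputable def signedMills (m ε : ℝ) : ℝ := Real.sign m * millsIntegral |m| ε

theorem signedMills_bound {m ε : ℝ} (hm : m ≠ 0) (hε : 0 ≤ ε) (N : ℕ) :
    |signedMills m ε - ∑ n ∈ Finset.range N, (-ε) ^ n * millsCoeff n / m ^ (2 * n + 1)|
      ≤ ε ^ N * millsCoeff N / |m| ^ (2 * N + 1) := by
  have h := millsIntegral_bound (abs_pos.2 hm) hε N
  rcases hm.lt_or_gt with hm' | hm'
  · rw [signedMills, Real.sign_of_neg hm', abs_of_neg hm'] at *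
    rw [← abs_neg]
    refine le_of_eq_of_le ?_ h
    congr 1
    rw [neg_sub', ← Finset.sum_neg_distrib]
    congr 1
    · ring
    · refine Finset.sum_congr rfl fun n _ => ?_
      rw [Odd.neg_pow (by simp : Odd (2 * n + 1)), div_neg]
  · rw [signedMills, Real.sign_of_pos hm', abs_of_pos hm', one_mul] at *
    exact h

/-- The odd extension turns `Φ(-x) = 1 - Φ(x)` into one formula for both signs of `m`, whose
indicator becomes the intrinsic part. -/
theorem stdNormalCDF_div {ε : ℝ} (hε : 0 < ε) {m : ℝ} (hm : m ≠ 0) :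
    stdNormalCDF (m / √ε) = (if 0 < m then 1 else 0)
      - √ε * gaussianPDFReal 0 1 (m / √ε) * signedMills m ε := by
  rcases hm.lt_or_gt with hm' | hm'
  · have h := one_sub_stdNormalCDF_div hε (-m)
    rw [neg_div, stdNormalCDF_neg, gaussianPDFReal_std, neg_sq, ← gaussianPDFReal_std] at h
    rw [signedMills, Real.sign_of_neg hm', abs_of_neg hm', if_neg hm'.not_gt]
    linarith
  · have h := one_sub_stdNormalCDF_div hε m
    rw [signedMills, Real.sign_of_pos hm', abs_of_pos hm', if_pos hm']
    linarith

theorem HasExpansion.inv {N : ℕ} {f : ℝ → ℝ} {c : ℝ} (hf : HasExpansion N f)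
    (hlim : Tendsto f (𝓝[>] 0) (𝓝 c)) (hc : c ≠ 0) : HasExpansion N fun ε => (f ε)⁻¹ :=
  HasExpansion.comp_analyticAt (analyticAt_inv hc) hf hlim

theorem signedMills_isBigO {m : ℝ → ℝ} {c : ℝ} (hlim : Tendsto m (𝓝[>] 0) (𝓝 c)) (hc : c ≠ 0)
    (N : ℕ) : (fun ε => signedMills (m ε) ε
      - ∑ n ∈ Finset.range N, (-ε) ^ n * millsCoeff n / m ε ^ (2 * n + 1))
        =O[𝓝[>] 0] fun ε => ε ^ N := by
  have h1 : Tendsto (fun ε => millsCoeff N / |m ε| ^ (2 * N + 1)) (𝓝[>] 0)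
      (𝓝 (millsCoeff N / |c| ^ (2 * N + 1))) :=
    tendsto_const_nhds.div (hlim.abs.pow _) (pow_ne_zero _ (abs_ne_zero.2 hc))
  have h2 : (fun ε => ε ^ N * (millsCoeff N / |m ε| ^ (2 * N + 1))) =O[𝓝[>] (0 : ℝ)]
      fun ε => ε ^ N := by
    simpa using (Asymptotics.isBigO_refl (fun ε : ℝ => ε ^ N) (𝓝[>] 0)).mul (h1.isBigO_one ℝ)
  refine Asymptotics.IsBigO.trans (Asymptotics.IsBigO.of_bound 1 ?_) h2
  filter_upwards [eventually_mem_nhdsWithin, hlim.eventually_ne hc] with ε hε hm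
  have := signedMills_bound hm (le_of_lt hε) N
  rw [one_mul, Real.norm_eq_abs]
  refine this.trans ((le_abs_self _).trans_eq ?_)
  rw [Real.norm_eq_abs, mul_div_assoc]

theorem HasExpansion.signedMills {N : ℕ} {m : ℝ → ℝ} {c : ℝ} (hm : HasExpansion N m)
    (hlim : Tendsto m (𝓝[>] 0) (𝓝 c)) (hc : c ≠ 0) :
    HasExpansion N fun ε => signedMills (m ε) ε := by
  refine HasExpansion.of_isBigO (HasExpansion.sum (Finset.range N) fun n _ =>
    ((HasExpansion.id.neg.pow n).mul (HasExpansion.const (millsCoeff n))).mul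
      ((hm.pow (2 * n + 1)).inv (hlim.pow _) (pow_ne_zero _ hc))) ?_
  simpa only [div_eq_mul_inv] using signedMills_isBigO hlim hc N

theorem tendsto_signedMills {m : ℝ → ℝ} {c : ℝ} (hlim : Tendsto m (𝓝[>] 0) (𝓝 c))
    (hc : c ≠ 0) : Tendsto (fun ε => _root_.signedMills (m ε) ε) (𝓝[>] 0) (𝓝 c⁻¹) := by
  have h := signedMills_isBigO hlim hc 1
  have h0 : Tendsto (fun ε : ℝ => ε ^ 1) (𝓝[>] 0) (𝓝 0) := by
    simp only [pow_one]
    exact nhdsWithin_le_nhds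
  have h1 := (h.trans_tendsto h0).add (hlim.inv₀ hc)
  rw [zero_add] at h1
  refine h1.congr fun ε => ?_
  simp [millsCoeff]

/-! ### The Black-Scholes price for long maturities -/

/-- The limit `d₁ / √τ` for total variance `τ w` and log-strike `τ k`. -/
noncomputable def bsD1 (k w : ℝ) : ℝ := (-k + w / 2) / √w

/-- The limit `d₂ / √τ` for total variance `τ w` and log-strike `τ k`. -/
noncomputable def bsD2 (k w : ℝ) : ℝ := (-k - w / 2) / √w

/-- The Black-Scholes counterpart of `callPrice_saddle`: intrinsic part plus a Gaussian factor times
a difference of Mills ratios. -/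
theorem bsCall_div {ε w k : ℝ} (hε : 0 < ε) (hw : 0 < w) (h1 : bsD1 k w ≠ 0)
    (h2 : bsD2 k w ≠ 0) :
    bsCall (w / ε) (k / ε) = (if 0 < bsD1 k w then 1 else 0)
      - (if 0 < bsD2 k w then Real.exp (k / ε) else 0)
      + √ε * gaussianPDFReal 0 1 (bsD1 k w / √ε)
        * (signedMills (bsD2 k w) ε - signedMills (bsD1 k w) ε) := by
  have hsε : 0 < √ε := Real.sqrt_pos.2 hε
  have hsw : 0 < √w := Real.sqrt_pos.2 hw
  have e : √ε ^ 2 = ε := Real.sq_sqrt hε.le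
  have a1 : (-(k / ε) + w / ε / 2) / √(w / ε) = bsD1 k w / √ε := by
    rw [Real.sqrt_div hw.le, bsD1]; field_simp; rw [e]; ring
  have a2 : (-(k / ε) - w / ε / 2) / √(w / ε) = bsD2 k w / √ε := by
    rw [Real.sqrt_div hw.le, bsD2]; field_simp; rw [e]; ring
  have h := gaussianPDFReal_bs (div_pos hw hε) (k / ε)
  rw [a1, a2] at h
  rw [bsCall, a1, a2, stdNormalCDF_div hε h1, stdNormalCDF_div hε h2, ← h]
  split_ifs <;> ring

/-! ### Elementary bounds for call prices -/

section LevyProcess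

variable {Ω : Type*} [MeasurableSpace Ω] {P : Measure Ω} [IsProbabilityMeasure P]
  {X : ℝ≥0 → Ω → ℝ} {σ : ℝ} {ν : Measure ℝ}

namespace IsExpLevyProcess

theorem isProbabilityMeasure_map (hX : IsExpLevyProcess P X σ ν) (t : ℝ≥0) :
    IsProbabilityMeasure (P.map (X t)) :=
  Measure.isProbabilityMeasure_map (hX.levy.measurable t).aemeasurable

theorem integrable_exp (hX : IsExpLevyProcess P X σ ν) (t : ℝ≥0) :
    Integrable (fun x : ℝ => Real.exp x) (P.map (X t)) :=
  have := hX.isProbabilityMeasure_map t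
  hX.measure.integrable_exp_law t.coe_nonneg (hX.charFun_eq t)

theorem integrable_min_exp (hX : IsExpLevyProcess P X σ ν) (t : ℝ≥0) (k : ℝ) :
    Integrable (fun x : ℝ => min (Real.exp x) (Real.exp k)) (P.map (X t)) :=
  have := hX.isProbabilityMeasure_map t
  (hX.integrable_exp t).inf (integrable_const _)

/-- Uses `E exp X = 1`. The right-hand side makes positivity and comparisons between strikes
evident. -/
theorem one_sub_callPrice (hX : IsExpLevyProcess P X σ ν) (t : ℝ≥0) (k : ℝ) :
    1 - callPrice P X t k = ∫ x, min (Real.exp x) (Real.exp k) ∂(P.map (X t)) := by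
  have := hX.isProbabilityMeasure_map t
  have h1 := hX.measure.integral_exp_law t.coe_nonneg (hX.charFun_eq t)
  rw [callPrice_eq_integral_map hX, ← h1, ← integral_sub (hX.integrable_exp t)
    (hX.measure.integrable_payoff t.coe_nonneg (hX.charFun_eq t) k)]
  congr 1
  funext x
  rcases le_total (Real.exp x) (Real.exp k) with h | h
  · rw [max_eq_right (by linarith), min_eq_left h]; ring
  · rw [max_eq_left (by linarith), min_eq_right h]; ring

theorem callPrice_lt_one (hX : IsExpLevyProcess P X σ ν) (t : ℝ≥0) (k : ℝ) :
    callPrice P X t k < 1 := by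
  have := hX.isProbabilityMeasure_map t
  rw [← sub_pos, hX.one_sub_callPrice]
  refine (integral_pos_iff_support_of_nonneg (fun x => by positivity)
    (hX.integrable_min_exp t k)).2 ?_
  have : Function.support (fun x => min (Real.exp x) (Real.exp k)) = univ :=
    eq_univ_of_forall fun x => by
      have : 0 < min (Real.exp x) (Real.exp k) := by positivity
      exact this.ne'
  rw [this, measure_univ]
  exact one_pos

theorem one_sub_callPrice_mono (hX : IsExpLevyProcess P X σ ν) (t : ℝ≥0) {k k' : ℝ}
    (h : k ≤ k') : 1 - callPrice P X t k ≤ 1 - callPrice P X t k' := by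
  rw [hX.one_sub_callPrice, hX.one_sub_callPrice]
  exact integral_mono (hX.integrable_min_exp t k) (hX.integrable_min_exp t k')
    fun x => min_le_min le_rfl (Real.exp_le_exp.2 h)

/-- Lowering the strike shrinks `min (exp x) (exp k)` by at most the factor `exp (k - k')`. With
`one_sub_callPrice_mono` this transfers bounds between nearby strikes. -/
theorem exp_mul_one_sub_callPrice_le (hX : IsExpLevyProcess P X σ ν) (t : ℝ≥0) {k k' : ℝ}
    (h : k ≤ k') : Real.exp (k - k') * (1 - callPrice P X t k') ≤ 1 - callPrice P X t k := by
  rw [hX.one_sub_callPrice, hX.one_sub_callPrice, ← integral_const_mul]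
  refine integral_mono ((hX.integrable_min_exp t k').const_mul _) (hX.integrable_min_exp t k)
    fun x => ?_
  simp only []
  rw [mul_min_of_nonneg _ _ (Real.exp_nonneg _), ← Real.exp_add, ← Real.exp_add]
  refine min_le_min (Real.exp_le_exp.2 (by linarith)) (Real.exp_le_exp.2 (by linarith))

/-- Put-call parity. -/
theorem callPrice_sub_intrinsic (hX : IsExpLevyProcess P X σ ν) (t : ℝ≥0) (k : ℝ) :
    callPrice P X t k - (1 - Real.exp k)
      = ∫ x, max (Real.exp k - Real.exp x) 0 ∂(P.map (X t)) := by
  have := hX.isProbabilityMeasure_map t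
  have e : (fun x => max (Real.exp k - Real.exp x) 0)
      = fun x => Real.exp k - min (Real.exp x) (Real.exp k) := by
    funext x
    rcases le_total (Real.exp x) (Real.exp k) with h | h
    · rw [max_eq_left (by linarith), min_eq_left h]
    · rw [max_eq_right (by linarith), min_eq_right h]; ring
  rw [e, integral_sub (integrable_const _) (hX.integrable_min_exp t k), ← hX.one_sub_callPrice]
  simp only [integral_const, probReal_univ, one_smul]
  ring

theorem integrable_put (hX : IsExpLevyProcess P X σ ν) (t : ℝ≥0) (k : ℝ) :
    Integrable (fun x => max (Real.exp k - Real.exp x) 0) (P.map (X t)) :=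
  have := hX.isProbabilityMeasure_map t
  ((integrable_const _).sub (hX.integrable_exp t)).pos_part

theorem callPrice_sub_intrinsic_mono (hX : IsExpLevyProcess P X σ ν) (t : ℝ≥0) {k k' : ℝ}
    (h : k ≤ k') :
    callPrice P X t k - (1 - Real.exp k) ≤ callPrice P X t k' - (1 - Real.exp k') := by
  rw [hX.callPrice_sub_intrinsic, hX.callPrice_sub_intrinsic]
  exact integral_mono (hX.integrable_put t k) (hX.integrable_put t k')
    fun x => max_le_max (by linarith [Real.exp_le_exp.2 h]) le_rfl

/-- The tilted laws are not concentrated on one side of their mean. -/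
theorem exists_tilt_gt (hX : IsExpLevyProcess P X σ ν) (hnl : StronglyNonlattice σ ν) {p q : ℝ}
    (hp : p ∈ interior (momentSet ν)) (hq : q ∈ momentSet ν) (hpq : p ≠ q) {t : ℝ≥0} (ht : 0 < t) :
    ¬ ∀ᵐ x ∂(P.map (X t)), (q - p) * (x - t * deriv (realCumulant σ ν) p) ≤ 0 := by
  intro hall
  have := hX.isProbabilityMeasure_map t
  have hν := hX.measure
  have hM := fun {q : ℝ} (hq : q ∈ momentSet ν) =>
    hν.integral_exp_mul_law t.coe_nonneg (hX.charFun_eq t) hq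
  have hI := fun {q : ℝ} (hq : q ∈ momentSet ν) =>
    (hν.exp_moment t.coe_nonneg (hX.charFun_eq t) hq).1
  -- One-sidedness gives `exp (q x) ≤ exp ((q - p) t K' p) exp (p x)` almost surely. Integration
  -- would put `K q` on or below the tangent at `p`.
  have hle : Real.exp (t * realCumulant σ ν q)
      ≤ Real.exp ((q - p) * (t * deriv (realCumulant σ ν) p)) * Real.exp (t * realCumulant σ ν p) := by
    rw [← hM hq, ← hM (interior_subset hp), ← integral_const_mul]
    refine integral_mono_ae (hI hq) ((hI (interior_subset hp)).const_mul _) ?_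
    filter_upwards [hall] with x hx
    rw [← Real.exp_add]
    exact Real.exp_le_exp.2 (by linarith)
  rw [← Real.exp_add, Real.exp_le_exp] at hle
  have h := hν.realCumulant_tangent_lt (σ := σ) hnl hp hq hpq
  have ht' : (0 : ℝ) < t := ht
  nlinarith [mul_lt_mul_of_pos_left h ht']

/-- A zero price means `X t ≤ t K' p` almost surely, which `exists_tilt_gt` excludes for some `q >
p`. -/
theorem callPrice_pos (hX : IsExpLevyProcess P X σ ν) (hnl : StronglyNonlattice σ ν) {p : ℝ}
    (hp : p ∈ interior (momentSet ν)) {t : ℝ≥0} (ht : 0 < t) :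
    0 < callPrice P X t (t * deriv (realCumulant σ ν) p) := by
  have := hX.isProbabilityMeasure_map t
  obtain ⟨q, hpq, hq⟩ := Filter.nonempty_of_mem (inter_mem self_mem_nhdsWithin
    (mem_nhdsWithin_of_mem_nhds (mem_interior_iff_mem_nhds.1 hp)) : Ioi p ∩ momentSet ν ∈ 𝓝[>] p)
  rw [callPrice_eq_integral_map hX]
  refine lt_of_le_of_ne (integral_nonneg fun x => le_max_right _ _) fun h0 => ?_
  have h0 := (integral_eq_zero_iff_of_nonneg (fun x => le_max_right _ _)
    (hX.measure.integrable_payoff t.coe_nonneg (hX.charFun_eq t) _)).1 h0.symm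
  refine hX.exists_tilt_gt hnl hp hq (ne_of_lt hpq) ht ?_
  filter_upwards [h0] with x hx
  have h1 : Real.exp x ≤ Real.exp (t * deriv (realCumulant σ ν) p) := by
    have := max_eq_right_iff.1 (show max _ _ = (0 : ℝ) from hx); linarith
  exact mul_nonpos_of_nonneg_of_nonpos (sub_nonneg.2 (le_of_lt hpq))
    (sub_nonpos.2 (Real.exp_le_exp.1 h1))

/-- The put analogue of `callPrice_pos`, with `q < p`. -/
theorem intrinsic_lt_callPrice (hX : IsExpLevyProcess P X σ ν) (hnl : StronglyNonlattice σ ν)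
    {p : ℝ} (hp : p ∈ interior (momentSet ν)) {t : ℝ≥0} (ht : 0 < t) :
    1 - Real.exp (t * deriv (realCumulant σ ν) p)
      < callPrice P X t (t * deriv (realCumulant σ ν) p) := by
  have := hX.isProbabilityMeasure_map t
  obtain ⟨q, hpq, hq⟩ := Filter.nonempty_of_mem (inter_mem self_mem_nhdsWithin
    (mem_nhdsWithin_of_mem_nhds (mem_interior_iff_mem_nhds.1 hp)) : Iio p ∩ momentSet ν ∈ 𝓝[<] p)
  rw [← sub_pos, hX.callPrice_sub_intrinsic]
  refine lt_of_le_of_ne (integral_nonneg fun x => le_max_right _ _) fun h0 => ?_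
  have h0 := (integral_eq_zero_iff_of_nonneg (fun x => le_max_right _ _)
    (hX.integrable_put t _)).1 h0.symm
  refine hX.exists_tilt_gt hnl hp hq (ne_of_gt hpq) ht ?_
  filter_upwards [h0] with x hx
  have h1 : Real.exp (t * deriv (realCumulant σ ν) p) ≤ Real.exp x := by
    have := max_eq_right_iff.1 (show max _ _ = (0 : ℝ) from hx); linarith
  exact mul_nonpos_of_nonpos_of_nonneg (sub_nonpos.2 (le_of_lt hpq))
    (sub_nonneg.2 (Real.exp_le_exp.1 h1))

/-- Implied volatilities exist and are unique. -/
theorem existsUnique_impliedVol (hX : IsExpLevyProcess P X σ ν) (hnl : StronglyNonlattice σ ν)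
    {y : ℝ} (hy : y ∈ analyticityInterval ν) {τ : ℝ≥0} (hτ : 0 < τ) :
    ∃! s : ℝ, 0 < s ∧ bsCall (s ^ 2 * τ) (τ * -deriv (levyXi σ ν) y)
      = callPrice P X τ (τ * -deriv (levyXi σ ν) y) := by
  have hp := analyticityInterval_iff.1 hy
  rw [deriv_levyXi, neg_neg]
  exact existsUnique_bsCall hτ (hX.intrinsic_lt_callPrice hnl hp hτ) (hX.callPrice_pos hnl hp hτ)
    (hX.callPrice_lt_one _ _)

end IsExpLevyProcess

end LevyProcess

/-! ### The geometry of the saddle point -/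

section Geometry

variable {σ : ℝ} {ν : Measure ℝ} {y : ℝ}

namespace IsExpLevyMeasure

/-- `Ξ₀₁₊` and `Ξ₀₁₋` are the values at `1` and `0` of the tangent to `K` at `p`. As `K` vanishes
there, strict convexity makes them negative unless `p` is the point itself. -/
theorem xi01_one_eq (σ : ℝ) (ν : Measure ℝ) (y : ℝ) : xi01 (levyXi σ ν) 1 y
    = realCumulant σ ν (1 / 2 - y)
      + deriv (realCumulant σ ν) (1 / 2 - y) * (1 - (1 / 2 - y)) := by
  rw [xi01, deriv_levyXi, levyXi_eq]; ring

theorem xi01_neg_one_eq (σ : ℝ) (ν : Measure ℝ) (y : ℝ) : xi01 (levyXi σ ν) (-1) y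
    = realCumulant σ ν (1 / 2 - y)
      + deriv (realCumulant σ ν) (1 / 2 - y) * (0 - (1 / 2 - y)) := by
  rw [xi01, deriv_levyXi, levyXi_eq]; ring

theorem xi01_one_neg (hν : IsExpLevyMeasure ν) (hnl : StronglyNonlattice σ ν)
    (hy : y ∈ analyticityInterval ν) (h : y ≠ -(1 / 2)) : xi01 (levyXi σ ν) 1 y < 0 := by
  rw [xi01_one_eq]
  simpa [realCumulant_one] using hν.realCumulant_tangent_lt (σ := σ) hnl
    (analyticityInterval_iff.1 hy) hν.one_mem fun h' => h (by linarith)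

theorem xi01_neg_one_neg (hν : IsExpLevyMeasure ν) (hnl : StronglyNonlattice σ ν)
    (hy : y ∈ analyticityInterval ν) (h : y ≠ 1 / 2) : xi01 (levyXi σ ν) (-1) y < 0 := by
  rw [xi01_neg_one_eq]
  simpa [realCumulant_zero] using hν.realCumulant_tangent_lt (σ := σ) hnl
    (analyticityInterval_iff.1 hy) hν.zero_mem fun h' => h (by linarith)

theorem xi01_one_nonpos (hν : IsExpLevyMeasure ν) (hnl : StronglyNonlattice σ ν)
    (hy : y ∈ analyticityInterval ν) : xi01 (levyXi σ ν) 1 y ≤ 0 := by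
  by_cases h : y = -(1 / 2)
  · subst h
    rw [xi01_one_eq]; norm_num [realCumulant_one]
  · exact (hν.xi01_one_neg hnl hy h).le

theorem xi01_neg_one_nonpos (hν : IsExpLevyMeasure ν) (hnl : StronglyNonlattice σ ν)
    (hy : y ∈ analyticityInterval ν) : xi01 (levyXi σ ν) (-1) y ≤ 0 := by
  by_cases h : y = 1 / 2
  · subst h
    rw [xi01_neg_one_eq]; norm_num [realCumulant_zero]
  · exact (hν.xi01_neg_one_neg hnl hy h).le

/-- The signed square root of `-2 Ξ_{01,±}`. -/
noncomputable def saddleRoot (σ : ℝ) (ν : Measure ℝ) (e y : ℝ) : ℝ :=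
  Real.sign (y + e / 2) * √(-2 * xi01 (levyXi σ ν) e y)

/-- The squared sign is `1` except at `y = -1/2`, where `Ξ₀₁₊` vanishes too. -/
theorem saddleRoot_sq_one (hν : IsExpLevyMeasure ν) (hnl : StronglyNonlattice σ ν)
    (hy : y ∈ analyticityInterval ν) :
    saddleRoot σ ν 1 y ^ 2 = -2 * xi01 (levyXi σ ν) 1 y := by
  rw [saddleRoot, mul_pow, Real.sq_sqrt (by linarith [hν.xi01_one_nonpos hnl hy])]
  by_cases h : y = -(1 / 2)
  · have : xi01 (levyXi σ ν) 1 y = 0 := by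
      subst h; rw [xi01_one_eq]; norm_num [realCumulant_one]
    rw [this]; ring
  · rcases (show y + 1 / 2 ≠ 0 from fun h' => h (by linarith)).lt_or_gt with h' | h'
    · rw [Real.sign_of_neg h']; ring
    · rw [Real.sign_of_pos h']; ring

theorem saddleRoot_sq_neg_one (hν : IsExpLevyMeasure ν) (hnl : StronglyNonlattice σ ν)
    (hy : y ∈ analyticityInterval ν) :
    saddleRoot σ ν (-1) y ^ 2 = -2 * xi01 (levyXi σ ν) (-1) y := by
  rw [saddleRoot, mul_pow, Real.sq_sqrt (by linarith [hν.xi01_neg_one_nonpos hnl hy])]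
  by_cases h : y = 1 / 2
  · have : xi01 (levyXi σ ν) (-1) y = 0 := by
      subst h; rw [xi01_neg_one_eq]; norm_num [realCumulant_zero]
    rw [this]; ring
  · rcases (show y + -1 / 2 ≠ 0 from fun h' => h (by linarith)).lt_or_gt with h' | h'
    · rw [Real.sign_of_neg h']; ring
    · rw [Real.sign_of_pos h']; ring

theorem saddleRoot_one_pos (hν : IsExpLevyMeasure ν) (hnl : StronglyNonlattice σ ν)
    (hy : y ∈ analyticityInterval ν) (h : -(1 / 2) < y) : 0 < saddleRoot σ ν 1 y := by
  have := hν.xi01_one_neg hnl hy h.ne'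
  rw [saddleRoot, Real.sign_of_pos (by linarith), one_mul]
  exact Real.sqrt_pos.2 (by linarith)

theorem saddleRoot_one_neg (hν : IsExpLevyMeasure ν) (hnl : StronglyNonlattice σ ν)
    (hy : y ∈ analyticityInterval ν) (h : y < -(1 / 2)) : saddleRoot σ ν 1 y < 0 := by
  have := hν.xi01_one_neg hnl hy h.ne
  rw [saddleRoot, Real.sign_of_neg (by linarith), neg_one_mul, neg_lt_zero]
  exact Real.sqrt_pos.2 (by linarith)

theorem saddleRoot_neg_one_pos (hν : IsExpLevyMeasure ν) (hnl : StronglyNonlattice σ ν)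
    (hy : y ∈ analyticityInterval ν) (h : 1 / 2 < y) : 0 < saddleRoot σ ν (-1) y := by
  have := hν.xi01_neg_one_neg hnl hy h.ne'
  rw [saddleRoot, Real.sign_of_pos (by linarith), one_mul]
  exact Real.sqrt_pos.2 (by linarith)

theorem saddleRoot_neg_one_neg (hν : IsExpLevyMeasure ν) (hnl : StronglyNonlattice σ ν)
    (hy : y ∈ analyticityInterval ν) (h : y < 1 / 2) : saddleRoot σ ν (-1) y < 0 := by
  have := hν.xi01_neg_one_neg hnl hy h.ne
  rw [saddleRoot, Real.sign_of_neg (by linarith), neg_one_mul, neg_lt_zero]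
  exact Real.sqrt_pos.2 (by linarith)

theorem saddleRoot_one_zero (h : y = -(1 / 2)) : saddleRoot σ ν 1 y = 0 := by
  rw [saddleRoot, show y + 1 / 2 = 0 by linarith, Real.sign_zero, zero_mul]

theorem saddleRoot_neg_one_zero (h : y = 1 / 2) : saddleRoot σ ν (-1) y = 0 := by
  rw [saddleRoot, show y + -1 / 2 = 0 by linarith, Real.sign_zero, zero_mul]

theorem coeffA0_eq (σ : ℝ) (ν : Measure ℝ) (y : ℝ) : coeffA0 (levyXi σ ν) y
    = (saddleRoot σ ν 1 y - saddleRoot σ ν (-1) y) ^ 2 := by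
  rw [coeffA0, saddleRoot, saddleRoot, sub_eq_add_neg y, neg_div]

theorem xi01_sub (σ : ℝ) (ν : Measure ℝ) (y : ℝ) :
    xi01 (levyXi σ ν) 1 y - xi01 (levyXi σ ν) (-1) y = -deriv (levyXi σ ν) y := by
  rw [xi01, xi01]; ring

/-- This removes the absolute value from `√a₀`. For `|y| ≤ 1/2` the roots have opposite signs or one
vanishes; otherwise their signs agree and their squares differ by `-2 K' p`, whose sign is known. -/
theorem saddleRoot_lt (hν : IsExpLevyMeasure ν) (hnl : StronglyNonlattice σ ν)
    (hy : y ∈ analyticityInterval ν) : saddleRoot σ ν (-1) y < saddleRoot σ ν 1 y := by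
  have hp := analyticityInterval_iff.1 hy
  have hc := hν.strictConvexOn_realCumulant (σ := σ) hnl
  have q1 := hν.saddleRoot_sq_one hnl hy
  have q2 := hν.saddleRoot_sq_neg_one hnl hy
  have e := xi01_sub σ ν y
  have n1 := hν.xi01_one_nonpos hnl hy
  have n2 := hν.xi01_neg_one_nonpos hnl hy
  rcases lt_or_ge (1 / 2) y with h | h
  · have s1 := hν.saddleRoot_one_pos hnl hy (by linarith)
    have s2 := hν.saddleRoot_neg_one_pos hnl hy h
    -- the cumulant function is positive to the left of `0`
    have hK := hc.slope_strict_mono_adjacent (interior_subset hp) hν.one_mem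
      (show 1 / 2 - y < 0 by linarith) zero_lt_one
    rw [realCumulant_zero, realCumulant_one, div_lt_iff₀ (by linarith)] at hK
    have hT := xi01_neg_one_eq σ ν y
    -- Otherwise the tangent at `p < 0` would still be positive at `0`, while its value there is
    -- `Ξ₀₁₋ < 0`.
    have hk : deriv (realCumulant σ ν) (1 / 2 - y) < 0 := by
      by_contra hcon
      push Not at hcon
      have : 0 ≤ deriv (realCumulant σ ν) (1 / 2 - y) * (0 - (1 / 2 - y)) :=
        mul_nonneg hcon (by linarith)
      have := hν.xi01_neg_one_neg hnl hy h.ne'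
      linarith
    rw [deriv_levyXi, neg_neg] at e
    exact lt_of_pow_lt_pow_left₀ 2 s1.le (by linarith)
  rcases lt_or_ge y (-(1 / 2)) with h' | h'
  · have s1 := hν.saddleRoot_one_neg hnl hy h'
    have s2 := hν.saddleRoot_neg_one_neg hnl hy (by linarith)
    have hK := hc.slope_strict_mono_adjacent hν.zero_mem (interior_subset hp)
      zero_lt_one (show 1 < 1 / 2 - y by linarith)
    rw [realCumulant_zero, realCumulant_one, lt_div_iff₀ (by linarith)] at hK
    have hT := xi01_one_eq σ ν y
    have hk : 0 < deriv (realCumulant σ ν) (1 / 2 - y) := by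
      by_contra hcon
      push Not at hcon
      have : 0 ≤ deriv (realCumulant σ ν) (1 / 2 - y) * (1 - (1 / 2 - y)) :=
        mul_nonneg_of_nonpos_of_nonpos hcon (by linarith)
      have := hν.xi01_one_neg hnl hy h'.ne
      linarith
    rw [deriv_levyXi, neg_neg] at e
    have := lt_of_pow_lt_pow_left₀ (a := -saddleRoot σ ν 1 y) (b := -saddleRoot σ ν (-1) y) 2
      (by linarith) (by rw [neg_sq, neg_sq]; linarith)
    linarith
  · rcases h.eq_or_lt with h2 | h2
    · rw [saddleRoot_neg_one_zero h2]
      exact hν.saddleRoot_one_pos hnl hy (by linarith)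
    · refine (hν.saddleRoot_neg_one_neg hnl hy h2).trans_le ?_
      rcases h'.eq_or_lt with h3 | h3
      · rw [saddleRoot_one_zero h3.symm]
      · exact (hν.saddleRoot_one_pos hnl hy h3).le

theorem coeffA0_pos (hν : IsExpLevyMeasure ν) (hnl : StronglyNonlattice σ ν)
    (hy : y ∈ analyticityInterval ν) : 0 < coeffA0 (levyXi σ ν) y := by
  rw [coeffA0_eq]
  exact pow_pos (sub_pos.2 (hν.saddleRoot_lt hnl hy)) 2

theorem sqrt_coeffA0 (hν : IsExpLevyMeasure ν) (hnl : StronglyNonlattice σ ν)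
    (hy : y ∈ analyticityInterval ν) :
    √(coeffA0 (levyXi σ ν) y) = saddleRoot σ ν 1 y - saddleRoot σ ν (-1) y := by
  rw [coeffA0_eq, Real.sqrt_sq (sub_pos.2 (hν.saddleRoot_lt hnl hy)).le]

theorem two_mul_deriv_levyXi (hν : IsExpLevyMeasure ν) (hnl : StronglyNonlattice σ ν)
    (hy : y ∈ analyticityInterval ν) :
    2 * deriv (levyXi σ ν) y = saddleRoot σ ν 1 y ^ 2 - saddleRoot σ ν (-1) y ^ 2 := by
  rw [hν.saddleRoot_sq_one hnl hy, hν.saddleRoot_sq_neg_one hnl hy]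
  linarith [xi01_sub σ ν y]

/-- With `s₊`, `s₋` the two roots, `-k = (s₊² - s₋²) / 2` and `a₀ = (s₊ - s₋)²`. So `a₀` is the
variance at which the Black-Scholes exponents equal those of the saddle point. -/
theorem bsD1_coeffA0 (hν : IsExpLevyMeasure ν) (hnl : StronglyNonlattice σ ν)
    (hy : y ∈ analyticityInterval ν) :
    bsD1 (-deriv (levyXi σ ν) y) (coeffA0 (levyXi σ ν) y) = saddleRoot σ ν 1 y := by
  have h := hν.two_mul_deriv_levyXi hnl hy
  rw [bsD1, hν.sqrt_coeffA0 hnl hy, div_eq_iff (sub_pos.2 (hν.saddleRoot_lt hnl hy)).ne',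
    coeffA0_eq]
  linarith

theorem bsD2_coeffA0 (hν : IsExpLevyMeasure ν) (hnl : StronglyNonlattice σ ν)
    (hy : y ∈ analyticityInterval ν) :
    bsD2 (-deriv (levyXi σ ν) y) (coeffA0 (levyXi σ ν) y) = saddleRoot σ ν (-1) y := by
  have h := hν.two_mul_deriv_levyXi hnl hy
  rw [bsD2, hν.sqrt_coeffA0 hnl hy, div_eq_iff (sub_pos.2 (hν.saddleRoot_lt hnl hy)).ne',
    coeffA0_eq]
  linarith

theorem coeffr_eq (hν : IsExpLevyMeasure ν) (hnl : StronglyNonlattice σ ν)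
    (hy : y ∈ analyticityInterval ν) :
    coeffr (levyXi σ ν) y
      = saddleRoot σ ν 1 y * saddleRoot σ ν (-1) y / coeffA0 (levyXi σ ν) y := by
  have h := hν.two_mul_deriv_levyXi hnl hy
  have hne : saddleRoot σ ν 1 y - saddleRoot σ ν (-1) y ≠ 0 :=
    (sub_pos.2 (hν.saddleRoot_lt hnl hy)).ne'
  have h' : deriv (levyXi σ ν) y = (saddleRoot σ ν 1 y - saddleRoot σ ν (-1) y)
      * (saddleRoot σ ν 1 y + saddleRoot σ ν (-1) y) / 2 := by linarith
  rw [coeffr, quadR, coeffA0_eq, h']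
  field_simp
  ring

end IsExpLevyMeasure

theorem bsD1_sq_sub {k w a : ℝ} (hw : 0 < w) (ha : 0 < a) :
    bsD1 k w ^ 2 - bsD1 k a ^ 2 = (w - a) * (1 / 4 - k ^ 2 / (w * a)) := by
  rw [bsD1, bsD1, div_pow, div_pow, Real.sq_sqrt hw.le, Real.sq_sqrt ha.le]
  field_simp
  ring

end Geometry

/-! ### Inversion of the Black-Scholes formula -/

/-- The Black-Scholes price increases in the variance, so comparing prices at trial variances `v` on
either side of `a` traps `w`. -/
theorem tendsto_nhdsGT_zero_of_bsCall {k a : ℝ} {c w : ℝ → ℝ} (ha : 0 < a)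
    (hw : ∀ ε, 0 < ε → 0 < w ε ∧ bsCall (w ε / ε) (k / ε) = c ε)
    (h₁ : ∀ᶠ v in 𝓝[>] a, ∀ᶠ ε in 𝓝[>] (0 : ℝ), c ε < bsCall (v / ε) (k / ε))
    (h₂ : ∀ᶠ v in 𝓝[<] a, ∀ᶠ ε in 𝓝[>] (0 : ℝ), bsCall (v / ε) (k / ε) < c ε) :
    Tendsto w (𝓝[>] 0) (𝓝 a) := by
  have key : ∀ {v ε : ℝ}, 0 < v → 0 < ε → (bsCall (v / ε) (k / ε) < c ε ↔ v < w ε) ∧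
      (c ε < bsCall (v / ε) (k / ε) ↔ w ε < v) := by
    intro v ε hv hε
    obtain ⟨h1, h2⟩ := hw ε hε
    rw [← h2, ← div_lt_div_iff_of_pos_right hε (a := v), ← div_lt_div_iff_of_pos_right hε (a := w ε)]
    exact ⟨(strictMonoOn_bsCall _).lt_iff_lt (mem_Ioi.2 (by positivity))
      (mem_Ioi.2 (by positivity)), (strictMonoOn_bsCall _).lt_iff_lt (mem_Ioi.2 (by positivity))
      (mem_Ioi.2 (by positivity))⟩
  refine tendsto_order.2 ⟨fun b hb => ?_, fun b hb => ?_⟩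
  · obtain ⟨v, hv, hv2⟩ := (h₂.and (Ioo_mem_nhdsLT (max_lt hb ha))).exists
    filter_upwards [hv, self_mem_nhdsWithin] with ε h hε
    exact ((le_max_left _ _).trans_lt hv2.1).trans
      ((key ((le_max_right _ _).trans_lt hv2.1) hε).1.1 h)
  · obtain ⟨v, hv, hv2⟩ := (h₁.and (Ioo_mem_nhdsGT hb)).exists
    filter_upwards [hv, self_mem_nhdsWithin] with ε h hε
    exact ((key (ha.trans hv2.1) hε).2.1 h).trans hv2.2

theorem tendsto_exp_neg_div_zero {b : ℝ} (hb : 0 < b) :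
    Tendsto (fun ε : ℝ => Real.exp (-(b / ε))) (𝓝[>] 0) (𝓝 0) := by
  refine Real.tendsto_exp_neg_atTop_nhds_zero.comp ?_
  exact (tendsto_inv_nhdsGT_zero.const_mul_atTop hb).congr fun ε => (div_eq_mul_inv b ε).symm

theorem tendsto_exp_neg_div_atTop {b : ℝ} (hb : b < 0) :
    Tendsto (fun ε : ℝ => Real.exp (-(b / ε))) (𝓝[>] 0) atTop := by
  refine Real.tendsto_exp_atTop.comp ?_
  simpa [div_eq_mul_inv] using tendsto_inv_nhdsGT_zero.const_mul_atTop (neg_pos.2 hb)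

/-- The factor `d` covers both signs of the amplitudes. A growing exponential swamps `S`; a
vanishing one, in `eventually_exp_gap_neg`, leaves only `-S`. -/
theorem eventually_exp_gap_pos {D S : ℝ → ℝ} {d s b : ℝ} (hD : Tendsto D (𝓝[>] 0) (𝓝 d))
    (hS : Tendsto S (𝓝[>] 0) (𝓝 s)) (hd : d ≠ 0) (hb : b < 0) :
    ∀ᶠ ε in 𝓝[>] (0 : ℝ), 0 < d * (Real.exp (-(b / ε)) * D ε - S ε) := by
  have h1 : Tendsto (fun ε => Real.exp (-(b / ε)) * (d * D ε) + -(d * S ε)) (𝓝[>] 0) atTop :=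
    ((tendsto_exp_neg_div_atTop hb).atTop_mul_pos (mul_self_pos.2 hd)
      (hD.const_mul d)).atTop_add (hS.const_mul d).neg
  filter_upwards [h1.eventually_gt_atTop 0] with ε h
  linarith

theorem eventually_exp_gap_neg {D S : ℝ → ℝ} {d s b : ℝ} (hD : Tendsto D (𝓝[>] 0) (𝓝 d))
    (hS : Tendsto S (𝓝[>] 0) (𝓝 s)) (hds : 0 < d * s) (hb : 0 < b) :
    ∀ᶠ ε in 𝓝[>] (0 : ℝ), d * (Real.exp (-(b / ε)) * D ε - S ε) < 0 := by
  have h1 : Tendsto (fun ε => d * (Real.exp (-(b / ε)) * D ε - S ε)) (𝓝[>] 0)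
      (𝓝 (d * (0 * d - s))) :=
    (((tendsto_exp_neg_div_zero hb).mul hD).sub hS).const_mul d
  exact h1.eventually_lt_const (by linarith)

theorem continuousAt_bsD1 {k a : ℝ} (ha : 0 < a) : ContinuousAt (bsD1 k) a :=
  ContinuousAt.div (by fun_prop) (by fun_prop) (Real.sqrt_pos.2 ha).ne'

theorem continuousAt_bsD2 {k a : ℝ} (ha : 0 < a) : ContinuousAt (bsD2 k) a :=
  ContinuousAt.div (by fun_prop) (by fun_prop) (Real.sqrt_pos.2 ha).ne'

theorem eventually_same_sign {f : ℝ → ℝ} {a : ℝ} (hf : ContinuousAt f a) (h : f a ≠ 0) :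
    ∀ᶠ v in 𝓝 a, (0 < f v ↔ 0 < f a) ∧ f v ≠ 0 := by
  rcases h.lt_or_gt with h | h
  · filter_upwards [hf.eventually_lt_const h] with v hv
    exact ⟨⟨fun h' => absurd h' hv.not_gt, fun h' => absurd h' h.not_gt⟩, hv.ne⟩
  · filter_upwards [hf.eventually_const_lt h] with v hv
    exact ⟨⟨fun _ => h, fun _ => hv⟩, hv.ne'⟩

theorem bsD1_sub_bsD2 (k : ℝ) {w : ℝ} (hw : 0 < w) : bsD1 k w - bsD2 k w = √w := by
  rw [bsD1, bsD2, ← sub_div, div_eq_iff (Real.sqrt_pos.2 hw).ne', Real.mul_self_sqrt hw.le]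
  ring

theorem bsD1_mul_bsD2 (k : ℝ) {w : ℝ} (hw : 0 < w) :
    bsD1 k w * bsD2 k w = k ^ 2 / w - w / 4 := by
  rw [bsD1, bsD2, div_mul_div_comm, Real.mul_self_sqrt hw.le]
  field_simp
  ring

/-- The call price `c`, at maturity `1 / ε` and log-strike `k / ε`, has the saddlepoint form
with exponent `bsD1 k a ^ 2 / 2` and amplitude `S`. -/
def IsSaddlePrice (k a : ℝ) (S c : ℝ → ℝ) : Prop :=
  ∀ ε, 0 < ε → c ε = (if 0 < bsD1 k a then 1 else 0)
      - (if 0 < bsD2 k a then Real.exp (k / ε) else 0)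
      + √ε * ((√(2 * Real.pi))⁻¹ * Real.exp (-(bsD1 k a ^ 2 / 2 / ε))) * S ε

/-- When `d₁` and `d₂` keep their signs between `a` and `v` the intrinsic parts cancel, and only
exponents and amplitudes remain to be compared. -/
theorem bsCall_sub_saddlePrice {k a ε v : ℝ} {S c : ℝ → ℝ} (hc : IsSaddlePrice k a S c)
    (hε : 0 < ε) (hv : 0 < v) (h1 : (0 < bsD1 k v ↔ 0 < bsD1 k a) ∧ bsD1 k v ≠ 0)
    (h2 : (0 < bsD2 k v ↔ 0 < bsD2 k a) ∧ bsD2 k v ≠ 0) :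
    bsCall (v / ε) (k / ε) - c ε
      = √ε * ((√(2 * Real.pi))⁻¹ * Real.exp (-(bsD1 k a ^ 2 / 2 / ε)))
        * (Real.exp (-((bsD1 k v ^ 2 - bsD1 k a ^ 2) / 2 / ε))
          * (signedMills (bsD2 k v) ε - signedMills (bsD1 k v) ε) - S ε) := by
  rw [bsCall_div hε hv h1.2 h2.2, hc ε hε, gaussianPDFReal_std]
  simp only [h1.1, h2.1]
  have : Real.exp (-(bsD1 k v / √ε) ^ 2 / 2) = Real.exp (-(bsD1 k a ^ 2 / 2 / ε))
      * Real.exp (-((bsD1 k v ^ 2 - bsD1 k a ^ 2) / 2 / ε)) := by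
    rw [← Real.exp_add, div_pow, Real.sq_sqrt hε.le]
    congr 1
    ring
  rw [this]
  ring

section Inversion

variable {k a s c₁ : ℝ} {c w S : ℝ → ℝ}

theorem tendsto_millsDiff {v : ℝ → ℝ} (ha : 0 < a) (hv : Tendsto v (𝓝[>] 0) (𝓝 a))
    (h1 : bsD1 k a ≠ 0) (h2 : bsD2 k a ≠ 0) :
    Tendsto (fun ε => signedMills (bsD2 k (v ε)) ε - signedMills (bsD1 k (v ε)) ε) (𝓝[>] 0)
      (𝓝 (√a / (bsD1 k a * bsD2 k a))) := by
  have := (tendsto_signedMills ((continuousAt_bsD2 ha).tendsto.comp hv) h2).sub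
    (tendsto_signedMills ((continuousAt_bsD1 ha).tendsto.comp hv) h1)
  have e : √a / (bsD1 k a * bsD2 k a) = (bsD2 k a)⁻¹ - (bsD1 k a)⁻¹ := by
    rw [← bsD1_sub_bsD2 k ha]
    field_simp
  rw [e]
  exact this

/-- `d₁(v)² - d₁(a)²` is `v - a` times a factor equal to `-d₁ d₂ / a` at `v = a`, hence of constant
sign near `a`. So for each fixed `v ≠ a` the exponents decide which price is larger. Hypothesis `hs`
says that `S` has the sign of the Mills difference. -/
theorem tendsto_impliedVariance (ha : 0 < a) (h1 : bsD1 k a ≠ 0) (h2 : bsD2 k a ≠ 0)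
    (hs : 0 < bsD1 k a * bsD2 k a * s) (hS : Tendsto S (𝓝[>] 0) (𝓝 s))
    (hc : IsSaddlePrice k a S c)
    (hw : ∀ ε, 0 < ε → 0 < w ε ∧ bsCall (w ε / ε) (k / ε) = c ε) :
    Tendsto w (𝓝[>] 0) (𝓝 a) := by
  have hpi : 0 < √(2 * Real.pi) := Real.sqrt_pos.2 (by positivity)
  -- near `a` the sign of the exponent is that of `-(v - a) * bsD1 * bsD2`
  have hG : ∀ᶠ v in 𝓝 a, 0 < -(bsD1 k a * bsD2 k a) * (1 / 4 - k ^ 2 / (v * a)) := by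
    have hcont : ContinuousAt (fun v => -(bsD1 k a * bsD2 k a) * (1 / 4 - k ^ 2 / (v * a))) a :=
      continuousAt_const.mul (continuousAt_const.sub
        (continuousAt_const.div (by fun_prop) (by positivity)))
    refine hcont.eventually_const_lt ?_
    beta_reduce
    have e : 1 / 4 - k ^ 2 / (a * a) = -(bsD1 k a * bsD2 k a) / a := by
      rw [bsD1_mul_bsD2 k ha]; field_simp; ring
    rw [e, ← mul_div_assoc]
    exact div_pos (mul_self_pos.2 (neg_ne_zero.2 (mul_ne_zero h1 h2))) ha
  have hpos : ∀ᶠ v in 𝓝 a, 0 < v := lt_mem_nhds ha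
  have hD12 : ∀ᶠ v in 𝓝 a, 0 < bsD1 k a * bsD2 k a * (bsD1 k v * bsD2 k v) := by
    refine (continuousAt_const.mul ((continuousAt_bsD1 ha).mul
      (continuousAt_bsD2 ha))).eventually_const_lt ?_
    exact mul_self_pos.2 (mul_ne_zero h1 h2)
  have main : ∀ᶠ v in 𝓝 a, v ≠ a → ∀ᶠ ε in 𝓝[>] (0 : ℝ),
      0 < (v - a) * (bsCall (v / ε) (k / ε) - c ε) := by
    filter_upwards [hG, hpos, eventually_same_sign (continuousAt_bsD1 ha) h1,
      eventually_same_sign (continuousAt_bsD2 ha) h2, hD12] with v hGv hv hs1 hs2 h12 hva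
    have hb := bsD1_sq_sub (k := k) hv ha
    set d := √v / (bsD1 k v * bsD2 k v) with hd
    have hD := tendsto_millsDiff hv (tendsto_const_nhds (f := 𝓝[>] (0 : ℝ))) hs1.2 hs2.2
    have hP0 : bsD1 k v * bsD2 k v ≠ 0 := mul_ne_zero hs1.2 hs2.2
    have hsv := Real.sqrt_pos.2 hv
    set Pa := bsD1 k a * bsD2 k a with hPa
    have hPd : 0 < Pa * d := by
      have : Pa * d = Pa * (bsD1 k v * bsD2 k v) * √v / (bsD1 k v * bsD2 k v) ^ 2 := by
        rw [hd]; field_simp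
      rw [this]; positivity
    have hds : 0 < d * s := by
      have h3 := mul_pos hPd hs
      have h4 : Pa * d * (Pa * s) = Pa ^ 2 * (d * s) := by ring
      rw [h4] at h3
      exact pos_of_mul_pos_right h3 (sq_nonneg _)
    have hd0 : d ≠ 0 := left_ne_zero_of_mul hds.ne'
    set G := 1 / 4 - k ^ 2 / (v * a) with hGdef
    have hPP : 0 < Pa * Pa := mul_self_pos.2 (mul_ne_zero h1 h2)
    have hfin : ∀ᶠ ε in 𝓝[>] (0 : ℝ), 0 < (v - a) *
        (Real.exp (-((bsD1 k v ^ 2 - bsD1 k a ^ 2) / 2 / ε))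
          * (signedMills (bsD2 k v) ε - signedMills (bsD1 k v) ε) - S ε) := by
      -- Dividing out factors of known sign replaces `d` by `v - a` and treats all sign patterns of
      -- `d₁`, `d₂` together.
      have hcancel : ∀ E : ℝ, 0 < (Pa * Pa) * -((v - a) * G * (d * E)) → 0 < (v - a) * E :=
        fun E hE => pos_of_mul_pos_right
          (a := Pa * d * (-Pa * G)) (by refine hE.trans_eq ?_; ring) (mul_pos hPd hGv).le
      rcases lt_or_gt_of_ne (show (v - a) * G ≠ 0 from mul_ne_zero (sub_ne_zero.2 hva)
          (right_ne_zero_of_mul hGv.ne')) with hbn | hbp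
      · filter_upwards [eventually_exp_gap_pos hD hS hd0
          (b := (bsD1 k v ^ 2 - bsD1 k a ^ 2) / 2) (by rw [hb]; linarith)] with ε h
        exact hcancel _ (mul_pos hPP (neg_pos.2 (mul_neg_of_neg_of_pos hbn h)))
      · filter_upwards [eventually_exp_gap_neg hD hS hds
          (b := (bsD1 k v ^ 2 - bsD1 k a ^ 2) / 2) (by rw [hb]; linarith)] with ε h
        exact hcancel _ (mul_pos hPP (neg_pos.2 (mul_neg_of_pos_of_neg hbp h)))
    filter_upwards [hfin, self_mem_nhdsWithin] with ε h hε
    rw [bsCall_sub_saddlePrice hc hε hv hs1 hs2]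
    have h7 : 0 < √ε * ((√(2 * Real.pi))⁻¹ * Real.exp (-(bsD1 k a ^ 2 / 2 / ε))) := by
      have := Real.sqrt_pos.2 (show (0 : ℝ) < ε from hε)
      positivity
    rw [mul_left_comm]
    exact mul_pos h7 h
  refine tendsto_nhdsGT_zero_of_bsCall ha hw ?_ ?_
  · filter_upwards [nhdsWithin_le_nhds main, self_mem_nhdsWithin] with v hv hva
    filter_upwards [hv (ne_of_gt hva)] with ε h
    exact sub_pos.1 (pos_of_mul_pos_right h (sub_pos.2 hva).le)
  · filter_upwards [nhdsWithin_le_nhds main, self_mem_nhdsWithin] with v hv hva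
    filter_upwards [hv (ne_of_lt hva)] with ε h
    have : (v - a) < 0 := sub_neg.2 hva
    nlinarith

/-- The correction term of the implied variance. -/
noncomputable def varianceCorrection (k a v D S : ℝ) : ℝ :=
  Real.log (D / S) / (1 / 8 - k ^ 2 / (2 * (v * a)))

/-- Equality of the two prices says `D / S = exp ((d₁(w)² - d₁(a)²) / (2 ε))`. Its logarithm
contains `w - a` as a factor, which gives a fixed point equation with a factor `ε` on the right. -/
theorem impliedVariance_eq (ha : 0 < a) (h1 : bsD1 k a ≠ 0) (h2 : bsD2 k a ≠ 0)
    (hs : 0 < bsD1 k a * bsD2 k a * s) (hS : Tendsto S (𝓝[>] 0) (𝓝 s))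
    (hc : IsSaddlePrice k a S c)
    (hw : ∀ ε, 0 < ε → 0 < w ε ∧ bsCall (w ε / ε) (k / ε) = c ε) :
    ∀ᶠ ε in 𝓝[>] (0 : ℝ), w ε = a + ε * varianceCorrection k a (w ε)
      (signedMills (bsD2 k (w ε)) ε - signedMills (bsD1 k (w ε)) ε) (S ε) := by
  have hlim := tendsto_impliedVariance ha h1 h2 hs hS hc hw
  have hG : ∀ᶠ v in 𝓝 a, (1 / 8 - k ^ 2 / (2 * (v * a))) ≠ 0 := by
    have hcont : ContinuousAt (fun v => 1 / 8 - k ^ 2 / (2 * (v * a))) a :=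
      continuousAt_const.sub (continuousAt_const.div (by fun_prop) (by positivity))
    refine hcont.eventually_ne ?_
    have e : 1 / 8 - k ^ 2 / (2 * (a * a)) = -(bsD1 k a * bsD2 k a) / (2 * a) := by
      rw [bsD1_mul_bsD2 k ha]; field_simp; ring
    rw [e]
    exact div_ne_zero (neg_ne_zero.2 (mul_ne_zero h1 h2)) (by positivity)
  have hs0 : s ≠ 0 := right_ne_zero_of_mul hs.ne'
  filter_upwards [self_mem_nhdsWithin, hlim.eventually hG,
    hlim.eventually (eventually_same_sign (continuousAt_bsD1 ha) h1),
    hlim.eventually (eventually_same_sign (continuousAt_bsD2 ha) h2),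
    hS.eventually_ne hs0] with ε (hε : 0 < ε) hGε hs1 hs2 hSε
  obtain ⟨hw0, hwc⟩ := hw ε hε
  have h := bsCall_sub_saddlePrice hc hε hw0 hs1 hs2
  rw [hwc, sub_self, eq_comm] at h
  have hpi : 0 < √(2 * Real.pi) := Real.sqrt_pos.2 (by positivity)
  have h7 : √ε * ((√(2 * Real.pi))⁻¹ * Real.exp (-(bsD1 k a ^ 2 / 2 / ε))) ≠ 0 := by
    have := Real.sqrt_pos.2 hε
    positivity
  have h8 := sub_eq_zero.1 ((mul_eq_zero.1 h).resolve_left h7)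
  have h9 : (signedMills (bsD2 k (w ε)) ε - signedMills (bsD1 k (w ε)) ε) / S ε
      = Real.exp ((bsD1 k (w ε) ^ 2 - bsD1 k a ^ 2) / 2 / ε) := by
    rw [div_eq_iff hSε, ← h8, ← mul_assoc, ← Real.exp_add]
    simp
  rw [varianceCorrection, h9, Real.log_exp, bsD1_sq_sub hw0 ha,
    show (w ε - a) * (1 / 4 - k ^ 2 / (w ε * a))
      = 2 * (w ε - a) * (1 / 8 - k ^ 2 / (2 * (w ε * a))) by field_simp; ring]
  set G := 1 / 8 - k ^ 2 / (2 * (w ε * a))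
  field_simp
  ring

end Inversion

/-! ### The asymptotic series of the implied variance -/

theorem Real.analyticAt_sqrt {x : ℝ} (hx : 0 < x) : AnalyticAt ℝ Real.sqrt x :=
  (Real.contDiffAt_sqrt hx.ne').analyticAt

theorem analyticAt_bsD1 (k : ℝ) {a : ℝ} (ha : 0 < a) : AnalyticAt ℝ (bsD1 k) a :=
  (analyticAt_const.add (analyticAt_id.div analyticAt_const two_ne_zero)).div
    (Real.analyticAt_sqrt ha) (Real.sqrt_pos.2 ha).ne'

theorem analyticAt_bsD2 (k : ℝ) {a : ℝ} (ha : 0 < a) : AnalyticAt ℝ (bsD2 k) a :=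
  (analyticAt_const.sub (analyticAt_id.div analyticAt_const two_ne_zero)).div
    (Real.analyticAt_sqrt ha) (Real.sqrt_pos.2 ha).ne'

section Expansion

variable {k a s c₁ : ℝ} {c w S : ℝ → ℝ}

theorem eighth_sub_eq (k : ℝ) (ha : 0 < a) :
    1 / 8 - k ^ 2 / (2 * (a * a)) = -(bsD1 k a * bsD2 k a) / (2 * a) := by
  rw [bsD1_mul_bsD2 k ha]; field_simp; ring

theorem HasExpansion.varianceCorrection {N : ℕ} (ha : 0 < a) (h1 : bsD1 k a ≠ 0)
    (h2 : bsD2 k a ≠ 0) (hs : 0 < bsD1 k a * bsD2 k a * s) (hS : Tendsto S (𝓝[>] 0) (𝓝 s))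
    (hlim : Tendsto w (𝓝[>] 0) (𝓝 a)) (hSN : HasExpansion N S) (hwN : HasExpansion N w) :
    HasExpansion N fun ε => varianceCorrection k a (w ε)
      (_root_.signedMills (bsD2 k (w ε)) ε - _root_.signedMills (bsD1 k (w ε)) ε) (S ε) := by
  have hP : bsD1 k a * bsD2 k a ≠ 0 := mul_ne_zero h1 h2
  have hs0 : s ≠ 0 := right_ne_zero_of_mul hs.ne'
  have e1 := hwN.comp_analyticAt (analyticAt_bsD1 k ha) hlim
  have e2 := hwN.comp_analyticAt (analyticAt_bsD2 k ha) hlim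
  have l1 := (continuousAt_bsD1 (k := k) ha).tendsto.comp hlim
  have l2 := (continuousAt_bsD2 (k := k) ha).tendsto.comp hlim
  have hD := (e2.signedMills l2 h2).sub (e1.signedMills l1 h1)
  have hDS := hD.mul (hSN.inv hS hs0)
  have hDl := (tendsto_millsDiff ha hlim h1 h2).mul (hS.inv₀ hs0)
  -- The limit of `D / S` must be positive for the logarithm to be analytic there.
  have hpos : 0 < √a / (bsD1 k a * bsD2 k a) * s⁻¹ := by
    have := Real.sqrt_pos.2 ha
    have e : √a / (bsD1 k a * bsD2 k a) * s⁻¹ = √a / (bsD1 k a * bsD2 k a * s) := by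
      rw [div_mul_eq_mul_div, ← div_eq_mul_inv, div_div, mul_comm s]
    rw [e]; positivity
  have hlog := hDS.comp_analyticAt (_root_.analyticAt_log hpos) hDl
  have hq : HasExpansion N fun ε => 1 / 8 - k ^ 2 / 2 * ((w ε)⁻¹ * a⁻¹) :=
    (HasExpansion.const _).sub (((hwN.inv hlim ha.ne').mul (HasExpansion.const _)).const_mul _)
  have hql : Tendsto (fun ε => 1 / 8 - k ^ 2 / 2 * ((w ε)⁻¹ * a⁻¹)) (𝓝[>] 0)
      (𝓝 (1 / 8 - k ^ 2 / 2 * (a⁻¹ * a⁻¹))) :=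
    tendsto_const_nhds.sub (((hlim.inv₀ ha.ne').mul tendsto_const_nhds).const_mul _)
  have hqne : 1 / 8 - k ^ 2 / 2 * (a⁻¹ * a⁻¹) ≠ 0 := by
    have e : 1 / 8 - k ^ 2 / 2 * (a⁻¹ * a⁻¹) = -(bsD1 k a * bsD2 k a) / (2 * a) := by
      rw [← eighth_sub_eq k ha]; field_simp
    rw [e]
    exact div_ne_zero (neg_ne_zero.2 hP) (by positivity)
  refine (hlog.mul (hq.inv hql hqne)).congr (Eventually.of_forall fun ε => ?_)
  simp only [_root_.varianceCorrection, div_eq_mul_inv, mul_inv]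
  ring_nf

/-- Bootstrap: an expansion of `w` to order `N` gives one of the correction to order `N`, and the
factor `ε` in the fixed point equation raises it to `N + 1`. It starts from convergence alone. -/
theorem hasExpansion_impliedVariance (ha : 0 < a) (h1 : bsD1 k a ≠ 0) (h2 : bsD2 k a ≠ 0)
    (hs : 0 < bsD1 k a * bsD2 k a * s) (hS : Tendsto S (𝓝[>] 0) (𝓝 s))
    (hSN : ∀ N, HasExpansion N S) (hc : IsSaddlePrice k a S c)
    (hw : ∀ ε, 0 < ε → 0 < w ε ∧ bsCall (w ε / ε) (k / ε) = c ε) (N : ℕ) :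
    HasExpansion N w := by
  have hlim := tendsto_impliedVariance ha h1 h2 hs hS hc hw
  induction N with
  | zero =>
    refine (HasExpansion.const 0).of_isBigO ?_
    simpa using hlim.isBigO_one ℝ
  | succ N ih =>
    have h := ((HasExpansion.varianceCorrection ha h1 h2 hs hS hlim (hSN N) ih).id_mul)
    refine ((HasExpansion.const a).add h).congr ?_
    filter_upwards [impliedVariance_eq ha h1 h2 hs hS hc hw] with ε h
    exact h.symm

/-- A first-order coefficient is the one-sided derivative at `0` of the function completed by its
limit. The coefficients can then be found with the chain rule. -/
theorem hasDerivWithinAt_update_iff {f : ℝ → ℝ} {c d : ℝ} :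
    HasDerivWithinAt (Function.update f 0 c) d (Ioi 0) 0
      ↔ Tendsto (fun ε => (f ε - c) / ε) (𝓝[>] 0) (𝓝 d) := by
  rw [hasDerivWithinAt_iff_tendsto_slope' (by simp)]
  refine tendsto_congr' ?_
  filter_upwards [self_mem_nhdsWithin] with ε (hε : 0 < ε)
  rw [slope_def_field, Function.update_self, Function.update_of_ne hε.ne', sub_zero]

theorem signedMills_zero_right {m : ℝ} (hm : m ≠ 0) : signedMills m 0 = m⁻¹ := by
  have h := signedMills_bound hm le_rfl 1
  simp [millsCoeff] at h
  linarith

/-- To first order the signed Mills ratio is `1 / m - ε / m³`, with an error of order `ε²` that does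
not affect the derivative. -/
theorem hasDerivWithinAt_signedMills {m : ℝ → ℝ} {m' : ℝ} (hm : HasDerivWithinAt m m' (Ioi 0) 0)
    (h0 : m 0 ≠ 0) :
    HasDerivWithinAt (fun ε => signedMills (m ε) ε) (-m' / m 0 ^ 2 - 1 / m 0 ^ 3) (Ioi 0) 0 := by
  have hlim : Tendsto m (𝓝[>] 0) (𝓝 (m 0)) := hm.continuousWithinAt
  have hR : HasDerivWithinAt (fun ε => signedMills (m ε) ε - ((m ε)⁻¹ - ε * (m ε ^ 3)⁻¹))
      0 (Ioi 0) 0 := by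
    rw [hasDerivWithinAt_iff_tendsto_slope' (by simp)]
    have h := signedMills_isBigO hlim h0 2
    have h2 : (fun ε : ℝ => ε⁻¹ * (signedMills (m ε) ε
        - ∑ n ∈ Finset.range 2, (-ε) ^ n * millsCoeff n / m ε ^ (2 * n + 1)))
        =O[𝓝[>] 0] fun ε => ε⁻¹ * ε ^ 2 := (Asymptotics.isBigO_refl _ _).mul h
    have h3 : Tendsto (fun ε : ℝ => ε⁻¹ * ε ^ 2) (𝓝[>] 0) (𝓝 0) := by
      refine (tendsto_id.mono_left (nhdsWithin_le_nhds (s := Ioi (0 : ℝ)))).congr' ?_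
      filter_upwards [self_mem_nhdsWithin] with ε (hε : 0 < ε)
      simp only [id]
      field_simp
    refine (h2.trans_tendsto h3).congr fun ε => ?_
    rw [slope_def_field, signedMills_zero_right h0]
    simp [Finset.sum_range_succ, millsCoeff]
    ring
  have hsub := (hm.inv h0).sub ((hasDerivWithinAt_id 0 (Ioi 0)).mul ((hm.pow 3).inv (pow_ne_zero 3 h0)))
  refine ((hR.add hsub).congr_deriv ?_).congr_of_eventuallyEq ?_ ?_
  · simp
  · exact Eventually.of_forall fun ε => by simp
  · simp

theorem hasDerivAt_bsD1 (k : ℝ) (ha : 0 < a) :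
    HasDerivAt (bsD1 k) (-bsD2 k a / (2 * a)) a := by
  have hs : 0 < √a := Real.sqrt_pos.2 ha
  refine ((((hasDerivAt_id a).div_const 2).const_add (-k)).div
    (Real.hasDerivAt_sqrt ha.ne') hs.ne').congr_deriv ?_
  have : √a ^ 2 = a := Real.sq_sqrt ha.le
  rw [bsD2]
  simp only [id]
  field_simp
  rw [this]
  ring

theorem hasDerivAt_bsD2 (k : ℝ) (ha : 0 < a) :
    HasDerivAt (bsD2 k) (-bsD1 k a / (2 * a)) a := by
  have hs : 0 < √a := Real.sqrt_pos.2 ha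
  refine ((((hasDerivAt_id a).div_const 2).const_sub (-k)).div
    (Real.hasDerivAt_sqrt ha.ne') hs.ne').congr_deriv ?_
  have : √a ^ 2 = a := Real.sq_sqrt ha.le
  rw [bsD1]
  simp only [id]
  field_simp
  rw [this]
  ring

/-- The right-hand side is the formula for `a₁` with `r = d₁ d₂ / a`. -/
theorem varianceCorrection_limit (ha : 0 < a) (h1 : bsD1 k a ≠ 0) (h2 : bsD2 k a ≠ 0)
    (hs : 0 < bsD1 k a * bsD2 k a * s) :
    varianceCorrection k a a ((bsD2 k a)⁻¹ - (bsD1 k a)⁻¹) s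
      = 2 * Real.log (√a * (bsD1 k a * bsD2 k a / a) * s) / (bsD1 k a * bsD2 k a / a) := by
  have hs0 : s ≠ 0 := right_ne_zero_of_mul hs.ne'
  have hsa : 0 < √a := Real.sqrt_pos.2 ha
  have e : ((bsD2 k a)⁻¹ - (bsD1 k a)⁻¹) / s = (√a * (bsD1 k a * bsD2 k a / a) * s)⁻¹ := by
    have h3 : (bsD2 k a)⁻¹ - (bsD1 k a)⁻¹ = √a / (bsD1 k a * bsD2 k a) := by
      rw [← bsD1_sub_bsD2 k ha]; field_simp
    have h4 : √a ^ 2 = a := Real.sq_sqrt ha.le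
    rw [h3]
    field_simp
    exact h4
  rw [varianceCorrection, e, Real.log_inv, eighth_sub_eq k ha]
  field_simp

/-- The derivative is left uncollected: one term for `log (D / S)`, one for the denominator, so that
the logarithm enters only through the value of the correction itself. -/
theorem hasDerivWithinAt_varianceCorrection {v T : ℝ → ℝ} {v' T' : ℝ} (ha : 0 < a)
    (h1 : bsD1 k a ≠ 0) (h2 : bsD2 k a ≠ 0) (hs : 0 < bsD1 k a * bsD2 k a * s)
    (hv : HasDerivWithinAt v v' (Ioi 0) 0) (hv0 : v 0 = a)
    (hT : HasDerivWithinAt T T' (Ioi 0) 0) (hT0 : T 0 = s) :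
    HasDerivWithinAt (fun ε => varianceCorrection k a (v ε)
        (signedMills (bsD2 k (v ε)) ε - signedMills (bsD1 k (v ε)) ε) (T ε))
      (((bsD1 k a * v' / (2 * a) / bsD2 k a ^ 2 - 1 / bsD2 k a ^ 3
            + (-(bsD2 k a * v' / (2 * a)) / bsD1 k a ^ 2 + 1 / bsD1 k a ^ 3))
          / ((bsD2 k a)⁻¹ - (bsD1 k a)⁻¹) - T' / s) / (1 / 8 - k ^ 2 / (2 * (a * a)))
        - varianceCorrection k a a ((bsD2 k a)⁻¹ - (bsD1 k a)⁻¹) s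
          * (k ^ 2 * v' / (2 * a ^ 3)) / (1 / 8 - k ^ 2 / (2 * (a * a)))) (Ioi 0) 0 := by
  have hs0 : s ≠ 0 := right_ne_zero_of_mul hs.ne'
  have hP : bsD1 k a * bsD2 k a ≠ 0 := mul_ne_zero h1 h2
  have d1 : HasDerivWithinAt (fun ε => bsD1 k (v ε)) (-bsD2 k a / (2 * a) * v') (Ioi 0) 0 :=
    HasDerivAt.comp_hasDerivWithinAt (h₂ := bsD1 k) 0 (by rw [hv0]; exact hasDerivAt_bsD1 k ha) hv
  have d2 : HasDerivWithinAt (fun ε => bsD2 k (v ε)) (-bsD1 k a / (2 * a) * v') (Ioi 0) 0 :=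
    HasDerivAt.comp_hasDerivWithinAt (h₂ := bsD2 k) 0 (by rw [hv0]; exact hasDerivAt_bsD2 k ha) hv
  have D1 := hasDerivWithinAt_signedMills d1 (by rw [hv0]; exact h1)
  have D2 := hasDerivWithinAt_signedMills d2 (by rw [hv0]; exact h2)
  have hDne : (bsD2 k a)⁻¹ - (bsD1 k a)⁻¹ ≠ 0 := by
    have h3 : (bsD2 k a)⁻¹ - (bsD1 k a)⁻¹ = √a / (bsD1 k a * bsD2 k a) := by
      rw [← bsD1_sub_bsD2 k ha]; field_simp
    rw [h3]
    exact div_ne_zero (Real.sqrt_pos.2 ha).ne' hP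
  have hQ := (D2.sub D1).div hT (by rw [hT0]; exact hs0)
  have hval : (signedMills (bsD2 k (v 0)) 0 - signedMills (bsD1 k (v 0)) 0)
      = (bsD2 k a)⁻¹ - (bsD1 k a)⁻¹ := by
    rw [hv0, signedMills_zero_right h1, signedMills_zero_right h2]
  rw [hv0] at hval
  have hL := hQ.log (by
    simp only [Pi.div_apply, Pi.sub_apply, hv0, hval, hT0]
    exact div_ne_zero hDne hs0)
  have hG := ((((hv.mul_const a).const_mul 2).inv (by rw [hv0]; positivity)).const_mul
    (k ^ 2)).const_sub (1 / 8)
  have hGne : 1 / 8 - k ^ 2 / (2 * (a * a)) ≠ 0 := by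
    rw [eighth_sub_eq k ha]
    exact div_ne_zero (neg_ne_zero.2 hP) (by positivity)
  have hfin := hL.div hG (by simp only [Pi.inv_apply, hv0, ← div_eq_mul_inv]; exact hGne)
  refine (hfin.congr_deriv ?_).congr_of_eventuallyEq (Eventually.of_forall fun ε => ?_) ?_
  · simp only [Pi.div_apply, Pi.sub_apply, Pi.inv_apply, hv0, hval, hT0, varianceCorrection,
      ← div_eq_mul_inv]
    set D0 := (bsD2 k a)⁻¹ - (bsD1 k a)⁻¹
    set G0 := 1 / 8 - k ^ 2 / (2 * (a * a))
    set lg := Real.log (D0 / s)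
    field_simp
    ring
  · simp only [Pi.div_apply, Pi.sub_apply, Pi.inv_apply, varianceCorrection, ← div_eq_mul_inv]
  · simp only [Pi.div_apply, Pi.sub_apply, Pi.inv_apply, varianceCorrection, ← div_eq_mul_inv]

end Expansion

/-! ### The first coefficients of the asymptotic series -/

section Coefficients

variable {k a s c₁ : ℝ} {c w S : ℝ → ℝ}

/-- Here `A = d₁`, `B = d₂`, and `α` stands for `a₁`. With the logarithm hidden in `α`, the identity
is rational in `A`, `B`, `α`, `c`. -/
theorem second_coefficient_algebra {A B a r s α c : ℝ} (hA : A ≠ 0) (hB : B ≠ 0)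
    (hAB : A - B ≠ 0) (ha : a = (A - B) ^ 2) (hr : r = A * B / a) (hs : s ≠ 0)
    (hk : k = -((A ^ 2 - B ^ 2) / 2)) :
    ((A * α / (2 * a) / B ^ 2 - 1 / B ^ 3 + (-(B * α / (2 * a)) / A ^ 2 + 1 / A ^ 3))
          / (B⁻¹ - A⁻¹) - s * c / s) / (-(A * B) / (2 * a))
        - α * (k ^ 2 * α / (2 * a ^ 3)) / (-(A * B) / (2 * a))
      = 2 * c / r + (r * α * ((r * α - 3) * (r + 1 / 4) - 1 / 4) + 6 * r + 2) / (r ^ 3 * a) := by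
  have hinv : B⁻¹ - A⁻¹ = (A - B) / (A * B) := by field_simp
  rw [hinv, mul_div_cancel_left₀ c hs, hr, hk, ha]
  field_simp
  ring

theorem tendsto_pow_zero_right (n : ℕ) : Tendsto (fun ε : ℝ => ε ^ (n + 1)) (𝓝[>] 0) (𝓝 0) := by
  have : Tendsto (fun ε : ℝ => ε ^ (n + 1)) (𝓝 0) (𝓝 (0 ^ (n + 1))) :=
    (continuous_pow (n + 1)).tendsto 0
  rw [zero_pow n.succ_ne_zero] at this
  exact this.mono_left nhdsWithin_le_nhds

/-- Writing `w = a + ε H(ε)` gives `a₁ = H(0)` and `a₂ = H'(0)`; the latter involves `w'(0)`, which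
is `a₁` again. -/
theorem impliedVariance_series (ha : 0 < a) (h1 : bsD1 k a ≠ 0) (h2 : bsD2 k a ≠ 0)
    (hs : 0 < bsD1 k a * bsD2 k a * s)
    (hSN : ∀ N, HasExpansion N S)
    (hS2 : ApproxPoly 2 S (Polynomial.C s + Polynomial.C (s * c₁) * Polynomial.X))
    (hc : IsSaddlePrice k a S c)
    (hw : ∀ ε, 0 < ε → 0 < w ε ∧ bsCall (w ε / ε) (k / ε) = c ε) {r α₁ : ℝ}
    (hr : r = bsD1 k a * bsD2 k a / a) (hα₁ : α₁ = 2 * Real.log (√a * r * s) / r) :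
    ∃ α : ℕ → ℝ, (∀ N, (fun ε => w ε - ∑ j ∈ Finset.range N, α j * ε ^ j)
        =O[𝓝[>] (0 : ℝ)] fun ε => ε ^ N) ∧ α 0 = a ∧ α 1 = α₁ ∧
      α 2 = 2 * c₁ / r
        + (r * α₁ * ((r * α₁ - 3) * (r + 1 / 4) - 1 / 4) + 6 * r + 2) / (r ^ 3 * a) := by
  have hS : Tendsto S (𝓝[>] 0) (𝓝 s) := by simpa using ApproxPoly.tendsto (N := 1) hS2
  have hs0 : s ≠ 0 := right_ne_zero_of_mul hs.ne'
  have hlim := tendsto_impliedVariance ha h1 h2 hs hS hc hw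
  obtain ⟨α, hα⟩ := exists_series_of_hasExpansion
    (hasExpansion_impliedVariance ha h1 h2 hs hS hSN hc hw)
  have heq := impliedVariance_eq ha h1 h2 hs hS hc hw
  have t0 := tendsto_of_series hα 0
  have t1 := tendsto_of_series hα 1
  have t2 := tendsto_of_series hα 2
  have hα0 : α 0 = a := by
    simp only [Finset.range_zero, Finset.sum_empty, sub_zero, pow_zero, div_one] at t0
    exact tendsto_nhds_unique t0 hlim
  have hTd : HasDerivWithinAt (Function.update S 0 s) (s * c₁) (Ioi 0) 0 := by
    rw [hasDerivWithinAt_update_iff]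
    have h3 : (fun ε : ℝ => ε⁻¹ * (S ε - (Polynomial.C s
        + Polynomial.C (s * c₁) * Polynomial.X).eval ε)) =O[𝓝[>] 0] fun ε => ε⁻¹ * ε ^ 2 :=
      (Asymptotics.isBigO_refl _ _).mul hS2
    have h4 : Tendsto (fun ε : ℝ => ε⁻¹ * ε ^ 2) (𝓝[>] 0) (𝓝 0) := by
      refine (tendsto_pow_zero_right 0).congr' ?_
      filter_upwards [self_mem_nhdsWithin] with ε (hε : 0 < ε)
      field_simp
      ring
    have h5 := (h3.trans_tendsto h4).add_const (s * c₁)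
    rw [zero_add] at h5
    refine h5.congr' ?_
    filter_upwards [self_mem_nhdsWithin] with ε (hε : 0 < ε)
    simp
    field_simp
    ring
  have hcorr : Tendsto (fun ε => varianceCorrection k a (w ε)
      (signedMills (bsD2 k (w ε)) ε - signedMills (bsD1 k (w ε)) ε) (S ε)) (𝓝[>] 0) (𝓝 (α 1)) := by
    refine t1.congr' ?_
    filter_upwards [heq, self_mem_nhdsWithin] with ε h (hε : 0 < ε)
    simp only [Finset.range_one, Finset.sum_singleton, pow_zero, mul_one, pow_one, hα0]
    rw [div_eq_iff hε.ne', sub_eq_iff_eq_add', mul_comm]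
    exact h
  have hwd : HasDerivWithinAt (Function.update w 0 a) (α 1) (Ioi 0) 0 := by
    rw [hasDerivWithinAt_update_iff]
    simpa [hα0] using t1
  have hH := hasDerivWithinAt_varianceCorrection ha h1 h2 hs hwd (Function.update_self _ _ _)
    hTd (Function.update_self _ _ _)
  have hH0 : varianceCorrection k a (Function.update w 0 a 0)
      (signedMills (bsD2 k (Function.update w 0 a 0)) 0
        - signedMills (bsD1 k (Function.update w 0 a 0)) 0) (Function.update S 0 s 0)
      = varianceCorrection k a a ((bsD2 k a)⁻¹ - (bsD1 k a)⁻¹) s := by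
    rw [Function.update_self, Function.update_self, signedMills_zero_right h1,
      signedMills_zero_right h2]
  have hα1 : α 1 = varianceCorrection k a a ((bsD2 k a)⁻¹ - (bsD1 k a)⁻¹) s := by
    have hcont : Tendsto _ (𝓝[>] (0 : ℝ)) _ := hH.continuousWithinAt
    beta_reduce at hcont
    rw [hH0] at hcont
    refine tendsto_nhds_unique hcorr (hcont.congr' ?_)
    filter_upwards [self_mem_nhdsWithin] with ε (hε : 0 < ε)
    rw [Function.update_of_ne hε.ne', Function.update_of_ne hε.ne']
  have hα1' : α 1 = α₁ := by
    rw [hα1, varianceCorrection_limit ha h1 h2 hs, hα₁, hr]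
  refine ⟨α, hα, hα0, hα1', ?_⟩
  rw [hasDerivWithinAt_iff_tendsto_slope' (by simp)] at hH
  -- The difference quotient of the correction at `0` is exactly the second-order quotient of `w`.
  have t2' := hH.congr' (f₂ := fun ε => (w ε - ∑ j ∈ Finset.range 2, α j * ε ^ j) / ε ^ 2) (by
    filter_upwards [heq, self_mem_nhdsWithin] with ε h (hε : 0 < ε)
    rw [slope_def_field, hH0, ← hα1, Function.update_of_ne hε.ne', Function.update_of_ne hε.ne',
      sub_zero]
    simp only [Finset.sum_range_succ, Finset.range_zero, Finset.sum_empty, pow_zero, pow_one,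
      mul_one, zero_add, hα0]
    rw [div_eq_div_iff hε.ne' (by positivity)]
    linear_combination (-ε) * h)
  rw [tendsto_nhds_unique t2 t2', ← hα1, hα1', eighth_sub_eq k ha]
  have hsa : 0 < √a := Real.sqrt_pos.2 ha
  have hsub := bsD1_sub_bsD2 k ha
  refine second_coefficient_algebra h1 h2 (by rw [hsub]; exact hsa.ne')
    (by rw [hsub, Real.sq_sqrt ha.le]) hr hs0 ?_
  have hsum : bsD1 k a + bsD2 k a = -(2 * k) / √a := by rw [bsD1, bsD2]; ring
  rw [sq_sub_sq, hsum, hsub]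
  field_simp

theorem sqrt_series (ha : 0 < a) {α : ℕ → ℝ} (hα0 : α 0 = a)
    (hα : ∀ N, (fun ε => w ε - ∑ j ∈ Finset.range N, α j * ε ^ j)
      =O[𝓝[>] (0 : ℝ)] fun ε => ε ^ N) (hw : ∀ ε, 0 < ε → 0 < w ε) :
    ∃ β : ℕ → ℝ, (∀ N, (fun ε => √(w ε) - ∑ j ∈ Finset.range N, β j * ε ^ j)
        =O[𝓝[>] (0 : ℝ)] fun ε => ε ^ N) ∧ β 0 = √a ∧ β 1 = α 1 / (2 * √a) ∧
      β 2 = (4 * a * α 2 - α 1 ^ 2) / (8 * √a ^ 3) := by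
  have hlim : Tendsto w (𝓝[>] 0) (𝓝 a) := by
    simpa [hα0] using tendsto_of_series hα 0
  have hE : ∀ N, HasExpansion N w := fun N =>
    ⟨∑ j ∈ Finset.range N, Polynomial.C (α j) * Polynomial.X ^ j, by
      simpa [ApproxPoly, Polynomial.eval_finsetSum] using hα N⟩
  obtain ⟨β, hβ⟩ := exists_series_of_hasExpansion fun N =>
    (hE N).comp_analyticAt (Real.analyticAt_sqrt ha) hlim
  have hsa : 0 < √a := Real.sqrt_pos.2 ha
  have hsq : √a ^ 2 = a := Real.sq_sqrt ha.le
  have hβ0 : β 0 = √a := by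
    have t0 := tendsto_of_series hβ 0
    simp only [Finset.range_zero, Finset.sum_empty, sub_zero, pow_zero, div_one] at t0
    exact tendsto_nhds_unique t0 ((Real.continuous_sqrt.tendsto a).comp hlim)
  have t2 := tendsto_of_series hβ 2
  have u1 := tendsto_of_series hα 1
  have u2 := tendsto_of_series hα 2
  simp only [Finset.sum_range_succ, Finset.range_zero, Finset.sum_empty, pow_zero, pow_one,
      mul_one, zero_add, hβ0, hα0] at t2 u1 u2
  have hid : Tendsto (fun ε : ℝ => ε) (𝓝[>] 0) (𝓝 0) := nhdsWithin_le_nhds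
  -- `ρ` is the second-order quotient of the root; squaring `√a + β₁ ε + ρ ε²` and comparing with
  -- the series of `w` gives `β₁` and `β₂`.
  set ρ := fun ε : ℝ => (√(w ε) - (√a + β 1 * ε)) / ε ^ 2 with hρ
  have hv : ∀ ε : ℝ, 0 < ε → w ε = (√a + β 1 * ε + ε ^ 2 * ρ ε) ^ 2 := fun ε hε => by
    have : √a + β 1 * ε + ε ^ 2 * ρ ε = √(w ε) := by
      rw [hρ]; field_simp; ring
    rw [this, Real.sq_sqrt (hw ε hε).le]
  have h1 : α 1 = 2 * √a * β 1 := by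
    have h : Tendsto (fun ε : ℝ => 2 * √a * β 1 + ε * (β 1 ^ 2 + 2 * √a * ρ ε
        + 2 * β 1 * (ε * ρ ε) + (ε * ρ ε) ^ 2)) (𝓝[>] 0) (𝓝 (2 * √a * β 1 + 0 * (β 1 ^ 2
          + 2 * √a * β 2 + 2 * β 1 * (0 * β 2) + (0 * β 2) ^ 2))) :=
      tendsto_const_nhds.add (hid.mul (((tendsto_const_nhds.add (t2.const_mul _)).add
        ((hid.mul t2).const_mul _)).add ((hid.mul t2).pow 2)))
    rw [zero_mul, add_zero] at h
    refine tendsto_nhds_unique u1 (h.congr' ?_)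
    filter_upwards [self_mem_nhdsWithin] with ε (hε : 0 < ε)
    rw [hv ε hε, eq_div_iff hε.ne']
    linear_combination (-1) * hsq
  have h2 : α 2 = β 1 ^ 2 + 2 * √a * β 2 := by
    have h : Tendsto (fun ε : ℝ => β 1 ^ 2 + 2 * √a * ρ ε
        + 2 * β 1 * (ε * ρ ε) + (ε * ρ ε) ^ 2) (𝓝[>] 0) (𝓝 (β 1 ^ 2
          + 2 * √a * β 2 + 2 * β 1 * (0 * β 2) + (0 * β 2) ^ 2)) :=
      (((tendsto_const_nhds.add (t2.const_mul _)).add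
        ((hid.mul t2).const_mul _)).add ((hid.mul t2).pow 2))
    have e : β 1 ^ 2 + 2 * √a * β 2 + 2 * β 1 * (0 * β 2) + (0 * β 2) ^ 2
      = β 1 ^ 2 + 2 * √a * β 2 := by ring
    rw [e] at h
    refine tendsto_nhds_unique u2 (h.congr' ?_)
    filter_upwards [self_mem_nhdsWithin] with ε (hε : 0 < ε)
    rw [hv ε hε, eq_div_iff (by positivity), h1]
    linear_combination (-1) * hsq
  refine ⟨β, hβ, hβ0, ?_, ?_⟩
  · rw [h1]; field_simp
  · rw [h2, h1]
    field_simp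
    linear_combination ((8 * β 1 ^ 2 + 16 * √a * β 2)) / 2 * hsq

end Coefficients

/-! ### Implied volatilities of exponential Lévy processes at long maturities -/

theorem tendsto_one_div_coe_nnreal :
    Tendsto (fun τ : ℝ≥0 => 1 / (τ : ℝ)) atTop (𝓝[>] 0) := by
  simp only [one_div]
  exact tendsto_inv_atTop_nhdsGT_zero.comp (NNReal.tendsto_coe_atTop.2 tendsto_id)

theorem hasLargeTimeSeries_of_isBigO {f : ℝ≥0 → ℝ} {F : ℝ → ℝ} {α : ℕ → ℝ}
    (hF : ∀ ε, 0 < ε → F ε = f (1 / ε).toNNReal)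
    (h : ∀ N, (fun ε => F ε - ∑ j ∈ Finset.range N, α j * ε ^ j)
      =O[𝓝[>] (0 : ℝ)] fun ε => ε ^ N) : HasLargeTimeSeries f α := by
  intro N
  refine ((h N).comp_tendsto tendsto_one_div_coe_nnreal).congr' ?_ ?_
  · filter_upwards [eventually_gt_atTop 0] with τ hτ
    have : (1 / (1 / (τ : ℝ))).toNNReal = τ := by simp
    simp only [Function.comp]
    rw [hF _ (by positivity), this]
    simp [div_eq_mul_inv]
  · filter_upwards with τ
    simp [div_eq_mul_inv]

theorem impliedVol_spec {C : ℝ≥0 → ℝ → ℝ} {τ : ℝ≥0} {k : ℝ}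
    (h : ∃ s : ℝ, 0 < s ∧ bsCall (s ^ 2 * τ) k = C τ k) :
    0 < impliedVol C τ k ∧ bsCall (impliedVol C τ k ^ 2 * τ) k = C τ k := by
  rw [impliedVol, dif_pos h]
  exact h.choose_spec

section LevyProcess

variable {Ω : Type*} [MeasurableSpace Ω] {P : Measure Ω} {X : ℝ≥0 → Ω → ℝ} {σ : ℝ}
  {ν : Measure ℝ} {y : ℝ}

/-- The price at maturity `1 / ε` and log-strike `k / ε`. -/
noncomputable def scaledPrice (P : Measure Ω) (X : ℝ≥0 → Ω → ℝ) (k ε : ℝ) : ℝ :=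
  callPrice P X (1 / ε).toNNReal (k / ε)

/-- The implied volatility at maturity `1 / ε` and log-strike `k / ε`. -/
noncomputable def scaledVol (P : Measure Ω) (X : ℝ≥0 → Ω → ℝ) (k ε : ℝ) : ℝ :=
  impliedVol (callPrice P X) (1 / ε).toNNReal (k / ε)

theorem coe_toNNReal_one_div {ε : ℝ} (hε : 0 < ε) : (((1 / ε).toNNReal : ℝ≥0) : ℝ) = 1 / ε :=
  Real.coe_toNNReal _ (by positivity)

theorem impliedVol_eq_scaledVol {k ε : ℝ} (hε : 0 < ε) :
    scaledVol P X k ε = impliedVol (callPrice P X) (1 / ε).toNNReal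
      ((1 / ε).toNNReal * k) := by
  rw [scaledVol, coe_toNNReal_one_div hε, div_mul_eq_mul_div, one_mul]

namespace IsExpLevyProcess

variable [IsProbabilityMeasure P]

theorem scaledVol_spec (hX : IsExpLevyProcess P X σ ν) (hnl : StronglyNonlattice σ ν)
    (hy : y ∈ analyticityInterval ν) {ε : ℝ} (hε : 0 < ε) :
    0 < scaledVol P X (-deriv (levyXi σ ν) y) ε ∧
      bsCall (scaledVol P X (-deriv (levyXi σ ν) y) ε ^ 2 / ε) (-deriv (levyXi σ ν) y / ε)
        = scaledPrice P X (-deriv (levyXi σ ν) y) ε := by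
  have hτ : 0 < (1 / ε).toNNReal := Real.toNNReal_pos.2 (by positivity)
  have h := impliedVol_spec (hX.existsUnique_impliedVol hnl hy hτ).exists
  have e : (((1 / ε).toNNReal : ℝ≥0) : ℝ) * -deriv (levyXi σ ν) y
      = -deriv (levyXi σ ν) y / ε := by
    rw [coe_toNNReal_one_div hε]; ring
  rw [e, coe_toNNReal_one_div hε, mul_one_div] at h
  exact h

theorem scaledPrice_saddle (hX : IsExpLevyProcess P X σ ν) (hy : y ∈ analyticityInterval ν)
    (h0 : y ≠ 1 / 2) (h1 : y ≠ -(1 / 2)) {ε : ℝ} (hε : 0 < ε) :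
    scaledPrice P X (-deriv (levyXi σ ν) y) ε
      = intrinsicPart y (-deriv (levyXi σ ν) y / ε)
        + √ε * ((√(2 * Real.pi))⁻¹ * Real.exp (xi01 (levyXi σ ν) 1 y / ε))
          * ((√(2 * Real.pi))⁻¹ * IsExpLevyMeasure.saddleIntegral σ ν (1 / 2 - y) ε) := by
  have hτ : 0 < (1 / ε).toNNReal := Real.toNNReal_pos.2 (by positivity)
  have h := callPrice_saddle hX hy h0 h1 hτ
  rw [coe_toNNReal_one_div hε, one_div_one_div, one_div_mul_eq_div, one_div_mul_eq_div] at h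
  rw [scaledPrice, h]
  have hpi : √(2 * Real.pi) * √(2 * Real.pi) = 2 * Real.pi := Real.mul_self_sqrt (by positivity)
  have hinv : (2 * Real.pi)⁻¹ = (√(2 * Real.pi))⁻¹ * (√(2 * Real.pi))⁻¹ := by
    rw [← mul_inv, hpi]
  congr 1
  rw [div_eq_mul_inv _ (2 * Real.pi), hinv]
  ring

theorem hasExpansion_amplitude (hν : IsExpLevyMeasure ν) (hnl : StronglyNonlattice σ ν)
    (hy : y ∈ analyticityInterval ν) (h0 : y ≠ 1 / 2) (h1 : y ≠ -(1 / 2)) (N : ℕ) :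
    HasExpansion N fun ε =>
      (√(2 * Real.pi))⁻¹ * IsExpLevyMeasure.saddleIntegral σ ν (1 / 2 - y) ε := by
  obtain ⟨κ, -, -, -, h⟩ := hν.saddleIntegral_approxPoly hnl (analyticityInterval_iff.1 hy)
    (fun h => h0 (by linarith)) (fun h => h1 (by linarith))
  exact HasExpansion.const_mul _ ⟨_, h N⟩

theorem amplitude_approxPoly_two (hν : IsExpLevyMeasure ν) (hnl : StronglyNonlattice σ ν)
    (hy : y ∈ analyticityInterval ν) (h0 : y ≠ 1 / 2) (h1 : y ≠ -(1 / 2)) :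
    ApproxPoly 2 (fun ε =>
      (√(2 * Real.pi))⁻¹ * IsExpLevyMeasure.saddleIntegral σ ν (1 / 2 - y) ε)
      (Polynomial.C (coeffc0 (levyXi σ ν) y)
        + Polynomial.C (coeffc0 (levyXi σ ν) y * coeffc1 (levyXi σ ν) y) * Polynomial.X) := by
  have h := (ApproxPoly.const (N := 2) (√(2 * Real.pi))⁻¹).mul
    (hν.saddleIntegral_approxPoly_two hnl hy h0 h1)
  have hpi : √(2 * Real.pi) ≠ 0 := (Real.sqrt_pos.2 (by positivity)).ne'
  convert h using 1
  rw [mul_add, ← mul_assoc, ← Polynomial.C_mul, ← Polynomial.C_mul, inv_mul_cancel_left₀ hpi,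
    inv_mul_cancel_left₀ hpi]

theorem tendsto_amplitude (hν : IsExpLevyMeasure ν) (hnl : StronglyNonlattice σ ν)
    (hy : y ∈ analyticityInterval ν) (h0 : y ≠ 1 / 2) (h1 : y ≠ -(1 / 2)) :
    Tendsto (fun ε => (√(2 * Real.pi))⁻¹
      * IsExpLevyMeasure.saddleIntegral σ ν (1 / 2 - y) ε) (𝓝[>] 0)
      (𝓝 (coeffc0 (levyXi σ ν) y)) := by
  simpa using ApproxPoly.tendsto (N := 1) (amplitude_approxPoly_two hν hnl hy h0 h1)

/-- With `quadR_mul_saddleRoot_pos` it shows that the amplitude `c₀` has the sign of `d₁ d₂`, both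
being the sign of `R(y)`. -/
theorem quadR_mul_coeffc0_pos (hν : IsExpLevyMeasure ν) (hnl : StronglyNonlattice σ ν)
    (hy : y ∈ analyticityInterval ν) (h0 : y ≠ 1 / 2) (h1 : y ≠ -(1 / 2)) :
    0 < quadR y * coeffc0 (levyXi σ ν) y := by
  have hA := hν.iteratedDeriv_two_pos hnl (analyticityInterval_iff.1 hy)
  have i2 : iteratedDeriv 2 (levyXi σ ν) y = iteratedDeriv 2 (realCumulant σ ν) (1 / 2 - y) := by
    rw [iteratedDeriv_levyXi]; ring
  have hR : quadR y ≠ 0 := by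
    rw [show quadR y = (y - 1 / 2) * (y - -(1 / 2)) by rw [quadR]; ring]
    exact mul_ne_zero (sub_ne_zero.2 h0) (sub_ne_zero.2 h1)
  have hs : 0 < √(iteratedDeriv 2 (levyXi σ ν) y) := Real.sqrt_pos.2 (i2 ▸ hA)
  rw [coeffc0]
  have : quadR y * (1 / (√(iteratedDeriv 2 (levyXi σ ν) y) * quadR y))
      = 1 / √(iteratedDeriv 2 (levyXi σ ν) y) := by field_simp
  rw [this]
  positivity

theorem quadR_mul_saddleRoot_pos (hν : IsExpLevyMeasure ν) (hnl : StronglyNonlattice σ ν)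
    (hy : y ∈ analyticityInterval ν) (h0 : y ≠ 1 / 2) (h1 : y ≠ -(1 / 2)) :
    0 < quadR y * (IsExpLevyMeasure.saddleRoot σ ν 1 y
      * IsExpLevyMeasure.saddleRoot σ ν (-1) y) := by
  have a1 : 0 < (y + 1 / 2) * IsExpLevyMeasure.saddleRoot σ ν 1 y := by
    rcases lt_or_gt_of_ne h1 with h | h
    · exact mul_pos_of_neg_of_neg (by linarith) (hν.saddleRoot_one_neg hnl hy h)
    · exact mul_pos (by linarith) (hν.saddleRoot_one_pos hnl hy h)
  have a2 : 0 < (y - 1 / 2) * IsExpLevyMeasure.saddleRoot σ ν (-1) y := by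
    rcases lt_or_gt_of_ne h0 with h | h
    · exact mul_pos_of_neg_of_neg (by linarith) (hν.saddleRoot_neg_one_neg hnl hy h)
    · exact mul_pos (by linarith) (hν.saddleRoot_neg_one_pos hnl hy h)
  refine (mul_pos a1 a2).trans_eq ?_
  rw [quadR]; ring

/-- The signs of `d₁` and `d₂` at `a₀` are those of `y + 1/2` and `y - 1/2`, so the intrinsic parts
of the two representations coincide. -/
theorem isSaddlePrice (hX : IsExpLevyProcess P X σ ν) (hnl : StronglyNonlattice σ ν)
    (hy : y ∈ analyticityInterval ν) (h0 : y ≠ 1 / 2) (h1 : y ≠ -(1 / 2)) :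
    IsSaddlePrice (-deriv (levyXi σ ν) y) (coeffA0 (levyXi σ ν) y)
      (fun ε => (√(2 * Real.pi))⁻¹ * IsExpLevyMeasure.saddleIntegral σ ν (1 / 2 - y) ε)
      (scaledPrice P X (-deriv (levyXi σ ν) y)) := by
  intro ε hε
  have hν := hX.measure
  have s1 : 0 < IsExpLevyMeasure.saddleRoot σ ν 1 y ↔ -(1 / 2) < y := by
    refine ⟨fun h => ?_, hν.saddleRoot_one_pos hnl hy⟩
    by_contra hcon
    exact absurd h (hν.saddleRoot_one_neg hnl hy (lt_of_le_of_ne (not_lt.1 hcon) h1)).not_gt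
  have s2 : 0 < IsExpLevyMeasure.saddleRoot σ ν (-1) y ↔ 1 / 2 < y := by
    refine ⟨fun h => ?_, hν.saddleRoot_neg_one_pos hnl hy⟩
    by_contra hcon
    exact absurd h (hν.saddleRoot_neg_one_neg hnl hy (lt_of_le_of_ne (not_lt.1 hcon) h0)).not_gt
  rw [hX.scaledPrice_saddle hy h0 h1 hε, hν.bsD1_coeffA0 hnl hy, hν.bsD2_coeffA0 hnl hy,
    hν.saddleRoot_sq_one hnl hy, intrinsicPart]
  simp only [s1, s2]
  congr 4
  rw [mul_div_assoc, mul_div_assoc]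
  congr 1
  ring

theorem longTimeSeries (hX : IsExpLevyProcess P X σ ν) (hnl : StronglyNonlattice σ ν)
    (hy : y ∈ analyticityInterval ν) (h0 : y ≠ 1 / 2) (h1 : y ≠ -(1 / 2)) :
    ∃ a b : ℕ → ℝ,
    HasLargeTimeSeries (fun τ => impliedVol (callPrice P X) τ (τ * -deriv (levyXi σ ν) y) ^ 2) a ∧
    HasLargeTimeSeries (fun τ => impliedVol (callPrice P X) τ (τ * -deriv (levyXi σ ν) y)) b ∧
    a 0 = coeffA0 (levyXi σ ν) y ∧ a 1 = coeffA1 (levyXi σ ν) y ∧ a 2 = coeffA2 (levyXi σ ν) y ∧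
    b 0 = coeffB0 (levyXi σ ν) y ∧ b 1 = coeffB1 (levyXi σ ν) y ∧
    b 2 = coeffB2 (levyXi σ ν) y := by
  have hν := hX.measure
  have ha := hν.coeffA0_pos hnl hy
  have e1 := hν.bsD1_coeffA0 hnl hy
  have e2 := hν.bsD2_coeffA0 hnl hy
  have hRs := quadR_mul_saddleRoot_pos hν hnl hy h0 h1
  have hRc := quadR_mul_coeffc0_pos hν hnl hy h0 h1
  have hP := right_ne_zero_of_mul hRs.ne'
  have hs : 0 < IsExpLevyMeasure.saddleRoot σ ν 1 y * IsExpLevyMeasure.saddleRoot σ ν (-1) y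
      * coeffc0 (levyXi σ ν) y := by
    refine pos_of_mul_pos_right (a := quadR y ^ 2) ((mul_pos hRs hRc).trans_eq ?_) (sq_nonneg _)
    ring
  have hw : ∀ ε, 0 < ε → 0 < scaledVol P X (-deriv (levyXi σ ν) y) ε ^ 2 ∧
      bsCall (scaledVol P X (-deriv (levyXi σ ν) y) ε ^ 2 / ε) (-deriv (levyXi σ ν) y / ε)
        = scaledPrice P X (-deriv (levyXi σ ν) y) ε := fun ε hε =>
    ⟨pow_pos (hX.scaledVol_spec hnl hy hε).1 2, (hX.scaledVol_spec hnl hy hε).2⟩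
  rw [← e1, ← e2] at hs
  obtain ⟨a, has, ha0, ha1, ha2⟩ := impliedVariance_series ha
    (by rw [e1]; exact left_ne_zero_of_mul hP) (by rw [e2]; exact right_ne_zero_of_mul hP) hs
    (hasExpansion_amplitude hν hnl hy h0 h1) (amplitude_approxPoly_two hν hnl hy h0 h1)
    (hX.isSaddlePrice hnl hy h0 h1) hw (r := coeffr (levyXi σ ν) y)
    (α₁ := coeffA1 (levyXi σ ν) y) (by rw [e1, e2, hν.coeffr_eq hnl hy]) rfl
  obtain ⟨b, hbs, hb0, hb1, hb2⟩ := sqrt_series ha ha0 has fun ε hε => (hw ε hε).1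
  refine ⟨a, b, hasLargeTimeSeries_of_isBigO (fun ε hε => ?_) has,
    hasLargeTimeSeries_of_isBigO (fun ε hε => ?_) hbs, ha0, ha1, ha2, hb0, ?_, ?_⟩
  · rw [impliedVol_eq_scaledVol hε]
  · rw [Real.sqrt_sq (hX.scaledVol_spec hnl hy hε).1.le, impliedVol_eq_scaledVol hε]
  · rw [hb1, ha1]; rfl
  · rw [hb2, ha1, ha2]; rfl

end IsExpLevyProcess

end LevyProcess

/-! ### The limit of the implied volatility at the exceptional points -/

/-- The Black-Scholes part beyond the intrinsic one decays like `exp (-e₁² / (2 ε))`, faster than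
any exponential with a larger rate `c`. -/
theorem eventually_millsPart_lt {e₁ e₂ c : ℝ} (h1 : e₁ ≠ 0) (h2 : e₂ ≠ 0)
    (hc : -(e₁ ^ 2 / 2) < c) : ∀ᶠ ε in 𝓝[>] (0 : ℝ),
      |√ε * gaussianPDFReal 0 1 (e₁ / √ε) * (signedMills e₂ ε - signedMills e₁ ε)|
        < Real.exp (c / ε) := by
  have hs : Tendsto (fun ε : ℝ => √ε) (𝓝[>] 0) (𝓝 0) := by
    simpa using (Real.continuous_sqrt.tendsto 0).mono_left nhdsWithin_le_nhds
  have hM : Tendsto (fun ε => |signedMills e₂ ε - signedMills e₁ ε|) (𝓝[>] 0)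
      (𝓝 |e₂⁻¹ - e₁⁻¹|) :=
    ((tendsto_signedMills tendsto_const_nhds h2).sub
      (tendsto_signedMills tendsto_const_nhds h1)).abs
  have hE := tendsto_exp_neg_div_zero (show 0 < c + e₁ ^ 2 / 2 by linarith)
  have h := ((hs.mul_const (√(2 * Real.pi))⁻¹).mul hE).mul hM
  rw [zero_mul, zero_mul, zero_mul] at h
  filter_upwards [h.eventually_lt_const one_pos, self_mem_nhdsWithin] with ε hε (hε0 : 0 < ε)
  have hexp : Real.exp (-(e₁ / √ε) ^ 2 / 2)
      = Real.exp (-((c + e₁ ^ 2 / 2) / ε)) * Real.exp (c / ε) := by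
    rw [← Real.exp_add, div_pow, Real.sq_sqrt hε0.le]
    congr 1
    ring
  rw [gaussianPDFReal_std, hexp, abs_mul, abs_of_nonneg (by positivity)]
  calc _ = (√ε * (√(2 * Real.pi))⁻¹ * Real.exp (-((c + e₁ ^ 2 / 2) / ε))
        * |signedMills e₂ ε - signedMills e₁ ε|) * Real.exp (c / ε) := by ring
    _ < 1 * Real.exp (c / ε) := mul_lt_mul_of_pos_right hε (Real.exp_pos _)
    _ = _ := one_mul _

theorem tendsto_sqrt_mul_exp_div {η : ℝ} (hη : 0 < η) :
    Tendsto (fun ε : ℝ => √ε * Real.exp (η / ε)) (𝓝[>] 0) atTop := by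
  have hs : Tendsto (fun ε : ℝ => √ε) (𝓝[>] 0) (𝓝[>] 0) := by
    refine tendsto_nhdsWithin_iff.2 ⟨?_, eventually_mem_nhdsWithin.mono fun v hv => Real.sqrt_pos.2 hv⟩
    simpa using (Real.continuous_sqrt.tendsto 0).mono_left nhdsWithin_le_nhds
  refine tendsto_atTop_mono' _ ?_ ((tendsto_inv_nhdsGT_zero.comp hs).const_mul_atTop hη)
  filter_upwards [self_mem_nhdsWithin] with ε (hε : 0 < ε)
  have h1 : η / ε ≤ Real.exp (η / ε) := by linarith [Real.add_one_le_exp (η / ε)]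
  have h2 : 0 < √ε := Real.sqrt_pos.2 hε
  calc η * (√ε)⁻¹ = √ε * (η / ε) := by
        have : √ε ^ 2 = ε := Real.sq_sqrt hε.le
        field_simp
        rw [this]
    _ ≤ _ := by gcongr

section LevyProcess

variable {Ω : Type*} [MeasurableSpace Ω] {P : Measure Ω} {X : ℝ≥0 → Ω → ℝ} {σ : ℝ}
  {ν : Measure ℝ} {y : ℝ}

namespace IsExpLevyMeasure

theorem analyticAt_levyXi (hν : IsExpLevyMeasure ν) (σ : ℝ) (hy : y ∈ analyticityInterval ν) :
    AnalyticAt ℝ (levyXi σ ν) y := by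
  have h1 : AnalyticAt ℝ (realCumulant σ ν) (1 / 2 - y) :=
    (hν.analyticAt_cumulant σ (z := ((1 / 2 - y : ℝ) : ℂ))
      (by simpa using analyticityInterval_iff.1 hy)).re_ofReal
  rw [levyXi_eq]
  exact h1.comp (analyticAt_const.sub analyticAt_id)

theorem continuousAt_xi01 (hν : IsExpLevyMeasure ν) (σ : ℝ) (hy : y ∈ analyticityInterval ν)
    (e : ℝ) : ContinuousAt (xi01 (levyXi σ ν) e) y := by
  have h := hν.analyticAt_levyXi σ hy
  exact h.continuousAt.sub (h.deriv.continuousAt.mul (by fun_prop))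

/-- Adding the tangent inequalities at `y` and at `z`: the slope of a strictly convex function is
increasing in `p`, hence decreasing in `y`. -/
theorem strictMono_strike (hν : IsExpLevyMeasure ν) (hnl : StronglyNonlattice σ ν) {y z : ℝ}
    (hy : y ∈ analyticityInterval ν) (hz : z ∈ analyticityInterval ν) (hyz : y < z) :
    -deriv (levyXi σ ν) z < -deriv (levyXi σ ν) y := by
  have hy' := analyticityInterval_iff.1 hy
  have hz' := analyticityInterval_iff.1 hz
  have t1 := hν.realCumulant_tangent_lt (σ := σ) hnl hy' (interior_subset hz')
    (fun h => hyz.ne (by linarith))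
  have t2 := hν.realCumulant_tangent_lt (σ := σ) hnl hz' (interior_subset hy')
    (fun h => hyz.ne (by linarith))
  rw [deriv_levyXi, deriv_levyXi, neg_neg, neg_neg]
  nlinarith

/-- Points near `y` have nearby strikes and exponents. -/
theorem eventually_near (hν : IsExpLevyMeasure ν) (σ : ℝ) (hy : y ∈ analyticityInterval ν)
    {η : ℝ} (hη : 0 < η) : ∀ᶠ z in 𝓝 y, z ∈ analyticityInterval ν ∧
      xi01 (levyXi σ ν) 1 y - η < xi01 (levyXi σ ν) 1 z ∧
      |deriv (levyXi σ ν) z - deriv (levyXi σ ν) y| < η := by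
  have hd := (hν.analyticAt_levyXi σ hy).deriv.continuousAt
  have hd' : ContinuousAt (fun z => |deriv (levyXi σ ν) z - deriv (levyXi σ ν) y|) y :=
    (hd.sub continuousAt_const).abs
  filter_upwards [isOpen_interior.mem_nhds hy,
    (hν.continuousAt_xi01 σ hy 1).eventually_const_lt (sub_lt_self _ hη),
    hd'.eventually_lt_const (by simpa using hη)] with z h1 h2 h3
  exact ⟨h1, h2, h3⟩

end IsExpLevyMeasure

namespace IsExpLevyProcess

variable [IsProbabilityMeasure P]

/-- The loss `η` in the rate absorbs `√ε` and the constants; the factor `R(y)` supplies the sign of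
the part beyond the intrinsic one. -/
theorem eventually_exp_le_saddle (hX : IsExpLevyProcess P X σ ν) (hnl : StronglyNonlattice σ ν)
    (hy : y ∈ analyticityInterval ν) (h0 : y ≠ 1 / 2) (h1 : y ≠ -(1 / 2)) {η : ℝ} (hη : 0 < η) :
    ∀ᶠ ε in 𝓝[>] (0 : ℝ), Real.exp ((xi01 (levyXi σ ν) 1 y - η) / ε)
      ≤ quadR y * (scaledPrice P X (-deriv (levyXi σ ν) y) ε
        - intrinsicPart y (-deriv (levyXi σ ν) y / ε)) := by
  have hν := hX.measure
  have hRc := quadR_mul_coeffc0_pos hν hnl hy h0 h1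
  have hS := (tendsto_amplitude hν hnl hy h0 h1).const_mul (quadR y)
  have hpi : 0 < (√(2 * Real.pi))⁻¹ := inv_pos.2 (Real.sqrt_pos.2 (by positivity))
  have hall := ((tendsto_sqrt_mul_exp_div hη).const_mul_atTop hpi).atTop_mul_pos hRc hS
  filter_upwards [hall.eventually_ge_atTop 1, self_mem_nhdsWithin] with ε h (hε : 0 < ε)
  rw [hX.scaledPrice_saddle hy h0 h1 hε, add_sub_cancel_left]
  have e : Real.exp (xi01 (levyXi σ ν) 1 y / ε)
      = Real.exp (η / ε) * Real.exp ((xi01 (levyXi σ ν) 1 y - η) / ε) := by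
    rw [← Real.exp_add]; congr 1; ring
  rw [e]
  have := mul_le_mul_of_nonneg_right h (Real.exp_nonneg ((xi01 (levyXi σ ν) 1 y - η) / ε))
  rw [one_mul] at this
  refine this.trans_eq ?_
  ring

end IsExpLevyProcess

end LevyProcess

/-! ### Price bounds at `y = ±1/2` from neighbouring strikes -/

section LevyProcess

variable {Ω : Type*} [MeasurableSpace Ω] {P : Measure Ω} {X : ℝ≥0 → Ω → ℝ} {σ : ℝ}
  {ν : Measure ℝ} {y : ℝ}

/-- At the exceptional points one of `d₁`, `d₂` vanishes, that is `k = ±a / 2`. The exponent then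
has a quadratic minimum at `v = a`, so both larger and smaller `v` give exponentially smaller
Black-Scholes terms. -/
theorem bsD1_sq_sub_of_sq_eq {k v a : ℝ} (hv : 0 < v) (ha : 0 < a) (hk : k ^ 2 = a ^ 2 / 4) :
    bsD1 k v ^ 2 - bsD1 k a ^ 2 = (v - a) ^ 2 / (4 * v) := by
  rw [bsD1_sq_sub hv ha, hk]
  field_simp

namespace IsExpLevyProcess

variable [IsProbabilityMeasure P]

theorem exp_le_one_sub_price_of_mem_Ioo (hX : IsExpLevyProcess P X σ ν)
    (hnl : StronglyNonlattice σ ν) (hy : y ∈ analyticityInterval ν) (h : y ∈ Ioo (-(1 / 2)) (1 / 2))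
    {η : ℝ} (hη : 0 < η) :
    ∀ᶠ ε in 𝓝[>] (0 : ℝ), Real.exp ((xi01 (levyXi σ ν) 1 y - η) / ε)
      ≤ 1 - scaledPrice P X (-deriv (levyXi σ ν) y) ε := by
  filter_upwards [hX.eventually_exp_le_saddle hnl hy h.2.ne h.1.ne' hη] with ε hε
  rw [intrinsicPart, if_pos h.1, if_neg h.2.not_gt, sub_zero] at hε
  have hR : -1 ≤ quadR y := by rw [quadR]; nlinarith [sq_nonneg y]
  have h1 := (hX.callPrice_lt_one (1 / ε).toNNReal (-deriv (levyXi σ ν) y / ε))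
  rw [← scaledPrice] at h1
  nlinarith

/-- The saddlepoint form is taken at some `z < 1/2` close to `y`. Three losses of `η / 3` arise:
from the exponent at `z`, from the amplitude there, and from lowering the strike to that of `y`. -/
theorem eventually_exp_le_one_sub_price_half (hX : IsExpLevyProcess P X σ ν)
    (hnl : StronglyNonlattice σ ν) (hy : y ∈ analyticityInterval ν) (h : y = 1 / 2)
    {η : ℝ} (hη : 0 < η) :
    ∀ᶠ ε in 𝓝[>] (0 : ℝ), Real.exp ((xi01 (levyXi σ ν) 1 y - η) / ε)
      ≤ 1 - scaledPrice P X (-deriv (levyXi σ ν) y) ε := by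
  have hν := hX.measure
  obtain ⟨z, ⟨hz, hz1, hz2⟩, hz3⟩ := (((hν.eventually_near σ hy (show 0 < η / 3 by linarith)).filter_mono
    nhdsWithin_le_nhds).and
      (Ioo_mem_nhdsLT (show -(1 / 2) < y by rw [h]; norm_num))).exists
  have hk := hν.strictMono_strike (σ := σ) hnl hz hy hz3.2
  filter_upwards [hX.exp_le_one_sub_price_of_mem_Ioo hnl hz ⟨hz3.1, h ▸ hz3.2⟩
    (show 0 < η / 3 by linarith), self_mem_nhdsWithin] with ε hε (hε0 : 0 < ε)
  refine le_trans ?_ (hX.exp_mul_one_sub_callPrice_le (1 / ε).toNNReal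
    (div_le_div_of_nonneg_right hk.le hε0.le))
  refine le_trans ?_ (mul_le_mul_of_nonneg_left hε (Real.exp_nonneg _))
  rw [← Real.exp_add, ← sub_div, ← add_div]
  refine Real.exp_le_exp.2 (div_le_div_of_nonneg_right ?_ hε0.le)
  have := (abs_lt.1 hz2).1
  linarith

/-- Here `z > 1/2` has a smaller strike, and put prices increase with the strike. -/
theorem eventually_exp_le_price_sub_intrinsic (hX : IsExpLevyProcess P X σ ν)
    (hnl : StronglyNonlattice σ ν) (hy : y ∈ analyticityInterval ν) (h : y = 1 / 2)
    {η : ℝ} (hη : 0 < η) :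
    ∀ᶠ ε in 𝓝[>] (0 : ℝ), Real.exp ((xi01 (levyXi σ ν) 1 y - η) / ε)
      ≤ scaledPrice P X (-deriv (levyXi σ ν) y) ε
        - (1 - Real.exp (-deriv (levyXi σ ν) y / ε)) := by
  have hν := hX.measure
  obtain ⟨z, ⟨hz, hz1, hz2⟩, hz3⟩ := (((hν.eventually_near σ hy (show 0 < η / 2 by linarith)).filter_mono
    nhdsWithin_le_nhds).and
      (Ioo_mem_nhdsGT (show y < 1 by rw [h]; norm_num))).exists
  have hk := hν.strictMono_strike (σ := σ) hnl hy hz hz3.1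
  have hz4 : 1 / 2 < z := h ▸ hz3.1
  filter_upwards [hX.eventually_exp_le_saddle hnl hz hz4.ne' (by linarith)
    (show 0 < η / 2 by linarith), self_mem_nhdsWithin] with ε hε (hε0 : 0 < ε)
  refine le_trans ?_ (hX.callPrice_sub_intrinsic_mono (1 / ε).toNNReal
    (div_le_div_of_nonneg_right hk.le hε0.le))
  rw [intrinsicPart, if_pos (by linarith), if_pos hz4] at hε
  have hexp : Real.exp ((xi01 (levyXi σ ν) 1 y - η) / ε)
      ≤ Real.exp ((xi01 (levyXi σ ν) 1 z - η / 2) / ε) :=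
    Real.exp_le_exp.2 (div_le_div_of_nonneg_right (by linarith) hε0.le)
  -- The restriction `z < 1` serves to keep `R(z)` below `1`, so that this factor can be dropped.
  have hR : quadR z ≤ 1 := by rw [quadR]; nlinarith [hz3.2]
  have hR0 : 0 < quadR z := by rw [quadR]; nlinarith
  have hpos := (Real.exp_pos _).trans_le hε
  have hpos' := pos_of_mul_pos_right hpos hR0.le
  rw [scaledPrice] at hε hpos'
  nlinarith

theorem eventually_exp_le_one_sub_price_neg_half (hX : IsExpLevyProcess P X σ ν)
    (hnl : StronglyNonlattice σ ν) (hy : y ∈ analyticityInterval ν) (h : y = -(1 / 2))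
    {η : ℝ} (hη : 0 < η) :
    ∀ᶠ ε in 𝓝[>] (0 : ℝ), Real.exp ((xi01 (levyXi σ ν) 1 y - η) / ε)
      ≤ 1 - scaledPrice P X (-deriv (levyXi σ ν) y) ε := by
  have hν := hX.measure
  obtain ⟨z, ⟨hz, hz1, hz2⟩, hz3⟩ := (((hν.eventually_near σ hy (show 0 < η / 2 by linarith)).filter_mono
    nhdsWithin_le_nhds).and
      (Ioo_mem_nhdsGT (show y < 1 / 2 by rw [h]; norm_num))).exists
  have hk := hν.strictMono_strike (σ := σ) hnl hy hz hz3.1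
  filter_upwards [hX.exp_le_one_sub_price_of_mem_Ioo hnl hz ⟨h ▸ hz3.1, hz3.2⟩
    (show 0 < η / 2 by linarith), self_mem_nhdsWithin] with ε hε (hε0 : 0 < ε)
  refine le_trans ?_ (hX.one_sub_callPrice_mono (1 / ε).toNNReal
    (div_le_div_of_nonneg_right hk.le hε0.le))
  exact (Real.exp_le_exp.2 (div_le_div_of_nonneg_right (by linarith) hε0.le)).trans hε

/-- Here `z < -1/2` has a larger strike, and call prices decrease with the strike. -/
theorem eventually_exp_le_price (hX : IsExpLevyProcess P X σ ν)
    (hnl : StronglyNonlattice σ ν) (hy : y ∈ analyticityInterval ν) (h : y = -(1 / 2))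
    {η : ℝ} (hη : 0 < η) :
    ∀ᶠ ε in 𝓝[>] (0 : ℝ), Real.exp ((xi01 (levyXi σ ν) 1 y - η) / ε)
      ≤ scaledPrice P X (-deriv (levyXi σ ν) y) ε := by
  have hν := hX.measure
  obtain ⟨z, ⟨hz, hz1, hz2⟩, hz3⟩ := (((hν.eventually_near σ hy (show 0 < η / 2 by linarith)).filter_mono
    nhdsWithin_le_nhds).and
      (Ioo_mem_nhdsLT (show -1 < y by rw [h]; norm_num))).exists
  have hk := hν.strictMono_strike (σ := σ) hnl hz hy hz3.2
  have hz4 : z < -(1 / 2) := h ▸ hz3.2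
  filter_upwards [hX.eventually_exp_le_saddle hnl hz (by linarith) hz4.ne
    (show 0 < η / 2 by linarith), self_mem_nhdsWithin] with ε hε (hε0 : 0 < ε)
  have hmono := hX.one_sub_callPrice_mono (1 / ε).toNNReal
    (div_le_div_of_nonneg_right hk.le hε0.le)
  rw [intrinsicPart, if_neg (by linarith), if_neg (by linarith)] at hε
  have hexp : Real.exp ((xi01 (levyXi σ ν) 1 y - η) / ε)
      ≤ Real.exp ((xi01 (levyXi σ ν) 1 z - η / 2) / ε) :=
    Real.exp_le_exp.2 (div_le_div_of_nonneg_right (by linarith) hε0.le)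
  have hR : quadR z ≤ 1 := by rw [quadR]; nlinarith [hz3.1]
  have hR0 : 0 < quadR z := by rw [quadR]; nlinarith
  have hpos := (Real.exp_pos _).trans_le hε
  have hpos' := pos_of_mul_pos_right hpos hR0.le
  rw [scaledPrice] at hε hpos' ⊢
  nlinarith

/-- For `v > a` the Black-Scholes price differs from `1` by less than the true price does. For `v <
a` it exceeds the intrinsic value by less than the true price does. Either way the comparison of
prices locates the implied variance. -/
theorem tendsto_scaledVol_of_eq_half (hX : IsExpLevyProcess P X σ ν) (hnl : StronglyNonlattice σ ν)
    (hy : y ∈ analyticityInterval ν) (h : y = 1 / 2 ∨ y = -(1 / 2)) :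
    Tendsto (fun ε => scaledVol P X (-deriv (levyXi σ ν) y) ε ^ 2) (𝓝[>] 0)
      (𝓝 (coeffA0 (levyXi σ ν) y)) := by
  have hν := hX.measure
  have ha := hν.coeffA0_pos hnl hy
  have e1 := hν.bsD1_coeffA0 hnl hy
  have e2 := hν.bsD2_coeffA0 hnl hy
  have q1 := hν.saddleRoot_sq_one hnl hy
  set a := coeffA0 (levyXi σ ν) y with ha_def
  set k := -deriv (levyXi σ ν) y with hk_def
  have hsa : 0 < √a := Real.sqrt_pos.2 ha
  -- The allowance `(v - a)² / (16 v)` is half of the available gap between the exponents, leaving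
  -- the strict inequality for the Mills part.
  have hrate : ∀ v : ℝ, 0 < v → v ≠ a → k ^ 2 = a ^ 2 / 4 →
      0 < (v - a) ^ 2 / (16 * v) ∧
        -(bsD1 k v ^ 2 / 2) < xi01 (levyXi σ ν) 1 y - (v - a) ^ 2 / (16 * v) := by
    intro v hv hva hk
    have h1 := bsD1_sq_sub_of_sq_eq hv ha hk
    have h2 : 0 < (v - a) ^ 2 / (16 * v) :=
      div_pos (pow_two_pos_of_ne_zero (sub_ne_zero.2 hva)) (by positivity)
    have h3 : (v - a) ^ 2 / (4 * v) = 4 * ((v - a) ^ 2 / (16 * v)) := by field_simp; norm_num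
    rw [e1, q1, h3] at h1
    exact ⟨h2, by linarith⟩
  refine tendsto_nhdsGT_zero_of_bsCall (k := k) (c := scaledPrice P X k) ha (fun ε hε =>
    ⟨pow_pos (hX.scaledVol_spec hnl hy hε).1 2, (hX.scaledVol_spec hnl hy hε).2⟩) ?_ ?_
  · filter_upwards [self_mem_nhdsWithin] with v (hv : a < v)
    have hv0 : 0 < v := ha.trans hv
    have hsv : 0 < √v := Real.sqrt_pos.2 hv0
    rcases h with h | h
    · have hk : k = -a / 2 := by
        rw [IsExpLevyMeasure.saddleRoot_neg_one_zero h, bsD2, div_eq_zero_iff] at e2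
        have := e2.resolve_right hsa.ne'
        linarith
      have d1 : 0 < bsD1 k v := div_pos (by rw [hk]; linarith) hsv
      have d2 : bsD2 k v < 0 := div_neg_of_neg_of_pos (by rw [hk]; linarith) hsv
      obtain ⟨hη, hlt⟩ := hrate v hv0 hv.ne' (by rw [hk]; ring)
      filter_upwards [hX.eventually_exp_le_one_sub_price_half hnl hy h hη,
        eventually_millsPart_lt d1.ne' d2.ne hlt, self_mem_nhdsWithin] with ε h1 h2 hε
      rw [bsCall_div hε hv0 d1.ne' d2.ne, if_pos d1, if_neg d2.not_gt]
      have := (abs_lt.1 h2).1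
      linarith
    · have hk : k = a / 2 := by
        rw [IsExpLevyMeasure.saddleRoot_one_zero h, bsD1, div_eq_zero_iff] at e1
        have := e1.resolve_right hsa.ne'
        linarith
      have d1 : 0 < bsD1 k v := div_pos (by rw [hk]; linarith) hsv
      have d2 : bsD2 k v < 0 := div_neg_of_neg_of_pos (by rw [hk]; linarith) hsv
      obtain ⟨hη, hlt⟩ := hrate v hv0 hv.ne' (by rw [hk]; ring)
      filter_upwards [hX.eventually_exp_le_one_sub_price_neg_half hnl hy h hη,
        eventually_millsPart_lt d1.ne' d2.ne hlt, self_mem_nhdsWithin] with ε h1 h2 hε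
      rw [bsCall_div hε hv0 d1.ne' d2.ne, if_pos d1, if_neg d2.not_gt]
      have := (abs_lt.1 h2).1
      linarith
  · filter_upwards [self_mem_nhdsWithin, Ioo_mem_nhdsLT ha] with v (hv : v < a) hv1
    have hv0 : 0 < v := hv1.1
    have hsv : 0 < √v := Real.sqrt_pos.2 hv0
    rcases h with h | h
    · have hk : k = -a / 2 := by
        rw [IsExpLevyMeasure.saddleRoot_neg_one_zero h, bsD2, div_eq_zero_iff] at e2
        have := e2.resolve_right hsa.ne'
        linarith
      have d1 : 0 < bsD1 k v := div_pos (by rw [hk]; linarith) hsv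
      have d2 : 0 < bsD2 k v := div_pos (by rw [hk]; linarith) hsv
      obtain ⟨hη, hlt⟩ := hrate v hv0 hv.ne (by rw [hk]; ring)
      filter_upwards [hX.eventually_exp_le_price_sub_intrinsic hnl hy h hη,
        eventually_millsPart_lt d1.ne' d2.ne' hlt, self_mem_nhdsWithin] with ε h1 h2 hε
      rw [bsCall_div hε hv0 d1.ne' d2.ne', if_pos d1, if_pos d2]
      have := (abs_lt.1 h2).2
      linarith
    · have hk : k = a / 2 := by
        rw [IsExpLevyMeasure.saddleRoot_one_zero h, bsD1, div_eq_zero_iff] at e1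
        have := e1.resolve_right hsa.ne'
        linarith
      have d1 : bsD1 k v < 0 := div_neg_of_neg_of_pos (by rw [hk]; linarith) hsv
      have d2 : bsD2 k v < 0 := div_neg_of_neg_of_pos (by rw [hk]; linarith) hsv
      obtain ⟨hη, hlt⟩ := hrate v hv0 hv.ne (by rw [hk]; ring)
      filter_upwards [hX.eventually_exp_le_price hnl hy h hη,
        eventually_millsPart_lt d1.ne d2.ne hlt, self_mem_nhdsWithin] with ε h1 h2 hε
      rw [bsCall_div hε hv0 d1.ne d2.ne, if_neg d1.not_gt, if_neg d2.not_gt]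
      have := (abs_lt.1 h2).2
      linarith

/-- The long-time expansion under the strong non-lattice condition. -/
theorem hasLongTimeExpansion (hX : IsExpLevyProcess P X σ ν) (hnl : StronglyNonlattice σ ν)
    (hy : y ∈ analyticityInterval ν) :
    HasLongTimeExpansion (callPrice P X) (levyXi σ ν) y := by
  refine ⟨fun τ hτ => hX.existsUnique_impliedVol hnl hy hτ,
    fun h0 h1 => hX.longTimeSeries hnl hy h0 h1, fun h => ?_⟩
  have h1 := ((Real.continuous_sqrt.tendsto _).comp
    (hX.tendsto_scaledVol_of_eq_half hnl hy h)).comp tendsto_one_div_coe_nnreal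
  refine h1.congr' ?_
  filter_upwards [eventually_gt_atTop 0] with τ hτ
  have hε : 0 < 1 / (τ : ℝ) := by positivity
  have e : (1 / (1 / (τ : ℝ))).toNNReal = τ := by simp
  simp only [Function.comp]
  rw [Real.sqrt_sq (hX.scaledVol_spec hnl hy hε).1.le, impliedVol_eq_scaledVol hε, e]

end IsExpLevyProcess

/-- The expansion depends on `Ξ` only through its germ at `y`. -/
theorem HasLongTimeExpansion.congr {C : ℝ≥0 → ℝ → ℝ} {Ξ Ξ' : ℝ → ℝ} {y : ℝ}
    (h : HasLongTimeExpansion C Ξ y) (hΞ : Ξ' =ᶠ[𝓝 y] Ξ) : HasLongTimeExpansion C Ξ' y := by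
  have d0 := hΞ.eq_of_nhds
  have d1 := hΞ.deriv_eq
  have dn := fun n => hΞ.iteratedDeriv_eq n
  have x1 : ∀ e, xi01 Ξ' e y = xi01 Ξ e y := fun e => by rw [xi01, xi01, d0, d1]
  have hA0 : coeffA0 Ξ' y = coeffA0 Ξ y := by rw [coeffA0, coeffA0, x1, x1]
  have hr : coeffr Ξ' y = coeffr Ξ y := by rw [coeffr, coeffr, d1, hA0]
  have hc0 : coeffc0 Ξ' y = coeffc0 Ξ y := by rw [coeffc0, coeffc0, dn]
  have hc1 : coeffc1 Ξ' y = coeffc1 Ξ y := by rw [coeffc1, coeffc1, dn, dn, dn]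
  have hA1 : coeffA1 Ξ' y = coeffA1 Ξ y := by rw [coeffA1, coeffA1, hA0, hr, hc0]
  have hA2 : coeffA2 Ξ' y = coeffA2 Ξ y := by rw [coeffA2, coeffA2, hA0, hr, hc1, hA1]
  have hB0 : coeffB0 Ξ' y = coeffB0 Ξ y := by rw [coeffB0, coeffB0, hA0]
  have hB1 : coeffB1 Ξ' y = coeffB1 Ξ y := by rw [coeffB1, coeffB1, hA0, hA1]
  have hB2 : coeffB2 Ξ' y = coeffB2 Ξ y := by rw [coeffB2, coeffB2, hA0, hA1, hA2]
  rw [HasLongTimeExpansion, d1, hA0, hA1, hA2, hB0, hB1, hB2]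
  exact h

end LevyProcess

open scoped NNReal FourierTransform

/-! ### Sufficient conditions for the strong non-lattice property -/

section Nonlattice

variable {Ω : Type*} [MeasurableSpace Ω] {P : Measure Ω} {X : ℝ≥0 → Ω → ℝ} {σ : ℝ}
  {ν : Measure ℝ}

/-- The modulus of the characteristic function of `X 1` is `exp` of minus the decay, so the
condition bounds the decay below near infinity. -/
theorem CramerCondition.stronglyNonlattice (hX : IsExpLevyProcess P X σ ν)
    (h : CramerCondition P X) : StronglyNonlattice σ ν := by
  obtain ⟨c, hc1, hc⟩ := h
  have hν := hX.measure
  -- The bound `c` need not be positive; `d` has a logarithm.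
  set d := max c (1 / 2) with hd
  have hd0 : 0 < d := lt_max_of_lt_right (by norm_num)
  have hd1 : d < 1 := max_lt hc1 (by norm_num)
  refine hν.stronglyNonlattice_of_eventually (η₀ := -Real.log d)
    (neg_pos.2 (Real.log_neg hd0 hd1)) ?_
  filter_upwards [hc] with u hu
  have h0 := hν.tiltedDecay_eq (σ := σ) hν.zero_mem u
  rw [hX.charFun_eq, Complex.norm_exp] at hu
  simp only [Complex.ofReal_zero, IsExpLevyMeasure.cumulant_zero, Complex.zero_re, zero_add] at h0
  simp only [NNReal.coe_one, Complex.ofReal_one, one_mul] at hu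
  have h1 := Real.log_le_log (Real.exp_pos _) (hu.trans (show c ≤ d from le_max_left c (1 / 2)))
  rw [Real.log_exp] at h1
  rw [h0]
  simpa using h1

theorem IsExpLevyMeasure.stronglyNonlattice_of_ne_zero (hν : IsExpLevyMeasure ν) (hσ : σ ≠ 0) :
    StronglyNonlattice σ ν := by
  refine hν.stronglyNonlattice_of_eventually (η₀ := σ ^ 2 / 2) (by positivity) ?_
  filter_upwards [(isCompact_closedBall (0 : ℝ) 1).compl_mem_cocompact] with u hu
  have hu1 : 1 < |u| := by simpa using hu
  have hu2 : 1 ≤ u ^ 2 := by rw [← sq_abs]; nlinarith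
  rw [tiltedDecay]
  have h0 : 0 ≤ ∫ x : ℝ, Real.exp (0 * x) * (1 - Real.cos (u * x)) ∂ν :=
    integral_nonneg fun x => mul_nonneg (Real.exp_nonneg _)
      (sub_nonneg.2 (Real.cos_le_one _))
  nlinarith [sq_nonneg σ]

/-! ### Lévy measures with a density -/

theorem integrable_withDensity_ofReal_iff {f g : ℝ → ℝ} (hf : Measurable f) (hf0 : ∀ x, 0 ≤ f x) :
    Integrable g (volume.withDensity fun x => ENNReal.ofReal (f x))
      ↔ Integrable (fun x => f x * g x) := by
  rw [integrable_withDensity_iff_integrable_smul₀' (by fun_prop)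
    (Eventually.of_forall fun _ => ENNReal.ofReal_lt_top)]
  simp only [ENNReal.toReal_ofReal (hf0 _), smul_eq_mul]

theorem integral_withDensity_ofReal {f g : ℝ → ℝ} (hf : Measurable f) (hf0 : ∀ x, 0 ≤ f x) :
    ∫ x, g x ∂(volume.withDensity fun x => ENNReal.ofReal (f x)) = ∫ x, f x * g x := by
  rw [integral_withDensity_eq_integral_toReal_smul (by fun_prop)
    (Eventually.of_forall fun _ => ENNReal.ofReal_lt_top)]
  simp only [ENNReal.toReal_ofReal (hf0 _), smul_eq_mul]

/-- The Riemann-Lebesgue lemma, with frequencies rescaled by `2π`. -/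
theorem tendsto_integral_mul_cos {g : ℝ → ℝ} (hg : Integrable g) :
    Tendsto (fun u : ℝ => ∫ x, g x * Real.cos (u * x)) (cocompact ℝ) (𝓝 0) := by
  have h := Real.tendsto_integral_exp_smul_cocompact fun x => (g x : ℂ)
  have hc : Tendsto (fun u : ℝ => u / (2 * Real.pi)) (cocompact ℝ) (cocompact ℝ) := by
    simpa [div_eq_mul_inv] using
      (Homeomorph.mulRight₀ (2 * Real.pi)⁻¹ (by positivity)).isClosedEmbedding.tendsto_cocompact
  have h2 := (Complex.continuous_re.tendsto _).comp (h.comp hc)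
  rw [Complex.zero_re] at h2
  refine h2.congr fun u => ?_
  simp only [Function.comp]
  have hi : Integrable fun v : ℝ => 𝐞 (-(v * (u / (2 * Real.pi)))) • (g v : ℂ) := by
    refine (hg.ofReal (𝕜 := ℂ)).congr' ?_ ?_
    · exact AEStronglyMeasurable.smul (by fun_prop) 
        (Complex.continuous_ofReal.comp_aestronglyMeasurable hg.aestronglyMeasurable)
    · exact Eventually.of_forall fun v => by simp
  rw [← RCLike.re_to_complex, ← integral_re hi]
  congr 1
  funext v
  rw [Circle.smul_def, Real.fourierChar_apply]
  have e : ((2 * Real.pi * -(v * (u / (2 * Real.pi))) : ℝ) : ℂ) * Complex.I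
      = ((-(u * v) : ℝ) : ℂ) * Complex.I := by
    congr 2; field_simp
  rw [e, smul_eq_mul, mul_comm, RCLike.re_to_complex, Complex.re_ofReal_mul,
    Complex.exp_ofReal_mul_I_re, Real.cos_neg]

/-- A Lévy density need not be integrable, so it is first cut down to the integrable minorant `g`.
The decay is at least `∫ g - ∫ g cos (u x)`, and the second integral tends to `0`. -/
theorem IsExpLevyMeasure.stronglyNonlattice_of_density {f : ℝ → ℝ} (hf : Measurable f)
    (hf0 : ∀ x, 0 ≤ f x)
    (hν : IsExpLevyMeasure (volume.withDensity fun x => ENNReal.ofReal (f x))) {a b : ℝ}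
    (hab : a < b) (hpos : ∀ x ∈ Ioo a b, 0 < f x) :
    StronglyNonlattice σ (volume.withDensity fun x => ENNReal.ofReal (f x)) := by
  set g : ℝ → ℝ := (Ioo a b).indicator fun x => min (f x) 1 with hg
  have hgm : Measurable g := (hf.min measurable_const).indicator measurableSet_Ioo
  have hg0 : ∀ x, 0 ≤ g x := fun x => indicator_nonneg (fun x _ => le_min (hf0 x) zero_le_one) x
  have hgf : ∀ x, g x ≤ f x := fun x => by
    by_cases hx : x ∈ Ioo a b
    · rw [hg, indicator_of_mem hx]; exact min_le_left _ _
    · rw [hg, indicator_of_notMem hx]; exact hf0 x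
  have hgi : Integrable g := by
    refine Integrable.mono' (g := (Ioo a b).indicator fun _ => (1 : ℝ)) ?_
      hgm.aestronglyMeasurable (Eventually.of_forall fun x => ?_)
    · exact (integrable_indicator_iff measurableSet_Ioo).2 (by simp)
    · rw [Real.norm_of_nonneg (hg0 x)]
      exact indicator_le_indicator (min_le_right _ _)
  have hgpos : 0 < ∫ x, g x := by
    rw [integral_pos_iff_support_of_nonneg hg0 hgi]
    refine lt_of_lt_of_le ?_ (measure_mono (show Ioo a b ⊆ Function.support g from fun x hx => ?_))
    · simpa using hab
    · rw [Function.mem_support, hg, indicator_of_mem hx]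
      exact (lt_min (hpos x hx) one_pos).ne'
  refine hν.stronglyNonlattice_of_eventually (η₀ := (∫ x, g x) / 2) (by positivity) ?_
  filter_upwards [(tendsto_integral_mul_cos hgi).eventually_lt_const
    (show (0 : ℝ) < (∫ x, g x) / 2 by positivity)] with u hu
  rw [tiltedDecay]
  have h1 : 0 ≤ σ ^ 2 * u ^ 2 / 2 := by positivity
  have hint := hν.integrable_tilt_cos hν.zero_mem u
  rw [integrable_withDensity_ofReal_iff hf hf0] at hint
  have hgc : Integrable fun x => g x * Real.cos (u * x) :=
    hgi.mul_bdd (c := 1) (by fun_prop) (Eventually.of_forall fun x => Real.abs_cos_le_one _)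
  have h2 : (∫ x, g x) - ∫ x, g x * Real.cos (u * x)
      ≤ ∫ x, f x * (Real.exp (0 * x) * (1 - Real.cos (u * x))) := by
    rw [← integral_sub hgi hgc]
    refine integral_mono (hgi.sub hgc) hint fun x => ?_
    simp only [zero_mul, Real.exp_zero, one_mul]
    have := mul_le_mul_of_nonneg_right (hgf x) (sub_nonneg.2 (Real.cos_le_one (u * x)))
    linarith
  rw [integral_withDensity_ofReal hf hf0]
  linarith

theorem levyXi_eq_integral (σ : ℝ) (ν : Measure ℝ) (y : ℝ) :
    levyXi σ ν y = 1 / 2 * σ ^ 2 * quadR y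
      + ∫ x, (Real.exp ((1 / 2 - y) * x) - 1 - (1 / 2 - y) * (Real.exp x - 1)) ∂ν := by
  rw [levyXi, add_comm, jumpExponent_eq]
  congr 1
  have e1 : Complex.I * (Complex.I * (y : ℂ) - Complex.I / 2) = ((1 / 2 - y : ℝ) : ℂ) := by
    push_cast
    ring_nf
    rw [Complex.I_sq]; ring
  have e2 : ∀ x : ℝ, jumpKernel ((1 / 2 - y : ℝ) : ℂ) x
      = ((Real.exp ((1 / 2 - y) * x) - 1 - (1 / 2 - y) * (Real.exp x - 1) : ℝ) : ℂ) := by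
    intro x; simp [jumpKernel]
  rw [e1]
  simp only [e2]
  rw [integral_complex_ofReal, Complex.ofReal_re]

/-- An open set of moments lies in the analyticity interval, and equality on an open set gives
equality of germs. -/
theorem IsExpLevyProcess.hasLongTimeExpansion_of_eqOn [IsProbabilityMeasure P]
    (hX : IsExpLevyProcess P X σ ν) (hnl : StronglyNonlattice σ ν) {U : Set ℝ} (hU : IsOpen U)
    (hm : ∀ y ∈ U, 1 / 2 - y ∈ momentSet ν) {Ξ : ℝ → ℝ} (hΞ : ∀ y ∈ U, Ξ y = levyXi σ ν y)
    {y : ℝ} (hy : y ∈ U) : HasLongTimeExpansion (callPrice P X) Ξ y :=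
  HasLongTimeExpansion.congr (hX.hasLongTimeExpansion hnl (interior_maximal hm hU hy))
    (eventually_of_mem (hU.mem_nhds hy) hΞ)

end Nonlattice

/-! ### Merton processes -/

theorem measurable_mertonDensity (l μ η : ℝ) : Measurable fun x : ℝ =>
    l / (√(2 * Real.pi) * η) * Real.exp (-(x - μ) ^ 2 / (2 * η ^ 2)) := by fun_prop

theorem mertonDensity_eq (l μ : ℝ) {η : ℝ} (hη : 0 < η) (x : ℝ) :
    l / (√(2 * Real.pi) * η) * Real.exp (-(x - μ) ^ 2 / (2 * η ^ 2))
      = l * gaussianPDFReal μ (Real.toNNReal (η ^ 2)) x := by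
  have h : √(2 * Real.pi * η ^ 2) = √(2 * Real.pi) * η := by
    rw [Real.sqrt_mul (by positivity), Real.sqrt_sq hη.le]
  simp only [gaussianPDFReal_def, Real.coe_toNNReal _ (sq_nonneg η), h]
  ring

theorem integrable_exp_gaussian (μ : ℝ) {η : ℝ} (hη : 0 < η) (p : ℝ) :
    Integrable (fun x => gaussianPDFReal μ (Real.toNNReal (η ^ 2)) x * Real.exp (p * x)) ∧
    ∫ x, gaussianPDFReal μ (Real.toNNReal (η ^ 2)) x * Real.exp (p * x)
      = Real.exp (μ * p + η ^ 2 * p ^ 2 / 2) := by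
  have hv : Real.toNNReal (η ^ 2) ≠ 0 := by
    rw [Ne, Real.toNNReal_eq_zero, not_le]; positivity
  have h1 := integrable_exp_mul_gaussianReal (μ := μ) (v := Real.toNNReal (η ^ 2)) p
  have h2 := mgf_fun_id_gaussianReal (μ := μ) (v := Real.toNNReal (η ^ 2))
  have h3 := congrFun h2 p
  rw [mgf, integral_gaussianReal_eq_integral_smul hv, Real.coe_toNNReal _ (sq_nonneg η)] at h3
  simp only [smul_eq_mul] at h3
  rw [h3]
  exact ⟨Integrable.of_integral_ne_zero (by rw [h3]; exact (Real.exp_pos _).ne'), rfl⟩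

/-- The integral is a combination of the Gaussian moment generating function at `1/2 - y`, `1` and
`0`. -/
theorem levyXi_merton {σ l μ η : ℝ} (hl : 0 < l) (hη : 0 < η) (y : ℝ) :
    levyXi σ (mertonMeasure l μ η) y = mertonXi σ l μ η y := by
  have hf0 : ∀ x : ℝ, 0 ≤ l / (√(2 * Real.pi) * η) * Real.exp (-(x - μ) ^ 2 / (2 * η ^ 2)) :=
    fun x => by positivity
  rw [levyXi_eq_integral, mertonMeasure,
    integral_withDensity_ofReal (measurable_mertonDensity l μ η) hf0, mertonXi]
  simp only [mertonDensity_eq l μ hη]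
  obtain ⟨i0, h0⟩ := integrable_exp_gaussian μ hη 0
  obtain ⟨i1, h1⟩ := integrable_exp_gaussian μ hη 1
  obtain ⟨ip, hp⟩ := integrable_exp_gaussian μ hη (1 / 2 - y)
  have e : ∀ x, l * gaussianPDFReal μ (Real.toNNReal (η ^ 2)) x
      * (Real.exp ((1 / 2 - y) * x) - 1 - (1 / 2 - y) * (Real.exp x - 1))
      = l * (gaussianPDFReal μ (Real.toNNReal (η ^ 2)) x * Real.exp ((1 / 2 - y) * x)
        - gaussianPDFReal μ (Real.toNNReal (η ^ 2)) x * Real.exp (0 * x)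
        - (1 / 2 - y) * (gaussianPDFReal μ (Real.toNNReal (η ^ 2)) x * Real.exp (1 * x)
          - gaussianPDFReal μ (Real.toNNReal (η ^ 2)) x * Real.exp (0 * x))) := by
    intro x; simp only [zero_mul, Real.exp_zero, one_mul]; ring
  simp only [e]
  have ip0 := ip.sub i0
  have i10 := (i1.sub i0).const_mul (1 / 2 - y)
  simp only [Pi.sub_def] at ip0 i10
  rw [integral_const_mul, integral_sub ip0 i10, integral_sub ip i0,
    integral_const_mul, integral_sub i1 i0, h0, h1, hp, quadR]
  have e1 : μ * (1 / 2 - y) + η ^ 2 * (1 / 2 - y) ^ 2 / 2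
      = -(μ + η ^ 2 / 2) * (y - 1 / 2) + η ^ 2 / 2 * (y ^ 2 - 1 / 4) := by ring
  have e2 : μ * 1 + η ^ 2 * 1 ^ 2 / 2 = μ + η ^ 2 / 2 := by ring
  rw [e1, e2]
  simp only [mul_zero, ne_eq, OfNat.ofNat_ne_zero, not_false_eq_true, zero_pow, zero_div,
    add_zero, Real.exp_zero]
  ring

theorem mem_momentSet_merton {l μ η : ℝ} (hl : 0 < l) (hη : 0 < η) (p : ℝ) :
    p ∈ momentSet (mertonMeasure l μ η) := by
  have hf0 : ∀ x : ℝ, 0 ≤ l / (√(2 * Real.pi) * η) * Real.exp (-(x - μ) ^ 2 / (2 * η ^ 2)) :=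
    fun x => by positivity
  refine Integrable.integrableOn ?_
  rw [mertonMeasure, integrable_withDensity_ofReal_iff (measurable_mertonDensity l μ η) hf0]
  simp only [mertonDensity_eq l μ hη, mul_assoc]
  exact (integrable_exp_gaussian μ hη p).1.const_mul l

theorem merton_hasLongTimeExpansion {Ω : Type*} [MeasurableSpace Ω] {P : Measure Ω}
    [IsProbabilityMeasure P] {X : ℝ≥0 → Ω → ℝ} {σ l μ η : ℝ} (hl : 0 < l) (hη : 0 < η)
    (hX : IsExpLevyProcess P X σ (mertonMeasure l μ η)) (y : ℝ) :
    HasLongTimeExpansion (callPrice P X) (mertonXi σ l μ η) y :=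
  hX.hasLongTimeExpansion_of_eqOn
    (IsExpLevyMeasure.stronglyNonlattice_of_density (measurable_mertonDensity l μ η)
      (fun x => by positivity) hX.measure zero_lt_one fun x _ => by positivity)
    isOpen_univ (fun y _ => mem_momentSet_merton hl hη _)
    (fun y _ => (levyXi_merton hl hη y).symm) (mem_univ y)

/-! ### Integrals of tempered powers -/

theorem integrable_and_integral_of_lintegral {α : Type*} [MeasurableSpace α] {μ : Measure α}
    {f : α → ℝ} {A : ℝ} (hf : AEStronglyMeasurable f μ) (hf0 : 0 ≤ᵐ[μ] f) (hA : 0 ≤ A)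
    (h : ∫⁻ x, ENNReal.ofReal (f x) ∂μ = ENNReal.ofReal A) :
    Integrable f μ ∧ ∫ x, f x ∂μ = A := by
  refine ⟨⟨hf, ?_⟩, ?_⟩
  · rw [hasFiniteIntegral_iff_ofReal hf0, h]; exact ENNReal.ofReal_lt_top
  · rw [integral_eq_lintegral_of_nonneg_ae hf0 hf, h, ENNReal.toReal_ofReal hA]

theorem integrable_of_integrableOn_Ioi_neg {h : ℝ → ℝ} (h1 : IntegrableOn h (Ioi 0))
    (h2 : IntegrableOn (fun x => h (-x)) (Ioi 0)) :
    Integrable h ∧ ∫ x, h x = (∫ x in Ioi 0, h x) + ∫ x in Ioi 0, h (-x) := by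
  have h3 : IntegrableOn h (Iic 0) := by
    rw [integrableOn_Iic_iff_integrableOn_Iio]
    have h4 := h2.comp_neg
    simpa using h4
  refine ⟨?_, ?_⟩
  · rw [← integrableOn_univ, ← Iic_union_Ioi (a := (0 : ℝ))]
    exact h3.union h1
  · rw [← intervalIntegral.integral_Iic_add_Ioi h3 h1, integral_comp_neg_Ioi, neg_zero, add_comm]

/-- Writing `Φ (b x)` as the integral of `x φ (θ x)` over `0 < θ ≤ b` and exchanging integrals
lowers the exponent by one. Starting from the Gamma integral, two such steps reach `-2 < s < -1`;
nonnegativity allows Tonelli. -/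
theorem lintegral_rpow_mul_primitive {φ Φ : ℝ → ℝ} {s A : ℝ} (hs : s < 0) (hA : 0 ≤ A)
    (hφ : Continuous φ) (hφ0 : ∀ z, 0 ≤ z → 0 ≤ φ z) (hΦ : ∀ z, HasDerivAt Φ (φ z) z)
    (hΦ0 : Φ 0 = 0)
    (h : ∀ θ : ℝ, 0 < θ → ∫⁻ x in Ioi (0 : ℝ), ENNReal.ofReal (x ^ s * φ (θ * x))
      = ENNReal.ofReal (A * θ ^ (-s - 1))) {b : ℝ} (hb : 0 ≤ b) :
    ∫⁻ x in Ioi (0 : ℝ), ENNReal.ofReal (x ^ (s - 1) * Φ (b * x))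
      = ENNReal.ofReal (A / (-s) * b ^ (-s)) := by
  have e1 : ∀ x ∈ Ioi (0 : ℝ), ENNReal.ofReal (x ^ (s - 1) * Φ (b * x))
      = ∫⁻ θ in Ioc 0 b, ENNReal.ofReal (x ^ s * φ (θ * x)) := by
    intro x hx
    have hx : 0 < x := hx
    have hd : ∀ θ ∈ uIcc 0 b, HasDerivAt (fun θ => x ^ (s - 1) * Φ (θ * x))
        (x ^ s * φ (θ * x)) θ := by
      intro θ _
      have := ((hΦ (θ * x)).comp θ ((hasDerivAt_id θ).mul_const x)).const_mul (x ^ (s - 1))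
      refine this.congr_deriv ?_
      rw [Real.rpow_sub_one hx.ne']
      field_simp
    have hc : Continuous fun θ => x ^ s * φ (θ * x) := by fun_prop
    have hi := intervalIntegral.integral_eq_sub_of_hasDerivAt hd (hc.intervalIntegrable 0 b)
    rw [zero_mul, hΦ0, mul_zero, sub_zero, intervalIntegral.integral_of_le hb] at hi
    rw [← hi]
    refine ofReal_integral_eq_lintegral_ofReal ((hc.integrableOn_Icc).mono_set Ioc_subset_Icc_self) ?_
    refine (ae_restrict_iff' measurableSet_Ioc).2 (Eventually.of_forall fun θ hθ => ?_)
    exact mul_nonneg (Real.rpow_nonneg hx.le _) (hφ0 _ (mul_nonneg hθ.1.le hx.le))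
  rw [setLIntegral_congr_fun measurableSet_Ioi e1, lintegral_lintegral_swap]
  · rw [setLIntegral_congr_fun measurableSet_Ioc (fun θ hθ => h θ hθ.1)]
    have hi : IntervalIntegrable (fun θ : ℝ => A * θ ^ (-s - 1)) volume 0 b :=
      (intervalIntegral.intervalIntegrable_rpow' (by linarith)).const_mul A
    rw [← ofReal_integral_eq_lintegral_ofReal hi.1,
      ← intervalIntegral.integral_of_le hb, intervalIntegral.integral_const_mul,
      integral_rpow (Or.inl (by linarith)), sub_add_cancel, Real.zero_rpow (by linarith), sub_zero]
    · congr 1; ring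
    · refine (ae_restrict_iff' measurableSet_Ioc).2 (Eventually.of_forall fun θ hθ => ?_)
      exact mul_nonneg hA (Real.rpow_nonneg hθ.1.le _)
  · have := hφ.measurable
    refine Measurable.aemeasurable ?_
    simp only [Function.uncurry_def]
    fun_prop

theorem lintegral_rpow_mul_exp_neg {s b : ℝ} (hs : 0 < s) (hb : 0 < b) :
    ∫⁻ x in Ioi (0 : ℝ), ENNReal.ofReal (x ^ (s - 1) * Real.exp (-(b * x)))
      = ENNReal.ofReal (Real.Gamma s * b ^ (-s)) := by
  rw [← ofReal_integral_eq_lintegral_ofReal,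
    Real.integral_rpow_mul_exp_neg_mul_Ioi hs hb, one_div, Real.inv_rpow hb.le,
    ← Real.rpow_neg hb.le, mul_comm]
  · have h : IntegrableOn (fun x : ℝ => x ^ (s - 1) * Real.exp (-(b * x))) (Ioi 0) := by
      simpa using integrableOn_rpow_mul_exp_neg_mul_rpow (s := s - 1) (by linarith) one_pos hb
    exact h
  · refine (ae_restrict_iff' measurableSet_Ioi).2 (Eventually.of_forall fun x hx => ?_)
    exact mul_nonneg (Real.rpow_nonneg (le_of_lt hx) _) (Real.exp_nonneg _)

theorem lintegral_rpow_mul_one_sub_exp_neg {s b : ℝ} (hs : s < 0) (hs1 : -1 < s) (hb : 0 ≤ b) :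
    ∫⁻ x in Ioi (0 : ℝ), ENNReal.ofReal (x ^ (s - 1) * (1 - Real.exp (-(b * x))))
      = ENNReal.ofReal (-Real.Gamma s * b ^ (-s)) := by
  have hG := Real.Gamma_add_one hs.ne
  rw [lintegral_rpow_mul_primitive (φ := fun z => Real.exp (-z)) (Φ := fun z => 1 - Real.exp (-z))
    hs (Real.Gamma_nonneg_of_nonneg (s := s + 1) (by linarith)) (by fun_prop)
    (fun z _ => Real.exp_nonneg _) (fun z => ?_) (by simp) (fun θ hθ => ?_) hb, hG]
  · rw [div_neg, mul_div_cancel_left₀ _ hs.ne]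
  · simpa using ((hasDerivAt_id z).neg.exp).const_sub 1
  · have := lintegral_rpow_mul_exp_neg (s := s + 1) (by linarith) hθ
    rwa [add_sub_cancel_right, neg_add'] at this

theorem lintegral_rpow_mul_exp_neg_sub {s b : ℝ} (hs : s < -1) (hs1 : -2 < s) (hb : 0 ≤ b) :
    ∫⁻ x in Ioi (0 : ℝ), ENNReal.ofReal (x ^ (s - 1) * (b * x - 1 + Real.exp (-(b * x))))
      = ENNReal.ofReal (Real.Gamma s * b ^ (-s)) := by
  have hG := Real.Gamma_add_one (s := s) (by linarith)
  have hG2 := Real.Gamma_add_one (s := s + 1) (by linarith)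
  have hpos : 0 ≤ -Real.Gamma (s + 1) := by
    have : 0 ≤ Real.Gamma (s + 1 + 1) := Real.Gamma_nonneg_of_nonneg (by linarith)
    rw [hG2] at this
    nlinarith
  rw [lintegral_rpow_mul_primitive (φ := fun z => 1 - Real.exp (-z))
    (Φ := fun z => z - 1 + Real.exp (-z)) (by linarith) hpos (by fun_prop)
    (fun z hz => ?_) (fun z => ?_) (by simp) (fun θ hθ => ?_) hb, hG]
  · congr 2
    have : s ≠ 0 := by linarith
    field_simp
  · simpa using hz
  · refine (((hasDerivAt_id z).sub_const 1).add ((hasDerivAt_id z).neg.exp)).congr_deriv ?_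
    simp [sub_eq_add_neg]
  · have := lintegral_rpow_mul_one_sub_exp_neg (s := s + 1) (by linarith) (by linarith) hθ.le
    rwa [add_sub_cancel_right, neg_add'] at this

/-- The compensator `c + d b x` depends on the range of `s` but its coefficients do not depend on
`b`. This is all that is used: it cancels in the combination below. -/
theorem exists_tempered_power_integral {s : ℝ} (h2 : -2 < s) (h0 : s ≠ 0) (h1 : s ≠ -1) :
    ∃ c d : ℝ, ∀ b : ℝ, 0 ≤ b → (0 < s → 0 < b) →
      IntegrableOn (fun x : ℝ => x ^ (s - 1) * (Real.exp (-(b * x)) + c + d * (b * x))) (Ioi 0) ∧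
      ∫ x in Ioi (0 : ℝ), x ^ (s - 1) * (Real.exp (-(b * x)) + c + d * (b * x))
        = Real.Gamma s * b ^ (-s) := by
  have hm : ∀ b c d : ℝ, AEStronglyMeasurable
      (fun x : ℝ => x ^ (s - 1) * (Real.exp (-(b * x)) + c + d * (b * x)))
      (volume.restrict (Ioi 0)) := fun b c d => by
    refine Measurable.aestronglyMeasurable ?_
    fun_prop
  rcases lt_or_gt_of_ne h0 with hs | hs
  · rcases lt_or_gt_of_ne h1 with hs1 | hs1
    · refine ⟨-1, 1, fun b hb _ => integrable_and_integral_of_lintegral (hm _ _ _) ?_ ?_ ?_⟩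
      · refine (ae_restrict_iff' measurableSet_Ioi).2 (Eventually.of_forall fun x hx => ?_)
        refine mul_nonneg (Real.rpow_nonneg (le_of_lt hx) _) ?_
        linarith [Real.add_one_le_exp (-(b * x))]
      · refine mul_nonneg ?_ (Real.rpow_nonneg hb _)
        have e1 := Real.Gamma_add_one (s := s) (by linarith)
        have e2 := Real.Gamma_add_one (s := s + 1) (by linarith)
        have : 0 ≤ Real.Gamma (s + 1 + 1) := Real.Gamma_nonneg_of_nonneg (by linarith)
        rw [e2, e1, ← mul_assoc] at this
        exact nonneg_of_mul_nonneg_right this (by nlinarith)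
      · rw [← lintegral_rpow_mul_exp_neg_sub hs1 h2 hb]
        congr 1; ext x; congr 2; ring
    · refine ⟨-1, 0, fun b hb _ => ?_⟩
      have := integrable_and_integral_of_lintegral (μ := volume.restrict (Ioi (0 : ℝ)))
        (f := fun x : ℝ => x ^ (s - 1) * (1 - Real.exp (-(b * x))))
        (A := -Real.Gamma s * b ^ (-s)) (Measurable.aestronglyMeasurable (by fun_prop)) ?_ ?_
        (lintegral_rpow_mul_one_sub_exp_neg hs hs1 hb)
      · have e : (fun x : ℝ => x ^ (s - 1) * (Real.exp (-(b * x)) + -1 + 0 * (b * x)))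
            = fun x => -(x ^ (s - 1) * (1 - Real.exp (-(b * x)))) := by
          ext x; ring
        rw [e]
        refine ⟨this.1.neg, ?_⟩
        rw [integral_neg, this.2]; ring
      · refine (ae_restrict_iff' measurableSet_Ioi).2 (Eventually.of_forall fun x hx => ?_)
        refine mul_nonneg (Real.rpow_nonneg (le_of_lt hx) _) ?_
        have : 0 ≤ b * x := mul_nonneg hb (le_of_lt hx)
        simpa using this
      · refine mul_nonneg ?_ (Real.rpow_nonneg hb _)
        have e1 := Real.Gamma_add_one (s := s) h0
        have : 0 ≤ Real.Gamma (s + 1) := Real.Gamma_nonneg_of_nonneg (by linarith)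
        rw [e1] at this
        nlinarith
  · refine ⟨0, 0, fun b hb hb' => integrable_and_integral_of_lintegral (hm _ _ _) ?_ ?_ ?_⟩
    · refine (ae_restrict_iff' measurableSet_Ioi).2 (Eventually.of_forall fun x hx => ?_)
      refine mul_nonneg (Real.rpow_nonneg (le_of_lt hx) _) ?_
      simpa using Real.exp_nonneg _
    · exact mul_nonneg (Real.Gamma_nonneg_of_nonneg hs.le) (Real.rpow_nonneg hb _)
    · simpa using lintegral_rpow_mul_exp_neg hs (hb' hs)

/-- The kernel is a combination of three tempered powers with weights `1`, `-(1 - p)`, `-p` and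
rates `b + p ε`, `b`, `b + ε`. Both the weights and the weighted rates sum to zero, so the affine
compensators disappear. Positive jumps use `ε = -1`, negative ones `ε = 1`. -/
theorem tempered_power_kernel_integral {s p b : ℝ} (h2 : -2 < s) (h0 : s ≠ 0) (h1 : s ≠ -1)
    (ε : ℝ) (hb : 0 ≤ b) (hb1 : 0 ≤ b + ε) (hbp : 0 ≤ b + p * ε)
    (hs : 0 < s → 0 < b ∧ 0 < b + ε ∧ 0 < b + p * ε) :
    IntegrableOn (fun x : ℝ => x ^ (s - 1) * Real.exp (-(b * x)) *
      (Real.exp (-(p * ε * x)) - 1 - p * (Real.exp (-(ε * x)) - 1))) (Ioi 0) ∧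
    ∫ x in Ioi (0 : ℝ), x ^ (s - 1) * Real.exp (-(b * x)) *
      (Real.exp (-(p * ε * x)) - 1 - p * (Real.exp (-(ε * x)) - 1))
      = Real.Gamma s * ((b + p * ε) ^ (-s) - (1 - p) * b ^ (-s) - p * (b + ε) ^ (-s)) := by
  obtain ⟨c, d, h⟩ := exists_tempered_power_integral h2 h0 h1
  obtain ⟨i0, e0⟩ := h _ hbp fun h => (hs h).2.2
  obtain ⟨i1, e1⟩ := h _ hb fun h => (hs h).1
  obtain ⟨i2, e2⟩ := h _ hb1 fun h => (hs h).2.1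
  have e : (fun x : ℝ => x ^ (s - 1) * Real.exp (-(b * x)) *
      (Real.exp (-(p * ε * x)) - 1 - p * (Real.exp (-(ε * x)) - 1)))
      = fun x => x ^ (s - 1) * (Real.exp (-((b + p * ε) * x)) + c + d * ((b + p * ε) * x))
        - (1 - p) * (x ^ (s - 1) * (Real.exp (-(b * x)) + c + d * (b * x)))
        - p * (x ^ (s - 1) * (Real.exp (-((b + ε) * x)) + c + d * ((b + ε) * x))) := by
    ext x
    have a1 : Real.exp (-((b + p * ε) * x)) = Real.exp (-(b * x)) * Real.exp (-(p * ε * x)) := by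
      rw [← Real.exp_add]; ring_nf
    have a2 : Real.exp (-((b + ε) * x)) = Real.exp (-(b * x)) * Real.exp (-(ε * x)) := by
      rw [← Real.exp_add]; ring_nf
    rw [a1, a2]; ring
  rw [e]
  have j := i0.sub (i1.const_mul (1 - p))
  simp only [Pi.sub_def] at j
  refine ⟨j.sub (i2.const_mul p), ?_⟩
  rw [integral_sub j (i2.const_mul p), integral_sub i0 (i1.const_mul (1 - p)), integral_const_mul,
    integral_const_mul, e0, e1, e2]
  ring

/-- On large jumps `1` and `exp x` are integrable, so the kernel is integrable only together with
`exp (p x)`. -/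
theorem IsExpLevyMeasure.mem_momentSet_of_integrable_kernel {ν : Measure ℝ}
    (hν : IsExpLevyMeasure ν) {p : ℝ}
    (h : Integrable (fun x => Real.exp (p * x) - 1 - p * (Real.exp x - 1)) ν) :
    p ∈ momentSet ν := by
  have h0 := hν.zero_mem
  have h1 := hν.one_mem
  simp only [momentSet, mem_ofPred_eq, zero_mul, Real.exp_zero, one_mul] at h0 h1 ⊢
  refine ((h.integrableOn.add h0).add ((h1.sub h0).const_mul p)).congr
    (Eventually.of_forall fun x => ?_)
  simp only [Pi.add_apply, Pi.sub_apply]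
  ring

theorem IsExpLevyProcess.hasLongTimeExpansion_of_density {Ω : Type*} [MeasurableSpace Ω]
    {P : Measure Ω} [IsProbabilityMeasure P] {X : ℝ≥0 → Ω → ℝ} {σ : ℝ} {f : ℝ → ℝ}
    (hf : Measurable f) (hf0 : ∀ x, 0 ≤ f x)
    (hX : IsExpLevyProcess P X σ (volume.withDensity fun x => ENNReal.ofReal (f x)))
    (hnl : StronglyNonlattice σ (volume.withDensity fun x => ENNReal.ofReal (f x)))
    {U : Set ℝ} (hU : IsOpen U) {Ξ : ℝ → ℝ}
    (hi : ∀ y ∈ U, Integrable fun x =>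
      f x * (Real.exp ((1 / 2 - y) * x) - 1 - (1 / 2 - y) * (Real.exp x - 1)))
    (hΞ : ∀ y ∈ U, Ξ y = 1 / 2 * σ ^ 2 * quadR y
      + ∫ x, f x * (Real.exp ((1 / 2 - y) * x) - 1 - (1 / 2 - y) * (Real.exp x - 1)))
    {y : ℝ} (hy : y ∈ U) : HasLongTimeExpansion (callPrice P X) Ξ y := by
  refine hX.hasLongTimeExpansion_of_eqOn hnl hU (fun y hy => ?_) (fun y hy => ?_) hy
  · exact hX.measure.mem_momentSet_of_integrable_kernel
      ((integrable_withDensity_ofReal_iff hf hf0).2 (hi y hy))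
  · rw [hΞ y hy, levyXi_eq_integral, integral_withDensity_ofReal hf hf0]

/-! ### Tempered stable processes -/

section TemperedStable

/-- The density of the tempered stable Lévy measure. -/
noncomputable def temperedStableDensity (α cp cm κp κm x : ℝ) : ℝ :=
  if 0 < x then cp / x ^ (α + 1) * Real.exp (-κp * x)
    else if x < 0 then cm / |x| ^ (α + 1) * Real.exp (-κm * |x|) else 0

variable {σ α cp cm κp κm : ℝ}

theorem measurable_temperedStableDensity :
    Measurable (temperedStableDensity α cp cm κp κm) := by
  refine Measurable.ite measurableSet_Ioi (by fun_prop) ?_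
  exact Measurable.ite measurableSet_Iio (by fun_prop) measurable_const

theorem temperedStableDensity_nonneg (hp : 0 ≤ cp) (hm : 0 ≤ cm) (x : ℝ) :
    0 ≤ temperedStableDensity α cp cm κp κm x := by
  rw [temperedStableDensity]
  split_ifs with h h'
  · have := Real.rpow_nonneg h.le (α + 1)
    positivity
  · have := Real.rpow_nonneg (abs_nonneg x) (α + 1)
    positivity
  · exact le_rfl

theorem temperedStableDensity_of_pos {x : ℝ} (hx : 0 < x) :
    temperedStableDensity α cp cm κp κm x = cp * (x ^ (-α - 1) * Real.exp (-(κp * x))) := by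
  rw [temperedStableDensity, if_pos hx, ← neg_add', Real.rpow_neg hx.le, neg_mul]
  ring

theorem temperedStableDensity_neg_of_pos {x : ℝ} (hx : 0 < x) :
    temperedStableDensity α cp cm κp κm (-x) = cm * (x ^ (-α - 1) * Real.exp (-(κm * x))) := by
  rw [temperedStableDensity, if_neg (by linarith), if_pos (by linarith), abs_neg, abs_of_pos hx,
    ← neg_add', Real.rpow_neg hx.le, neg_mul]
  ring

/-- For `κp = 1` the moment `exp x` would require `x ^ (-α - 1)` to be integrable at infinity, false
for `α < 0`. The strict inequality is what the Gamma integral with positive exponent needs. -/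
theorem one_lt_of_isExpLevyMeasure_temperedStable (hp : 0 ≤ cp) (hm : 0 ≤ cm)
    (hν : IsExpLevyMeasure (temperedStableMeasure α cp cm κp κm)) (hα : α < 0) (hcp : 0 < cp)
    (hκ : 1 ≤ κp) : 1 < κp := by
  by_contra hle
  obtain rfl : κp = 1 := le_antisymm (not_lt.1 hle) hκ
  have h : Integrable (fun x : ℝ => {x : ℝ | 1 < |x|}.indicator (fun x => Real.exp (1 * x)) x)
      (temperedStableMeasure α cp cm 1 κm) :=
    (integrable_indicator_iff (measurableSet_lt measurable_const (by fun_prop))).2 hν.one_mem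
  have h2 := (integrable_withDensity_ofReal_iff (measurable_temperedStableDensity (α := α))
    (temperedStableDensity_nonneg hp hm)).1 h
  have h3 : IntegrableOn (fun x : ℝ => cp⁻¹ * (temperedStableDensity α cp cm 1 κm x *
      {x : ℝ | 1 < |x|}.indicator (fun x => Real.exp (1 * x)) x)) (Ioi 1) :=
    (h2.const_mul cp⁻¹).integrableOn
  have h4 : IntegrableOn (fun x : ℝ => x ^ (-α - 1)) (Ioi 1) := by
    refine h3.congr_fun (fun x hx => ?_) measurableSet_Ioi
    have hx : 1 < x := hx
    have hx0 : 0 < x := one_pos.trans hx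
    beta_reduce
    rw [temperedStableDensity_of_pos hx0,
      indicator_of_mem (show x ∈ {x : ℝ | 1 < |x|} from hx.trans_le (le_abs_self x)), Real.exp_neg]
    have := (Real.exp_pos (1 * x)).ne'
    field_simp
  have := (integrableOn_Ioi_rpow_iff one_pos).1 h4
  linarith

theorem pos_of_isExpLevyMeasure_temperedStable (hp : 0 ≤ cp) (hm : 0 ≤ cm)
    (hν : IsExpLevyMeasure (temperedStableMeasure α cp cm κp κm)) (hα : α < 0) (hcm : 0 < cm)
    (hκ : 0 ≤ κm) : 0 < κm := by
  by_contra hle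
  obtain rfl : κm = 0 := le_antisymm (not_lt.1 hle) hκ
  have h : Integrable (fun x : ℝ => {x : ℝ | 1 < |x|}.indicator (fun x => Real.exp (0 * x)) x)
      (temperedStableMeasure α cp cm κp 0) :=
    (integrable_indicator_iff (measurableSet_lt measurable_const (by fun_prop))).2 hν.zero_mem
  have h2 := (integrable_withDensity_ofReal_iff (measurable_temperedStableDensity (α := α))
    (temperedStableDensity_nonneg hp hm)).1 h
  have h3 : IntegrableOn (fun x : ℝ => cm⁻¹ * (temperedStableDensity α cp cm κp 0 (-x) *
      {x : ℝ | 1 < |x|}.indicator (fun x => Real.exp (0 * x)) (-x))) (Ioi 1) :=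
    (h2.comp_neg.const_mul cm⁻¹).integrableOn
  have h4 : IntegrableOn (fun x : ℝ => x ^ (-α - 1)) (Ioi 1) := by
    refine h3.congr_fun (fun x hx => ?_) measurableSet_Ioi
    have hx : 1 < x := hx
    have hx0 : 0 < x := one_pos.trans hx
    beta_reduce
    rw [temperedStableDensity_neg_of_pos hx0, indicator_of_mem (show -x ∈ {x : ℝ | 1 < |x|} by
      rw [mem_ofPred_eq, abs_neg]; exact hx.trans_le (le_abs_self x))]
    simp only [zero_mul, neg_zero, Real.exp_zero, mul_one]
    field_simp
  have := (integrableOn_Ioi_rpow_iff one_pos).1 h4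
  linarith

theorem integral_temperedStableDensity_kernel (h2 : α < 2) (h0 : α ≠ 0) (h1 : α ≠ 1)
    (hp : 0 ≤ cp) (hm : 0 ≤ cm) (hκp : 1 ≤ κp) (hκm : 0 ≤ κm)
    (hp' : α < 0 → 0 < cp → 1 < κp) (hm' : α < 0 → 0 < cm → 0 < κm) {p : ℝ} (hpl : -κm < p)
    (hpu : p < κp) :
    Integrable (fun x => temperedStableDensity α cp cm κp κm x
      * (Real.exp (p * x) - 1 - p * (Real.exp x - 1))) ∧
    ∫ x, temperedStableDensity α cp cm κp κm x * (Real.exp (p * x) - 1 - p * (Real.exp x - 1))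
      = cp * (Real.Gamma (-α) * ((κp - p) ^ α - (1 - p) * κp ^ α - p * (κp - 1) ^ α))
        + cm * (Real.Gamma (-α) * ((κm + p) ^ α - (1 - p) * κm ^ α - p * (κm + 1) ^ α)) := by
  have key : ∀ c κ ε : ℝ, 0 ≤ c → 0 ≤ κ → 0 ≤ κ + ε → 0 ≤ κ + p * ε →
      (α < 0 → 0 < c → 0 < κ ∧ 0 < κ + ε ∧ 0 < κ + p * ε) →
      IntegrableOn (fun x : ℝ => c * (x ^ (-α - 1) * Real.exp (-(κ * x)) *
        (Real.exp (-(p * ε * x)) - 1 - p * (Real.exp (-(ε * x)) - 1)))) (Ioi 0) ∧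
      ∫ x in Ioi (0 : ℝ), c * (x ^ (-α - 1) * Real.exp (-(κ * x)) *
        (Real.exp (-(p * ε * x)) - 1 - p * (Real.exp (-(ε * x)) - 1)))
        = c * (Real.Gamma (-α) * ((κ + p * ε) ^ α - (1 - p) * κ ^ α - p * (κ + ε) ^ α)) := by
    intro c κ ε hc k1 k2 k3 k4
    rcases hc.eq_or_lt with rfl | hc
    · simp
    · have := tempered_power_kernel_integral (s := -α) (p := p) (by linarith) (neg_ne_zero.2 h0)
        (by simpa using h1) ε k1 k2 k3 (fun h => k4 (by linarith) hc)
      rw [neg_neg] at this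
      exact ⟨this.1.const_mul c, by rw [integral_const_mul, this.2]⟩
  obtain ⟨ip, ep⟩ := key cp κp (-1) hp (by linarith) (by linarith) (by linarith) fun h h' => by
    have := hp' h h'
    exact ⟨by linarith, by linarith, by linarith⟩
  obtain ⟨im, em⟩ := key cm κm 1 hm (by linarith) (by linarith) (by linarith) fun h h' => by
    have := hm' h h'
    exact ⟨by linarith, by linarith, by linarith⟩
  have e1 : EqOn (fun x : ℝ => cp * (x ^ (-α - 1) * Real.exp (-(κp * x)) *
      (Real.exp (-(p * -1 * x)) - 1 - p * (Real.exp (-(-1 * x)) - 1))))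
      (fun x => temperedStableDensity α cp cm κp κm x
        * (Real.exp (p * x) - 1 - p * (Real.exp x - 1))) (Ioi 0) := by
    intro x hx
    simp only
    rw [temperedStableDensity_of_pos hx]
    ring_nf
  have e2 : EqOn (fun x : ℝ => cm * (x ^ (-α - 1) * Real.exp (-(κm * x)) *
      (Real.exp (-(p * 1 * x)) - 1 - p * (Real.exp (-(1 * x)) - 1))))
      (fun x => temperedStableDensity α cp cm κp κm (-x)
        * (Real.exp (p * -x) - 1 - p * (Real.exp (-x) - 1))) (Ioi 0) := by
    intro x hx
    simp only
    rw [temperedStableDensity_neg_of_pos hx]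
    ring_nf
  obtain ⟨hi, he⟩ := integrable_of_integrableOn_Ioi_neg (h := fun x =>
    temperedStableDensity α cp cm κp κm x * (Real.exp (p * x) - 1 - p * (Real.exp x - 1)))
    (ip.congr_fun e1 measurableSet_Ioi) (im.congr_fun e2 measurableSet_Ioi)
  refine ⟨hi, ?_⟩
  rw [he, ← setIntegral_congr_fun measurableSet_Ioi e1,
    ← setIntegral_congr_fun measurableSet_Ioi e2, ep, em]
  ring_nf

theorem temperedStable_hasLongTimeExpansion {Ω : Type*} [MeasurableSpace Ω] {P : Measure Ω}
    [IsProbabilityMeasure P] {X : ℝ≥0 → Ω → ℝ} (h2 : α < 2) (h0 : α ≠ 0) (h1 : α ≠ 1)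
    (hp : 0 ≤ cp) (hm : 0 ≤ cm) (hκp : 1 ≤ κp) (hκm : 0 ≤ κm) (hne : σ ≠ 0 ∨ 0 < cp ∨ 0 < cm)
    (hX : IsExpLevyProcess P X σ (temperedStableMeasure α cp cm κp κm)) {y : ℝ}
    (hy : y ∈ Ioo (-κp + 1 / 2) (κm + 1 / 2)) :
    HasLongTimeExpansion (callPrice P X) (temperedStableXi σ α cp cm κp κm) y := by
  have hf := measurable_temperedStableDensity (α := α) (cp := cp) (cm := cm) (κp := κp) (κm := κm)
  have hf0 := temperedStableDensity_nonneg (α := α) (κp := κp) (κm := κm) hp hm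
  have hnl : StronglyNonlattice σ (temperedStableMeasure α cp cm κp κm) := by
    rcases hne with h | h | h
    · exact hX.measure.stronglyNonlattice_of_ne_zero h
    · refine IsExpLevyMeasure.stronglyNonlattice_of_density
        (f := temperedStableDensity α cp cm κp κm) hf hf0 hX.measure one_lt_two
        fun x hx => ?_
      have : 0 < x := one_pos.trans hx.1
      rw [temperedStableDensity_of_pos this]
      positivity
    · refine IsExpLevyMeasure.stronglyNonlattice_of_density
        (f := temperedStableDensity α cp cm κp κm) hf hf0 hX.measure
        (show (-2 : ℝ) < -1 by norm_num) fun x hx => ?_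
      have : 0 < -x := by linarith [hx.2]
      rw [← neg_neg x, temperedStableDensity_neg_of_pos this]
      positivity
  have key := fun (y : ℝ) (hy : y ∈ Ioo (-κp + 1 / 2) (κm + 1 / 2)) =>
    integral_temperedStableDensity_kernel h2 h0 h1 hp hm hκp hκm
      (fun h h' => one_lt_of_isExpLevyMeasure_temperedStable hp hm hX.measure h h' hκp)
      (fun h h' => pos_of_isExpLevyMeasure_temperedStable hp hm hX.measure h h' hκm)
      (p := 1 / 2 - y) (by linarith [hy.2]) (by linarith [hy.1])
  refine IsExpLevyProcess.hasLongTimeExpansion_of_density hf hf0 hX hnl isOpen_Ioo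
    (fun y hy => (key y hy).1) (fun y hy => ?_) hy
  rw [(key y hy).2, temperedStableXi, show κp + (y - 1 / 2) = κp - (1 / 2 - y) by ring,
    show κm - (y - 1 / 2) = κm + (1 / 2 - y) by ring]
  ring

end TemperedStable

/-! ### The modified Bessel function and normal inverse Gaussian processes -/

section NormalInverseGaussian

/-- `cosh t = sinh t + exp (-t)`: the first part gives an exact derivative, the second is
integrable. -/
theorem integrableOn_besselK1_integrand {z : ℝ} (hz : 0 < z) :
    IntegrableOn (fun t => Real.exp (-z * Real.cosh t) * Real.cosh t) (Ioi 0) := by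
  have hd : ∀ t ∈ Ici (0 : ℝ), HasDerivAt (fun t => -(1 / z) * Real.exp (-z * Real.cosh t))
      (Real.exp (-z * Real.cosh t) * Real.sinh t) t := fun t _ => by
    refine ((((Real.hasDerivAt_cosh t).const_mul (-z)).exp).const_mul (-(1 / z))).congr_deriv ?_
    field_simp
  have hlim : Tendsto (fun t => -(1 / z) * Real.exp (-z * Real.cosh t)) atTop
      (𝓝 (-(1 / z) * 0)) := by
    refine Tendsto.const_mul _ (Real.tendsto_exp_atBot.comp ?_)
    refine Tendsto.const_mul_atTop_of_neg (by linarith) ?_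
    refine tendsto_atTop_mono (fun t => ?_) Real.sinhOrderIso.tendsto_atTop
    exact (Real.sinh_lt_cosh t).le
  have h1 := integrableOn_Ioi_deriv_of_nonneg' hd
    (fun t ht => mul_nonneg (Real.exp_nonneg _) (Real.sinh_nonneg_iff.2 (le_of_lt ht))) hlim
  have h2 : IntegrableOn (fun t : ℝ => Real.exp (-1 * t)) (Ioi 0) :=
    integrableOn_exp_mul_Ioi (by norm_num) 0
  refine Integrable.mono' (h1.add h2) (by fun_prop) (Eventually.of_forall fun t => ?_)
  have hc := Real.cosh_pos t
  rw [Real.norm_of_nonneg (by positivity)]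
  have e : Real.cosh t = Real.sinh t + Real.exp (-1 * t) := by
    rw [neg_one_mul, ← Real.cosh_sub_sinh]; ring
  have h3 : Real.exp (-z * Real.cosh t) ≤ 1 := Real.exp_le_one_iff.2 (by nlinarith)
  have h4 := Real.exp_nonneg (-1 * t)
  calc Real.exp (-z * Real.cosh t) * Real.cosh t
      = Real.exp (-z * Real.cosh t) * Real.sinh t
        + Real.exp (-z * Real.cosh t) * Real.exp (-1 * t) := by
        rw [← mul_add, ← e]
    _ ≤ _ := by
        simp only [Pi.add_apply]
        nlinarith

theorem besselK1_nonneg (z : ℝ) : 0 ≤ besselK1 z :=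
  integral_nonneg fun t => mul_nonneg (Real.exp_nonneg _) (Real.cosh_pos t).le

theorem besselK1_pos {z : ℝ} (hz : 0 < z) : 0 < besselK1 z := by
  rw [besselK1, integral_pos_iff_support_of_nonneg
    (fun t => mul_nonneg (Real.exp_nonneg _) (Real.cosh_pos t).le)
    (integrableOn_besselK1_integrand hz)]
  have : Function.support (fun t => Real.exp (-z * Real.cosh t) * Real.cosh t) = univ :=
    eq_univ_of_forall fun t => (mul_pos (Real.exp_pos _) (Real.cosh_pos t)).ne'
  rw [this]
  simp

theorem measurable_besselK1 : Measurable besselK1 := by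
  have h : StronglyMeasurable (Function.uncurry fun z t : ℝ =>
      Real.exp (-z * Real.cosh t) * Real.cosh t) := by
    refine Continuous.stronglyMeasurable ?_
    simp only [Function.uncurry_def]
    fun_prop
  exact h.integral_prod_right.measurable

theorem ofReal_besselK1 {z : ℝ} (hz : 0 < z) : ENNReal.ofReal (besselK1 z)
    = ∫⁻ t in Ioi (0 : ℝ), ENNReal.ofReal (Real.exp (-z * Real.cosh t) * Real.cosh t) :=
  ofReal_integral_eq_lintegral_ofReal (integrableOn_besselK1_integrand hz)
    (Eventually.of_forall fun t => mul_nonneg (Real.exp_nonneg _) (Real.cosh_pos t).le)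

/-! ### Integration of `cosh (y x) - 1` against `K₁` -/

theorem lintegral_sinh_mul_exp_neg {u b : ℝ} (hu : 0 ≤ u) (hb : u < b) :
    ∫⁻ x in Ioi (0 : ℝ), ENNReal.ofReal (2 * Real.sinh (u * x) * Real.exp (-b * x))
      = ENNReal.ofReal (2 * u / (b ^ 2 - u ^ 2)) := by
  have e : (fun x : ℝ => 2 * Real.sinh (u * x) * Real.exp (-b * x))
      = fun x => Real.exp ((u - b) * x) - Real.exp (-(u + b) * x) := by
    ext x
    rw [Real.sinh_eq, show (u - b) * x = u * x + -b * x by ring,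
      show -(u + b) * x = -(u * x) + -b * x by ring, Real.exp_add, Real.exp_add]
    ring
  have i1 := integrableOn_exp_mul_Ioi (a := u - b) (by linarith) 0
  have i2 := integrableOn_exp_mul_Ioi (a := -(u + b)) (by linarith) 0
  rw [← ofReal_integral_eq_lintegral_ofReal]
  · rw [e, integral_sub i1 i2, integral_exp_mul_Ioi (by linarith),
      integral_exp_mul_Ioi (by linarith)]
    congr 1
    have h1 : u - b ≠ 0 := by linarith
    have h2 : u + b ≠ 0 := by linarith
    simp only [mul_zero, Real.exp_zero]
    rw [show b ^ 2 - u ^ 2 = -((u - b) * (u + b)) by ring]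
    field_simp
    ring
  · rw [e]; exact i1.sub i2
  · refine (ae_restrict_iff' measurableSet_Ioi).2 (Eventually.of_forall fun x hx => ?_)
    have : 0 ≤ Real.sinh (u * x) := Real.sinh_nonneg_iff.2 (mul_nonneg hu (le_of_lt hx))
    have := Real.exp_nonneg (-b * x)
    change 0 ≤ 2 * Real.sinh (u * x) * Real.exp (-b * x)
    positivity

theorem lintegral_cosh_div {u w : ℝ} (hu : 0 ≤ u) (hw : u < w) :
    ∫⁻ t in Ioi (0 : ℝ), ENNReal.ofReal
      (2 * u / ((w * Real.cosh t) ^ 2 - u ^ 2) * Real.cosh t)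
      = ENNReal.ofReal (Real.pi * (u / (w * √(w ^ 2 - u ^ 2)))) := by
  have hw0 : 0 < w := hu.trans_lt hw
  have hq : 0 < w ^ 2 - u ^ 2 := by nlinarith
  set q := √(w ^ 2 - u ^ 2) with hqd
  have hq0 : 0 < q := Real.sqrt_pos.2 hq
  have hq2 : q ^ 2 = w ^ 2 - u ^ 2 := Real.sq_sqrt hq.le
  have hden : ∀ t, (w * Real.cosh t) ^ 2 - u ^ 2 = q ^ 2 + (w * Real.sinh t) ^ 2 := fun t => by
    rw [hq2, mul_pow, Real.cosh_sq]; ring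
  have hd : ∀ t ∈ Ici (0 : ℝ),
      HasDerivAt (fun t => 2 * u / (w * q) * Real.arctan (w / q * Real.sinh t))
      (2 * u / ((w * Real.cosh t) ^ 2 - u ^ 2) * Real.cosh t) t := fun t _ => by
    refine ((((Real.hasDerivAt_sinh t).const_mul (w / q)).arctan).const_mul
      (2 * u / (w * q))).congr_deriv ?_
    rw [hden]
    have : q ^ 2 + (w * Real.sinh t) ^ 2 ≠ 0 := by positivity
    have h2 : 1 + (w / q * Real.sinh t) ^ 2 = (q ^ 2 + (w * Real.sinh t) ^ 2) / q ^ 2 := by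
      field_simp
    rw [h2]
    field_simp
  have hnn : ∀ t, 0 ≤ 2 * u / ((w * Real.cosh t) ^ 2 - u ^ 2) * Real.cosh t := fun t => by
    rw [hden]
    have := Real.cosh_pos t
    positivity
  have hlim : Tendsto (fun t => 2 * u / (w * q) * Real.arctan (w / q * Real.sinh t)) atTop
      (𝓝 (2 * u / (w * q) * (Real.pi / 2))) := by
    refine Tendsto.const_mul _ ((tendsto_nhds_of_tendsto_nhdsWithin
      Real.tendsto_arctan_atTop).comp ?_)
    exact Tendsto.const_mul_atTop (by positivity) Real.sinhOrderIso.tendsto_atTop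
  rw [← ofReal_integral_eq_lintegral_ofReal
      (integrableOn_Ioi_deriv_of_nonneg' hd (fun t _ => hnn t) hlim) (Eventually.of_forall hnn),
    integral_Ioi_of_hasDerivAt_of_nonneg' hd (fun t _ => hnn t) hlim]
  congr 1
  simp only [Real.sinh_zero, mul_zero, Real.arctan_zero, sub_zero]
  field_simp

theorem lintegral_div_sqrt {y w : ℝ} (hy : 0 ≤ y) (hw : y < w) :
    ∫⁻ u in Ioc 0 y, ENNReal.ofReal (Real.pi * (u / (w * √(w ^ 2 - u ^ 2))))
      = ENNReal.ofReal (Real.pi / w * (w - √(w ^ 2 - y ^ 2))) := by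
  have hw0 : 0 < w := hy.trans_lt hw
  have hpos : ∀ u ∈ uIcc 0 y, 0 < w ^ 2 - u ^ 2 := fun u hu => by
    rw [uIcc_of_le hy] at hu
    nlinarith [hu.1, hu.2]
  have hd : ∀ u ∈ uIcc 0 y, HasDerivAt (fun u => -(Real.pi / w) * √(w ^ 2 - u ^ 2))
      (Real.pi * (u / (w * √(w ^ 2 - u ^ 2)))) u := fun u hu => by
    have h := hpos u hu
    refine ((((hasDerivAt_pow 2 u).const_sub (w ^ 2)).sqrt h.ne').const_mul
      (-(Real.pi / w))).congr_deriv ?_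
    have := Real.sqrt_pos.2 h
    simp only [Nat.cast_ofNat, Nat.add_one_sub_one, pow_one]
    field_simp
  have hc : ContinuousOn (fun u => Real.pi * (u / (w * √(w ^ 2 - u ^ 2)))) (uIcc 0 y) := by
    have hc' : Continuous fun u => w * √(w ^ 2 - u ^ 2) := by fun_prop
    refine continuousOn_const.mul (continuousOn_id.div hc'.continuousOn ?_)
    intro u hu
    have := Real.sqrt_pos.2 (hpos u hu)
    positivity
  have hi := hc.intervalIntegrable (μ := volume)
  have he := intervalIntegral.integral_eq_sub_of_hasDerivAt hd hi
  rw [intervalIntegral.integral_of_le hy] at he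
  rw [← ofReal_integral_eq_lintegral_ofReal hi.1, he]
  · congr 1
    rw [show w ^ 2 - (0 : ℝ) ^ 2 = w ^ 2 by ring, Real.sqrt_sq hw0.le]
    ring
  · refine (ae_restrict_iff' measurableSet_Ioc).2 (Eventually.of_forall fun u hu => ?_)
    have := hu.1
    change 0 ≤ Real.pi * (u / (w * √(w ^ 2 - u ^ 2)))
    positivity

theorem ofReal_cosh_sub_one_div {x y : ℝ} (hx : 0 < x) (hy : 0 ≤ y) :
    ENNReal.ofReal (2 * (Real.cosh (y * x) - 1) / x)
      = ∫⁻ u in Ioc 0 y, ENNReal.ofReal (2 * Real.sinh (u * x)) := by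
  have hd : ∀ u ∈ uIcc 0 y, HasDerivAt (fun u => 2 / x * Real.cosh (u * x))
      (2 * Real.sinh (u * x)) u := fun u _ => by
    refine ((((hasDerivAt_id u).mul_const x).cosh).const_mul (2 / x)).congr_deriv ?_
    simp only [id_eq, one_mul]
    field_simp
  have hc : Continuous fun u => 2 * Real.sinh (u * x) := by fun_prop
  have he := intervalIntegral.integral_eq_sub_of_hasDerivAt hd (hc.intervalIntegrable 0 y)
  rw [intervalIntegral.integral_of_le hy] at he
  rw [← ofReal_integral_eq_lintegral_ofReal (hc.intervalIntegrable 0 y).1, he]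
  · congr 1
    simp only [zero_mul, Real.cosh_zero]
    ring
  · refine (ae_restrict_iff' measurableSet_Ioc).2 (Eventually.of_forall fun u hu => ?_)
    have : 0 ≤ Real.sinh (u * x) := Real.sinh_nonneg_iff.2 (mul_nonneg hu.1.le hx.le)
    change 0 ≤ 2 * Real.sinh (u * x)
    positivity

/-- `2 (cosh (y x) - 1) / x` is the integral of `2 sinh (u x)` over `0 < u ≤ y`, and `K₁` is an
integral over `t`. By Tonelli the three integrations are done in the order `x`, `t`, `u`, each with
an elementary primitive. -/
theorem lintegral_cosh_sub_one_mul_besselK1 {y w : ℝ} (hy : 0 ≤ y) (hw : y < w) :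
    ∫⁻ x in Ioi (0 : ℝ), ENNReal.ofReal (2 * (Real.cosh (y * x) - 1) / x * besselK1 (w * x))
      = ENNReal.ofReal (Real.pi / w * (w - √(w ^ 2 - y ^ 2))) := by
  have hw0 : 0 < w := hy.trans_lt hw
  have e1 : ∀ x ∈ Ioi (0 : ℝ),
      ENNReal.ofReal (2 * (Real.cosh (y * x) - 1) / x * besselK1 (w * x))
      = ∫⁻ u in Ioc 0 y, ENNReal.ofReal (2 * Real.sinh (u * x))
        * ENNReal.ofReal (besselK1 (w * x)) := by
    intro x hx
    rw [ENNReal.ofReal_mul' (besselK1_nonneg _), ofReal_cosh_sub_one_div hx hy,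
      lintegral_mul_const _ (by fun_prop)]
  have hK := measurable_besselK1
  rw [setLIntegral_congr_fun measurableSet_Ioi e1, lintegral_lintegral_swap (by
    refine Measurable.aemeasurable ?_
    simp only [Function.uncurry_def]
    fun_prop), ← lintegral_div_sqrt hy hw]
  refine setLIntegral_congr_fun measurableSet_Ioc fun u hu => ?_
  have hu0 : 0 ≤ u := hu.1.le
  have e2 : ∀ x ∈ Ioi (0 : ℝ),
      ENNReal.ofReal (2 * Real.sinh (u * x)) * ENNReal.ofReal (besselK1 (w * x))
      = ∫⁻ t in Ioi (0 : ℝ), ENNReal.ofReal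
        (2 * Real.sinh (u * x) * Real.exp (-(w * Real.cosh t) * x)) *
          ENNReal.ofReal (Real.cosh t) := by
    intro x hx
    have hx : 0 < x := hx
    have hs : 0 ≤ Real.sinh (u * x) := Real.sinh_nonneg_iff.2 (mul_nonneg hu0 hx.le)
    rw [ofReal_besselK1 (mul_pos hw0 hx), ← lintegral_const_mul _ (by fun_prop)]
    refine lintegral_congr fun t => ?_
    rw [← ENNReal.ofReal_mul (by positivity), ← ENNReal.ofReal_mul (by positivity)]
    congr 1
    rw [show -(w * x) * Real.cosh t = -(w * Real.cosh t) * x by ring]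
    ring
  rw [setLIntegral_congr_fun measurableSet_Ioi e2, lintegral_lintegral_swap (by
    refine Measurable.aemeasurable ?_
    simp only [Function.uncurry_def]
    fun_prop), ← lintegral_cosh_div hu0 (hu.2.trans_lt hw)]
  refine lintegral_congr fun t => ?_
  have hlt : u < w * Real.cosh t := by
    have := Real.one_le_cosh t
    nlinarith [hu.2]
  rw [lintegral_mul_const _ (by fun_prop), lintegral_sinh_mul_exp_neg hu0 hlt,
    ENNReal.ofReal_mul' (Real.cosh_pos t).le]

theorem integral_cosh_sub_one_mul_besselK1 {y w : ℝ} (hw : |y| < w) :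
    IntegrableOn (fun x => 2 * (Real.cosh (y * x) - 1) / x * besselK1 (w * x)) (Ioi 0) ∧
    ∫ x in Ioi (0 : ℝ), 2 * (Real.cosh (y * x) - 1) / x * besselK1 (w * x)
      = Real.pi / w * (w - √(w ^ 2 - y ^ 2)) := by
  have hw0 : 0 < w := (abs_nonneg y).trans_lt hw
  have hK := measurable_besselK1
  have e : ∀ x, Real.cosh (y * x) = Real.cosh (|y| * x) := fun x => by
    rw [← Real.cosh_abs (y * x), ← Real.cosh_abs (|y| * x), abs_mul, abs_mul, abs_abs]
  simp only [e]
  rw [← sq_abs y]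
  refine integrable_and_integral_of_lintegral (Measurable.aestronglyMeasurable (by fun_prop)) ?_ ?_
    (lintegral_cosh_sub_one_mul_besselK1 (abs_nonneg y) hw)
  · refine (ae_restrict_iff' measurableSet_Ioi).2 (Eventually.of_forall fun x hx => ?_)
    have hx : 0 < x := hx
    refine mul_nonneg (div_nonneg ?_ hx.le) (besselK1_nonneg _)
    linarith [Real.one_le_cosh (|y| * x)]
  · refine mul_nonneg (by positivity) (sub_nonneg.2 ?_)
    rw [Real.sqrt_le_left hw0.le]
    nlinarith [sq_nonneg |y|]

/-- Bernoulli's inequality for `(exp x) ^ p`. A kernel of constant sign is integrable as soon as its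
symmetrisation is. -/
theorem exp_kernel_nonneg_or_nonpos (p : ℝ) :
    (∀ x : ℝ, 0 ≤ Real.exp (p * x) - 1 - p * (Real.exp x - 1)) ∨
    ∀ x : ℝ, Real.exp (p * x) - 1 - p * (Real.exp x - 1) ≤ 0 := by
  rcases lt_or_ge p 0 with h | h
  · left
    intro x
    nlinarith [Real.add_one_le_exp (p * x), Real.add_one_le_exp x]
  have e : ∀ x : ℝ, Real.exp (p * x) = (1 + (Real.exp x - 1)) ^ p := fun x => by
    rw [add_sub_cancel, ← Real.exp_mul, mul_comm]
  have h1 : ∀ x : ℝ, -1 ≤ Real.exp x - 1 := fun x => by linarith [Real.exp_pos x]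
  rcases le_total p 1 with h' | h'
  · right
    intro x
    rw [e]
    linarith [rpow_one_add_le_one_add_mul_self (h1 x) h h']
  · left
    intro x
    rw [e]
    linarith [one_add_mul_self_le_rpow_one_add (h1 x) h']

/-- For a function of constant sign, `|h x|` and `|h (-x)|` are both at most `|h x + h (-x)|`. -/
theorem integrable_of_integrableOn_add_neg {h : ℝ → ℝ} (hm : Measurable h)
    (hs : (∀ x, 0 ≤ h x) ∨ ∀ x, h x ≤ 0)
    (hi : IntegrableOn (fun x => h x + h (-x)) (Ioi 0)) :
    Integrable h ∧ ∫ x, h x = ∫ x in Ioi 0, h x + h (-x) := by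
  have hb : ∀ x, |h x| ≤ |h x + h (-x)| ∧ |h (-x)| ≤ |h x + h (-x)| := fun x => by
    rcases hs with hs | hs
    · have := hs x
      have := hs (-x)
      constructor <;> rw [abs_of_nonneg (by assumption), abs_of_nonneg (by linarith)] <;> linarith
    · have := hs x
      have := hs (-x)
      constructor <;> rw [abs_of_nonpos (by assumption), abs_of_nonpos (by linarith)] <;> linarith
  have i1 : IntegrableOn h (Ioi 0) :=
    Integrable.mono hi hm.aestronglyMeasurable (Eventually.of_forall fun x => (hb x).1)
  have i2 : IntegrableOn (fun x => h (-x)) (Ioi 0) :=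
    Integrable.mono hi (hm.comp measurable_neg).aestronglyMeasurable (Eventually.of_forall fun x => (hb x).2)
  obtain ⟨a, b⟩ := integrable_of_integrableOn_Ioi_neg i1 i2
  exact ⟨a, by rw [b, integral_add i1 i2]⟩

/-! ### The normal inverse Gaussian Lévy density -/

variable {σ ϰ : ℝ}

/-- The density of the normal inverse Gaussian Lévy measure. -/
noncomputable def nigDensity (σ ϰ x : ℝ) : ℝ :=
  σ ^ 2 * √(ϰ ^ 2 + 1 / 4) * ϰ * Real.exp (-x / 2) / (Real.pi * |x|)
    * besselK1 (√(ϰ ^ 2 + 1 / 4) * |x|)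

theorem measurable_nigDensity : Measurable (nigDensity σ ϰ) := by
  have := measurable_besselK1
  unfold nigDensity
  fun_prop

theorem nigDensity_nonneg (hϰ : 0 < ϰ) (x : ℝ) : 0 ≤ nigDensity σ ϰ x := by
  have := besselK1_nonneg (√(ϰ ^ 2 + 1 / 4) * |x|)
  rw [nigDensity]
  positivity

theorem nigDensity_pos (hσ : 0 < σ) (hϰ : 0 < ϰ) {x : ℝ} (hx : x ≠ 0) : 0 < nigDensity σ ϰ x := by
  have hx' := abs_pos.2 hx
  have := besselK1_pos (z := √(ϰ ^ 2 + 1 / 4) * |x|) (by positivity)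
  rw [nigDensity]
  positivity

theorem integral_nigDensity_kernel (hϰ : 0 < ϰ) {y : ℝ} (hy : |y| < √(ϰ ^ 2 + 1 / 4)) :
    Integrable (fun x => nigDensity σ ϰ x
      * (Real.exp ((1 / 2 - y) * x) - 1 - (1 / 2 - y) * (Real.exp x - 1))) ∧
    ∫ x, nigDensity σ ϰ x * (Real.exp ((1 / 2 - y) * x) - 1 - (1 / 2 - y) * (Real.exp x - 1))
      = nigXi σ ϰ y := by
  set w := √(ϰ ^ 2 + 1 / 4) with hw
  have hw0 : 0 < w := (abs_nonneg y).trans_lt hy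
  have hw2 : w ^ 2 = ϰ ^ 2 + 1 / 4 := Real.sq_sqrt (by positivity)
  have hhalf : |(1 / 2 : ℝ)| < w := by
    rw [abs_of_pos (by norm_num)]
    nlinarith
  obtain ⟨i1, e1⟩ := integral_cosh_sub_one_mul_besselK1 hy
  obtain ⟨i2, e2⟩ := integral_cosh_sub_one_mul_besselK1 hhalf
  set C := σ ^ 2 * w * ϰ / Real.pi with hC
  -- After multiplication by `exp (-x / 2)` the drift term is odd in `x` and cancels; what remains
  -- is `2 cosh (y x) - 2 cosh (x / 2)`, a difference of two Bessel integrals already known.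
  have hsum : EqOn (fun x => C * (2 * (Real.cosh (y * x) - 1) / x * besselK1 (w * x)
      - 2 * (Real.cosh (1 / 2 * x) - 1) / x * besselK1 (w * x)))
      (fun x => nigDensity σ ϰ x
        * (Real.exp ((1 / 2 - y) * x) - 1 - (1 / 2 - y) * (Real.exp x - 1))
        + nigDensity σ ϰ (-x)
        * (Real.exp ((1 / 2 - y) * -x) - 1 - (1 / 2 - y) * (Real.exp (-x) - 1))) (Ioi 0) := by
    intro x hx
    have hx : 0 < x := hx
    simp only [nigDensity, abs_neg, abs_of_pos hx, ← hw, hC, Real.cosh_eq]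
    have a1 : Real.exp (-x / 2) = (Real.exp (x / 2))⁻¹ := by rw [← Real.exp_neg]; ring_nf
    have a2 : Real.exp (- -x / 2) = Real.exp (x / 2) := by ring_nf
    have a3 : Real.exp ((1 / 2 - y) * x) = Real.exp (x / 2) * (Real.exp (y * x))⁻¹ := by
      rw [← Real.exp_neg, ← Real.exp_add]; ring_nf
    have a4 : Real.exp ((1 / 2 - y) * -x) = (Real.exp (x / 2))⁻¹ * Real.exp (y * x) := by
      rw [← Real.exp_neg, ← Real.exp_add]; ring_nf
    have a5 : Real.exp x = Real.exp (x / 2) ^ 2 := by rw [← Real.exp_nat_mul]; ring_nf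
    have a6 : Real.exp (-x) = (Real.exp (x / 2))⁻¹ ^ 2 := by
      rw [← Real.exp_neg, ← Real.exp_nat_mul]; ring_nf
    have a7 : Real.exp (1 / 2 * x) = Real.exp (x / 2) := by ring_nf
    have a8 : Real.exp (-(1 / 2 * x)) = (Real.exp (x / 2))⁻¹ := by
      rw [← Real.exp_neg]; ring_nf
    rw [a1, a2, a3, a4, a5, a6, a7, a8, Real.exp_neg]
    have := Real.exp_pos (x / 2)
    have := Real.exp_pos (y * x)
    have := Real.pi_pos
    field_simp
    ring
  have hi := (i1.sub i2).const_mul C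
  simp only [Pi.sub_def] at hi
  have hm := measurable_nigDensity (σ := σ) (ϰ := ϰ)
  obtain ⟨a, b⟩ := integrable_of_integrableOn_add_neg (h := fun x => nigDensity σ ϰ x
    * (Real.exp ((1 / 2 - y) * x) - 1 - (1 / 2 - y) * (Real.exp x - 1))) (by fun_prop)
    ((exp_kernel_nonneg_or_nonpos (1 / 2 - y)).imp
      (fun h x => mul_nonneg (nigDensity_nonneg hϰ x) (h x))
      (fun h x => mul_nonpos_of_nonneg_of_nonpos (nigDensity_nonneg hϰ x) (h x)))
    (IntegrableOn.congr_fun hi hsum measurableSet_Ioi)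
  refine ⟨a, ?_⟩
  rw [b, ← setIntegral_congr_fun measurableSet_Ioi hsum, integral_const_mul, integral_sub i1 i2,
    e1, e2, nigXi, hC, show w ^ 2 - (1 / 2) ^ 2 = ϰ ^ 2 by rw [hw2]; ring, Real.sqrt_sq hϰ.le,
    hw2]
  have := Real.pi_pos
  field_simp
  ring

theorem nig_hasLongTimeExpansion {Ω : Type*} [MeasurableSpace Ω] {P : Measure Ω}
    [IsProbabilityMeasure P] {X : ℝ≥0 → Ω → ℝ} (hσ : 0 < σ) (hϰ : 0 < ϰ)
    (hX : IsExpLevyProcess P X 0 (nigMeasure σ ϰ)) {y : ℝ}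
    (hy : y ∈ Ioo (-√(ϰ ^ 2 + 1 / 4)) (√(ϰ ^ 2 + 1 / 4))) :
    HasLongTimeExpansion (callPrice P X) (nigXi σ ϰ) y := by
  have hf := measurable_nigDensity (σ := σ) (ϰ := ϰ)
  have hf0 := nigDensity_nonneg (σ := σ) hϰ
  have key := fun (y : ℝ) (hy : y ∈ Ioo (-√(ϰ ^ 2 + 1 / 4)) (√(ϰ ^ 2 + 1 / 4))) =>
    integral_nigDensity_kernel (σ := σ) hϰ (abs_lt.2 hy)
  refine IsExpLevyProcess.hasLongTimeExpansion_of_density hf hf0 hX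
    (IsExpLevyMeasure.stronglyNonlattice_of_density hf hf0 hX.measure zero_lt_one
      fun x hx => nigDensity_pos hσ hϰ hx.1.ne') isOpen_Ioo (fun y hy => (key y hy).1)
    (fun y hy => ?_) hy
  rw [(key y hy).2]
  ring

end NormalInverseGaussian

theorem mainTheorem4 {Ω : Type*} [MeasurableSpace Ω] (P : Measure Ω) [IsProbabilityMeasure P]
    (X : ℝ≥0 → Ω → ℝ) :
    -- generic exponential Lévy processes
    (∀ (σ : ℝ) (ν : Measure ℝ), IsExpLevyProcess P X σ ν → CramerCondition P X →
      ∀ y ∈ analyticityInterval ν, HasLongTimeExpansion (callPrice P X) (levyXi σ ν) y) ∧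
    -- tempered stable processes with an optional diffusion component
    (∀ σ α cp cm κp κm : ℝ, α < 2 → α ≠ 0 → α ≠ 1 → 0 ≤ cp → 0 ≤ cm → 1 ≤ κp → 0 ≤ κm →
      (σ ≠ 0 ∨ 0 < cp ∨ 0 < cm) →
      IsExpLevyProcess P X σ (temperedStableMeasure α cp cm κp κm) →
      ∀ y ∈ Set.Ioo (-κp + 1 / 2) (κm + 1 / 2),
        HasLongTimeExpansion (callPrice P X) (temperedStableXi σ α cp cm κp κm) y) ∧
    -- normal inverse Gaussian processes
    (∀ σ ϰ : ℝ, 0 < σ → 0 < ϰ → IsExpLevyProcess P X 0 (nigMeasure σ ϰ) →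
      ∀ y ∈ Set.Ioo (-√(ϰ ^ 2 + 1 / 4)) (√(ϰ ^ 2 + 1 / 4)),
        HasLongTimeExpansion (callPrice P X) (nigXi σ ϰ) y) ∧
    -- Merton processes with an optional diffusion component
    (∀ σ l μ η : ℝ, 0 < l → 0 < η → IsExpLevyProcess P X σ (mertonMeasure l μ η) →
      ∀ y : ℝ, HasLongTimeExpansion (callPrice P X) (mertonXi σ l μ η) y) := by
  refine ⟨fun σ ν hX hC y hy => hX.hasLongTimeExpansion (hC.stronglyNonlattice hX) hy,
    fun σ α cp cm κp κm h2 h0 h1 hp hm hκp hκm hne hX y hy =>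
      temperedStable_hasLongTimeExpansion h2 h0 h1 hp hm hκp hκm hne hX hy,
    fun σ ϰ hσ hϰ hX y hy => nig_hasLongTimeExpansion hσ hϰ hX hy,
    fun σ l μ η hl hη hX y => merton_hasLongTimeExpansion hl hη hX y⟩
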